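/- Let $(M,g,I,J,K)$ be a hyperkähler manifold of real dimension $4n$: $g$ is a Riemannian metric that is Kähler with respect to the complex structures $I,J,K$, and $IJ=K=-JI$, $JK=I=-KJ$, $KI=J=-IK$. Write $\omega_A(X,Y)=g(AX,Y)$ for an orthogonal almost complex structure $A$, regarded also as the map $T\to T^*$, $X\mapsto\iota_X\omega_A$, and put $\sigma=\omega_J+i\omega_K$. For $\eta\in\mathbb{CP}^1=\mathbb{C}\cup\{\infty\}$ let $$I_\eta=\frac{1-|\eta|^2}{1+|\eta|^2}\,I+\frac{2\,\mathrm{Re}\,\eta}{1+|\eta|^2}\,J+\frac{2\,\mathrm{Im}\,\eta}{1+|\eta|^2}\,K,\qquad I_\infty=-I,\qquad \omega_\eta=\omega_{I_\eta}.$$ A generalized almost complex structure is a smooth endomorphism $\mathcal J$ of $T\oplus T^*$, orthogonal for $\langle X+\xi,Y+\eta\rangle=\frac12(\xi(Y)+\eta(X))$, with $\mathcal J^2=-1$. It is integrable (a generalized complex structure) if its $+i$-eigenbundle $L\subset(T\oplus T^*)\otimes\mathbb{C}$ is closed under the Courant bracket $[X+\xi,Y+\eta]=[X,Y]+\mathcal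 L_X\eta-\iota_Yd\xi$. A pure spinor for $\mathcal J$ on an open set is a smooth complex form of mixed degree whose annihilator at each point, under $(X+\xi)\cdot\Phi=\iota_X\Phi+\xi\wedge\Phi$, is the fibre of $L$. For an almost complex structure $A$ let $\mathcal J_A=\begin{pmatrix}-A&0\\0&A^*\end{pmatrix}$. For $\alpha,\beta\in\mathbb{CP}^1$ define on $M$ $$\mathcal J_{\alpha,\beta}=\frac12\begin{pmatrix}-(I_\alpha+I_\beta)&-(\omega_\alpha^{-1}-\omega_\beta^{-1})\\ \omega_\alpha-\omega_\beta&I_\alpha^*+I_\beta^*\end{pmatrix},\qquad \mathcal J'_{\alpha,\beta}=\frac12\begin{pmatrix}-(I_\alpha-I_\beta)&-(\omega_\alpha^{-1}+\omega_\beta^{-1})\\ \omega_\alpha+\omega_\beta&I_\alpha^*-I_\beta^*\end{pmatrix},$$ and on $\mathcal X=M\times\mathbb{CP}^1\times\mathbb{CP}^1$, at the point $(m,\alpha,\beta)$, $$\mathcal J=\mathcal J_{\alpha,\beta}\times\mathcal J_{I_{\mathbb{CP}^1}}\times\mathcal J_{I_{\mathbb{CP}^1}},\qquad \mathcal J'=\mathcal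 J'_{\alpha,\beta}\times\mathcal J_{I_{\mathbb{CP}^1}}\times\mathcal J_{-I_{\mathbb{CP}^1}},$$ where $I_{\mathbb{CP}^1}$ is the standard complex structure of $\mathbb{CP}^1$. **Theorem.** 1. $\mathcal J'$ is an integrable generalized almost complex structure on $\mathcal X$. 2. On the open set $\{\alpha\ne\infty,\ \beta\neq0\}$, with $\tilde\beta=\beta^{-1}$, the form $\Phi'\wedge d\alpha\wedge d\bar{\tilde\beta}$ is a pure spinor for $\mathcal J'$ and is closed, where $$\Phi'=i^n(\alpha+\bar{\tilde\beta})^n\exp\left(-\frac{\sigma-(\alpha-\bar{\tilde\beta})\omega_I+\alpha\bar{\tilde\beta}\,\bar\sigma}{i(\alpha+\bar{\tilde\beta})}\right)=\sum_{j=0}^{2n}\frac{(-1)^j}{j!}\bigl(i(\alpha+\bar{\tilde\beta})\bigr)^{n-j}\bigl(\sigma-(\alpha-\bar{\tilde\beta})\omega_I+\alpha\bar{\tilde\beta}\,\bar\sigma\bigr)^{j},$$ extended continuously to the points with $\alpha+\bar{\tilde\beta}=0$, where only the term $j=n$ remains. 3. $\mathcal J$ and $\mathcal J'$ form a generalized pseudo-Kähler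 structure on $\mathcal X$: both are generalized complex structures, they commute, and the symmetric pairing $G(e_1,e_2)=-\langle\mathcal Je_1,\mathcal J'e_2\rangle$ is non-degenerate. At every point $G$ has signature $(8n+4,4)$. -/

import Mathlib

open Set Filter Topology Manifold ContDiff Bundle

noncomputable section

/-- The projective line `ℂ ∪ {∞}`. -/
abbrev CP1 : Type := OnePoint ℂ

namespace CP1

/-- The map `z ↦ z⁻¹` of `ℂ ∪ {∞}`, exchanging `0` and `∞`. -/
def invFun (p : CP1) : CP1 :=
  p.elim ((0 : ℂ) : CP1) fun z => if z = 0 then OnePoint.infty else ((z⁻¹ : ℂ) : CP1)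

theorem invFun_infty : invFun OnePoint.infty = ((0 : ℂ) : CP1) := rfl

theorem invFun_coe (z : ℂ) : invFun z = if z = 0 then OnePoint.infty else ((z⁻¹ : ℂ) : CP1) := rfl

theorem invFun_invFun (p : CP1) : invFun (invFun p) = p := by
  induction p using OnePoint.rec with
  | infty => simp [invFun_infty, invFun_coe]
  | coe z =>
    by_cases hz : z = 0
    · simp [invFun_infty, invFun_coe, hz]
    · simp [invFun_coe, hz]

theorem continuous_invFun : Continuous invFun := by
  rw [continuous_iff_continuousAt]
  have key : Tendsto (fun z : ℂ => invFun (z : CP1)) (𝓝[≠] 0) (𝓝 OnePoint.infty) := by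
    have h1 : Tendsto (fun z : ℂ => ((z⁻¹ : ℂ) : CP1)) (𝓝[≠] 0) (𝓝 OnePoint.infty) := by
      have h2 : Tendsto (fun z : ℂ => (z : CP1)) (Filter.coclosedCompact ℂ) (𝓝 OnePoint.infty) :=
        OnePoint.tendsto_coe_infty
      rw [Filter.coclosedCompact_eq_cocompact] at h2
      refine h2.comp ?_
      rw [← Metric.cobounded_eq_cocompact]
      exact tendsto_inv₀_nhdsNE_zero
    refine h1.congr' ?_
    filter_upwards [self_mem_nhdsWithin] with z hz
    rw [invFun_coe, if_neg (by simpa using hz)]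
  intro p
  induction p using OnePoint.rec with
  | infty =>
    rw [OnePoint.continuousAt_infty', Filter.coclosedCompact_eq_cocompact, invFun_infty,
      ← Metric.cobounded_eq_cocompact]
    have h1 : Tendsto (fun z : ℂ => ((z⁻¹ : ℂ) : CP1)) (Bornology.cobounded ℂ)
        (𝓝 ((0 : ℂ) : CP1)) :=
      (OnePoint.continuous_coe.tendsto (0 : ℂ)).comp tendsto_inv₀_cobounded
    refine h1.congr' ?_
    have : ∀ᶠ z : ℂ in Bornology.cobounded ℂ, z ≠ 0 := by
      rw [Metric.cobounded_eq_cocompact]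
      exact isCompact_singleton.compl_mem_cocompact
    filter_upwards [this] with z hz
    simp [invFun_coe, hz]
  | coe z =>
    rw [OnePoint.continuousAt_coe]
    by_cases hz : z = 0
    · subst hz
      rw [continuousAt_iff_punctured_nhds]
      have h0 : invFun ((0 : ℂ) : CP1) = OnePoint.infty := by simp [invFun_coe]
      change Tendsto (fun z : ℂ => invFun (z : CP1)) _ (𝓝 (invFun ((0 : ℂ) : CP1)))
      rw [h0]
      exact key
    · have h1 : ContinuousAt (fun w : ℂ => ((w⁻¹ : ℂ) : CP1)) z :=
        (OnePoint.continuous_coe.continuousAt (x := z⁻¹)).comp (continuousAt_inv₀ hz)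
      refine h1.congr ?_
      filter_upwards [eventually_ne_nhds hz] with w hw
      simp [invFun_coe, hw]

/-- The homeomorphism `z ↦ z⁻¹` of `ℂ ∪ {∞}`. -/
def invHomeo : CP1 ≃ₜ CP1 where
  toFun := invFun
  invFun := invFun
  left_inv := invFun_invFun
  right_inv := invFun_invFun
  continuous_toFun := continuous_invFun
  continuous_invFun := continuous_invFun

/-- The coordinate `z` on `CP1 \ {∞}`, with the value `0` at `∞`. -/
def coord (p : CP1) : ℂ := OnePoint.elim p 0 id

/-- The coordinate `z⁻¹` on `CP1 \ {0}`, with the value `0` at `∞`. -/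
def coordInv (p : CP1) : ℂ := coord (invFun p)

/-- The chart `z` with domain `CP1 \ {∞}`. -/
def chart : OpenPartialHomeomorph CP1 ℂ :=
  ((OnePoint.isOpenEmbedding_coe (X := ℂ)).toOpenPartialHomeomorph _).symm

/-- The chart `z⁻¹` with domain `CP1 \ {0}`. -/
def chartInv : OpenPartialHomeomorph CP1 ℂ := invHomeo.transOpenPartialHomeomorph chart

theorem chart_source : chart.source = {p | p ≠ OnePoint.infty} := by
  ext p; simp [chart, OnePoint.ne_infty_iff_exists]

theorem chart_target : chart.target = univ := by simp [chart]

theorem chart_symm_apply (z : ℂ) : chart.symm z = (z : CP1) := rfl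

theorem chart_coe (z : ℂ) : chart (z : CP1) = z :=
  (OnePoint.isOpenEmbedding_coe (X := ℂ)).toOpenPartialHomeomorph_left_inv _

instance : ChartedSpace ℂ CP1 where
  atlas := {chart, chartInv}
  chartAt p := OnePoint.elim p chartInv (fun _ => chart)
  mem_chart_source p := by
    induction p using OnePoint.rec with
    | infty => simp [chartInv, chart_source, invHomeo, invFun_infty]
    | coe z => simp [chart_source]
  chart_mem_atlas p := by
    induction p using OnePoint.rec with
    | infty => simp
    | coe z => simp

theorem inv_contDiffOn {𝕜 : Type*} [NontriviallyNormedField 𝕜] [NormedAlgebra 𝕜 ℂ] :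
    ContDiffOn 𝕜 ω (fun z : ℂ => z⁻¹) {z | z ≠ 0} := fun _ hz =>
  (contDiffAt_inv 𝕜 hz).contDiffWithinAt

theorem chartInv_coe (z : ℂ) (hz : z ≠ 0) : chartInv (z : CP1) = z⁻¹ := by
  simp [chartInv, invHomeo, invFun_coe, hz, chart_coe]

theorem chartInv_symm (z : ℂ) (hz : z ≠ 0) : chartInv.symm z = ((z⁻¹ : ℂ) : CP1) := by
  simp [chartInv, invHomeo, chart_symm_apply, invFun_coe, hz]

theorem chartInv_symm_zero : chartInv.symm 0 = OnePoint.infty := by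
  simp [chartInv, invHomeo, chart_symm_apply, invFun_coe]

/-- The two charts form a holomorphic (hence real analytic and smooth) atlas. -/
theorem isManifold_of_algebra {𝕜 : Type*} [NontriviallyNormedField 𝕜] [NormedAlgebra 𝕜 ℂ] :
    IsManifold 𝓘(𝕜, ℂ) ω CP1 := by
  refine isManifold_of_contDiffOn _ _ _ ?_
  have h12 : ∀ z ∈ (chart.symm.trans chartInv).source, z ≠ 0 := by
    rintro z hz rfl
    simp [chartInv, chart_symm_apply, invHomeo, invFun_coe, chart_source] at hz
  have h21 : ∀ z ∈ (chartInv.symm.trans chart).source, z ≠ 0 := by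
    rintro z hz rfl
    simp [chart_source, chartInv_symm_zero] at hz
  rintro e e' (rfl | rfl) (rfl | rfl)
  · refine contDiffOn_id.congr fun z _ => ?_
    simp [chart_symm_apply, chart_coe]
  · refine (inv_contDiffOn (𝕜 := 𝕜)).mono ?_ |>.congr ?_
    · intro z hz; simp only [modelWithCornersSelf_coe, modelWithCornersSelf_coe_symm] at hz
      exact h12 z hz.1
    · intro z hz
      have := h12 z hz.1
      simp [chart_symm_apply, chartInv_coe z this]
  · refine (inv_contDiffOn (𝕜 := 𝕜)).mono ?_ |>.congr ?_
    · intro z hz; exact h21 z hz.1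
    · intro z hz
      have := h21 z hz.1
      simp [chartInv_symm z this, chart_coe]
  · refine contDiffOn_id.congr fun z hz => ?_
    have h : z ∈ chartInv.target := by simp [chartInv, chart_target]
    simpa using chartInv.right_inv h

instance : IsManifold 𝓘(ℂ, ℂ) ω CP1 := isManifold_of_algebra
instance : IsManifold 𝓘(ℝ, ℂ) ω CP1 := isManifold_of_algebra
instance : IsManifold 𝓘(ℝ, ℂ) ∞ CP1 := IsManifold.of_le (n := ω) le_top

end CP1

/-! ### Exterior algebra of complex covectors -/

section Forms

/-- The algebra `Λ(V* ⊗ ℂ)` of complex-valued forms of mixed degree on a real vector space `V`;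
its product is the wedge product. -/
abbrev CForm (V : Type*) [AddCommGroup V] [Module ℝ V] [TopologicalSpace V] : Type _ :=
  ExteriorAlgebra ℂ (V →L[ℝ] ℂ)

/-- A complex covector as a form of degree one. -/
def oneForm {V : Type*} [AddCommGroup V] [Module ℝ V] [TopologicalSpace V]
    (φ : V →L[ℝ] ℂ) : CForm V :=
  ExteriorAlgebra.ι ℂ φ

/-- The complex-valued covector `φ + i ψ` with real and imaginary parts `φ` and `ψ`. -/
def complexCovector {V : Type*} [AddCommGroup V] [Module ℝ V] [TopologicalSpace V]
    (φ ψ : V →L[ℝ] ℝ) : V →L[ℝ] ℂ :=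
  Complex.ofRealCLM.comp φ + Complex.I • Complex.ofRealCLM.comp ψ

/-- Evaluation of complex covectors at the complex vector `v + i w`. -/
def complexEval {V : Type*} [AddCommGroup V] [Module ℝ V] [TopologicalSpace V]
    (v w : V) : Module.Dual ℂ (V →L[ℝ] ℂ) where
  toFun φ := φ v + Complex.I * φ w
  map_add' φ ψ := by simp; ring
  map_smul' c φ := by simp; ring

/-- The action `ι_X Φ + ξ ∧ Φ` of the complex generalized vector
`X + ξ = (u.1 + i v.1) + (u.2 + i v.2)` on a form `Φ` of mixed degree. -/
def cliffordAct {V : Type*} [AddCommGroup V] [Module ℝ V] [TopologicalSpace V]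
    (u v : V × (V →L[ℝ] ℝ)) (Φ : CForm V) : CForm V :=
  CliffordAlgebra.contractLeft (Q := (0 : QuadraticForm ℂ (V →L[ℝ] ℂ)))
      (complexEval u.1 v.1) Φ + oneForm (complexCovector u.2 v.2) * Φ

/-- Pull-back of forms along a linear map. -/
def pullForm {V W : Type*} [AddCommGroup V] [Module ℝ V] [TopologicalSpace V]
    [AddCommGroup W] [Module ℝ W] [TopologicalSpace W] (A : V →L[ℝ] W) :
    CForm W →ₐ[ℂ] CForm V :=
  ExteriorAlgebra.map
    { toFun := fun φ : W →L[ℝ] ℂ => φ.comp A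
      map_add' := fun _ _ => rfl
      map_smul' := fun _ _ => rfl }

/-- The element `½ ∑ᵢ eⁱ ∧ B(eᵢ, ·)` of `Λ²(V*)` given by an alternating bilinear form `B`
on `V`, where `eᵢ` is a basis of `V` with dual basis `eⁱ`. -/
def twoForm {V : Type*} [AddCommGroup V] [Module ℝ V] [TopologicalSpace V]
    [IsTopologicalAddGroup V] [ContinuousSMul ℝ V] [T2Space V] [FiniteDimensional ℝ V]
    (B : V →L[ℝ] V →L[ℝ] ℝ) : CForm V :=
  (1 / 2 : ℂ) • ∑ i, oneForm (complexCovector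
      (LinearMap.toContinuousLinearMap ((Module.finBasis ℝ V).coord i)) 0) *
    oneForm (complexCovector (B (Module.finBasis ℝ V i)) 0)

end Forms

/-! ### Generalized geometry of a manifold -/

section Manifold

variable {E : Type*} [NormedAddCommGroup E] [NormedSpace ℝ E] {H : Type*} [TopologicalSpace H]
  (I : ModelWithCorners ℝ E H) {M : Type*} [TopologicalSpace M] [ChartedSpace H M]

instance [FiniteDimensional ℝ E] (x : M) : FiniteDimensional ℝ (TangentSpace I x) :=
  inferInstanceAs (FiniteDimensional ℝ E)

instance (x : M) : T2Space (TangentSpace I x) := inferInstanceAs (T2Space E)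

/-- The fibre at `x` of the generalized tangent bundle `T ⊕ T*`. -/
abbrev GenTangent (x : M) : Type _ := TangentSpace I x × (TangentSpace I x →L[ℝ] ℝ)

/-- The inner product `⟨X + ξ, Y + η⟩ = ½ (ξ(Y) + η(X))`. -/
def pairing (x : M) : LinearMap.BilinForm ℝ (GenTangent I x) :=
  LinearMap.mk₂ ℝ (fun u v => (1 / 2) * (u.2 v.1 + v.2 u.1))
    (fun u u' v => by simp; ring) (fun c u v => by simp; ring)
    (fun u v v' => by simp; ring) (fun c u v => by simp; ring)

/-- Smoothness on `U` of a vector field. -/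
def SmoothVectorOn [IsManifold I ∞ M] (X : ∀ x : M, TangentSpace I x) (U : Set M) : Prop :=
  ContMDiffOn I I.tangent ∞ (fun x => (⟨x, X x⟩ : TangentBundle I M)) U

/-- Smoothness on `U` of a one-form. -/
def SmoothCovectorOn [IsManifold I ∞ M] (ξ : ∀ x : M, TangentSpace I x →L[ℝ] ℝ)
    (U : Set M) : Prop :=
  ContMDiffOn I (I.prod 𝓘(ℝ, E →L[ℝ] ℝ)) ∞
    (fun x => TotalSpace.mk' (E →L[ℝ] ℝ)
      (E := fun x : M => TangentSpace I x →L[ℝ] Bundle.Trivial M ℝ x) x (ξ x)) U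

/-- Smoothness on `U` of a section of `T ⊕ T*`. -/
def SmoothSectionOn [IsManifold I ∞ M] (u : ∀ x : M, GenTangent I x) (U : Set M) : Prop :=
  SmoothVectorOn I (fun x => (u x).1) U ∧ SmoothCovectorOn I (fun x => (u x).2) U

/-- A one-form in the preferred chart at `x₀`. -/
def covectorInChart (ξ : ∀ x : M, TangentSpace I x →L[ℝ] ℝ) (x₀ : M) (y : E) : E →L[ℝ] ℝ :=
  (ξ ((extChartAt I x₀).symm y)).comp
    (mfderivWithin 𝓘(ℝ, E) I (extChartAt I x₀).symm (range I) y)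

/-- `ι_Y dξ` at the point `x` for a one-form `ξ` and a vector `Y`, where
`dξ(Y, Z) = (D_Y ξ)(Z) - (D_Z ξ)(Y)` in the preferred chart at `x`. -/
def contractExtDeriv (ξ : ∀ x : M, TangentSpace I x →L[ℝ] ℝ) (x : M) (Y : TangentSpace I x) :
    TangentSpace I x →L[ℝ] ℝ :=
  let D : E →L[ℝ] E →L[ℝ] ℝ :=
    fderivWithin ℝ (covectorInChart I ξ x) (range I) (extChartAt I x x)
  let A : TangentSpace I x →L[ℝ] E := mfderiv I 𝓘(ℝ, E) (extChartAt I x) x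
  (D (A Y) - D.flip (A Y)).comp A

/-- The (Dorfman form of the) Courant bracket `[X + ξ, Y + η] = [X, Y] + 𝓛_X η - ι_Y dξ`, where
`𝓛_X η = d(η(X)) + ι_X dη`. -/
def courantBracket (u v : ∀ x : M, GenTangent I x) (x : M) : GenTangent I x :=
  (VectorField.mlieBracket I (fun y => (u y).1) (fun y => (v y).1) x,
    (mvfderiv I (fun y => (v y).2 (u y).1) x
        + contractExtDeriv I (fun y => (v y).2) x (u x).1)
      - contractExtDeriv I (fun y => (u y).2) x (v x).1)

/-- The complex vector `a + i b` lies in the `+i`-eigenspace of the real endomorphism `A`. -/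
def InEigen {V : Type*} [AddCommGroup V] (A : V → V) (a b : V) : Prop :=
  A a = -b ∧ A b = a

/-- The `+i`-eigenbundle of `J` in `(T ⊕ T*) ⊗ ℂ` is closed under the Courant bracket of smooth
(local) sections; the sections are written as `a + i b` and the bracket is extended
complex bilinearly. -/
def CourantInvolutive [IsManifold I ∞ M] (J : ∀ x : M, GenTangent I x →ₗ[ℝ] GenTangent I x) :
    Prop :=
  ∀ U : Set M, IsOpen U → ∀ a b c d : ∀ x : M, GenTangent I x,
    SmoothSectionOn I a U → SmoothSectionOn I b U →
    SmoothSectionOn I c U → SmoothSectionOn I d U →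
    (∀ x ∈ U, InEigen (J x) (a x) (b x)) → (∀ x ∈ U, InEigen (J x) (c x) (d x)) →
    ∀ x ∈ U, InEigen (J x) (courantBracket I a c x - courantBracket I b d x)
      (courantBracket I a d x + courantBracket I b c x)

/-- A generalized almost complex structure: a smooth orthogonal endomorphism of `T ⊕ T*` with
square minus the identity. -/
structure IsGenAlmostComplex [IsManifold I ∞ M]
    (J : ∀ x : M, GenTangent I x →ₗ[ℝ] GenTangent I x) : Prop where
  smooth : ∀ U : Set M, IsOpen U → ∀ u : ∀ x : M, GenTangent I x,
    SmoothSectionOn I u U → SmoothSectionOn I (fun x => J x (u x)) U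
  orthogonal : ∀ (x : M) (u v : GenTangent I x), pairing I x (J x u) (J x v) = pairing I x u v
  sq : ∀ (x : M) (u : GenTangent I x), J x (J x u) = -u

/-- A generalized complex structure: an integrable generalized almost complex structure. -/
structure IsGenComplex [IsManifold I ∞ M]
    (J : ∀ x : M, GenTangent I x →ₗ[ℝ] GenTangent I x) : Prop
    extends IsGenAlmostComplex I J where
  involutive : CourantInvolutive I J

/-- The pairing `G(e₁, e₂) = -⟨J e₁, J' e₂⟩`. -/
def genMetric (J J' : ∀ x : M, GenTangent I x →ₗ[ℝ] GenTangent I x) (x : M) :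
    LinearMap.BilinForm ℝ (GenTangent I x) :=
  -(pairing I x).compl₁₂ (J x) (J' x)

/-- A generalized pseudo-Kähler structure: a pair of commuting generalized complex structures
for which the symmetric pairing `G` is non-degenerate (but not necessarily definite). -/
structure IsGenPseudoKahler [IsManifold I ∞ M]
    (J J' : ∀ x : M, GenTangent I x →ₗ[ℝ] GenTangent I x) : Prop where
  left : IsGenComplex I J
  right : IsGenComplex I J'
  commute : ∀ (x : M) (u : GenTangent I x), J x (J' x u) = J' x (J x u)
  symm : ∀ x : M, (genMetric I J J' x).IsSymm
  nondegenerate : ∀ x : M, (genMetric I J J' x).Nondegenerate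

/-- The metric `G` of the pair `J`, `J'` has signature `(p, q)` at every point. -/
def HasSignature (J J' : ∀ x : M, GenTangent I x →ₗ[ℝ] GenTangent I x) (p q : ℕ) : Prop :=
  ∀ x : M, sigPos (LinearMap.BilinMap.toQuadraticMap (genMetric I J J' x)) = p ∧
    sigNeg (LinearMap.BilinMap.toQuadraticMap (genMetric I J J' x)) = q

/-- A complex form of mixed degree in the preferred chart at `x₀`. -/
def formInChart (Φ : ∀ x : M, CForm (TangentSpace I x)) (x₀ : M) (y : E) : CForm E :=
  pullForm (V := E) (mfderivWithin 𝓘(ℝ, E) I (extChartAt I x₀).symm (range I) y)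
    (Φ ((extChartAt I x₀).symm y))

/-- Smoothness on an open set `U` of a complex form of mixed degree: all its components in the
preferred chart at each `x ∈ U` are smooth near `x`. -/
def SmoothFormOn (Φ : ∀ x : M, CForm (TangentSpace I x)) (U : Set M) : Prop :=
  ∀ x ∈ U, ∀ l : Module.Dual ℂ (CForm E),
    ContDiffWithinAt ℝ ∞ (fun y => l (formInChart I Φ x y)) (range I) (extChartAt I x x)

/-- `dΦ = 0` on an open set `U`. In a chart, `dΦ = ∑ᵢ eⁱ ∧ ∂ᵢ Φ`, where `∂ᵢ` is the derivative
in the direction of the basis vector `eᵢ`; its vanishing is tested on all linear functionals. -/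
def ClosedFormOn [FiniteDimensional ℝ E] (Φ : ∀ x : M, CForm (TangentSpace I x))
    (U : Set M) : Prop :=
  ∀ x ∈ U, ∀ l : Module.Dual ℂ (CForm E),
    ∑ i, fderivWithin ℝ (fun y => l (oneForm (complexCovector
        (LinearMap.toContinuousLinearMap ((Module.finBasis ℝ E).coord i)) 0)
          * formInChart I Φ x y))
      (range I) (extChartAt I x x) (Module.finBasis ℝ E i) = 0

/-- `Φ` is a pure spinor on `U` for `J`: a smooth complex form of mixed degree whose annihilator
in `(T ⊕ T*) ⊗ ℂ` at each point is the `+i`-eigenspace of `J`. -/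
def IsPureSpinorOn (J : ∀ x : M, GenTangent I x →ₗ[ℝ] GenTangent I x)
    (Φ : ∀ x : M, CForm (TangentSpace I x)) (U : Set M) : Prop :=
  SmoothFormOn I Φ U ∧
    ∀ x ∈ U, ∀ u v : GenTangent I x, cliffordAct u v (Φ x) = 0 ↔ InEigen (J x) u v

end Manifold

/-! ### Linear algebra of generalized complex structures -/

section Linear

variable {V : Type*} [AddCommGroup V] [Module ℝ V] [TopologicalSpace V]
  [IsTopologicalAddGroup V] [ContinuousSMul ℝ V]

/-- The dual `A* : V* → V*` of an endomorphism `A` of `V`. -/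
def dualEnd (A : V →L[ℝ] V) : (V →L[ℝ] ℝ) →ₗ[ℝ] (V →L[ℝ] ℝ) where
  toFun ξ := ξ.comp A
  map_add' _ _ := rfl
  map_smul' _ _ := rfl

/-- The endomorphism of `V ⊕ V*` with block matrix `(a b; c d)`. -/
def blockEnd (a : V →ₗ[ℝ] V) (b : (V →L[ℝ] ℝ) →ₗ[ℝ] V) (c : V →ₗ[ℝ] (V →L[ℝ] ℝ))
    (d : (V →L[ℝ] ℝ) →ₗ[ℝ] (V →L[ℝ] ℝ)) : V × (V →L[ℝ] ℝ) →ₗ[ℝ] V × (V →L[ℝ] ℝ) :=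
  (a.coprod b).prod (c.coprod d)

/-- The structure `𝒥_A = (-A 0; 0 A*)` given by a complex structure `A`. -/
def genOfComplex (A : V →L[ℝ] V) : V × (V →L[ℝ] ℝ) →ₗ[ℝ] V × (V →L[ℝ] ℝ) :=
  blockEnd (-A : V →L[ℝ] V) 0 0 (dualEnd A)

/-- The fundamental form `ω(X, Y) = g(A X, Y)`, also regarded as the map `X ↦ ι_X ω`. -/
def fundForm (g : V →L[ℝ] V →L[ℝ] ℝ) (A : V →L[ℝ] V) : V →L[ℝ] V →L[ℝ] ℝ := g.comp A

/-- The structure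
`½ (-(A₊ + A₋)  -(ω₊⁻¹ - ω₋⁻¹); ω₊ - ω₋  A₊* + A₋*)` of a bi-Hermitian structure
`(g, A₊, A₋)`. -/
def biHermitianJ (g : V →L[ℝ] V →L[ℝ] ℝ) (Ap Am : V →L[ℝ] V) :
    V × (V →L[ℝ] ℝ) →ₗ[ℝ] V × (V →L[ℝ] ℝ) :=
  (1 / 2 : ℝ) • blockEnd (-(Ap + Am) : V →L[ℝ] V)
    (-((fundForm g Ap).inverse - (fundForm g Am).inverse) : (V →L[ℝ] ℝ) →L[ℝ] V)
    (fundForm g Ap - fundForm g Am : V →L[ℝ] V →L[ℝ] ℝ) (dualEnd Ap + dualEnd Am)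

/-- The structure
`½ (-(A₊ - A₋)  -(ω₊⁻¹ + ω₋⁻¹); ω₊ + ω₋  A₊* - A₋*)` of a bi-Hermitian structure
`(g, A₊, A₋)`. -/
def biHermitianJ' (g : V →L[ℝ] V →L[ℝ] ℝ) (Ap Am : V →L[ℝ] V) :
    V × (V →L[ℝ] ℝ) →ₗ[ℝ] V × (V →L[ℝ] ℝ) :=
  (1 / 2 : ℝ) • blockEnd (-(Ap - Am) : V →L[ℝ] V)
    (-((fundForm g Ap).inverse + (fundForm g Am).inverse) : (V →L[ℝ] ℝ) →L[ℝ] V)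
    (fundForm g Ap + fundForm g Am : V →L[ℝ] V →L[ℝ] ℝ) (dualEnd Ap - dualEnd Am)

end Linear

/-- The endomorphism `J₁ × J₂` of `T(M × N) ⊕ T*(M × N)` at `(x, y)`, for endomorphisms `J₁` of
`T_x M ⊕ T*_x M` and `J₂` of `T_y N ⊕ T*_y N`. -/
def genProd {E : Type*} [NormedAddCommGroup E] [NormedSpace ℝ E] {H : Type*} [TopologicalSpace H]
    (I : ModelWithCorners ℝ E H) {M : Type*} [TopologicalSpace M] [ChartedSpace H M]
    {E' : Type*} [NormedAddCommGroup E'] [NormedSpace ℝ E'] {H' : Type*} [TopologicalSpace H']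
    (I' : ModelWithCorners ℝ E' H') {N : Type*} [TopologicalSpace N] [ChartedSpace H' N]
    {x : M} {y : N} (J₁ : GenTangent I x →ₗ[ℝ] GenTangent I x)
    (J₂ : GenTangent I' y →ₗ[ℝ] GenTangent I' y) :
    GenTangent (I.prod I') (x, y) →ₗ[ℝ] GenTangent (I.prod I') (x, y) :=
  let p₁ : TangentSpace (I.prod I') (x, y) →L[ℝ] TangentSpace I x :=
    mfderiv (I.prod I') I Prod.fst (x, y)
  let p₂ : TangentSpace (I.prod I') (x, y) →L[ℝ] TangentSpace I' y :=
    mfderiv (I.prod I') I' Prod.snd (x, y)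
  let i₁ : TangentSpace I x →L[ℝ] TangentSpace (I.prod I') (x, y) :=
    mfderiv I (I.prod I') (fun x' => (x', y)) x
  let i₂ : TangentSpace I' y →L[ℝ] TangentSpace (I.prod I') (x, y) :=
    mfderiv I' (I.prod I') (fun y' => (x, y')) y
  { toFun := fun u =>
      (i₁ (J₁ (p₁ u.1, u.2.comp i₁)).1 + i₂ (J₂ (p₂ u.1, u.2.comp i₂)).1,
        (J₁ (p₁ u.1, u.2.comp i₁)).2.comp p₁ + (J₂ (p₂ u.1, u.2.comp i₂)).2.comp p₂)
    map_add' := fun u v => by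
      have h₁ : (p₁ (u + v).1, (u + v).2.comp i₁)
          = ((p₁ u.1, u.2.comp i₁) : GenTangent I x) + (p₁ v.1, v.2.comp i₁) := by
        simp [ContinuousLinearMap.add_comp]
      have h₂ : (p₂ (u + v).1, (u + v).2.comp i₂)
          = ((p₂ u.1, u.2.comp i₂) : GenTangent I' y) + (p₂ v.1, v.2.comp i₂) := by
        simp [ContinuousLinearMap.add_comp]
      rw [h₁, h₂, map_add, map_add]
      ext1
      · simp only [Prod.fst_add, map_add]; abel
      · simp only [Prod.snd_add, ContinuousLinearMap.add_comp]; abel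
    map_smul' := fun c u => by
      have h₁ : (p₁ (c • u).1, (c • u).2.comp i₁)
          = c • ((p₁ u.1, u.2.comp i₁) : GenTangent I x) := by
        simp [ContinuousLinearMap.smul_comp]
      have h₂ : (p₂ (c • u).1, (c • u).2.comp i₂)
          = c • ((p₂ u.1, u.2.comp i₂) : GenTangent I' y) := by
        simp [ContinuousLinearMap.smul_comp]
      rw [h₁, h₂, map_smul, map_smul]
      ext1
      · simp only [Prod.smul_fst, map_smul, smul_add, RingHom.id_apply]
      · simp only [Prod.smul_snd, ContinuousLinearMap.smul_comp, smul_add, RingHom.id_apply] }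

/-! ### Hyperkähler manifolds -/

section Hyperkahler

variable {E : Type*} [NormedAddCommGroup E] [NormedSpace ℝ E] [FiniteDimensional ℝ E]
  {M : Type*} [TopologicalSpace M] [ChartedSpace E M]

/-- The metric `g` is Kähler with respect to `A`: `A` is a smooth almost complex structure whose
`+i`-eigenbundle `T^{1,0}` is involutive, `g` is `A`-invariant, and the form `g(A·, ·)` is
closed. -/
structure IsKahlerian [IsManifold 𝓘(ℝ, E) ∞ M]
    (g : ContMDiffRiemannianMetric 𝓘(ℝ, E) ∞ E (fun x : M => TangentSpace 𝓘(ℝ, E) x))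
    (A : ∀ x : M, TangentSpace 𝓘(ℝ, E) x →L[ℝ] TangentSpace 𝓘(ℝ, E) x) : Prop where
  smooth : ContMDiff 𝓘(ℝ, E) (𝓘(ℝ, E).prod 𝓘(ℝ, E →L[ℝ] E)) ∞
    (fun x => TotalSpace.mk' (E →L[ℝ] E)
      (E := fun x : M => TangentSpace 𝓘(ℝ, E) x →L[ℝ] TangentSpace 𝓘(ℝ, E) x) x (A x))
  sq : ∀ (x : M) (v : TangentSpace 𝓘(ℝ, E) x), A x (A x v) = -v
  invariant : ∀ (x : M) (v w : TangentSpace 𝓘(ℝ, E) x),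
    g.inner x (A x v) (A x w) = g.inner x v w
  involutive : ∀ U : Set M, IsOpen U → ∀ X Y Z W : ∀ x : M, TangentSpace 𝓘(ℝ, E) x,
    SmoothVectorOn 𝓘(ℝ, E) X U → SmoothVectorOn 𝓘(ℝ, E) Y U →
    SmoothVectorOn 𝓘(ℝ, E) Z U → SmoothVectorOn 𝓘(ℝ, E) W U →
    (∀ x ∈ U, InEigen (A x) (X x) (Y x)) → (∀ x ∈ U, InEigen (A x) (Z x) (W x)) →
    ∀ x ∈ U, InEigen (A x)
      (VectorField.mlieBracket 𝓘(ℝ, E) X Z x - VectorField.mlieBracket 𝓘(ℝ, E) Y W x)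
      (VectorField.mlieBracket 𝓘(ℝ, E) X W x + VectorField.mlieBracket 𝓘(ℝ, E) Y Z x)
  closed : ClosedFormOn 𝓘(ℝ, E) (fun x : M => twoForm (fundForm (g.inner x) (A x))) univ

variable (E M) in
/-- A hyperkähler structure on `M`: a Riemannian metric that is Kähler with respect to three
complex structures `I`, `J`, `K` that behave like the quaternions. -/
structure HyperkahlerStructure [IsManifold 𝓘(ℝ, E) ∞ M] where
  g : ContMDiffRiemannianMetric 𝓘(ℝ, E) ∞ E (fun x : M => TangentSpace 𝓘(ℝ, E) x)
  I : ∀ x : M, TangentSpace 𝓘(ℝ, E) x →L[ℝ] TangentSpace 𝓘(ℝ, E) x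
  J : ∀ x : M, TangentSpace 𝓘(ℝ, E) x →L[ℝ] TangentSpace 𝓘(ℝ, E) x
  K : ∀ x : M, TangentSpace 𝓘(ℝ, E) x →L[ℝ] TangentSpace 𝓘(ℝ, E) x
  kahler_I : IsKahlerian g I
  kahler_J : IsKahlerian g J
  kahler_K : IsKahlerian g K
  I_J : ∀ x, (I x).comp (J x) = K x
  J_I : ∀ x, (J x).comp (I x) = -K x
  J_K : ∀ x, (J x).comp (K x) = I x
  K_J : ∀ x, (K x).comp (J x) = -I x
  K_I : ∀ x, (K x).comp (I x) = J x
  I_K : ∀ x, (I x).comp (K x) = -J x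

variable [IsManifold 𝓘(ℝ, E) ∞ M] (h : HyperkahlerStructure E M)

namespace HyperkahlerStructure

/-- The complex structure `I_η` of the twistor family,
`((1 - |η|²) I + 2 Re(η) J + 2 Im(η) K) / (1 + |η|²)` for `η ∈ ℂ` and `-I` for `η = ∞`. -/
def twistorI (η : CP1) (x : M) : TangentSpace 𝓘(ℝ, E) x →L[ℝ] TangentSpace 𝓘(ℝ, E) x :=
  η.elim (-h.I x) fun z =>
    ((1 - ‖z‖ ^ 2) / (1 + ‖z‖ ^ 2)) • h.I x + (2 * z.re / (1 + ‖z‖ ^ 2)) • h.J x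
      + (2 * z.im / (1 + ‖z‖ ^ 2)) • h.K x

/-- `𝒥_{α,β}` at `x ∈ M`. -/
def familyJ (α β : CP1) (x : M) : GenTangent 𝓘(ℝ, E) x →ₗ[ℝ] GenTangent 𝓘(ℝ, E) x :=
  biHermitianJ (h.g.inner x) (h.twistorI α x) (h.twistorI β x)

/-- `𝒥'_{α,β}` at `x ∈ M`. -/
def familyJ' (α β : CP1) (x : M) : GenTangent 𝓘(ℝ, E) x →ₗ[ℝ] GenTangent 𝓘(ℝ, E) x :=
  biHermitianJ' (h.g.inner x) (h.twistorI α x) (h.twistorI β x)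

end HyperkahlerStructure

/-- The complex structure of `CP1`: multiplication by `i` on tangent spaces, in the holomorphic
charts `z` and `z⁻¹`. -/
def complexStructureCP1 (p : CP1) : TangentSpace 𝓘(ℝ, ℂ) p →L[ℝ] TangentSpace 𝓘(ℝ, ℂ) p :=
  (ContinuousLinearMap.mul ℝ ℂ Complex.I : ℂ →L[ℝ] ℂ)

variable (E) in
/-- The model with corners of `M × CP1 × CP1`. -/
abbrev twistorModel : ModelWithCorners ℝ (E × ℂ × ℂ) (ModelProd E (ModelProd ℂ ℂ)) :=
  𝓘(ℝ, E).prod (𝓘(ℝ, ℂ).prod 𝓘(ℝ, ℂ))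

namespace HyperkahlerStructure

/-- `𝒥 = 𝒥_{α,β} × 𝒥_{I_{CP1}} × 𝒥_{I_{CP1}}` at the point `(x, α, β)` of `M × CP1 × CP1`. -/
def twistorJ (p : M × CP1 × CP1) :
    GenTangent (twistorModel E) p →ₗ[ℝ] GenTangent (twistorModel E) p :=
  genProd 𝓘(ℝ, E) (𝓘(ℝ, ℂ).prod 𝓘(ℝ, ℂ)) (h.familyJ p.2.1 p.2.2 p.1)
    (genProd 𝓘(ℝ, ℂ) 𝓘(ℝ, ℂ) (genOfComplex (complexStructureCP1 p.2.1))
      (genOfComplex (complexStructureCP1 p.2.2)))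

/-- `𝒥' = 𝒥'_{α,β} × 𝒥_{I_{CP1}} × 𝒥_{-I_{CP1}}` at the point `(x, α, β)` of
`M × CP1 × CP1`. -/
def twistorJ' (p : M × CP1 × CP1) :
    GenTangent (twistorModel E) p →ₗ[ℝ] GenTangent (twistorModel E) p :=
  genProd 𝓘(ℝ, E) (𝓘(ℝ, ℂ).prod 𝓘(ℝ, ℂ)) (h.familyJ' p.2.1 p.2.2 p.1)
    (genProd 𝓘(ℝ, ℂ) 𝓘(ℝ, ℂ) (genOfComplex (complexStructureCP1 p.2.1))
      (genOfComplex (-complexStructureCP1 p.2.2)))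

/-- The Kähler form `g(A·, ·)` on `M`, pulled back to `M × CP1 × CP1`. -/
def pulledForm (A : ∀ x : M, TangentSpace 𝓘(ℝ, E) x →L[ℝ] TangentSpace 𝓘(ℝ, E) x)
    (p : M × CP1 × CP1) : CForm (TangentSpace (twistorModel E) p) :=
  pullForm (mfderiv (twistorModel E) 𝓘(ℝ, E) Prod.fst p)
    (twoForm (fundForm (h.g.inner p.1) (A p.1)))

/-- With `σ = ω_J + i ω_K` and `γ` the conjugate of `β⁻¹`, the two-form
`σ - (α - γ) ω_I + α γ \bar σ`. -/
def exponentForm (p : M × CP1 × CP1) : CForm (TangentSpace (twistorModel E) p) :=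
  let α : ℂ := CP1.coord p.2.1
  let γ : ℂ := starRingEnd ℂ (CP1.coordInv p.2.2)
  let ωI := h.pulledForm h.I p
  let ωJ := h.pulledForm h.J p
  let ωK := h.pulledForm h.K p
  (ωJ + Complex.I • ωK) - (α - γ) • ωI + (α * γ) • (ωJ - Complex.I • ωK)

/-- With `γ` the conjugate of `β⁻¹` and `S` the two-form above, the form
`iⁿ (α + γ)ⁿ exp (-S / (i (α + γ)))`, expanded as
`∑_{j ≤ 2n} (1/j!) (-1)ʲ (i (α + γ))ⁿ⁻ʲ Sʲ`. Where `α + γ = 0` only the term `j = n` remains, by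
the conventions `0 ^ 0 = 1` and `0 ^ k = 0` for integers `k ≠ 0`; this is the continuous
extension, since there the terms with `j ≠ n` tend to zero. -/
def spinor' (n : ℕ) (p : M × CP1 × CP1) : CForm (TangentSpace (twistorModel E) p) :=
  ∑ j ∈ Finset.range (2 * n + 1),
    (((j.factorial : ℂ)⁻¹ * (-1) ^ j) *
      (Complex.I * (CP1.coord p.2.1 + starRingEnd ℂ (CP1.coordInv p.2.2))) ^ ((n : ℤ) - (j : ℤ))) •
        h.exponentForm p ^ j

/-- The form `Φ' ∧ dα ∧ dγ` on `M × CP1 × CP1`, with `γ` the conjugate of `β⁻¹`. -/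
def twistorSpinor' (n : ℕ) (p : M × CP1 × CP1) : CForm (TangentSpace (twistorModel E) p) :=
  h.spinor' n p *
    oneForm (mvfderiv (twistorModel E) (fun q : M × CP1 × CP1 => CP1.coord q.2.1) p) *
    oneForm (mvfderiv (twistorModel E)
      (fun q : M × CP1 × CP1 => starRingEnd ℂ (CP1.coordInv q.2.2)) p)

end HyperkahlerStructure

end Hyperkahler

end

/-! Both structures are handled through spinors. Let `L` be the `+i`-eigenspace of a linear
generalized complex structure. If a non-zero form is annihilated by `L`, its annihilator is exactly
`L`: the Clifford relation makes every annihilating vector orthogonal to `L`, and `L` is its own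
orthogonal complement (`cliffordAct_eq_zero_iff`). If the form is also closed, `L` is involutive:
differentiating `a·Φ = 0` and `b·Φ = 0` gives `[a, b]·Φ = -b·a·dΦ = 0` (`cAct_cBracket`). So
integrability follows once every point has a neighbourhood carrying a smooth, closed, non-zero form
annihilated by `L` (`courantInvolutive_of_hasChartExpr`).

Pointwise, the complex covectors are a module over the complexified quaternions, and contracting the
two-form `g(q·, ·)` with `X` gives `q·g(X)` (`contr_form`). Take homogeneous coordinates `(a₀, a₁)`
for `α` and `(g₀, g₁)` for the conjugate of `β⁻¹`. The exponent `S` is then the form of a quaternion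
`s` that is bilinear in the two pairs, with `s² = -δ²` and `δ = a₁g₀ + a₀g₁`. It acts by `-iδ` on
the covectors of type (1,0) for `I_α` and by `iδ` on those of type (0,1) for `I_β`. On the other
side, `𝒥'` acts as `I_β` on the graph of `g` and as `-I_α` on the graph of `-g`. An element `X + ξ`
of `L` therefore satisfies `s·g(X) = iδ ξ`, which says precisely that it annihilates `exp(-S/(iδ))`
(`contr_spinor`).

At `δ = 0` the exponential formula breaks down. Write `S = λ S₀ + δ T`, where `S₀` is the
holomorphic symplectic form of `I_α`. Since `S₀^(n+1) = 0` and `S₀^n T = 0`, all negative powers of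
`δ` cancel, and the spinor is a polynomial in `λ`, `δ`, `S₀`, `T` (`expSpinor_eq_polySpinor`). This
gives smoothness, the value at `δ = 0` and its non-vanishing. The vanishing statements come from
`pow_top_of_numberOp`: an operator `∑ wᵢ ∧ ι_{xᵢ}` multiplies `S^k` by `2k`, whereas it multiplies a
form killed by all `wᵢ` by the trace `∑ xᵢ(wᵢ)`. Comparing the two finds the last non-zero power.

For closedness put `θ = dα ∧ dγ`. The forms `f` with `df ∧ θ = 0` contain the Kähler forms and the
functions `α`, `γ`, and are stable under sums and products; hence they contain the spinor, and `d(f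
∧ dα ∧ dγ) = 0`.

The structure `𝒥` needs no separate argument: `-I_β` belongs to the antipodal point of the twistor
line, so `𝒥_{α,β}` is `𝒥'` for the antipode of `β`, and its spinor depends holomorphically on `β`
instead of antiholomorphically. Finally `𝒥_{α,β} 𝒥'_{α,β}` interchanges `X` and `g(X)`, so `G` is
positive definite on the `8n` dimensions coming from `M`. On each line it is the natural pairing up
to sign, of signature `(2,2)`. The total is `(8n+4, 4)`. -/

set_option linter.unusedSectionVars false
set_option linter.unusedSimpArgs false
set_option linter.unnecessarySeqFocus false

noncomputable section

/-! ### Contractions in the exterior algebra -/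

section Contraction

variable {N : Type*} [AddCommGroup N] [Module ℂ N]

/-- The contraction of an element of the exterior algebra with a covector. -/
def contr : Module.Dual ℂ N →ₗ[ℂ] ExteriorAlgebra ℂ N →ₗ[ℂ] ExteriorAlgebra ℂ N :=
  CliffordAlgebra.contractLeft (Q := (0 : QuadraticForm ℂ N))

theorem contr_ι_mul (x : Module.Dual ℂ N) (a : N) (Φ : ExteriorAlgebra ℂ N) :
    contr x (ExteriorAlgebra.ι ℂ a * Φ) = x a • Φ - ExteriorAlgebra.ι ℂ a * contr x Φ :=
  CliffordAlgebra.contractLeft_ι_mul ..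

theorem contr_ι (x : Module.Dual ℂ N) (a : N) :
    contr x (ExteriorAlgebra.ι ℂ a) = algebraMap ℂ _ (x a) :=
  CliffordAlgebra.contractLeft_ι ..

theorem contr_one (x : Module.Dual ℂ N) : contr x (1 : ExteriorAlgebra ℂ N) = 0 :=
  CliffordAlgebra.contractLeft_one ..

theorem contr_comm (x y : Module.Dual ℂ N) (Φ : ExteriorAlgebra ℂ N) :
    contr x (contr y Φ) = -contr y (contr x Φ) :=
  CliffordAlgebra.contractLeft_comm ..

theorem ι_mul_ι_comm (a b : N) :
    ExteriorAlgebra.ι ℂ a * ExteriorAlgebra.ι ℂ b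
      = -(ExteriorAlgebra.ι ℂ b * ExteriorAlgebra.ι ℂ a) :=
  eq_neg_of_add_eq_zero_left (ExteriorAlgebra.ι_add_mul_swap a b)

/-- The subalgebra of even elements of the exterior algebra. -/
def evenForms (N : Type*) [AddCommGroup N] [Module ℂ N] : Subalgebra ℂ (ExteriorAlgebra ℂ N) :=
  Algebra.adjoin ℂ (range fun p : N × N => ExteriorAlgebra.ι ℂ p.1 * ExteriorAlgebra.ι ℂ p.2)

theorem ι_mul_ι_mem_evenForms (a b : N) :
    ExteriorAlgebra.ι ℂ a * ExteriorAlgebra.ι ℂ b ∈ evenForms N :=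
  Algebra.subset_adjoin ⟨(a, b), rfl⟩

/-- A product of two one-forms passes a third one with two sign changes, and commutation extends
from generators to the algebra they generate. -/
theorem evenForms_comm {S : ExteriorAlgebra ℂ N} (hS : S ∈ evenForms N)
    (Φ : ExteriorAlgebra ℂ N) : S * Φ = Φ * S := by
  induction hS using Algebra.adjoin_induction generalizing Φ with
  | mem S hS =>
    obtain ⟨⟨a, b⟩, rfl⟩ := hS
    dsimp only
    induction Φ using ExteriorAlgebra.induction with
    | algebraMap r => exact (Algebra.commutes r _).symm
    | ι c =>
      rw [mul_assoc, ι_mul_ι_comm b c, mul_neg, ← mul_assoc, ι_mul_ι_comm a c, neg_mul, neg_neg,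
        mul_assoc]
    | mul Φ Ψ h₁ h₂ => rw [← mul_assoc, h₁, mul_assoc, h₂, mul_assoc]
    | add Φ Ψ h₁ h₂ => rw [mul_add, add_mul, h₁, h₂]
  | algebraMap c => exact Algebra.commutes c Φ
  | add S T _ _ hS hT => rw [add_mul, mul_add, hS, hT]
  | mul S T _ _ hS hT => rw [mul_assoc, hT, ← mul_assoc, hS, mul_assoc]

/-- The sign in the antiderivation rule disappears when the first factor is even. Contraction thus
becomes an ordinary derivation on even forms, and powers and exponentials can be differentiated as
in the commutative case. -/
theorem contr_even_mul {S : ExteriorAlgebra ℂ N} (hS : S ∈ evenForms N) (x : Module.Dual ℂ N)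
    (Φ : ExteriorAlgebra ℂ N) : contr x (S * Φ) = contr x S * Φ + S * contr x Φ := by
  induction hS using Algebra.adjoin_induction generalizing Φ with
  | mem S hS =>
    obtain ⟨⟨a, b⟩, rfl⟩ := hS
    dsimp only
    rw [mul_assoc, contr_ι_mul, contr_ι_mul, contr_ι_mul, contr_ι]
    simp only [sub_mul, mul_sub, mul_assoc, smul_mul_assoc, mul_smul_comm,
      Algebra.algebraMap_eq_smul_one, mul_one]
    abel
  | algebraMap c =>
    rw [Algebra.algebraMap_eq_smul_one, smul_one_mul, map_smul, map_smul, contr_one]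
    simp
  | add S T _ _ hS hT =>
    rw [add_mul, map_add, hS, hT, map_add, add_mul, add_mul]
    abel
  | mul S T _ _ hS hT =>
    rw [mul_assoc, hS, hT, hS T]
    simp only [mul_add, add_mul, mul_assoc, add_assoc]

theorem contr_even_pow {S : ExteriorAlgebra ℂ N} (hS : S ∈ evenForms N) (x : Module.Dual ℂ N)
    (k : ℕ) : contr x (S ^ (k + 1)) = (k + 1 : ℂ) • (contr x S * S ^ k) := by
  induction k with
  | zero => simp
  | succ k ih =>
    rw [pow_succ' S (k + 1), contr_even_mul hS, ih, mul_smul_comm, ← mul_assoc,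
      evenForms_comm hS (contr x S), mul_assoc, ← pow_succ']
    push_cast
    module

/-- The operator `∑ᵢ wᵢ ∧ ι_{xᵢ}`. -/
def numberOp {κ : Type*} [Fintype κ] (x : κ → Module.Dual ℂ N) (w : κ → N) :
    ExteriorAlgebra ℂ N →ₗ[ℂ] ExteriorAlgebra ℂ N :=
  ∑ i, (LinearMap.mulLeft ℂ (ExteriorAlgebra.ι ℂ (w i))).comp (contr (x i))

variable {κ : Type*} [Fintype κ] {x : κ → Module.Dual ℂ N} {w : κ → N}

theorem numberOp_apply (Φ : ExteriorAlgebra ℂ N) :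
    numberOp x w Φ = ∑ i, ExteriorAlgebra.ι ℂ (w i) * contr (x i) Φ := by
  simp [numberOp]

/-- Contracting `wᵢ ∧ Φ = 0` with `xᵢ` gives `wᵢ ∧ ι_{xᵢ} Φ = xᵢ(wᵢ) Φ`. On such forms the operator
is multiplication by a trace. -/
theorem numberOp_of_mul_eq_zero {Φ : ExteriorAlgebra ℂ N}
    (h : ∀ i, ExteriorAlgebra.ι ℂ (w i) * Φ = 0) :
    numberOp x w Φ = (∑ i, x i (w i)) • Φ := by
  rw [numberOp_apply, Finset.sum_smul]
  refine Finset.sum_congr rfl fun i _ => ?_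
  have := contr_ι_mul (x i) (w i) Φ
  rw [h i, map_zero] at this
  exact (sub_eq_zero.1 this.symm).symm

theorem numberOp_pow {S : ExteriorAlgebra ℂ N} (hS : S ∈ evenForms N)
    (h : numberOp x w S = (2 : ℂ) • S) (k : ℕ) :
    numberOp x w (S ^ k) = (2 * k : ℂ) • S ^ k := by
  cases k with
  | zero => simp [numberOp_apply, contr_one]
  | succ k =>
    rw [numberOp_apply] at h ⊢
    simp only [contr_even_pow hS, mul_smul_comm, ← mul_assoc]
    rw [← Finset.smul_sum, ← Finset.sum_mul, h, smul_mul_assoc, ← pow_succ', smul_smul]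
    push_cast
    congr 1
    ring

/-- Non-zero powers would be eigenvectors for the pairwise distinct eigenvalues `2k`, an infinite
independent family in a finite-dimensional space. -/
theorem exists_pow_eq_zero_of_numberOp [FiniteDimensional ℂ (ExteriorAlgebra ℂ N)]
    {S : ExteriorAlgebra ℂ N} (hS : S ∈ evenForms N)
    (h : numberOp x w S = (2 : ℂ) • S) : ∃ k, S ^ k = 0 := by
  by_contra! hne
  have hinj : Function.Injective (fun k : ℕ => (2 * k : ℂ)) := fun a b hab => by
    simpa using hab
  have := Module.End.eigenvectors_linearIndependent' (numberOp x w) (fun k : ℕ => (2 * k : ℂ)) hinj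
    (fun k => S ^ k) fun k => ⟨Module.End.mem_eigenspace_iff.2 (numberOp_pow hS h k), hne k⟩
  exact not_finite_iff_infinite.2 inferInstance this.finite

/-- If `S` is a nondegenerate two-form on a space of dimension `2 m`, then `S ^ m` spans the top
exterior power. -/
theorem pow_top_of_numberOp [FiniteDimensional ℂ (ExteriorAlgebra ℂ N)]
    {S : ExteriorAlgebra ℂ N} (hS : S ∈ evenForms N)
    (h : numberOp x w S = (2 : ℂ) • S) {m : ℕ} (hm : ∑ i, x i (w i) = 2 * m)
    (hw : ∀ i, ∃ y, contr y S = ExteriorAlgebra.ι ℂ (w i)) :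
    S ^ m ≠ 0 ∧ S ^ (m + 1) = 0 ∧ ∀ i, ExteriorAlgebra.ι ℂ (w i) * S ^ m = 0 := by
  classical
  -- Let `k + 1` be the least exponent at which the power vanishes; the aim is `k = m`.
  have hex := exists_pow_eq_zero_of_numberOp hS h
  obtain ⟨k, hk⟩ : ∃ k, Nat.find hex = k + 1 := by
    refine Nat.exists_eq_succ_of_ne_zero fun h0 => ?_
    have := Nat.find_spec hex
    rw [h0, pow_zero] at this
    exact one_ne_zero this
  have h1 : S ^ (k + 1) = 0 := hk ▸ Nat.find_spec hex
  have h2 : S ^ k ≠ 0 := Nat.find_min hex (by omega)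
  -- Each `wᵢ` is a contraction of `S`, so contracting `S^(k+1) = 0` yields `(k + 1) wᵢ ∧ S^k = 0`.
  have h3 : ∀ i, ExteriorAlgebra.ι ℂ (w i) * S ^ k = 0 := fun i => by
    obtain ⟨y, hy⟩ := hw i
    have := contr_even_pow hS y k
    rw [h1, map_zero, hy] at this
    exact (smul_eq_zero.1 this.symm).resolve_left (by exact_mod_cast k.succ_ne_zero)
  -- The non-zero form `S^k` now has two eigenvalues for the same operator: the trace `2m` and the
  -- degree count `2k`.
  have h4 := numberOp_of_mul_eq_zero (x := x) h3
  rw [numberOp_pow hS h, hm] at h4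
  have h5 : (2 * k : ℂ) = 2 * m := smul_left_injective ℂ h2 h4
  have h6 : k = m := by simpa using h5
  exact h6 ▸ ⟨h2, h1, h3⟩

theorem contr_mul_pow_eq_zero {S : ExteriorAlgebra ℂ N} (hS : S ∈ evenForms N) {k : ℕ}
    (h : S ^ (k + 1) = 0) (y : Module.Dual ℂ N) : contr y S * S ^ k = 0 := by
  have := contr_even_pow hS y k
  rw [h, map_zero] at this
  exact (smul_eq_zero.1 this.symm).resolve_left (by exact_mod_cast k.succ_ne_zero)

/-- The sum `∑_{j ≤ 2n} (1/j!) (-1)ʲ cⁿ⁻ʲ Sʲ`, that is `cⁿ exp (-S / c)`. -/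
def expSpinor (n : ℕ) (c : ℂ) (S : ExteriorAlgebra ℂ N) : ExteriorAlgebra ℂ N :=
  ∑ j ∈ Finset.range (2 * n + 1),
    (((j.factorial : ℂ)⁻¹ * (-1) ^ j) * c ^ ((n : ℤ) - (j : ℤ))) • S ^ j

theorem expSpinor_mem_evenForms (n : ℕ) (c : ℂ) {S : ExteriorAlgebra ℂ N}
    (hS : S ∈ evenForms N) : expSpinor n c S ∈ evenForms N :=
  Subalgebra.sum_mem _ fun j _ => Subalgebra.smul_mem _ (Subalgebra.pow_mem _ hS j) _

/-- Only `j = n` survives because `0 ^ 0 = 1` while every other integer power of `0`, negative ones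
included, is `0` by convention. -/
theorem expSpinor_zero (n : ℕ) (S : ExteriorAlgebra ℂ N) :
    expSpinor n 0 S = (((n.factorial : ℂ)⁻¹ * (-1) ^ n)) • S ^ n := by
  rw [expSpinor, Finset.sum_eq_single n]
  · simp
  · intro j _ hj
    rw [zero_zpow _ (by omega)]
    simp
  · intro h
    simp at h
    omega

/-- The chain rule for an exponential. The truncation at `2n` is harmless: the missing term contains
`ι_y S ∧ S^(2n)`, a multiple of the contraction of `S^(2n+1) = 0`. -/
theorem contr_expSpinor (n : ℕ) {c : ℂ} (hc : c ≠ 0) {S : ExteriorAlgebra ℂ N}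
    (hS : S ∈ evenForms N) (h : S ^ (2 * n + 1) = 0) (y : Module.Dual ℂ N) :
    contr y (expSpinor n c S) = -c⁻¹ • (contr y S * expSpinor n c S) := by
  -- For partial sums the rule holds exactly, with one term fewer on the right.
  have key : ∀ m : ℕ, contr y (∑ j ∈ Finset.range (m + 1),
        (((j.factorial : ℂ)⁻¹ * (-1) ^ j) * c ^ ((n : ℤ) - (j : ℤ))) • S ^ j)
      = -c⁻¹ • (contr y S * ∑ j ∈ Finset.range m,
        (((j.factorial : ℂ)⁻¹ * (-1) ^ j) * c ^ ((n : ℤ) - (j : ℤ))) • S ^ j) := by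
    intro m
    induction m with
    | zero => simp [contr_one]
    | succ m ih =>
      rw [Finset.sum_range_succ, map_add, ih, Finset.sum_range_succ, mul_add, smul_add, map_smul,
        contr_even_pow hS, mul_smul_comm, smul_smul, smul_smul]
      congr 2
      have hm : (m + 1 : ℂ) ≠ 0 := by exact_mod_cast m.succ_ne_zero
      have hf : (m.factorial : ℂ) ≠ 0 := by exact_mod_cast m.factorial_ne_zero
      have hz : c ^ ((n : ℤ) - (m : ℤ)) = c ^ ((n : ℤ) - ((m + 1 : ℕ) : ℤ)) * c := by
        rw [← zpow_add_one₀ hc]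
        congr 1
        push_cast
        ring
      rw [hz, Nat.factorial_succ]
      push_cast
      field_simp
      ring
  have h0 := contr_mul_pow_eq_zero hS h y
  rw [expSpinor, key (2 * n), Finset.sum_range_succ, mul_add, mul_smul_comm, h0, smul_zero,
    add_zero]

/-- Multiplication by `S^(2n)` kills every term except the constant one, `c^n`. -/
theorem expSpinor_ne_zero (n : ℕ) {c : ℂ} (hc : c ≠ 0) {S : ExteriorAlgebra ℂ N}
    (h : S ^ (2 * n + 1) = 0) (h' : S ^ (2 * n) ≠ 0) : expSpinor n c S ≠ 0 := by
  intro h0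
  have : S ^ (2 * n) * expSpinor n c S = c ^ n • S ^ (2 * n) := by
    rw [expSpinor, Finset.mul_sum, Finset.sum_eq_single 0]
    · simp
    · intro j _ hj
      rw [mul_smul_comm, ← pow_add, show 2 * n + j = 2 * n + 1 + (j - 1) by omega, pow_add, h,
        zero_mul, smul_zero]
    · simp
  rw [h0, mul_zero] at this
  exact (smul_ne_zero (pow_ne_zero n hc) h') this.symm

end Contraction

/-! ### Finite-dimensionality of the space of forms. -/

instance {V : Type*} [AddCommGroup V] [Module ℝ V] [TopologicalSpace V]
    [IsTopologicalAddGroup V] [ContinuousSMul ℝ V] [T2Space V] [FiniteDimensional ℝ V] :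
    FiniteDimensional ℂ (V →L[ℝ] ℂ) := by
  have h : FiniteDimensional ℝ (V →L[ℝ] ℂ) :=
    Module.Finite.equiv (LinearMap.toContinuousLinearMap (𝕜 := ℝ) (E := V) (F' := ℂ))
  exact Module.Finite.of_restrictScalars_finite ℝ ℂ _

instance {N : Type*} [AddCommGroup N] [Module ℂ N] [FiniteDimensional ℂ N] :
    FiniteDimensional ℂ (ExteriorAlgebra ℂ N) :=
  Module.Finite.of_basis (Module.finBasis ℂ N).ExteriorAlgebra

end

noncomputable section

section OneForm

variable {V : Type*} [AddCommGroup V] [Module ℝ V] [TopologicalSpace V]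

theorem oneForm_add (φ ψ : V →L[ℝ] ℂ) : oneForm (φ + ψ) = oneForm φ + oneForm ψ := map_add _ _ _

theorem oneForm_smul (c : ℂ) (φ : V →L[ℝ] ℂ) : oneForm (c • φ) = c • oneForm φ := map_smul _ _ _

end OneForm

/-! ### The spinor as a polynomial in its parameters. -/

section Contraction

variable {N : Type*} [AddCommGroup N] [Module ℂ N]

/-- For `S = λ S₀ + δ T` the form `(i δ)ⁿ exp (-S / (i δ))` as a polynomial in `λ`, `δ`, `S₀`,
`T`, valid when `S₀ ^ (n + 1) = 0`. -/
def polySpinor (n : ℕ) (l δ : ℂ) (S₀ T : ExteriorAlgebra ℂ N) : ExteriorAlgebra ℂ N :=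
  ∑ j ∈ Finset.range (2 * n + 1), ∑ k ∈ Finset.range (j + 1),
    ((((j.factorial : ℂ)⁻¹ * (-1) ^ j) * Complex.I ^ ((n : ℤ) - (j : ℤ)) * (j.choose k)) *
      (δ ^ (n - k) * l ^ k)) • (S₀ ^ k * T ^ (j - k))

/-- In the binomial expansion of `(λ S₀ + δ T)^j` the term with `S₀^k` carries `δ^(n-j) δ^(j-k) =
δ^(n-k)`. As `S₀^k = 0` for `k > n`, no negative power of `δ` remains. At `δ = 0` only `k = n`
contributes, and `S₀^n T = 0` forces `j = n`, in agreement with the convention for the degenerate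
value. -/
theorem expSpinor_eq_polySpinor (n : ℕ) (l δ : ℂ) {S₀ T : ExteriorAlgebra ℂ N}
    (hS : S₀ ∈ evenForms N) (h : S₀ ^ (n + 1) = 0) (hT : S₀ ^ n * T = 0) :
    expSpinor n (Complex.I * δ) (l • S₀ + δ • T) = polySpinor n l δ S₀ T := by
  have hbig : ∀ k, n < k → S₀ ^ k = 0 := fun k hk => by
    rw [show k = n + 1 + (k - (n + 1)) by omega, pow_add, h, zero_mul]
  by_cases hδ : δ = 0
  · subst hδ
    rw [mul_zero, expSpinor_zero, zero_smul, add_zero, polySpinor,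
      Finset.sum_eq_single_of_mem n (by simp; omega), Finset.sum_eq_single_of_mem n (by simp)]
    · simp [smul_pow, smul_smul]
    · intro k hk hkn
      have : n - k ≠ 0 := by simp at hk; omega
      simp [zero_pow this]
    · intro j hj hjn
      refine Finset.sum_eq_zero fun k hk => ?_
      rcases lt_trichotomy k n with hkn | rfl | hkn
      · have : n - k ≠ 0 := by omega
        simp [zero_pow this]
      -- Here `k = n < j`: the term still contains a factor `T` next to `S₀^n`.
      · have : j - k = (j - k - 1) + 1 := by simp at hk; omega
        rw [this, pow_succ', ← mul_assoc (S₀ ^ _), hT]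
        simp
      · simp [hbig k hkn]
  · rw [expSpinor, polySpinor]
    refine Finset.sum_congr rfl fun j _ => ?_
    have hc : Commute (l • S₀) (δ • T) :=
      evenForms_comm (Subalgebra.smul_mem _ hS l) _
    rw [hc.add_pow, Finset.smul_sum]
    refine Finset.sum_congr rfl fun k hk => ?_
    have hkj : k ≤ j := by simp at hk; omega
    by_cases hkn : n < k
    · simp [hbig k hkn, smul_pow]
    -- The integer exponent `n - k` is a natural number because `k ≤ n` in this case.
    · have hz : (Complex.I * δ) ^ ((n : ℤ) - (j : ℤ)) * δ ^ (j - k)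
          = Complex.I ^ ((n : ℤ) - (j : ℤ)) * δ ^ (n - k) := by
        rw [mul_zpow, mul_assoc, ← zpow_natCast δ (j - k), ← zpow_natCast δ (n - k),
          ← zpow_add₀ hδ]
        congr 2
        push_cast [hkj, not_lt.1 hkn]
        ring
      rw [smul_pow, smul_pow, smul_mul_smul_comm, ← Nat.cast_comm, ← nsmul_eq_mul,
        ← Nat.cast_smul_eq_nsmul ℂ, smul_smul, smul_smul]
      congr 1
      linear_combination ((j.factorial : ℂ)⁻¹ * (-1) ^ j) * (j.choose k) * l ^ k * hz

end Contraction

/-! ### Two-forms of complex bilinear forms -/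

section Wedge

variable {V : Type*} [AddCommGroup V] [Module ℝ V] [TopologicalSpace V]
  [IsTopologicalAddGroup V] [ContinuousSMul ℝ V] [T2Space V] [FiniteDimensional ℝ V]
  {W : Type*} [AddCommGroup W] [Module ℝ W] [TopologicalSpace W]
  [IsTopologicalAddGroup W] [ContinuousSMul ℝ W] [T2Space W] [FiniteDimensional ℝ W]

variable (V) in
/-- The complexified dual basis. -/
def dualVec (i : Fin (Module.finrank ℝ V)) : V →L[ℝ] ℂ :=
  complexCovector (LinearMap.toContinuousLinearMap ((Module.finBasis ℝ V).coord i)) 0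

theorem dualVec_apply (i : Fin (Module.finrank ℝ V)) (v : V) :
    dualVec V i v = ((Module.finBasis ℝ V).repr v i : ℂ) := by
  simp [dualVec, complexCovector]

theorem sum_dualVec_smul (φ : V →L[ℝ] ℂ) :
    ∑ i, φ (Module.finBasis ℝ V i) • dualVec V i = φ := by
  ext v
  conv_rhs => rw [← (Module.finBasis ℝ V).sum_repr v]
  simp only [map_sum, map_smul, FunLike.coe_sum, Finset.sum_apply, FunLike.coe_smul,
    Pi.smul_apply, dualVec_apply, smul_eq_mul, Complex.real_smul]
  exact Finset.sum_congr rfl fun i _ => mul_comm _ _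

/-- Linearity over the reals of a map with values in a complex vector space. -/
structure IsRealLinear {V X : Type*} [AddCommGroup V] [Module ℝ V] [AddCommGroup X] [Module ℂ X]
    (F : V → X) : Prop where
  map_add : ∀ v w, F (v + w) = F v + F w
  map_smul : ∀ (c : ℝ) v, F (c • v) = (c : ℂ) • F v

theorem IsRealLinear.map_sum_smul {V X : Type*} [AddCommGroup V] [Module ℝ V] [AddCommGroup X]
    [Module ℂ X] {F : V → X} (hF : IsRealLinear F) {κ : Type*} (s : Finset κ) (c : κ → ℝ)
    (v : κ → V) : F (∑ i ∈ s, c i • v i) = ∑ i ∈ s, (c i : ℂ) • F (v i) := by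
  classical
  induction s using Finset.induction_on with
  | empty => simpa using hF.map_smul 0 0
  | insert a s ha ih => rw [Finset.sum_insert ha, Finset.sum_insert ha, hF.map_add, hF.map_smul, ih]

theorem IsRealLinear.sum_dualVec {X : Type*} [AddCommGroup X] [Module ℂ X] {F : V → X}
    (hF : IsRealLinear F) (v : V) :
    ∑ i, dualVec V i v • F (Module.finBasis ℝ V i) = F v := by
  conv_rhs => rw [← (Module.finBasis ℝ V).sum_repr v, hF.map_sum_smul]
  exact Finset.sum_congr rfl fun i _ => by rw [dualVec_apply]

theorem IsRealLinear.of_linearMap (B : V →ₗ[ℝ] (V →L[ℝ] ℂ)) : IsRealLinear B :=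
  ⟨LinearMap.map_add B, fun c v => by rw [LinearMap.map_smul]; ext; simp⟩

/-- The wedge product `∑ᵢ eⁱ ∧ F(eᵢ)`. -/
def wedgeD (F : V → CForm V) : CForm V :=
  ∑ i, oneForm (dualVec V i) * F (Module.finBasis ℝ V i)

/-- Expanding `eⁱ ∘ A` in the dual basis of `V` moves `A` from the covector to the argument of `F`:
this is the basis independence of `∑ eⁱ ⊗ eᵢ`. It yields naturality of two-forms and of `d` under
pull-back, and below it turns precomposition with a complex structure into quaternion
multiplication. -/
theorem sum_oneForm_comp (A : V →L[ℝ] W) {F : W → CForm V} (hF : IsRealLinear F) :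
    ∑ i, oneForm ((dualVec W i).comp A) * F (Module.finBasis ℝ W i)
      = wedgeD (fun v => F (A v)) := by
  have h1 : ∀ i, oneForm ((dualVec W i).comp A)
      = ∑ j, (dualVec W i (A (Module.finBasis ℝ V j))) • oneForm (dualVec V j) := fun i => by
    conv_lhs => rw [← sum_dualVec_smul ((dualVec W i).comp A)]
    simp only [oneForm, map_sum, map_smul, ContinuousLinearMap.comp_apply]
  simp only [wedgeD, h1, ← hF.sum_dualVec (A _), Finset.mul_sum,
    Finset.sum_mul, smul_mul_assoc, mul_smul_comm]
  exact Finset.sum_comm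

/-- The linear map `v ↦ B v` with values in one-forms. -/
def formMap (B : V →ₗ[ℝ] (V →L[ℝ] ℂ)) (v : V) : CForm V := oneForm (B v)

theorem formMap_apply (B : V →ₗ[ℝ] (V →L[ℝ] ℂ)) (v : V) : formMap B v = oneForm (B v) := rfl

theorem isRealLinear_formMap (B : V →ₗ[ℝ] (V →L[ℝ] ℂ)) : IsRealLinear (formMap B) :=
  ⟨fun v w => by rw [formMap_apply, map_add, oneForm_add]; rfl, fun c v => by
    rw [formMap_apply, (IsRealLinear.of_linearMap B).map_smul, oneForm_smul]; rfl⟩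

/-- The two-form of a complex bilinear form. -/
def bilForm (B : V →ₗ[ℝ] (V →L[ℝ] ℂ)) : CForm V := (1 / 2 : ℂ) • wedgeD (formMap B)

theorem bilForm_mem_evenForms (B : V →ₗ[ℝ] (V →L[ℝ] ℂ)) :
    bilForm B ∈ evenForms (V →L[ℝ] ℂ) :=
  Subalgebra.smul_mem _ (Subalgebra.sum_mem _ fun _ _ => ι_mul_ι_mem_evenForms _ _) _

theorem bilForm_add (B C : V →ₗ[ℝ] (V →L[ℝ] ℂ)) : bilForm (B + C) = bilForm B + bilForm C := by
  simp only [bilForm, wedgeD, formMap_apply, LinearMap.add_apply, oneForm_add, mul_add,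
    Finset.sum_add_distrib, smul_add]

theorem bilForm_smul (c : ℂ) (B : V →ₗ[ℝ] (V →L[ℝ] ℂ)) : bilForm (c • B) = c • bilForm B := by
  simp only [bilForm, wedgeD, formMap_apply, LinearMap.smul_apply, oneForm_smul, mul_smul_comm,
    ← Finset.smul_sum]
  exact smul_comm _ _ _

theorem twoForm_eq_bilForm (B : V →L[ℝ] V →L[ℝ] ℝ) (C : V →ₗ[ℝ] (V →L[ℝ] ℂ))
    (h : ∀ v, C v = complexCovector (B v) 0) : twoForm B = bilForm C := by
  simp only [twoForm, bilForm, wedgeD, formMap_apply, h, dualVec]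

theorem complexEval_eq (v w : V) :
    complexEval v w = complexEval v 0 + Complex.I • complexEval w 0 := by
  ext φ
  simp [complexEval]

/-- Contraction hits either factor of `½ ∑ eⁱ ∧ B(eᵢ)`. Skew-symmetry makes the two contributions
equal, which cancels the factor one half. -/
theorem contr_bilForm {B : V →ₗ[ℝ] (V →L[ℝ] ℂ)} (hB : ∀ v w, B v w = -B w v) (v w : V) :
    contr (complexEval v w) (bilForm B) = oneForm (B v + Complex.I • B w) := by
  have key : ∀ v, contr (complexEval v 0) (bilForm B) = oneForm (B v) := fun v => by
    have h1 : ∑ i, (B (Module.finBasis ℝ V i) v) • dualVec V i = -B v := by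
      rw [← sum_dualVec_smul (-B v)]
      refine Finset.sum_congr rfl fun i _ => ?_
      rw [hB]
      rfl
    have h2 := (IsRealLinear.of_linearMap B).sum_dualVec v
    have h3 : contr (complexEval v 0) (wedgeD (formMap B)) = oneForm (B v) - oneForm (-B v) := by
      rw [← h1, ← h2]
      simp only [wedgeD, formMap_apply, map_sum, oneForm, contr_ι_mul, contr_ι, map_smul,
        Finset.sum_sub_distrib]
      congr 1
      · exact Finset.sum_congr rfl fun i _ => by simp [complexEval]
      · refine Finset.sum_congr rfl fun i _ => ?_
        rw [← Algebra.commutes, Algebra.algebraMap_eq_smul_one, smul_one_mul]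
        simp [complexEval]
    rw [bilForm, map_smul, h3]
    simp only [oneForm, map_neg]
    module
  rw [complexEval_eq, map_add, map_smul, LinearMap.add_apply, LinearMap.smul_apply, key, key,
    oneForm_add, oneForm_smul]

/-- Interchanging the two summation indices reproduces the sum with the opposite sign. The lemma
serves twice: for real quaternions, where `B` is a multiple of the metric, and for `d² = 0`, where
`B` is a second derivative. -/
theorem wedgeD_symm {B : V →ₗ[ℝ] (V →L[ℝ] ℂ)} (hB : ∀ v w, B v w = B w v) :
    wedgeD (formMap B) = 0 := by
  have h1 : ∀ i, oneForm (B (Module.finBasis ℝ V i))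
      = ∑ j, B (Module.finBasis ℝ V i) (Module.finBasis ℝ V j) • oneForm (dualVec V j) := by
    intro i
    conv_lhs => rw [← sum_dualVec_smul (B (Module.finBasis ℝ V i))]
    simp only [oneForm, map_sum, map_smul]
  have h2 : wedgeD (formMap B) = -wedgeD (formMap B) := by
    simp only [wedgeD, formMap_apply, h1, Finset.mul_sum, mul_smul_comm]
    conv_lhs => rw [Finset.sum_comm]
    rw [← Finset.sum_neg_distrib]
    refine Finset.sum_congr rfl fun i _ => ?_
    rw [← Finset.sum_neg_distrib]
    refine Finset.sum_congr rfl fun j _ => ?_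
    rw [hB, oneForm, oneForm, ι_mul_ι_comm, smul_neg]
  have h3 : (2 : ℂ) • wedgeD (formMap B) = 0 := by
    rw [two_smul]
    exact add_eq_zero_iff_eq_neg.2 h2
  exact (smul_eq_zero.1 h3).resolve_left two_ne_zero

end Wedge
end

noncomputable section

/-! ### Quaternionic linear algebra -/

section Quaternion

variable {V : Type*} [AddCommGroup V] [Module ℝ V] [TopologicalSpace V]
  [IsTopologicalAddGroup V] [ContinuousSMul ℝ V] [T2Space V] [FiniteDimensional ℝ V]

/-- An inner product `g` that is Hermitian with respect to three complex structures that behave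
like the quaternions. -/
structure IsQuaternionHermitian (g : V →L[ℝ] V →L[ℝ] ℝ) (I J K : V →L[ℝ] V) : Prop where
  symm : ∀ v w, g v w = g w v
  pos : ∀ v, v ≠ 0 → 0 < g v v
  skew_I : ∀ v w, g (I v) w = -g v (I w)
  skew_J : ∀ v w, g (J v) w = -g v (J w)
  skew_K : ∀ v w, g (K v) w = -g v (K w)
  I_I : ∀ v, I (I v) = -v
  J_J : ∀ v, J (J v) = -v
  I_J : ∀ v, I (J v) = K v
  J_I : ∀ v, J (I v) = -K v

/-- The action `φ ↦ -φ ∘ A` on complex covectors. -/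
def dualRep (A : V →L[ℝ] V) : Module.End ℂ (V →L[ℝ] ℂ) where
  toFun φ := -φ.comp A
  map_add' φ ψ := by ext; simp; ring
  map_smul' c φ := by ext; simp

theorem dualRep_apply (A : V →L[ℝ] V) (φ : V →L[ℝ] ℂ) (v : V) : dualRep A φ v = -φ (A v) := rfl

/-- The complexified linear map `V → V* ⊗ ℂ` given by a bilinear form. -/
def flatMap (g : V →L[ℝ] V →L[ℝ] ℝ) : V →ₗ[ℝ] (V →L[ℝ] ℂ) where
  toFun v := complexCovector (g v) 0
  map_add' v w := by ext; simp [complexCovector]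
  map_smul' c v := by ext; simp [complexCovector]

theorem flatMap_apply (g : V →L[ℝ] V →L[ℝ] ℝ) (v w : V) : flatMap g v w = g v w := by
  simp [flatMap, complexCovector]

theorem complexCovector_eq (φ ψ : V →L[ℝ] ℝ) :
    complexCovector φ ψ = complexCovector φ 0 + Complex.I • complexCovector ψ 0 := by
  ext; simp [complexCovector]

namespace IsQuaternionHermitian

variable {g : V →L[ℝ] V →L[ℝ] ℝ} {I J K : V →L[ℝ] V} (h : IsQuaternionHermitian g I J K)

/-- The quaternion basis of endomorphisms of the space of complex covectors. -/
def basis : QuaternionAlgebra.Basis (Module.End ℂ (V →L[ℝ] ℂ)) (-1 : ℂ) 0 (-1) where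
  i := dualRep I
  j := dualRep J
  k := dualRep K
  i_mul_i := by ext φ v; simp [dualRep_apply, h.I_I]
  j_mul_j := by ext φ v; simp [dualRep_apply, h.J_J]
  i_mul_j := by ext φ v; simp [dualRep_apply, h.J_I]
  j_mul_i := by ext φ v; simp [dualRep_apply, h.I_J]

/-- The action of the complexified quaternions on the space of complex covectors. -/
def rep : Quaternion ℂ →ₐ[ℂ] Module.End ℂ (V →L[ℝ] ℂ) := h.basis.liftHom

theorem rep_apply (q : Quaternion ℂ) (φ : V →L[ℝ] ℂ) :
    h.rep q φ = q.re • φ + q.imI • dualRep I φ + q.imJ • dualRep J φ + q.imK • dualRep K φ := by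
  change (algebraMap ℂ (Module.End ℂ (V →L[ℝ] ℂ)) q.re + q.imI • dualRep I + q.imJ • dualRep J
    + q.imK • dualRep K) φ = _
  simp [Algebra.algebraMap_eq_smul_one]

theorem rep_mul (p q : Quaternion ℂ) (φ : V →L[ℝ] ℂ) :
    h.rep p (h.rep q φ) = h.rep (p * q) φ := by rw [_root_.map_mul]; rfl

/-- The endomorphism of `V` given by a real imaginary quaternion. -/
def _root_.imagEnd (I J K : V →L[ℝ] V) (x y z : ℝ) : V →L[ℝ] V := x • I + y • J + z • K

/-- The quaternion with given imaginary part. -/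
def _root_.imagQuat (x y z : ℂ) : Quaternion ℂ := ⟨0, x, y, z⟩

theorem rep_imagQuat (x y z : ℝ) : h.rep (imagQuat x y z) = dualRep (imagEnd I J K x y z) := by
  ext φ v
  rw [rep_apply]
  simp [imagQuat, imagEnd, dualRep_apply]
  ring

theorem skew_imagEnd (h : IsQuaternionHermitian g I J K) (x y z : ℝ) (v w : V) :
    g (imagEnd I J K x y z v) w = -g v (imagEnd I J K x y z w) := by
  simp [imagEnd, h.skew_I, h.skew_J, h.skew_K]
  ring

/-- The minus sign in `dualRep` offsets the skew-symmetry of imaginary quaternions, so that `v ↦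
g(v)` is equivariant. It also makes precomposition, which reverses products, respect `ij = k`. -/
theorem dualRep_imagEnd_flatMap (h : IsQuaternionHermitian g I J K) (x y z : ℝ) (v : V) :
    dualRep (imagEnd I J K x y z) (flatMap g v) = flatMap g (imagEnd I J K x y z v) := by
  ext w
  rw [dualRep_apply, flatMap_apply, flatMap_apply, h.skew_imagEnd]
  simp

theorem rep_flatMap_apply (q : Quaternion ℂ) (v w : V) :
    h.rep q (flatMap g v) w = q.re * g v w + q.imI * g (I v) w + q.imJ * g (J v) w
      + q.imK * g (K v) w := by
  rw [rep_apply]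
  simp [dualRep_apply, flatMap_apply, h.skew_I, h.skew_J, h.skew_K]

theorem rep_flatMap_skew {q : Quaternion ℂ} (hq : q.re = 0) (v w : V) :
    h.rep q (flatMap g v) w = -h.rep q (flatMap g w) v := by
  rw [rep_flatMap_apply, rep_flatMap_apply, hq, h.skew_I, h.skew_J, h.skew_K, h.symm v (I w),
    h.symm v (J w), h.symm v (K w)]
  push_cast
  ring

/-- The bilinear form `g (q ·, ·)`. -/
def bil (q : Quaternion ℂ) : V →ₗ[ℝ] (V →L[ℝ] ℂ) where
  toFun v := h.rep q (flatMap g v)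
  map_add' v w := by rw [_root_.map_add, _root_.map_add]
  map_smul' c v := by ext; simp [rep_flatMap_apply]

theorem bil_apply (q : Quaternion ℂ) (v : V) : h.bil q v = h.rep q (flatMap g v) := rfl

/-- The two-form `g (q ·, ·)` of an imaginary quaternion `q`. -/
def form (q : Quaternion ℂ) : CForm V := bilForm (h.bil q)

theorem form_mem_evenForms (q : Quaternion ℂ) : h.form q ∈ evenForms (V →L[ℝ] ℂ) :=
  bilForm_mem_evenForms _

theorem form_add (p q : Quaternion ℂ) : h.form (p + q) = h.form p + h.form q := by
  rw [form, form, form, ← bilForm_add]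
  congr 1
  ext v : 1
  simp [bil_apply]

theorem form_smul (c : ℂ) (q : Quaternion ℂ) : h.form (c • q) = c • h.form q := by
  rw [form, form, ← bilForm_smul]
  congr 1
  ext v : 1
  simp [bil_apply]

theorem twoForm_fundForm (x y z : ℝ) :
    twoForm (fundForm g (imagEnd I J K x y z)) = h.form (imagQuat x y z) := by
  refine twoForm_eq_bilForm _ _ fun v => ?_
  rw [bil_apply, rep_imagQuat, h.dualRep_imagEnd_flatMap]
  rfl

/-- This is the bridge from exterior to quaternion algebra: contraction by `X` becomes the action of
`q` on the covector `g(X)`. -/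
theorem contr_form {q : Quaternion ℂ} (hq : q.re = 0) (v w : V) :
    contr (complexEval v w) (h.form q) = oneForm (h.rep q (complexCovector (g v) (g w))) := by
  rw [form, contr_bilForm (fun v w => h.rep_flatMap_skew hq v w), complexCovector_eq]
  simp only [bil_apply, _root_.map_add, _root_.map_smul]
  rfl

theorem injective (h : IsQuaternionHermitian g I J K) : Function.Injective (g : V →ₗ[ℝ] V →L[ℝ] ℝ) := by
  rw [injective_iff_map_eq_zero]
  intro v hv
  by_contra hne
  have := h.pos v hne
  rw [show g v = 0 from hv] at this
  simp at this

theorem surjective (h : IsQuaternionHermitian g I J K) (φ : V →L[ℝ] ℝ) : ∃ v, g v = φ := by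
  have hfin : FiniteDimensional ℝ (V →L[ℝ] ℝ) :=
    Module.Finite.equiv (LinearMap.toContinuousLinearMap (𝕜 := ℝ) (E := V) (F' := ℝ))
  have hrank : Module.finrank ℝ V = Module.finrank ℝ (V →L[ℝ] ℝ) := by
    rw [← (LinearMap.toContinuousLinearMap (𝕜 := ℝ) (E := V) (F' := ℝ)).finrank_eq]
    exact (Subspace.dual_finrank_eq (K := ℝ) (V := V)).symm
  exact (LinearMap.injective_iff_surjective_of_finrank_eq_finrank hrank).1 h.injective φ

theorem exists_complexCovector (h : IsQuaternionHermitian g I J K) (φ : V →L[ℝ] ℂ) : ∃ v w, complexCovector (g v) (g w) = φ := by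
  obtain ⟨v, hv⟩ := h.surjective (Complex.reCLM.comp φ)
  obtain ⟨w, hw⟩ := h.surjective (Complex.imCLM.comp φ)
  refine ⟨v, w, ?_⟩
  rw [hv, hw]
  ext x
  simp [complexCovector, mul_comm Complex.I]

theorem exists_contr_form {q : Quaternion ℂ} (hq : q.re = 0) (φ : V →L[ℝ] ℂ) :
    ∃ y, contr y (h.form q) = oneForm (h.rep q φ) := by
  obtain ⟨v, w, rfl⟩ := h.exists_complexCovector φ
  exact ⟨_, h.contr_form hq v w⟩

theorem wedgeD_bil (q : Quaternion ℂ) : wedgeD (formMap (h.bil q)) = (2 : ℂ) • h.form q := by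
  rw [form, bilForm, smul_smul]
  norm_num

theorem wedgeD_bil_real {q : Quaternion ℂ} (hq : q.imI = 0) (hq' : q.imJ = 0) (hq'' : q.imK = 0) :
    wedgeD (formMap (h.bil q)) = 0 :=
  wedgeD_symm fun v w => by
    rw [bil_apply, bil_apply, rep_flatMap_apply, rep_flatMap_apply, hq, hq', hq'', h.symm v]
    simp

/-- The operator `∑ᵢ (p eⁱ) ∧ ι_{eᵢ}` for a quaternion `p`. -/
def numOp (p : Quaternion ℂ) : CForm V →ₗ[ℂ] CForm V :=
  numberOp (fun i => complexEval (Module.finBasis ℝ V i) 0) (fun i => h.rep p (dualVec V i))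

/-- The scalar half of `p` contributes `½ ∑ eⁱ ∧ q·g(eᵢ)`, the form itself. The imaginary half
precomposes `eⁱ` with an endomorphism; `sum_oneForm_comp` carries it to the other slot, where
equivariance of `g` makes it multiply `q` on the right. -/
theorem numOp_form (c : ℂ) (x y z : ℝ) {q : Quaternion ℂ} (hq : q.re = 0) (p : Quaternion ℂ)
    (hp : p = algebraMap ℂ _ (1 / 2) + c • imagQuat x y z) :
    h.numOp p (h.form q) = h.form q - c • wedgeD (formMap (h.bil (q * imagQuat x y z))) := by
  have h1 : ∀ i, contr (complexEval (Module.finBasis ℝ V i) 0) (h.form q)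
      = formMap (h.bil q) (Module.finBasis ℝ V i) := fun i => by
    rw [h.contr_form hq, _root_.map_zero]
    rfl
  have h2 : ∀ i, h.rep p (dualVec V i) = (1 / 2 : ℂ) • dualVec V i
      + (-c) • ((dualVec V i).comp (imagEnd I J K x y z)) := fun i => by
    rw [hp, _root_.map_add, AlgHom.commutes, _root_.map_smul, rep_imagQuat]
    ext v
    simp [dualRep_apply]
  rw [numOp, numberOp_apply]
  simp only [h1, h2]
  have h3 : ∀ i, ExteriorAlgebra.ι ℂ ((1 / 2 : ℂ) • dualVec V i
      + (-c) • ((dualVec V i).comp (imagEnd I J K x y z)))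
      = (1 / 2 : ℂ) • oneForm (dualVec V i)
        + (-c) • oneForm ((dualVec V i).comp (imagEnd I J K x y z)) := fun i => by
    rw [_root_.map_add, _root_.map_smul, _root_.map_smul]; rfl
  simp only [h3, add_mul, smul_mul_assoc, Finset.sum_add_distrib, ← Finset.smul_sum]
  rw [sum_oneForm_comp _ (isRealLinear_formMap _), sub_eq_add_neg, ← neg_smul]
  congr 2
  refine Finset.sum_congr rfl fun i _ => ?_
  simp only [formMap_apply, bil_apply]
  rw [← h.rep_mul, rep_imagQuat, h.dualRep_imagEnd_flatMap]

end IsQuaternionHermitian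

end Quaternion
end

noncomputable section

/-! ### The quaternions of the twistor family -/

section QuaternionIdentities

/-- The quaternion `a₀g₀ (j + ik) - (a₁g₀ - a₀g₁) i + a₁g₁ (j - ik)`. -/
def spinQuat (a₀ a₁ g₀ g₁ : ℂ) : Quaternion ℂ :=
  ⟨0, -(a₁ * g₀ - a₀ * g₁), a₀ * g₀ + a₁ * g₁, Complex.I * (a₀ * g₀ - a₁ * g₁)⟩

/-- The complex conjugate of the quaternion `spinQuat a₀ a₁ a₀ (-a₁)`, where `p₀` and `p₁` are the
conjugates of `a₀` and `a₁`. -/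
def conjSpinQuat (p₀ p₁ : ℂ) : Quaternion ℂ :=
  ⟨0, -(2 * p₀ * p₁), p₀ ^ 2 - p₁ ^ 2, -Complex.I * (p₀ ^ 2 + p₁ ^ 2)⟩

/-- The numerator of the imaginary quaternion of the twistor family at the point with homogeneous
coordinates `a₀`, `a₁`, whose conjugates are `p₀`, `p₁`. -/
def twistorQuat (a₀ a₁ p₀ p₁ : ℂ) : Quaternion ℂ :=
  ⟨0, a₀ * p₀ - a₁ * p₁, a₁ * p₀ + p₁ * a₀, -Complex.I * (a₁ * p₀ - p₁ * a₀)⟩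

variable (a₀ a₁ g₀ g₁ p₀ p₁ b₀ b₁ : ℂ)

@[simp] theorem spinQuat_re : (spinQuat a₀ a₁ g₀ g₁).re = 0 := rfl

@[simp] theorem spinQuat_imI : (spinQuat a₀ a₁ g₀ g₁).imI = -(a₁ * g₀ - a₀ * g₁) := rfl

@[simp] theorem spinQuat_imJ : (spinQuat a₀ a₁ g₀ g₁).imJ = a₀ * g₀ + a₁ * g₁ := rfl

@[simp] theorem spinQuat_imK : (spinQuat a₀ a₁ g₀ g₁).imK = Complex.I * (a₀ * g₀ - a₁ * g₁) := rfl

@[simp] theorem conjSpinQuat_re : (conjSpinQuat p₀ p₁).re = 0 := rfl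

@[simp] theorem conjSpinQuat_imI : (conjSpinQuat p₀ p₁).imI = -(2 * p₀ * p₁) := rfl

@[simp] theorem conjSpinQuat_imJ : (conjSpinQuat p₀ p₁).imJ = p₀ ^ 2 - p₁ ^ 2 := rfl

@[simp] theorem conjSpinQuat_imK : (conjSpinQuat p₀ p₁).imK = -Complex.I * (p₀ ^ 2 + p₁ ^ 2) := rfl

@[simp] theorem twistorQuat_re : (twistorQuat a₀ a₁ p₀ p₁).re = 0 := rfl

@[simp] theorem twistorQuat_imI : (twistorQuat a₀ a₁ p₀ p₁).imI = a₀ * p₀ - a₁ * p₁ := rfl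

@[simp] theorem twistorQuat_imJ : (twistorQuat a₀ a₁ p₀ p₁).imJ = a₁ * p₀ + p₁ * a₀ := rfl

@[simp] theorem twistorQuat_imK : (twistorQuat a₀ a₁ p₀ p₁).imK = -Complex.I * (a₁ * p₀ - p₁ * a₀) := rfl

@[simp] theorem Quaternion.algebraMap_re (c : ℂ) : (algebraMap ℂ (Quaternion ℂ) c).re = c := rfl

@[simp] theorem Quaternion.algebraMap_imI (c : ℂ) : (algebraMap ℂ (Quaternion ℂ) c).imI = 0 := rfl

@[simp] theorem Quaternion.algebraMap_imJ (c : ℂ) : (algebraMap ℂ (Quaternion ℂ) c).imJ = 0 := rfl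

@[simp] theorem Quaternion.algebraMap_imK (c : ℂ) : (algebraMap ℂ (Quaternion ℂ) c).imK = 0 := rfl

theorem Quaternion.ext_complex {p q : Quaternion ℂ} (h₀ : p.re = q.re) (h₁ : p.imI = q.imI)
    (h₂ : p.imJ = q.imJ) (h₃ : p.imK = q.imK) : p = q := QuaternionAlgebra.ext h₀ h₁ h₂ h₃

/-- With `t` the quaternion of the twistor family and `D = a₀p₀ + a₁p₁`, the `-i`-eigenspace of
`t/D` is the image of `t - iD`. The identity therefore says that `s` acts there as `-iδ`. The
variables `p₀`, `p₁` stand for conjugates but are left free, which keeps these identities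
polynomial. -/
theorem spinQuat_add_mul : (spinQuat a₀ a₁ g₀ g₁
      + algebraMap ℂ _ (Complex.I * (a₁ * g₀ + a₀ * g₁))) *
    (twistorQuat a₀ a₁ p₀ p₁ - algebraMap ℂ _ (Complex.I * (a₀ * p₀ + a₁ * p₁))) = 0 := by
  rw [← map_zero (algebraMap ℂ (Quaternion ℂ))]
  apply Quaternion.ext_complex <;> simp only [Quaternion.re_mul, Quaternion.imI_mul, Quaternion.imJ_mul,    Quaternion.imK_mul,
    Quaternion.re_add, Quaternion.imI_add, Quaternion.imJ_add, Quaternion.imK_add,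
    Quaternion.re_sub, Quaternion.imI_sub, Quaternion.imJ_sub, Quaternion.imK_sub,
    Quaternion.re_smul,    Quaternion.imI_smul, Quaternion.imJ_smul, Quaternion.imK_smul,
    smul_eq_mul, spinQuat_re, spinQuat_imI, spinQuat_imJ, spinQuat_imK, twistorQuat_re,
    twistorQuat_imI, twistorQuat_imJ, twistorQuat_imK, conjSpinQuat_re, conjSpinQuat_imI,
    conjSpinQuat_imJ, conjSpinQuat_imK, Quaternion.algebraMap_re, Quaternion.algebraMap_imI,
    Quaternion.algebraMap_imJ, Quaternion.algebraMap_imK] <;> ring_nf <;>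
    (try simp only [Complex.I_sq]) <;> (try ring)

/-- The counterpart for the other parameter: `s` is `iδ` on the `+i`-eigenspace of the complex
structure with homogeneous coordinates `(ḡ₁, ḡ₀)`. -/
theorem spinQuat_sub_mul : (spinQuat a₀ a₁ g₀ g₁
      - algebraMap ℂ _ (Complex.I * (a₁ * g₀ + a₀ * g₁))) *
    (twistorQuat p₁ p₀ g₁ g₀ + algebraMap ℂ _ (Complex.I * (g₀ * p₀ + g₁ * p₁))) = 0 := by
  rw [← map_zero (algebraMap ℂ (Quaternion ℂ))]
  apply Quaternion.ext_complex <;> simp only [Quaternion.re_mul, Quaternion.imI_mul, Quaternion.imJ_mul,    Quaternion.imK_mul,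
    Quaternion.re_add, Quaternion.imI_add, Quaternion.imJ_add, Quaternion.imK_add,
    Quaternion.re_sub, Quaternion.imI_sub, Quaternion.imJ_sub, Quaternion.imK_sub,
    Quaternion.re_smul,    Quaternion.imI_smul, Quaternion.imJ_smul, Quaternion.imK_smul,
    smul_eq_mul, spinQuat_re, spinQuat_imI, spinQuat_imJ, spinQuat_imK, twistorQuat_re,
    twistorQuat_imI, twistorQuat_imJ, twistorQuat_imK, conjSpinQuat_re, conjSpinQuat_imI,
    conjSpinQuat_imJ, conjSpinQuat_imK, Quaternion.algebraMap_re, Quaternion.algebraMap_imI,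
    Quaternion.algebraMap_imJ, Quaternion.algebraMap_imK] <;> ring_nf <;>
    (try simp only [Complex.I_sq]) <;> (try ring)

/-- For `δ ≠ 0` the quaternion is thus invertible, so its two-form is nondegenerate. -/
theorem spinQuat_mul_self : spinQuat a₀ a₁ g₀ g₁ * spinQuat a₀ a₁ g₀ g₁
    = algebraMap ℂ _ (-(a₁ * g₀ + a₀ * g₁) ^ 2) := by
  apply Quaternion.ext_complex <;> simp only [Quaternion.re_mul, Quaternion.imI_mul, Quaternion.imJ_mul,    Quaternion.imK_mul,
    Quaternion.re_add, Quaternion.imI_add, Quaternion.imJ_add, Quaternion.imK_add,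
    Quaternion.re_sub, Quaternion.imI_sub, Quaternion.imJ_sub, Quaternion.imK_sub,
    Quaternion.re_smul,    Quaternion.imI_smul, Quaternion.imJ_smul, Quaternion.imK_smul,
    smul_eq_mul, spinQuat_re, spinQuat_imI, spinQuat_imJ, spinQuat_imK, twistorQuat_re,
    twistorQuat_imI, twistorQuat_imJ, twistorQuat_imK, conjSpinQuat_re, conjSpinQuat_imI,
    conjSpinQuat_imJ, conjSpinQuat_imK, Quaternion.algebraMap_re, Quaternion.algebraMap_imI,
    Quaternion.algebraMap_imJ, Quaternion.algebraMap_imK] <;> ring_nf <;>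
    (try simp only [Complex.I_sq]) <;> (try ring)

/-- For `g = (a₀, -a₁)` the scalar `δ` vanishes. Right multiplication by the complex structure then
acts as `i`, which expresses that the associated two-form is of type (2,0). -/
theorem spinQuat_mul_twistorQuat : spinQuat a₀ a₁ a₀ (-a₁) * twistorQuat a₀ a₁ p₀ p₁
    = (Complex.I * (a₀ * p₀ + a₁ * p₁)) • spinQuat a₀ a₁ a₀ (-a₁) := by
  apply Quaternion.ext_complex <;> simp only [Quaternion.re_mul, Quaternion.imI_mul, Quaternion.imJ_mul,    Quaternion.imK_mul,
    Quaternion.re_add, Quaternion.imI_add, Quaternion.imJ_add, Quaternion.imK_add,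
    Quaternion.re_sub, Quaternion.imI_sub, Quaternion.imJ_sub, Quaternion.imK_sub,
    Quaternion.re_smul,    Quaternion.imI_smul, Quaternion.imJ_smul, Quaternion.imK_smul,
    smul_eq_mul, spinQuat_re, spinQuat_imI, spinQuat_imJ, spinQuat_imK, twistorQuat_re,
    twistorQuat_imI, twistorQuat_imJ, twistorQuat_imK, conjSpinQuat_re, conjSpinQuat_imI,
    conjSpinQuat_imJ, conjSpinQuat_imK, Quaternion.algebraMap_re, Quaternion.algebraMap_imI,
    Quaternion.algebraMap_imJ, Quaternion.algebraMap_imK] <;> ring_nf <;>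
    (try simp only [Complex.I_sq]) <;> (try ring)

/-- The product with the conjugate is a multiple of the projection to (1,0)-covectors, so every such
covector lies in the image of `s₀`. -/
theorem spinQuat_mul_conjSpinQuat : spinQuat a₀ a₁ a₀ (-a₁) * conjSpinQuat p₀ p₁
    = (-2 * (a₀ * p₀ + a₁ * p₁)) • (algebraMap ℂ _ (a₀ * p₀ + a₁ * p₁)
      + Complex.I • twistorQuat a₀ a₁ p₀ p₁) := by
  apply Quaternion.ext_complex <;> simp only [Quaternion.re_mul, Quaternion.imI_mul, Quaternion.imJ_mul,    Quaternion.imK_mul,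
    Quaternion.re_add, Quaternion.imI_add, Quaternion.imJ_add, Quaternion.imK_add,
    Quaternion.re_sub, Quaternion.imI_sub, Quaternion.imJ_sub, Quaternion.imK_sub,
    Quaternion.re_smul,    Quaternion.imI_smul, Quaternion.imJ_smul, Quaternion.imK_smul,
    smul_eq_mul, spinQuat_re, spinQuat_imI, spinQuat_imJ, spinQuat_imK, twistorQuat_re,
    twistorQuat_imI, twistorQuat_imJ, twistorQuat_imK, conjSpinQuat_re, conjSpinQuat_imI,
    conjSpinQuat_imJ, conjSpinQuat_imK, Quaternion.algebraMap_re, Quaternion.algebraMap_imI,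
    Quaternion.algebraMap_imJ, Quaternion.algebraMap_imK] <;> ring_nf <;>
    (try simp only [Complex.I_sq]) <;> (try ring)

/-- In this order the product is a multiple of the complementary projection, which identifies the
kernel of `s₀` with the (1,0)-covectors. -/
theorem conjSpinQuat_mul_spinQuat : conjSpinQuat p₀ p₁ * spinQuat a₀ a₁ a₀ (-a₁)
    = (-2 * (a₀ * p₀ + a₁ * p₁)) • (algebraMap ℂ _ (a₀ * p₀ + a₁ * p₁)
      - Complex.I • twistorQuat a₀ a₁ p₀ p₁) := by
  apply Quaternion.ext_complex <;> simp only [Quaternion.re_mul, Quaternion.imI_mul, Quaternion.imJ_mul,    Quaternion.imK_mul,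
    Quaternion.re_add, Quaternion.imI_add, Quaternion.imJ_add, Quaternion.imK_add,
    Quaternion.re_sub, Quaternion.imI_sub, Quaternion.imJ_sub, Quaternion.imK_sub,
    Quaternion.re_smul,    Quaternion.imI_smul, Quaternion.imJ_smul, Quaternion.imK_smul,
    smul_eq_mul, spinQuat_re, spinQuat_imI, spinQuat_imJ, spinQuat_imK, twistorQuat_re,
    twistorQuat_imI, twistorQuat_imJ, twistorQuat_imK, conjSpinQuat_re, conjSpinQuat_imI,
    conjSpinQuat_imJ, conjSpinQuat_imK, Quaternion.algebraMap_re, Quaternion.algebraMap_imI,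
    Quaternion.algebraMap_imJ, Quaternion.algebraMap_imK] <;> ring_nf <;>
    (try simp only [Complex.I_sq]) <;> (try ring)

theorem twistorQuat_mul_self : twistorQuat a₀ a₁ p₀ p₁ * twistorQuat a₀ a₁ p₀ p₁
    = algebraMap ℂ _ (-(a₀ * p₀ + a₁ * p₁) ^ 2) := by
  apply Quaternion.ext_complex <;> simp only [Quaternion.re_mul, Quaternion.imI_mul, Quaternion.imJ_mul,    Quaternion.imK_mul,
    Quaternion.re_add, Quaternion.imI_add, Quaternion.imJ_add, Quaternion.imK_add,
    Quaternion.re_sub, Quaternion.imI_sub, Quaternion.imJ_sub, Quaternion.imK_sub,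
    Quaternion.re_smul,    Quaternion.imI_smul, Quaternion.imJ_smul, Quaternion.imK_smul,
    smul_eq_mul, spinQuat_re, spinQuat_imI, spinQuat_imJ, spinQuat_imK, twistorQuat_re,
    twistorQuat_imI, twistorQuat_imJ, twistorQuat_imK, conjSpinQuat_re, conjSpinQuat_imI,
    conjSpinQuat_imJ, conjSpinQuat_imK, Quaternion.algebraMap_re, Quaternion.algebraMap_imI,
    Quaternion.algebraMap_imJ, Quaternion.algebraMap_imK] <;> ring_nf <;>
    (try simp only [Complex.I_sq]) <;> (try ring)

/-- `spinQuat` is linear in `(g₀, g₁)`, and the normalisation of `(b₀, b₁)` makes `(a₀, -a₁)` and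
`(b₀, b₁)` a basis of `ℂ²` in which `g` has coordinates `λ = g₀b₁ - g₁b₀` and `δ`. -/
theorem spinQuat_eq (hb : a₁ * b₀ + a₀ * b₁ = 1) : spinQuat a₀ a₁ g₀ g₁
    = (g₀ * b₁ - g₁ * b₀) • spinQuat a₀ a₁ a₀ (-a₁)
      + (a₁ * g₀ + a₀ * g₁) • spinQuat a₀ a₁ b₀ b₁ := by
  apply Quaternion.ext_complex <;> simp
  · linear_combination (a₁ * g₀ - a₀ * g₁) * hb
  · linear_combination -(a₀ * g₀ + a₁ * g₁) * hb
  · linear_combination -(a₀ * g₀ - a₁ * g₁) * Complex.I * hb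

/-- This is the preceding decomposition for `g = (p₁, p₀)`, because `twistorQuat a₀ a₁ p₀ p₁` equals
`spinQuat a₀ a₁ p₁ p₀`. It expresses `T` through `S₀` and the Kähler form of `I_α`. -/
theorem smul_spinQuat_eq (hb : a₁ * b₀ + a₀ * b₁ = 1) :
    (a₀ * p₀ + a₁ * p₁) • spinQuat a₀ a₁ b₀ b₁
      = (p₀ * b₀ - p₁ * b₁) • spinQuat a₀ a₁ a₀ (-a₁) + twistorQuat a₀ a₁ p₀ p₁ := by
  apply Quaternion.ext_complex <;> simp
  · linear_combination (a₀ * p₀ - a₁ * p₁) * hb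
  · linear_combination (a₁ * p₀ + a₀ * p₁) * hb
  · linear_combination (a₀ * p₁ - a₁ * p₀) * Complex.I * hb

end QuaternionIdentities
end

noncomputable section

/-! ### The pure spinors of the twistor family at a point -/

section TwistorLinear

variable {V : Type*} [AddCommGroup V] [Module ℝ V] [TopologicalSpace V]
  [IsTopologicalAddGroup V] [ContinuousSMul ℝ V] [T2Space V] [FiniteDimensional ℝ V]

/-- The coefficient of `I` in the complex structure with homogeneous coordinates `a₀`, `a₁`. -/
def twistorX (a₀ a₁ : ℂ) : ℝ := (‖a₀‖ ^ 2 - ‖a₁‖ ^ 2) / (‖a₀‖ ^ 2 + ‖a₁‖ ^ 2)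

/-- The coefficient of `J` in the complex structure with homogeneous coordinates `a₀`, `a₁`. -/
def twistorY (a₀ a₁ : ℂ) : ℝ :=
  2 * (a₁ * starRingEnd ℂ a₀).re / (‖a₀‖ ^ 2 + ‖a₁‖ ^ 2)

/-- The coefficient of `K` in the complex structure with homogeneous coordinates `a₀`, `a₁`. -/
def twistorZ (a₀ a₁ : ℂ) : ℝ :=
  2 * (a₁ * starRingEnd ℂ a₀).im / (‖a₀‖ ^ 2 + ‖a₁‖ ^ 2)

/-- The complex structure of the twistor family with homogeneous coordinates `a₀`, `a₁`. -/
def twistorEnd (I J K : V →L[ℝ] V) (a₀ a₁ : ℂ) : V →L[ℝ] V :=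
  imagEnd I J K (twistorX a₀ a₁) (twistorY a₀ a₁) (twistorZ a₀ a₁)

theorem Quaternion.mul_smul_complex (c : ℂ) (p q : Quaternion ℂ) : p * (c • q) = c • (p * q) := by
  apply Quaternion.ext_complex <;> simp <;> ring

theorem Quaternion.smul_mul_complex (c : ℂ) (p q : Quaternion ℂ) : (c • p) * q = c • (p * q) := by
  apply Quaternion.ext_complex <;> simp <;> ring

/-- The squared norm of `(a₀, a₁)` as a complex number. -/
def normSqC (a₀ a₁ : ℂ) : ℂ := a₀ * starRingEnd ℂ a₀ + a₁ * starRingEnd ℂ a₁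

theorem normSqC_eq (a₀ a₁ : ℂ) : normSqC a₀ a₁ = ((‖a₀‖ ^ 2 + ‖a₁‖ ^ 2 : ℝ) : ℂ) := by
  simp [normSqC, Complex.mul_conj, Complex.normSq_eq_norm_sq]

theorem norm_sq_add_ne_zero {a₀ a₁ : ℂ} (ha : a₀ ≠ 0 ∨ a₁ ≠ 0) : ‖a₀‖ ^ 2 + ‖a₁‖ ^ 2 ≠ 0 := by
  rcases ha with h | h
  · have := norm_pos_iff.2 h
    positivity
  · have := norm_pos_iff.2 h
    positivity

theorem normSqC_ne_zero {a₀ a₁ : ℂ} (ha : a₀ ≠ 0 ∨ a₁ ≠ 0) : normSqC a₀ a₁ ≠ 0 := by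
  rw [normSqC_eq]
  exact_mod_cast norm_sq_add_ne_zero ha

theorem smul_imagQuat_twistor {a₀ a₁ : ℂ} (ha : a₀ ≠ 0 ∨ a₁ ≠ 0) :
    normSqC a₀ a₁ • imagQuat (twistorX a₀ a₁) (twistorY a₀ a₁) (twistorZ a₀ a₁)
      = twistorQuat a₀ a₁ (starRingEnd ℂ a₀) (starRingEnd ℂ a₁) := by
  have hD := norm_sq_add_ne_zero ha
  have hc : ∀ x : ℝ, ((‖a₀‖ ^ 2 + ‖a₁‖ ^ 2 : ℝ) : ℂ) * ((x / (‖a₀‖ ^ 2 + ‖a₁‖ ^ 2) : ℝ) : ℂ)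
      = (x : ℂ) := fun x => by
    rw [← Complex.ofReal_mul, mul_div_cancel₀ _ hD]
  have hconj : starRingEnd ℂ (a₁ * starRingEnd ℂ a₀) = starRingEnd ℂ a₁ * a₀ := by simp
  rw [normSqC_eq]
  apply Quaternion.ext_complex
  · exact mul_zero _
  · change _ * (twistorX a₀ a₁ : ℂ) = a₀ * starRingEnd ℂ a₀ - a₁ * starRingEnd ℂ a₁
    rw [twistorX, hc]
    simp [Complex.mul_conj, Complex.normSq_eq_norm_sq]
  · change _ * (twistorY a₀ a₁ : ℂ) = a₁ * starRingEnd ℂ a₀ + starRingEnd ℂ a₁ * a₀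
    rw [twistorY, hc, ← hconj, Complex.add_conj]
  · change _ * (twistorZ a₀ a₁ : ℂ) = -Complex.I * (a₁ * starRingEnd ℂ a₀ - starRingEnd ℂ a₁ * a₀)
    rw [twistorZ, hc, ← hconj, Complex.sub_conj]
    linear_combination ((2 * (a₁ * starRingEnd ℂ a₀).im : ℝ) : ℂ) * Complex.I_sq

namespace IsQuaternionHermitian

variable {g : V →L[ℝ] V →L[ℝ] ℝ} {I J K : V →L[ℝ] V} (h : IsQuaternionHermitian g I J K)

theorem smul_dualRep_twistorEnd {a₀ a₁ : ℂ} (ha : a₀ ≠ 0 ∨ a₁ ≠ 0) (φ : V →L[ℝ] ℂ) :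
    normSqC a₀ a₁ • dualRep (twistorEnd I J K a₀ a₁) φ
      = h.rep (twistorQuat a₀ a₁ (starRingEnd ℂ a₀) (starRingEnd ℂ a₁)) φ := by
  rw [← smul_imagQuat_twistor ha, _root_.map_smul, rep_imagQuat]
  rfl

/-- Each of `I`, `J`, `K` anticommutes with another complex structure, hence has trace zero. -/
theorem trace_imagEnd (h : IsQuaternionHermitian g I J K) (x y z : ℝ) :
    LinearMap.trace ℝ V (imagEnd I J K x y z : V →ₗ[ℝ] V) = 0 := by
  have key : ∀ A B : V →ₗ[ℝ] V, (∀ v, B (B v) = -v) → (∀ v, A (B v) = -B (A v)) →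
      LinearMap.trace ℝ V A = 0 := fun A B hB hAB => by
    -- By cyclicity `tr A = tr (B A B) = tr (A B²) = -tr A`.
    have h1 : B ∘ₗ (A ∘ₗ B) = A := by
      ext v
      simp only [LinearMap.comp_apply, hAB, _root_.map_neg, hB, neg_neg]
    have h2 : (A ∘ₗ B) ∘ₗ B = -A := by
      ext v
      simp only [LinearMap.comp_apply, hB, _root_.map_neg, LinearMap.neg_apply]
    have h3 := LinearMap.trace_comp_comm' B (A ∘ₗ B)
    rw [h1, h2, _root_.map_neg] at h3
    linarith
  have hI : LinearMap.trace ℝ V (I : V →ₗ[ℝ] V) = 0 :=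
    key _ (J : V →ₗ[ℝ] V) (fun v => h.J_J v) fun v => by simp [h.I_J, h.J_I]
  have hJ : LinearMap.trace ℝ V (J : V →ₗ[ℝ] V) = 0 :=
    key _ (I : V →ₗ[ℝ] V) (fun v => h.I_I v) fun v => by simp [h.I_J, h.J_I]
  have hK : LinearMap.trace ℝ V (K : V →ₗ[ℝ] V) = 0 :=
    key _ (I : V →ₗ[ℝ] V) (fun v => h.I_I v) fun v => by
      change K (I v) = -I (K v)
      rw [← h.I_J (I v), h.J_I, _root_.map_neg]
  have : (imagEnd I J K x y z : V →ₗ[ℝ] V)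
      = x • (I : V →ₗ[ℝ] V) + y • (J : V →ₗ[ℝ] V) + z • (K : V →ₗ[ℝ] V) := rfl
  rw [this, _root_.map_add, _root_.map_add, _root_.map_smul, _root_.map_smul, _root_.map_smul, hI, hJ, hK]
  simp

theorem sum_dualVec_eq_trace (A : V →L[ℝ] V) :
    ∑ i, dualVec V i (A (Module.finBasis ℝ V i))
      = (LinearMap.trace ℝ V (A : V →ₗ[ℝ] V) : ℂ) := by
  rw [LinearMap.trace_eq_matrix_trace ℝ (Module.finBasis ℝ V), Matrix.trace, Complex.ofReal_sum]
  refine Finset.sum_congr rfl fun i _ => ?_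
  rw [dualVec_apply, Matrix.diag_apply, LinearMap.toMatrix_apply]
  rfl

theorem sum_dualVec_self : ∑ i, dualVec V i (Module.finBasis ℝ V i) = Module.finrank ℝ V := by
  simp [dualVec_apply]

/-- The projection to forms of type `(1, 0)` as a quaternion. -/
def projQuat (a₀ a₁ : ℂ) : Quaternion ℂ := algebraMap ℂ _ (1 / 2) +
  (Complex.I / 2) • imagQuat (twistorX a₀ a₁) (twistorY a₀ a₁) (twistorZ a₀ a₁)

theorem smul_projQuat {a₀ a₁ : ℂ} (ha : a₀ ≠ 0 ∨ a₁ ≠ 0) :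
    (2 * normSqC a₀ a₁) • projQuat a₀ a₁ = algebraMap ℂ _ (normSqC a₀ a₁) +
      Complex.I • twistorQuat a₀ a₁ (starRingEnd ℂ a₀) (starRingEnd ℂ a₁) := by
  rw [projQuat, ← smul_imagQuat_twistor ha, Algebra.algebraMap_eq_smul_one,
    Algebra.algebraMap_eq_smul_one]
  module

theorem rep_projQuat_apply (a₀ a₁ : ℂ) (φ : V →L[ℝ] ℂ) : h.rep (projQuat a₀ a₁) φ
    = (1 / 2 : ℂ) • φ + (Complex.I / 2) • dualRep (twistorEnd I J K a₀ a₁) φ := by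
  rw [projQuat, _root_.map_add, AlgHom.commutes, _root_.map_smul, rep_imagQuat]
  simp [twistorEnd, Algebra.algebraMap_eq_smul_one]

/-- The complex structure is traceless, so the trace of the projection to (1,0)-covectors is half of
`4n`. It is the number that limits the powers of `S₀`. -/
theorem sum_rep_projQuat (a₀ a₁ : ℂ) {n : ℕ} (hn : Module.finrank ℝ V = 4 * n) :
    ∑ i, complexEval (Module.finBasis ℝ V i) 0 (h.rep (projQuat a₀ a₁) (dualVec V i))
      = 2 * n := by
  have h1 : ∀ i, complexEval (Module.finBasis ℝ V i) 0 (h.rep (projQuat a₀ a₁) (dualVec V i))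
      = (1 / 2 : ℂ) * dualVec V i (Module.finBasis ℝ V i)
        - (Complex.I / 2) * dualVec V i (twistorEnd I J K a₀ a₁ (Module.finBasis ℝ V i)) :=
    fun i => by
      rw [rep_projQuat_apply]
      simp [complexEval, dualRep_apply]
      ring
  simp only [h1, Finset.sum_sub_distrib, ← Finset.mul_sum]
  rw [sum_dualVec_self, sum_dualVec_eq_trace, twistorEnd, h.trace_imagEnd, hn]
  push_cast
  ring

/-- Right multiplication by the complex structure is `i` on the quaternion of `S₀`, so the
correction term in `numOp_form` is `-(i/2)·i·2 = 1` times `S₀`. The eigenvalue 2 counts the two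
(1,0)-factors. -/
theorem numOp_pureForm {a₀ a₁ : ℂ} (ha : a₀ ≠ 0 ∨ a₁ ≠ 0) :
    h.numOp (projQuat a₀ a₁) (h.form (spinQuat a₀ a₁ a₀ (-a₁)))
      = (2 : ℂ) • h.form (spinQuat a₀ a₁ a₀ (-a₁)) := by
  have hmul : spinQuat a₀ a₁ a₀ (-a₁)
      * imagQuat (twistorX a₀ a₁) (twistorY a₀ a₁) (twistorZ a₀ a₁)
      = Complex.I • spinQuat a₀ a₁ a₀ (-a₁) := by
    have h1 := spinQuat_mul_twistorQuat a₀ a₁ (starRingEnd ℂ a₀) (starRingEnd ℂ a₁)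
    rw [← smul_imagQuat_twistor ha, Quaternion.mul_smul_complex, mul_comm Complex.I, mul_smul] at h1
    exact smul_right_injective _ (normSqC_ne_zero ha) h1
  have h2 := h.numOp_form (Complex.I / 2) (twistorX a₀ a₁) (twistorY a₀ a₁) (twistorZ a₀ a₁)
    (q := spinQuat a₀ a₁ a₀ (-a₁)) rfl (projQuat a₀ a₁) rfl
  rw [h2, hmul, wedgeD_bil, form_smul, smul_smul, smul_smul]
  rw [show Complex.I / 2 * 2 * Complex.I = -1 by linear_combination Complex.I_sq]
  module

theorem contr_mul_spinQuat_conj {a₀ a₁ : ℂ} (ha : a₀ ≠ 0 ∨ a₁ ≠ 0) (φ : V →L[ℝ] ℂ) :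
    ∃ ψ, h.rep (spinQuat a₀ a₁ a₀ (-a₁)) ψ = h.rep (projQuat a₀ a₁) φ := by
  have hD := normSqC_ne_zero ha
  -- With `D` the squared norm, `s₀` times its conjugate is `-2D · 2D` times the projection, whence
  -- the constant `-4D²`.
  refine ⟨h.rep ((-4 * normSqC a₀ a₁ ^ 2)⁻¹ •
    conjSpinQuat (starRingEnd ℂ a₀) (starRingEnd ℂ a₁)) φ, ?_⟩
  have h1 := spinQuat_mul_conjSpinQuat a₀ a₁ (starRingEnd ℂ a₀) (starRingEnd ℂ a₁)
  have h2 := smul_projQuat ha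
  rw [show a₀ * starRingEnd ℂ a₀ + a₁ * starRingEnd ℂ a₁ = normSqC a₀ a₁ from rfl, ← h2,
    smul_smul] at h1
  rw [h.rep_mul, Quaternion.mul_smul_complex, h1, smul_smul]
  congr 2
  rw [show (-4 * normSqC a₀ a₁ ^ 2)⁻¹ * (-2 * normSqC a₀ a₁ * (2 * normSqC a₀ a₁)) = 1 by
    field_simp; norm_num, one_smul]

/-- The form of type `(2, 0)` with respect to the complex structure with homogeneous coordinates
`a₀`, `a₁`. -/
def pureForm (a₀ a₁ : ℂ) : CForm V := h.form (spinQuat a₀ a₁ a₀ (-a₁))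

/-- The operator counting (1,0)-factors has trace `2n`, and the (1,0)-covectors are contractions of
`S₀`. The general lemma then makes `S₀^n` the holomorphic volume form. -/
theorem pureForm_top {a₀ a₁ : ℂ} (ha : a₀ ≠ 0 ∨ a₁ ≠ 0) {n : ℕ}
    (hn : Module.finrank ℝ V = 4 * n) :
    h.pureForm a₀ a₁ ^ n ≠ 0 ∧ h.pureForm a₀ a₁ ^ (n + 1) = 0 ∧
      ∀ i, oneForm (h.rep (projQuat a₀ a₁) (dualVec V i)) * h.pureForm a₀ a₁ ^ n = 0 := by
  refine pow_top_of_numberOp (h.form_mem_evenForms _) (h.numOp_pureForm ha)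
    (h.sum_rep_projQuat a₀ a₁ hn) fun i => ?_
  obtain ⟨ψ, hψ⟩ := h.contr_mul_spinQuat_conj ha (dualVec V i)
  obtain ⟨y, hy⟩ := h.exists_contr_form (q := spinQuat a₀ a₁ a₀ (-a₁)) rfl ψ
  exact ⟨y, by rw [hy, hψ]; rfl⟩

theorem oneForm_mul_pureForm {a₀ a₁ : ℂ} (ha : a₀ ≠ 0 ∨ a₁ ≠ 0) {n : ℕ}
    (hn : Module.finrank ℝ V = 4 * n) {φ : V →L[ℝ] ℂ}
    (hφ : dualRep (twistorEnd I J K a₀ a₁) φ = -Complex.I • φ) :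
    oneForm φ * h.pureForm a₀ a₁ ^ n = 0 := by
  -- The hypothesis means `φ ∘ A = i φ`, that is, type (1,0); such covectors are fixed by the
  -- projection and are sums of the projected basis covectors.
  have h1 : h.rep (projQuat a₀ a₁) φ = φ := by
    rw [rep_projQuat_apply, hφ]
    ext v
    simp only [add_apply, smul_apply, smul_eq_mul]
    linear_combination -(1 / 2) * φ v * Complex.I_sq
  rw [← h1, ← sum_dualVec_smul φ, _root_.map_sum, oneForm, _root_.map_sum, Finset.sum_mul]
  refine Finset.sum_eq_zero fun i _ => ?_
  rw [_root_.map_smul, _root_.map_smul, smul_mul_assoc]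
  have := (h.pureForm_top ha hn).2.2 i
  rw [oneForm] at this
  rw [this, smul_zero]

/-- The Kähler form `ω` of `I_α` is of type (1,1), so each of its terms has a (1,0)-factor and is
killed by the holomorphic volume form `S₀^n`. As `D T` is a combination of `S₀` and `ω`, and
`S₀^(n+1) = 0`, also `S₀^n T = 0`. -/
theorem pureForm_mul_form {a₀ a₁ b₀ b₁ : ℂ} (ha : a₀ ≠ 0 ∨ a₁ ≠ 0) {n : ℕ}
    (hn : Module.finrank ℝ V = 4 * n) (hb : a₁ * b₀ + a₀ * b₁ = 1) :
    h.pureForm a₀ a₁ ^ n * h.form (spinQuat a₀ a₁ b₀ b₁) = 0 := by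
  have hD := normSqC_ne_zero ha
  have h1 : h.pureForm a₀ a₁ ^ n
      * h.form (imagQuat (twistorX a₀ a₁) (twistorY a₀ a₁) (twistorZ a₀ a₁)) = 0 := by
    -- The square of the complex structure is the real quaternion `-1`, whose bilinear form is
    -- symmetric. The correction term in `numOp_form` therefore vanishes and `ω` is fixed by the
    -- operator.
    have hre : ∀ q : Quaternion ℂ, q = algebraMap ℂ _ (-1) → wedgeD (formMap (h.bil q)) = 0 := by
      rintro q rfl
      exact h.wedgeD_bil_real rfl rfl rfl
    have h2 := h.numOp_form (Complex.I / 2) (twistorX a₀ a₁) (twistorY a₀ a₁) (twistorZ a₀ a₁)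
      (q := imagQuat (twistorX a₀ a₁) (twistorY a₀ a₁) (twistorZ a₀ a₁)) rfl (projQuat a₀ a₁) rfl
    rw [hre, smul_zero, sub_zero] at h2
    · rw [← h2, numOp, numberOp_apply, Finset.mul_sum]
      refine Finset.sum_eq_zero fun i _ => ?_
      have h3 := evenForms_comm (Subalgebra.pow_mem _ (h.form_mem_evenForms
        (spinQuat a₀ a₁ a₀ (-a₁))) n) (oneForm (h.rep (projQuat a₀ a₁) (dualVec V i)))
      have h4 := (h.pureForm_top ha hn).2.2 i
      rw [pureForm] at h4 ⊢
      rw [h4] at h3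
      rw [← mul_assoc]
      change _ * oneForm _ * _ = _
      rw [h3, zero_mul]
    · have h3 := twistorQuat_mul_self a₀ a₁ (starRingEnd ℂ a₀) (starRingEnd ℂ a₁)
      rw [← smul_imagQuat_twistor ha, Quaternion.mul_smul_complex, Quaternion.smul_mul_complex,
        smul_smul, show -(a₀ * starRingEnd ℂ a₀ + a₁ * starRingEnd ℂ a₁) ^ 2
          = (normSqC a₀ a₁ * normSqC a₀ a₁) * -1 by rw [normSqC]; ring, _root_.map_mul,
        ← Algebra.smul_def] at h3
      exact smul_right_injective _ (mul_ne_zero hD hD) h3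
  have h4 := smul_spinQuat_eq a₀ a₁ (starRingEnd ℂ a₀) (starRingEnd ℂ a₁) b₀ b₁ hb
  rw [show a₀ * starRingEnd ℂ a₀ + a₁ * starRingEnd ℂ a₁ = normSqC a₀ a₁ from rfl,
    ← smul_imagQuat_twistor ha] at h4
  have h5 := congrArg (fun q => h.pureForm a₀ a₁ ^ n * h.form q) h4
  simp only [form_add, form_smul, mul_add, mul_smul_comm, h1, smul_zero, add_zero] at h5
  rw [show h.form (spinQuat a₀ a₁ a₀ (-a₁)) = h.pureForm a₀ a₁ from rfl, ← pow_succ,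
    (h.pureForm_top ha hn).2.1, smul_zero] at h5
  exact (smul_eq_zero.1 h5).resolve_left hD

/-- For `δ ≠ 0` use the full degree operator `∑ eⁱ ∧ ι_{eᵢ}`, of trace `4n`. Every covector is a
contraction of `S`, since `s` has inverse `-s/δ²`. -/
theorem form_top {a₀ a₁ g₀ g₁ : ℂ} (hδ : a₁ * g₀ + a₀ * g₁ ≠ 0) {n : ℕ}
    (hn : Module.finrank ℝ V = 4 * n) :
    h.form (spinQuat a₀ a₁ g₀ g₁) ^ (2 * n) ≠ 0 ∧
      h.form (spinQuat a₀ a₁ g₀ g₁) ^ (2 * n + 1) = 0 := by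
  have := pow_top_of_numberOp (x := fun i => complexEval (Module.finBasis ℝ V i) 0)
    (w := fun i => dualVec V i) (m := 2 * n) (h.form_mem_evenForms (spinQuat a₀ a₁ g₀ g₁))
    ?_ ?_ ?_
  · exact ⟨this.1, this.2.1⟩
  · rw [← h.wedgeD_bil, numberOp_apply]
    refine Finset.sum_congr rfl fun i _ => ?_
    rw [h.contr_form rfl, _root_.map_zero]
    rfl
  · have h1 : ∀ i, complexEval (Module.finBasis ℝ V i) 0 (dualVec V i)
        = dualVec V i (Module.finBasis ℝ V i) := fun i => by simp [complexEval]
    simp only [h1]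
    rw [sum_dualVec_self, hn]
    push_cast
    ring
  · intro i
    obtain ⟨y, hy⟩ := h.exists_contr_form (q := spinQuat a₀ a₁ g₀ g₁) rfl
      (h.rep ((-(a₁ * g₀ + a₀ * g₁) ^ 2)⁻¹ • spinQuat a₀ a₁ g₀ g₁) (dualVec V i))
    refine ⟨y, ?_⟩
    have h2 : -(a₁ * g₀ + a₀ * g₁) ^ 2 ≠ 0 := neg_ne_zero.2 (pow_ne_zero _ hδ)
    rw [hy, h.rep_mul, Quaternion.mul_smul_complex, spinQuat_mul_self, Algebra.algebraMap_eq_smul_one,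
      smul_smul, inv_mul_cancel₀ h2, one_smul, _root_.map_one]
    rfl

end IsQuaternionHermitian

end TwistorLinear
end

noncomputable section

/-! ### Non-vanishing and annihilator of the spinor at a point. -/

section TwistorSpinor

variable {V : Type*} [AddCommGroup V] [Module ℝ V] [TopologicalSpace V]
  [IsTopologicalAddGroup V] [ContinuousSMul ℝ V] [T2Space V] [FiniteDimensional ℝ V]

theorem covector_eq_zero_of_smul {c : ℂ} (hc : c ≠ 0) {φ : V →L[ℝ] ℂ} (h : c • φ = 0) : φ = 0 :=
  (smul_eq_zero.1 h).resolve_left hc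

namespace IsQuaternionHermitian

variable {g : V →L[ℝ] V →L[ℝ] ℝ} {I J K : V →L[ℝ] V} (h : IsQuaternionHermitian g I J K)

/-- The pure spinor with parameters of homogeneous coordinates `a₀`, `a₁` and `g₀`, `g₁`. -/
def spinor (n : ℕ) (a₀ a₁ g₀ g₁ : ℂ) : CForm V :=
  expSpinor n (Complex.I * (a₁ * g₀ + a₀ * g₁)) (h.form (spinQuat a₀ a₁ g₀ g₁))

theorem form_spinQuat_eq {a₀ a₁ g₀ g₁ b₀ b₁ : ℂ} (hb : a₁ * b₀ + a₀ * b₁ = 1) :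
    h.form (spinQuat a₀ a₁ g₀ g₁) = (g₀ * b₁ - g₁ * b₀) • h.pureForm a₀ a₁
      + (a₁ * g₀ + a₀ * g₁) • h.form (spinQuat a₀ a₁ b₀ b₁) := by
  rw [spinQuat_eq a₀ a₁ g₀ g₁ b₀ b₁ hb, form_add, form_smul, form_smul]
  rfl

theorem spinor_eq_polySpinor {a₀ a₁ g₀ g₁ b₀ b₁ : ℂ} (hb : a₁ * b₀ + a₀ * b₁ = 1) {n : ℕ}
    (hn : Module.finrank ℝ V = 4 * n) :
    h.spinor n a₀ a₁ g₀ g₁ = polySpinor n (g₀ * b₁ - g₁ * b₀) (a₁ * g₀ + a₀ * g₁)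
      (h.pureForm a₀ a₁) (h.form (spinQuat a₀ a₁ b₀ b₁)) := by
  have ha : a₀ ≠ 0 ∨ a₁ ≠ 0 := by
    by_contra! hne
    simp [hne.1, hne.2] at hb
  rw [spinor, h.form_spinQuat_eq hb]
  exact expSpinor_eq_polySpinor n _ _ (S₀ := h.pureForm a₀ a₁) (h.form_mem_evenForms _)
    (h.pureForm_top ha hn).2.1 (h.pureForm_mul_form ha hn hb)

theorem spinor_mem_evenForms (n : ℕ) (a₀ a₁ g₀ g₁ : ℂ) :
    h.spinor n a₀ a₁ g₀ g₁ ∈ evenForms (V →L[ℝ] ℂ) :=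
  expSpinor_mem_evenForms _ _ (h.form_mem_evenForms _)

theorem _root_.exists_dual_coords {a₀ a₁ : ℂ} (ha : a₀ ≠ 0 ∨ a₁ ≠ 0) :
    ∃ b₀ b₁, a₁ * b₀ + a₀ * b₁ = 1 := by
  rcases ha with ha | ha
  · exact ⟨0, a₀⁻¹, by simp [ha]⟩
  · exact ⟨a₁⁻¹, 0, by simp [ha]⟩

/-- `λ` and `δ` are the coordinates of the non-zero vector `(g₀, g₁)` in a basis, so they cannot
both vanish. -/
theorem _root_.coords_ne_zero {a₀ a₁ g₀ g₁ b₀ b₁ : ℂ} (hb : a₁ * b₀ + a₀ * b₁ = 1)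
    (hg : g₀ ≠ 0 ∨ g₁ ≠ 0) (hδ : a₁ * g₀ + a₀ * g₁ = 0) : g₀ * b₁ - g₁ * b₀ ≠ 0 := by
  intro hl
  have h1 : g₀ = 0 := by linear_combination -g₀ * hb + b₀ * hδ + a₀ * hl
  have h2 : g₁ = 0 := by linear_combination -g₁ * hb + b₁ * hδ - a₁ * hl
  exact hg.elim (· h1) (· h2)

/-- For `δ = 0` the spinor is a non-zero multiple of the holomorphic volume form; otherwise it is an
exponential with non-zero constant term. -/
theorem spinor_ne_zero {a₀ a₁ g₀ g₁ : ℂ} (ha : a₀ ≠ 0 ∨ a₁ ≠ 0) (hg : g₀ ≠ 0 ∨ g₁ ≠ 0) {n : ℕ}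
    (hn : Module.finrank ℝ V = 4 * n) : h.spinor n a₀ a₁ g₀ g₁ ≠ 0 := by
  rw [spinor]
  by_cases hδ : a₁ * g₀ + a₀ * g₁ = 0
  · obtain ⟨b₀, b₁, hb⟩ := exists_dual_coords ha
    rw [h.form_spinQuat_eq hb, hδ, mul_zero, expSpinor_zero, zero_smul, add_zero, smul_pow]
    refine smul_ne_zero ?_ (smul_ne_zero (pow_ne_zero _ (coords_ne_zero hb hg hδ))
      (h.pureForm_top ha hn).1)
    exact mul_ne_zero (inv_ne_zero (by exact_mod_cast n.factorial_ne_zero)) (by simp)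
  · exact expSpinor_ne_zero n (mul_ne_zero Complex.I_ne_zero hδ) (h.form_top hδ hn).2
      (h.form_top hδ hn).1

/-- On such a covector `t - iD` is multiplication by `-2iD ≠ 0`, so `(s + iδ)(t - iD) = 0` leaves
`(s + iδ) q = 0`. -/
theorem rep_spinQuat_of_anti {a₀ a₁ g₀ g₁ : ℂ} (ha : a₀ ≠ 0 ∨ a₁ ≠ 0) {q : V →L[ℝ] ℂ}
    (hq : dualRep (twistorEnd I J K a₀ a₁) q = -Complex.I • q) :
    h.rep (spinQuat a₀ a₁ g₀ g₁) q = -(Complex.I * (a₁ * g₀ + a₀ * g₁)) • q := by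
  have hD := normSqC_ne_zero ha
  have h1 := DFunLike.congr_fun (congrArg h.rep (spinQuat_add_mul a₀ a₁ g₀ g₁
    (starRingEnd ℂ a₀) (starRingEnd ℂ a₁))) q
  have h2 := h.smul_dualRep_twistorEnd ha q
  rw [← h.rep_mul, _root_.map_sub, AlgHom.commutes, LinearMap.sub_apply, ← h2, hq,
    Module.algebraMap_end_apply,
    show a₀ * starRingEnd ℂ a₀ + a₁ * starRingEnd ℂ a₁ = normSqC a₀ a₁ from rfl,
    show normSqC a₀ a₁ • -Complex.I • q - (Complex.I * normSqC a₀ a₁) • q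
      = (-2 * Complex.I * normSqC a₀ a₁) • q by module, _root_.map_smul, _root_.map_zero,
    LinearMap.zero_apply] at h1
  have h3 := covector_eq_zero_of_smul (mul_ne_zero (mul_ne_zero (by norm_num) Complex.I_ne_zero)
    hD) h1
  rw [_root_.map_add, AlgHom.commutes, LinearMap.add_apply, Module.algebraMap_end_apply] at h3
  rw [eq_neg_of_add_eq_zero_left h3]
  module

theorem rep_spinQuat_of_holo {a₀ a₁ g₀ g₁ : ℂ} (hg : g₀ ≠ 0 ∨ g₁ ≠ 0) {p : V →L[ℝ] ℂ}
    (hp : dualRep (twistorEnd I J K (starRingEnd ℂ g₁) (starRingEnd ℂ g₀)) p = Complex.I • p) :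
    h.rep (spinQuat a₀ a₁ g₀ g₁) p = (Complex.I * (a₁ * g₀ + a₀ * g₁)) • p := by
  have hg' : starRingEnd ℂ g₁ ≠ 0 ∨ starRingEnd ℂ g₀ ≠ 0 := by
    simpa [or_comm] using hg
  have hD := normSqC_ne_zero hg'
  have h1 := DFunLike.congr_fun (congrArg h.rep (spinQuat_sub_mul a₀ a₁ g₀ g₁
    (starRingEnd ℂ g₀) (starRingEnd ℂ g₁))) p
  have h2 := h.smul_dualRep_twistorEnd hg' p
  rw [Complex.conj_conj, Complex.conj_conj] at h2
  rw [← h.rep_mul, _root_.map_add, AlgHom.commutes, LinearMap.add_apply, ← h2, hp,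
    Module.algebraMap_end_apply,
    show g₀ * starRingEnd ℂ g₀ + g₁ * starRingEnd ℂ g₁
      = normSqC (starRingEnd ℂ g₁) (starRingEnd ℂ g₀) by simp [normSqC]; ring,
    show normSqC (starRingEnd ℂ g₁) (starRingEnd ℂ g₀) • Complex.I • p
      + (Complex.I * normSqC (starRingEnd ℂ g₁) (starRingEnd ℂ g₀)) • p
      = (2 * Complex.I * normSqC (starRingEnd ℂ g₁) (starRingEnd ℂ g₀)) • p by module,
    _root_.map_smul, _root_.map_zero,
    LinearMap.zero_apply] at h1
  have h3 := covector_eq_zero_of_smul (mul_ne_zero (mul_ne_zero (by norm_num) Complex.I_ne_zero)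
    hD) h1
  rw [_root_.map_sub, AlgHom.commutes, LinearMap.sub_apply, Module.algebraMap_end_apply] at h3
  exact sub_eq_zero.1 h3

/-- Applying the conjugate quaternion to `s₀ p = 0` gives `(D - it) p = 0`, the eigenvalue equation.
-/
theorem dualRep_of_rep_pure {a₀ a₁ : ℂ} (ha : a₀ ≠ 0 ∨ a₁ ≠ 0) {p : V →L[ℝ] ℂ}
    (hp : h.rep (spinQuat a₀ a₁ a₀ (-a₁)) p = 0) :
    dualRep (twistorEnd I J K a₀ a₁) p = -Complex.I • p := by
  have hD := normSqC_ne_zero ha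
  have h1 := DFunLike.congr_fun (congrArg h.rep (conjSpinQuat_mul_spinQuat a₀ a₁
    (starRingEnd ℂ a₀) (starRingEnd ℂ a₁))) p
  rw [← h.rep_mul, hp, _root_.map_zero, _root_.map_smul, LinearMap.smul_apply, eq_comm,
    show a₀ * starRingEnd ℂ a₀ + a₁ * starRingEnd ℂ a₁ = normSqC a₀ a₁ from rfl,
    _root_.map_sub, AlgHom.commutes, LinearMap.sub_apply, _root_.map_smul, LinearMap.smul_apply,
    ← h.smul_dualRep_twistorEnd ha, Module.algebraMap_end_apply] at h1
  have h3 := sub_eq_zero.1 (covector_eq_zero_of_smul (mul_ne_zero (by norm_num) hD) h1)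
  have h4 : normSqC a₀ a₁ • dualRep (twistorEnd I J K a₀ a₁) p
      = normSqC a₀ a₁ • (-Complex.I • p) := by
    rw [smul_smul, mul_comm, mul_smul, h3, smul_smul, neg_mul, Complex.I_mul_I, neg_neg, one_smul]
  exact smul_right_injective _ hD h4

/-- The generalized vectors of the `+i`-eigenspace annihilate the spinor. -/
theorem contr_spinor {a₀ a₁ g₀ g₁ : ℂ} (ha : a₀ ≠ 0 ∨ a₁ ≠ 0) (hg : g₀ ≠ 0 ∨ g₁ ≠ 0) {n : ℕ}
    (hn : Module.finrank ℝ V = 4 * n) (v w : V) (ζ : V →L[ℝ] ℂ)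
    (hp : dualRep (twistorEnd I J K (starRingEnd ℂ g₁) (starRingEnd ℂ g₀))
      (complexCovector (g v) (g w) + ζ) = Complex.I • (complexCovector (g v) (g w) + ζ))
    (hq : dualRep (twistorEnd I J K a₀ a₁) (complexCovector (g v) (g w) - ζ)
      = -Complex.I • (complexCovector (g v) (g w) - ζ)) :
    contr (complexEval v w) (h.spinor n a₀ a₁ g₀ g₁) + oneForm ζ * h.spinor n a₀ a₁ g₀ g₁ = 0 := by
  set z := complexCovector (g v) (g w) with hz
  have hp' := h.rep_spinQuat_of_holo (a₀ := a₀) (a₁ := a₁) hg hp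
  have hq' := h.rep_spinQuat_of_anti (g₀ := g₀) (g₁ := g₁) ha hq
  -- Adding the equations `s(z + ζ) = iδ(z + ζ)` and `s(z - ζ) = -iδ(z - ζ)` gives `s z = iδ ζ`,
  -- hence `ι_X S = iδ ζ`.
  have hs : h.rep (spinQuat a₀ a₁ g₀ g₁) z = (Complex.I * (a₁ * g₀ + a₀ * g₁)) • ζ := by
    have h1 : (2 : ℂ) • h.rep (spinQuat a₀ a₁ g₀ g₁) z
        = (2 : ℂ) • ((Complex.I * (a₁ * g₀ + a₀ * g₁)) • ζ) := by
      rw [← _root_.map_smul, show (2 : ℂ) • z = (z + ζ) + (z - ζ) by module, _root_.map_add, hp', hq']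
      module
    exact smul_right_injective _ two_ne_zero h1
  have hc := h.contr_form (q := spinQuat a₀ a₁ g₀ g₁) rfl v w
  rw [← hz, hs] at hc
  by_cases hδ : a₁ * g₀ + a₀ * g₁ = 0
  -- At `δ = 0` the two terms vanish separately: `ι_X S = 0`, and `ζ` is a (1,0)-covector, which
  -- kills `S₀^n`.
  · obtain ⟨b₀, b₁, hb⟩ := exists_dual_coords ha
    have hl := coords_ne_zero hb hg hδ
    have hform := h.form_spinQuat_eq (g₀ := g₀) (g₁ := g₁) hb
    rw [hδ, zero_smul, add_zero] at hform
    rw [hδ, mul_zero, zero_smul ℂ ζ, oneForm, _root_.map_zero] at hc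
    rw [spinor, hδ, mul_zero, expSpinor_zero]
    have h1 : contr (complexEval v w) (h.form (spinQuat a₀ a₁ g₀ g₁) ^ n) = 0 := by
      cases n with
      | zero => simp [contr_one]
      | succ n => rw [contr_even_pow (h.form_mem_evenForms _), hc, zero_mul, smul_zero]
    have h2 : dualRep (twistorEnd I J K a₀ a₁) ζ = -Complex.I • ζ := by
      -- Here `s = λ s₀` with `λ ≠ 0`, so `z + ζ` lies in the kernel of `s₀` and has the same type
      -- as `z - ζ`.
      have h3 : h.rep (spinQuat a₀ a₁ a₀ (-a₁)) (z + ζ) = 0 := by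
        rw [spinQuat_eq a₀ a₁ g₀ g₁ b₀ b₁ hb, hδ] at hp'
        rw [zero_smul ℂ (spinQuat a₀ a₁ b₀ b₁), add_zero, mul_zero, zero_smul ℂ (z + ζ),
          _root_.map_smul, LinearMap.smul_apply] at hp'
        exact covector_eq_zero_of_smul hl hp'
      have h4 := h.dualRep_of_rep_pure ha h3
      have h5 : (2 : ℂ) • dualRep (twistorEnd I J K a₀ a₁) ζ = (2 : ℂ) • (-Complex.I • ζ) := by
        rw [← _root_.map_smul, show (2 : ℂ) • ζ = (z + ζ) - (z - ζ) by module, _root_.map_sub, h4, hq]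
        module
      exact smul_right_injective _ two_ne_zero h5
    rw [_root_.map_smul, h1, hform, smul_pow, mul_smul_comm, mul_smul_comm,
      h.oneForm_mul_pureForm ha hn h2]
    simp
  · have hc0 := mul_ne_zero Complex.I_ne_zero hδ
    -- For `δ ≠ 0` the exponential rule gives `ι_X Φ = -(iδ)⁻¹ (iδ ζ) ∧ Φ = -ζ ∧ Φ`.
    rw [spinor, contr_expSpinor n hc0 (h.form_mem_evenForms _) (h.form_top hδ hn).2, hc, oneForm_smul,
      smul_mul_assoc, smul_smul, neg_mul, inv_mul_cancel₀ hc0]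
    simp

end IsQuaternionHermitian

end TwistorSpinor
end

noncomputable section

/-! ### Linear generalized complex structures -/

section LinearGen

variable {V : Type*} [AddCommGroup V] [Module ℝ V] [TopologicalSpace V]
  [IsTopologicalAddGroup V] [ContinuousSMul ℝ V]
  {W : Type*} [AddCommGroup W] [Module ℝ W] [TopologicalSpace W]
  [IsTopologicalAddGroup W] [ContinuousSMul ℝ W]

variable (V) in
/-- The inner product `⟨X + ξ, Y + η⟩ = ½ (ξ(Y) + η(X))` on `V ⊕ V*`. -/
def genPairing : LinearMap.BilinForm ℝ (V × (V →L[ℝ] ℝ)) :=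
  LinearMap.mk₂ ℝ (fun u v => (1 / 2) * (u.2 v.1 + v.2 u.1))
    (fun u u' v => by simp; ring) (fun c u v => by simp; ring)
    (fun u v v' => by simp; ring) (fun c u v => by simp; ring)

theorem genPairing_apply (u v : V × (V →L[ℝ] ℝ)) :
    genPairing V u v = (1 / 2) * (u.2 v.1 + v.2 u.1) := rfl

/-- A skew endomorphism of `V ⊕ V*` with square minus the identity. -/
structure IsLinGenComplex (J : V × (V →L[ℝ] ℝ) →ₗ[ℝ] V × (V →L[ℝ] ℝ)) : Prop where
  skew : ∀ u v, genPairing V (J u) v = -genPairing V u (J v)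
  sq : ∀ u, J (J u) = -u

theorem IsLinGenComplex.orthogonal {J : V × (V →L[ℝ] ℝ) →ₗ[ℝ] V × (V →L[ℝ] ℝ)}
    (hJ : IsLinGenComplex J) (u v : V × (V →L[ℝ] ℝ)) :
    genPairing V (J u) (J v) = genPairing V u v := by
  rw [hJ.skew, hJ.sq, map_neg, neg_neg]

/-- The component in `V ⊕ V*` of an element of `(V × W) ⊕ (V × W)*`. -/
def genFst : (V × W) × (V × W →L[ℝ] ℝ) →ₗ[ℝ] V × (V →L[ℝ] ℝ) where
  toFun u := (u.1.1, u.2.comp (.inl ℝ V W))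
  map_add' _ _ := rfl
  map_smul' _ _ := rfl

/-- The component in `W ⊕ W*` of an element of `(V × W) ⊕ (V × W)*`. -/
def genSnd : (V × W) × (V × W →L[ℝ] ℝ) →ₗ[ℝ] W × (W →L[ℝ] ℝ) where
  toFun u := (u.1.2, u.2.comp (.inr ℝ V W))
  map_add' _ _ := rfl
  map_smul' _ _ := rfl

theorem genFst_apply (u : (V × W) × (V × W →L[ℝ] ℝ)) :
    genFst u = (u.1.1, u.2.comp (.inl ℝ V W)) := rfl

theorem genSnd_apply (u : (V × W) × (V × W →L[ℝ] ℝ)) :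
    genSnd u = (u.1.2, u.2.comp (.inr ℝ V W)) := rfl

/-- The element of `(V × W) ⊕ (V × W)*` with given components. -/
def genPair : (V × (V →L[ℝ] ℝ)) × (W × (W →L[ℝ] ℝ)) →ₗ[ℝ] (V × W) × (V × W →L[ℝ] ℝ) where
  toFun u := ((u.1.1, u.2.1), u.1.2.comp (.fst ℝ V W) + u.2.2.comp (.snd ℝ V W))
  map_add' u v := by
    ext <;> simp
  map_smul' c u := by
    ext <;> simp

theorem genPair_apply (u : (V × (V →L[ℝ] ℝ)) × (W × (W →L[ℝ] ℝ))) :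
    genPair u = ((u.1.1, u.2.1), u.1.2.comp (.fst ℝ V W) + u.2.2.comp (.snd ℝ V W)) := rfl

theorem genFst_genPair (u : (V × (V →L[ℝ] ℝ)) × (W × (W →L[ℝ] ℝ))) : genFst (genPair u) = u.1 := by
  ext <;> simp [genFst_apply, genPair_apply]

theorem genSnd_genPair (u : (V × (V →L[ℝ] ℝ)) × (W × (W →L[ℝ] ℝ))) : genSnd (genPair u) = u.2 := by
  ext <;> simp [genSnd_apply, genPair_apply]

theorem genPair_genFst_genSnd (u : (V × W) × (V × W →L[ℝ] ℝ)) :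
    genPair (genFst u, genSnd u) = u := by
  have h0 : u.2 ((0 : V), (0 : W)) = 0 := map_zero u.2
  ext <;> simp [genFst_apply, genSnd_apply, genPair_apply, h0]

theorem gen_ext {u v : (V × W) × (V × W →L[ℝ] ℝ)} (h : genFst u = genFst v)
    (h' : genSnd u = genSnd v) : u = v := by
  rw [← genPair_genFst_genSnd u, h, h', genPair_genFst_genSnd]

theorem genPairing_eq_add (u v : (V × W) × (V × W →L[ℝ] ℝ)) :
    genPairing (V × W) u v = genPairing V (genFst u) (genFst v)
      + genPairing W (genSnd u) (genSnd v) := by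
  obtain ⟨⟨x, y⟩, ξ⟩ := u
  obtain ⟨⟨x', y'⟩, ξ'⟩ := v
  have h1 : ∀ (η : V × W →L[ℝ] ℝ) x y, η (x, y) = η (x, 0) + η (0, y) := fun η x y => by
    rw [← map_add]; simp
  simp only [genPairing_apply, genFst_apply, genSnd_apply,
    ContinuousLinearMap.comp_apply, ContinuousLinearMap.inl_apply, ContinuousLinearMap.inr_apply]
  rw [h1 ξ, h1 ξ']
  ring

/-- The direct sum of endomorphisms of `V ⊕ V*` and `W ⊕ W*`. -/
def prodEnd (J₁ : V × (V →L[ℝ] ℝ) →ₗ[ℝ] V × (V →L[ℝ] ℝ))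
    (J₂ : W × (W →L[ℝ] ℝ) →ₗ[ℝ] W × (W →L[ℝ] ℝ)) :
    (V × W) × (V × W →L[ℝ] ℝ) →ₗ[ℝ] (V × W) × (V × W →L[ℝ] ℝ) :=
  genPair ∘ₗ (J₁ ∘ₗ genFst).prod (J₂ ∘ₗ genSnd)

variable {J₁ : V × (V →L[ℝ] ℝ) →ₗ[ℝ] V × (V →L[ℝ] ℝ)} {J₂ : W × (W →L[ℝ] ℝ) →ₗ[ℝ] W × (W →L[ℝ] ℝ)}

theorem prodEnd_apply (J₁ : V × (V →L[ℝ] ℝ) →ₗ[ℝ] V × (V →L[ℝ] ℝ))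
    (J₂ : W × (W →L[ℝ] ℝ) →ₗ[ℝ] W × (W →L[ℝ] ℝ)) (u : (V × W) × (V × W →L[ℝ] ℝ)) :
    prodEnd J₁ J₂ u = genPair (J₁ (genFst u), J₂ (genSnd u)) := rfl

theorem genFst_prodEnd (J₁ : V × (V →L[ℝ] ℝ) →ₗ[ℝ] V × (V →L[ℝ] ℝ))
    (J₂ : W × (W →L[ℝ] ℝ) →ₗ[ℝ] W × (W →L[ℝ] ℝ)) (u : (V × W) × (V × W →L[ℝ] ℝ)) :
    genFst (prodEnd J₁ J₂ u) = J₁ (genFst u) := genFst_genPair _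

theorem genSnd_prodEnd (J₁ : V × (V →L[ℝ] ℝ) →ₗ[ℝ] V × (V →L[ℝ] ℝ))
    (J₂ : W × (W →L[ℝ] ℝ) →ₗ[ℝ] W × (W →L[ℝ] ℝ)) (u : (V × W) × (V × W →L[ℝ] ℝ)) :
    genSnd (prodEnd J₁ J₂ u) = J₂ (genSnd u) := genSnd_genPair _

theorem IsLinGenComplex.prodEnd (h₁ : IsLinGenComplex J₁) (h₂ : IsLinGenComplex J₂) :
    IsLinGenComplex (prodEnd J₁ J₂) where
  skew u v := by
    rw [genPairing_eq_add, genPairing_eq_add, genFst_prodEnd, genSnd_prodEnd, genFst_prodEnd,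
      genSnd_prodEnd, h₁.skew, h₂.skew]
    ring
  sq u := by
    apply gen_ext
    · rw [genFst_prodEnd, genFst_prodEnd, h₁.sq, map_neg]
    · rw [genSnd_prodEnd, genSnd_prodEnd, h₂.sq, map_neg]

theorem inEigen_prodEnd {u v : (V × W) × (V × W →L[ℝ] ℝ)} (h : InEigen (prodEnd J₁ J₂) u v) :
    InEigen J₁ (genFst u) (genFst v) ∧ InEigen J₂ (genSnd u) (genSnd v) := by
  have h1 := congrArg genFst h.1
  have h2 := congrArg genFst h.2
  have h3 := congrArg genSnd h.1
  have h4 := congrArg genSnd h.2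
  rw [genFst_prodEnd] at h1 h2
  rw [genSnd_prodEnd] at h3 h4
  exact ⟨⟨by rw [h1, map_neg], h2⟩, ⟨by rw [h3, map_neg], h4⟩⟩

theorem prodEnd_comm {J₁' : V × (V →L[ℝ] ℝ) →ₗ[ℝ] V × (V →L[ℝ] ℝ)}
    {J₂' : W × (W →L[ℝ] ℝ) →ₗ[ℝ] W × (W →L[ℝ] ℝ)} (h₁ : ∀ u, J₁ (J₁' u) = J₁' (J₁ u))
    (h₂ : ∀ u, J₂ (J₂' u) = J₂' (J₂ u)) (u : (V × W) × (V × W →L[ℝ] ℝ)) :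
    prodEnd J₁ J₂ (prodEnd J₁' J₂' u) = prodEnd J₁' J₂' (prodEnd J₁ J₂ u) := by
  apply gen_ext
  · simp only [genFst_prodEnd, h₁]
  · simp only [genSnd_prodEnd, h₂]

theorem dualEnd_apply (A : V →L[ℝ] V) (ξ : V →L[ℝ] ℝ) : dualEnd A ξ = ξ.comp A := rfl

theorem genOfComplex_apply (A : V →L[ℝ] V) (u : V × (V →L[ℝ] ℝ)) :
    genOfComplex A u = (-A u.1, u.2.comp A) := by
  simp [genOfComplex, blockEnd, dualEnd_apply]

theorem isLinGenComplex_genOfComplex {A : V →L[ℝ] V} (hA : ∀ v, A (A v) = -v) :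
    IsLinGenComplex (genOfComplex A) where
  skew u v := by
    simp only [genPairing_apply, genOfComplex_apply, ContinuousLinearMap.comp_apply, map_neg]
    ring
  sq u := by
    simp only [genOfComplex_apply]
    ext v
    · simp [hA]
    · simp [hA]

theorem genOfComplex_neg (A : V →L[ℝ] V) (u : V × (V →L[ℝ] ℝ)) :
    genOfComplex (-A) u = -genOfComplex A u := by
  simp [genOfComplex_apply, ContinuousLinearMap.comp_neg]

/-- An inner product that is Hermitian with respect to two complex structures. -/
structure IsBiHermitian (g : V →L[ℝ] V →L[ℝ] ℝ) (A B : V →L[ℝ] V) : Prop where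
  symm : ∀ v w, g v w = g w v
  pos : ∀ v, v ≠ 0 → 0 < g v v
  skew_left : ∀ v w, g (A v) w = -g v (A w)
  skew_right : ∀ v w, g (B v) w = -g v (B w)
  sq_left : ∀ v, A (A v) = -v
  sq_right : ∀ v, B (B v) = -v

namespace IsBiHermitian

variable {g : V →L[ℝ] V →L[ℝ] ℝ} {A B : V →L[ℝ] V}

theorem neg_right (h : IsBiHermitian g A B) : IsBiHermitian g A (-B) where
  symm := h.symm
  pos := h.pos
  skew_left := h.skew_left
  skew_right v w := by simp [h.skew_right]
  sq_left := h.sq_left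
  sq_right v := by simp [h.sq_right]

theorem swap (h : IsBiHermitian g A B) : IsBiHermitian g B A :=
  ⟨h.symm, h.pos, h.skew_right, h.skew_left, h.sq_right, h.sq_left⟩

theorem ext_right (h : IsBiHermitian g A B) {v w : V} (hvw : ∀ z, g v z = g w z) : v = w := by
  by_contra hne
  have h1 := h.pos (v - w) (sub_ne_zero.2 hne)
  rw [show g (v - w) = 0 by ext z; simp [hvw]] at h1
  simp at h1

variable [T2Space V] [FiniteDimensional ℝ V]

theorem surjective (h : IsBiHermitian g A B) (φ : V →L[ℝ] ℝ) : ∃ v, g v = φ := by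
  have hfin : FiniteDimensional ℝ (V →L[ℝ] ℝ) :=
    Module.Finite.equiv (LinearMap.toContinuousLinearMap (𝕜 := ℝ) (E := V) (F' := ℝ))
  have hrank : Module.finrank ℝ V = Module.finrank ℝ (V →L[ℝ] ℝ) := by
    rw [← (LinearMap.toContinuousLinearMap (𝕜 := ℝ) (E := V) (F' := ℝ)).finrank_eq]
    exact (Subspace.dual_finrank_eq (K := ℝ) (V := V)).symm
  refine (LinearMap.injective_iff_surjective_of_finrank_eq_finrank
    (f := (g : V →ₗ[ℝ] V →L[ℝ] ℝ)) hrank).1 (fun v w hvw => ?_) φ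
  exact h.ext_right fun z => congrArg (fun ψ : V →L[ℝ] ℝ => ψ z) hvw

/-- `ContinuousLinearMap.inverse` returns zero off the invertible maps; the equivalence shows that
the inverses in the block matrices are genuine, and later that they depend smoothly on the point. -/
theorem exists_equiv (h : IsBiHermitian g A B) :
    ∃ e : V ≃L[ℝ] (V →L[ℝ] ℝ), (e : V →L[ℝ] V →L[ℝ] ℝ) = fundForm g A := by
  have hb : Function.Bijective (fundForm g A : V →ₗ[ℝ] V →L[ℝ] ℝ) := by
    constructor
    · intro v w hvw
      have h1 : A v = A w :=
        h.ext_right fun z => congrArg (fun ψ : V →L[ℝ] ℝ => ψ z) hvw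
      exact neg_injective (by rw [← h.sq_left, h1, h.sq_left])
    · intro φ
      obtain ⟨v, rfl⟩ := h.surjective φ
      refine ⟨-A v, ?_⟩
      simp [fundForm, h.sq_left]
  exact ⟨{ LinearEquiv.ofBijective (fundForm g A : V →ₗ[ℝ] V →L[ℝ] ℝ) hb with
      continuous_toFun := (fundForm g A).continuous
      continuous_invFun := by
        have hfin : FiniteDimensional ℝ (V →L[ℝ] ℝ) :=
          Module.Finite.equiv (LinearMap.toContinuousLinearMap (𝕜 := ℝ) (E := V) (F' := ℝ))
        exact LinearMap.continuous_of_finiteDimensional (𝕜 := ℝ) (E := V →L[ℝ] ℝ) (F' := V)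
          ((LinearEquiv.ofBijective (fundForm g A : V →ₗ[ℝ] V →L[ℝ] ℝ) hb).symm :
            (V →L[ℝ] ℝ) →ₗ[ℝ] V) }, rfl⟩

theorem inverse_left (h : IsBiHermitian g A B) (v : V) :
    (fundForm g A).inverse (g v) = -A v := by
  obtain ⟨e, he⟩ := h.exists_equiv
  rw [← he, ContinuousLinearMap.inverse_equiv]
  change e.symm (g v) = _
  rw [ContinuousLinearEquiv.symm_apply_eq]
  change g v = (e : V →L[ℝ] V →L[ℝ] ℝ) (-A v)
  rw [he]
  simp [fundForm, h.sq_left]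

theorem _root_.biHermitianJ'_mk (g : V →L[ℝ] V →L[ℝ] ℝ) (A B : V →L[ℝ] V) (x : V)
    (φ : V →L[ℝ] ℝ) : biHermitianJ' g A B (x, φ)
      = ((1 / 2 : ℝ) • (-(A x - B x)
          + -((fundForm g A).inverse φ + (fundForm g B).inverse φ)),
        (1 / 2 : ℝ) • ((g (A x) + g (B x)) + (φ.comp A - φ.comp B))) := rfl

theorem _root_.biHermitianJ_mk (g : V →L[ℝ] V →L[ℝ] ℝ) (A B : V →L[ℝ] V) (x : V)
    (φ : V →L[ℝ] ℝ) : biHermitianJ g A B (x, φ)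
      = ((1 / 2 : ℝ) • (-(A x + B x)
          + -((fundForm g A).inverse φ - (fundForm g B).inverse φ)),
        (1 / 2 : ℝ) • ((g (A x) - g (B x)) + (φ.comp A + φ.comp B))) := rfl

theorem comp_left (h : IsBiHermitian g A B) (y : V) : (g y).comp A = -g (A y) := by
  ext z
  simp [h.skew_left]

/-- Writing covectors as `g(y)` removes inverses and duals. In the coordinates `x + y` and `x - y`,
along the graphs of `g` and `-g`, the structure is diagonal: it acts as `B` on the first and as `-A`
on the second. -/
theorem biHermitianJ'_apply (h : IsBiHermitian g A B) (x y : V) :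
    biHermitianJ' g A B (x, g y) = ((1 / 2 : ℝ) • (-(A x - B x) + (A y + B y)),
      g ((1 / 2 : ℝ) • ((A x + B x) - (A y - B y)))) := by
  rw [biHermitianJ'_mk, h.inverse_left, h.swap.inverse_left, h.comp_left, h.swap.comp_left,
    map_smul, map_sub, map_sub, map_add]
  ext1
  · dsimp only; module
  · dsimp only; module

/-- Changing the sign of `B` interchanges the two formulas, so a single theory covers both
structures. -/
theorem biHermitianJ_eq (h : IsBiHermitian g A B) : biHermitianJ g A B = biHermitianJ' g A (-B) := by
  refine LinearMap.ext fun u => ?_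
  obtain ⟨x, φ⟩ := u
  obtain ⟨y, rfl⟩ := h.surjective φ
  rw [h.neg_right.biHermitianJ'_apply, biHermitianJ_mk, h.inverse_left, h.swap.inverse_left,
    h.comp_left, h.swap.comp_left, map_smul, map_sub, map_sub, map_add]
  simp only [neg_apply, map_neg]
  ext1
  · dsimp only; module
  · dsimp only; module

theorem isLinGenComplex (h : IsBiHermitian g A B) : IsLinGenComplex (biHermitianJ' g A B) where
  skew u v := by
    obtain ⟨x, φ⟩ := u
    obtain ⟨x', φ'⟩ := v
    obtain ⟨y, rfl⟩ := h.surjective φ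
    obtain ⟨y', rfl⟩ := h.surjective φ'
    simp only [h.biHermitianJ'_apply, genPairing_apply, map_smul, map_add, map_sub, map_neg,
      _root_.smul_apply, _root_.add_apply, _root_.sub_apply,
      smul_eq_mul, h.skew_left, h.skew_right]
    rw [h.symm x' (A x), h.symm x' (B x), h.symm y' (A y), h.symm y' (B y)]
    simp only [h.skew_left, h.skew_right]
    ring
  sq u := by
    obtain ⟨x, φ⟩ := u
    obtain ⟨y, rfl⟩ := h.surjective φ
    rw [h.biHermitianJ'_apply, h.biHermitianJ'_apply, Prod.neg_mk, ← map_neg]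
    simp only [map_smul, map_add, map_sub, map_neg, h.sq_left, h.sq_right]
    ext1
    · dsimp only; module
    · dsimp only; module

/-- On the graph of `g` the product is `-B·B = 1`, on the graph of `-g` it is `A·A = -1`. The
product is therefore the interchange of vectors and covectors by `g`, whichever factor comes first;
this gives commutation and the positive part of `G`. -/
theorem biHermitianJ'_neg_right (h : IsBiHermitian g A B) (x y : V) :
    biHermitianJ' g A (-B) (biHermitianJ' g A B (x, g y)) = (y, g x) := by
  rw [h.biHermitianJ'_apply, h.neg_right.biHermitianJ'_apply]
  simp only [map_smul, map_add, map_sub, map_neg, h.sq_left, h.sq_right,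
    _root_.neg_apply]
  ext1
  · dsimp only; module
  · dsimp only; module

theorem comm (h : IsBiHermitian g A B) (u : V × (V →L[ℝ] ℝ)) :
    biHermitianJ' g A (-B) (biHermitianJ' g A B u)
      = biHermitianJ' g A B (biHermitianJ' g A (-B) u) := by
  obtain ⟨x, φ⟩ := u
  obtain ⟨y, rfl⟩ := h.surjective φ
  have h1 := h.neg_right.biHermitianJ'_neg_right x y
  rw [neg_neg] at h1
  rw [h1, h.biHermitianJ'_neg_right]

/-- The components of an eigenvector in the two summands of the bi-Hermitian decomposition. -/
theorem inEigen (h : IsBiHermitian g A B) {u v : V × (V →L[ℝ] ℝ)}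
    (huv : InEigen (biHermitianJ' g A B) u v) :
    dualRep B (complexCovector (g u.1) (g v.1) + complexCovector u.2 v.2)
        = Complex.I • (complexCovector (g u.1) (g v.1) + complexCovector u.2 v.2) ∧
      dualRep A (complexCovector (g u.1) (g v.1) - complexCovector u.2 v.2)
        = -Complex.I • (complexCovector (g u.1) (g v.1) - complexCovector u.2 v.2) := by
  obtain ⟨x, φ⟩ := u
  obtain ⟨x', φ'⟩ := v
  obtain ⟨y, rfl⟩ := h.surjective φ
  obtain ⟨y', rfl⟩ := h.surjective φ'
  obtain ⟨e1, e2⟩ := huv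
  rw [h.biHermitianJ'_apply, Prod.neg_mk, ← map_neg, Prod.mk.injEq] at e1
  rw [h.biHermitianJ'_apply, Prod.mk.injEq] at e2
  have inj : ∀ {v w : V}, g v = g w → v = w := fun hvw =>
    h.ext_right fun z => congrArg (fun ψ : V →L[ℝ] ℝ => ψ z) hvw
  have a1 := inj e1.2
  have a2 := inj e2.2
  -- The eigenvalue equation separates along the graphs of `g` and `-g`.
  have f1 : B (x + y) = -(x' + y') := by
    rw [neg_add, ← e1.1, ← a1, map_add]; module
  have f2 : A (x - y) = x' - y' := by
    rw [show x' - y' = -(-x') + -y' by abel, ← e1.1, ← a1, map_sub]; module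
  have hc : ∀ v w v' w', complexCovector (g v) (g w) + complexCovector (g v') (g w')
      = complexCovector (g (v + v')) (g (w + w')) := by
    intro v w v' w'; ext; simp [complexCovector]; ring
  have hc' : ∀ v w v' w', complexCovector (g v) (g w) - complexCovector (g v') (g w')
      = complexCovector (g (v - v')) (g (w - w')) := by
    intro v w v' w'; ext; simp [complexCovector]; ring
  have f1' : B (x' + y') = x + y := by
    have := congrArg B f1
    rw [h.sq_right, map_neg] at this
    exact (neg_injective this).symm
  have f2' : A (x' - y') = -(x - y) := by rw [← f2, h.sq_left]
  constructor
  · dsimp only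
    rw [hc]
    ext z
    simp only [dualRep_apply, complexCovector, _root_.add_apply,
      ContinuousLinearMap.comp_apply, _root_.smul_apply, Complex.ofRealCLM_apply,
      smul_eq_mul]
    rw [← neg_neg (g (x + y) (B z)), ← h.skew_right, ← neg_neg (g (x' + y') (B z)), ← h.skew_right,
      f1, f1']
    apply Complex.ext <;> simp
  · dsimp only
    rw [hc']
    ext z
    simp only [dualRep_apply, complexCovector, _root_.add_apply,
      ContinuousLinearMap.comp_apply, _root_.smul_apply, Complex.ofRealCLM_apply,
      smul_eq_mul]
    rw [← neg_neg (g (x - y) (A z)), ← h.skew_left, ← neg_neg (g (x' - y') (A z)), ← h.skew_left,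
      f2, f2']
    apply Complex.ext <;> simp

end IsBiHermitian

theorem IsQuaternionHermitian.isBiHermitian [T2Space V] [FiniteDimensional ℝ V]
    {g : V →L[ℝ] V →L[ℝ] ℝ} {I J K : V →L[ℝ] V}
    (h : IsQuaternionHermitian g I J K) {x y z x' y' z' : ℝ} (hx : x ^ 2 + y ^ 2 + z ^ 2 = 1)
    (hx' : x' ^ 2 + y' ^ 2 + z' ^ 2 = 1) :
    IsBiHermitian g (imagEnd I J K x y z) (imagEnd I J K x' y' z') := by
  have hsq : ∀ {x y z : ℝ}, x ^ 2 + y ^ 2 + z ^ 2 = 1 → ∀ v,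
      imagEnd I J K x y z (imagEnd I J K x y z v) = -v := by
    intro x y z hx v
    have h1 : ∀ v, K v = I (J v) := fun v => (h.I_J v).symm
    have h2 : ∀ v, J (I v) = -I (J v) := fun v => by rw [h.J_I, h1]
    simp only [imagEnd, _root_.add_apply, _root_.smul_apply, map_add,
      map_smul, h1, h2, h.I_I, h.J_J, map_neg, neg_neg]
    have : -v = -(x ^ 2 + y ^ 2 + z ^ 2) • v := by rw [hx]; simp
    refine Eq.trans ?_ this.symm
    module
  exact ⟨h.symm, h.pos, h.skew_imagEnd x y z, h.skew_imagEnd x' y' z', hsq hx, hsq hx'⟩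

end LinearGen
end

noncomputable section

/-! ### Pull-backs and annihilators of forms -/

section Annihilator

variable {V : Type*} [AddCommGroup V] [Module ℝ V] [TopologicalSpace V]
  {W : Type*} [AddCommGroup W] [Module ℝ W] [TopologicalSpace W]
  {Z : Type*} [AddCommGroup Z] [Module ℝ Z] [TopologicalSpace Z]

theorem pullForm_oneForm (A : V →L[ℝ] W) (φ : W →L[ℝ] ℂ) :
    pullForm A (oneForm φ) = oneForm (φ.comp A) := ExteriorAlgebra.map_apply_ι _ _

theorem pullForm_pullForm (A : V →L[ℝ] W) (B : W →L[ℝ] Z) (Φ : CForm Z) :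
    pullForm A (pullForm B Φ) = pullForm (B.comp A) Φ := by
  induction Φ using ExteriorAlgebra.induction with
  | algebraMap r => simp only [AlgHom.commutes]
  | ι c =>
    exact (congrArg (pullForm A) (pullForm_oneForm B c)).trans
      ((pullForm_oneForm A _).trans (pullForm_oneForm (B.comp A) c).symm)
  | mul Φ Ψ h₁ h₂ => simp only [map_mul, h₁, h₂]
  | add Φ Ψ h₁ h₂ => simp only [map_add, h₁, h₂]

theorem pullForm_id (Φ : CForm V) : pullForm (.id ℝ V) Φ = Φ := by
  induction Φ using ExteriorAlgebra.induction with
  | algebraMap r => simp only [AlgHom.commutes]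
  | ι c => exact pullForm_oneForm _ c
  | mul Φ Ψ h₁ h₂ => simp only [map_mul, h₁, h₂]
  | add Φ Ψ h₁ h₂ => simp only [map_add, h₁, h₂]

theorem pullForm_injective {A : V →L[ℝ] W} {B : W →L[ℝ] V} (h : A.comp B = .id ℝ W) :
    Function.Injective (pullForm A) := fun Φ Ψ he => by
  rw [← pullForm_id Φ, ← pullForm_id Ψ, ← h, ← pullForm_pullForm, he, pullForm_pullForm]

theorem contr_pullForm (A : V →L[ℝ] W) (v w : V) (Φ : CForm W) :
    contr (complexEval v w) (pullForm A Φ)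
      = pullForm A (contr (complexEval (A v) (A w)) Φ) := by
  induction Φ using CliffordAlgebra.left_induction with
  | algebraMap r =>
    change contr _ (pullForm A (algebraMap ℂ _ r)) = pullForm A (contr _ (algebraMap ℂ _ r))
    rw [AlgHom.commutes, Algebra.algebraMap_eq_smul_one, Algebra.algebraMap_eq_smul_one, map_smul,
      map_smul, contr_one, contr_one]
    simp
  | add Φ Ψ h₁ h₂ => simp only [map_add, h₁, h₂]
  | ι_mul Φ φ h =>
    change contr _ (pullForm A (oneForm φ * Φ)) = pullForm A (contr _ (ExteriorAlgebra.ι ℂ φ * Φ))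
    rw [map_mul, pullForm_oneForm, contr_ι_mul]
    change contr _ (ExteriorAlgebra.ι ℂ (φ.comp A) * _) = _
    rw [contr_ι_mul, h, map_sub, map_mul, map_smul]
    congr 2
    exact (pullForm_oneForm A φ).symm

theorem pullForm_mem_evenForms (A : V →L[ℝ] W) {Φ : CForm W} (h : Φ ∈ evenForms (W →L[ℝ] ℂ)) :
    pullForm A Φ ∈ evenForms (V →L[ℝ] ℂ) := by
  induction h using Algebra.adjoin_induction with
  | mem S hS =>
    obtain ⟨⟨a, b⟩, rfl⟩ := hS
    change pullForm A (oneForm a * oneForm b) ∈ _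
    rw [map_mul, pullForm_oneForm, pullForm_oneForm]
    exact ι_mul_ι_mem_evenForms _ _
  | algebraMap c => rw [AlgHom.commutes]; exact Subalgebra.algebraMap_mem _ _
  | add S T _ _ hS hT => rw [map_add]; exact Subalgebra.add_mem _ hS hT
  | mul S T _ _ hS hT => rw [map_mul]; exact Subalgebra.mul_mem _ hS hT

theorem cliffordAct_eq (u v : V × (V →L[ℝ] ℝ)) (Φ : CForm V) : cliffordAct u v Φ
    = contr (complexEval u.1 v.1) Φ + oneForm (complexCovector u.2 v.2) * Φ := rfl

/-- The complexified Clifford relation. If both vectors annihilate a non-zero form, their complex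
pairing must vanish. -/
theorem cliffordAct_anticomm [IsTopologicalAddGroup V] [ContinuousSMul ℝ V]
    (u v u' v' : V × (V →L[ℝ] ℝ)) (Φ : CForm V) :
    cliffordAct u v (cliffordAct u' v' Φ) + cliffordAct u' v' (cliffordAct u v Φ)
      = (2 * ((genPairing V u u' - genPairing V v v' : ℝ) + Complex.I *
          (genPairing V u v' + genPairing V v u' : ℝ)) : ℂ) • Φ := by
  simp only [cliffordAct_eq, map_add]
  rw [mul_add, mul_add]
  simp only [oneForm, contr_ι_mul]
  rw [contr_comm (complexEval u'.1 v'.1), ← mul_assoc, ← mul_assoc,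
    ι_mul_ι_comm (complexCovector u'.2 v'.2)]
  have h1 : complexEval u.1 v.1 (complexCovector u'.2 v'.2)
      + complexEval u'.1 v'.1 (complexCovector u.2 v.2)
      = 2 * ((genPairing V u u' - genPairing V v v' : ℝ) + Complex.I *
          (genPairing V u v' + genPairing V v u' : ℝ)) := by
    simp only [genPairing_apply, complexEval, complexCovector, LinearMap.coe_mk, AddHom.coe_mk]
    apply Complex.ext <;> simp <;> ring
  rw [← h1]
  simp only [add_smul, neg_mul]
  abel

/-- The annihilator of a non-zero form that contains the `+i`-eigenspace of a linear generalized
complex structure equals it. -/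
theorem cliffordAct_eq_zero_iff [IsTopologicalAddGroup V] [ContinuousSMul ℝ V]
    {J : V × (V →L[ℝ] ℝ) →ₗ[ℝ] V × (V →L[ℝ] ℝ)} (hJ : IsLinGenComplex J)
    (hsep : ∀ v : V, (∀ φ : V →L[ℝ] ℝ, φ v = 0) → v = 0) {Φ : CForm V}
    (hΦ : Φ ≠ 0) (h : ∀ u v, InEigen J u v → cliffordAct u v Φ = 0) (u v : V × (V →L[ℝ] ℝ)) :
    cliffordAct u v Φ = 0 ↔ InEigen J u v := by
  refine ⟨fun h0 => ?_, h u v⟩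
  have nondeg : ∀ w : V × (V →L[ℝ] ℝ), (∀ x, genPairing V w x = 0) → w = 0 := by
    intro w hw
    ext1
    · refine hsep _ fun φ => ?_
      have := hw (0, φ)
      simpa [genPairing_apply] using this
    · ext x
      have := hw (x, 0)
      simpa [genPairing_apply] using this
  have key : ∀ x, genPairing V u x + genPairing V v (J x) = 0 ∧
      -genPairing V u (J x) + genPairing V v x = 0 := by
    intro x
    -- The vectors `x - i Jx` exhaust the `+i`-eigenspace. Orthogonality of `u + iv` to all of them
    -- forces it into that eigenspace.
    have hx : InEigen J x (-J x) := ⟨by simp, by rw [map_neg, hJ.sq, neg_neg]⟩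
    have h1 := cliffordAct_anticomm u v x (-J x) Φ
    rw [h _ _ hx, h0] at h1
    have hz : ∀ a b, cliffordAct (V := V) a b 0 = 0 := fun a b => by simp [cliffordAct]
    rw [hz, hz, add_zero, eq_comm, smul_eq_zero] at h1
    have h2 := h1.resolve_right hΦ
    have h3 := congrArg Complex.re h2
    have h4 := congrArg Complex.im h2
    simp at h3 h4
    exact ⟨by linarith, by linarith⟩
  constructor
  · have : J u + v = 0 := nondeg _ fun x => by
      rw [map_add, LinearMap.add_apply, hJ.skew]
      exact (key x).2
    exact eq_neg_of_add_eq_zero_left this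
  · have : u - J v = 0 := nondeg _ fun x => by
      rw [map_sub, LinearMap.sub_apply, hJ.skew]
      linarith [(key x).1]
    exact (sub_eq_zero.1 this).symm

end Annihilator

/-! ### Spinors on the product with two lines -/

section ProdSpinor

variable {V : Type*} [AddCommGroup V] [Module ℝ V] [TopologicalSpace V]
  [IsTopologicalAddGroup V] [ContinuousSMul ℝ V]

/-- The form `Ψ ∧ ds ∧ dt` on `V × ℂ × ℂ`. -/
def prodSpinor (Ψ : CForm V) (σ τ : V × ℂ × ℂ →L[ℝ] ℂ) : CForm (V × ℂ × ℂ) :=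
  pullForm (.fst ℝ V (ℂ × ℂ)) Ψ * oneForm σ * oneForm τ

theorem contr_even_mul_mul {N : Type*} [AddCommGroup N] [Module ℂ N] {S : ExteriorAlgebra ℂ N}
    (hS : S ∈ evenForms N) (x : Module.Dual ℂ N) (a b : N) :
    contr x (S * ExteriorAlgebra.ι ℂ a * ExteriorAlgebra.ι ℂ b)
      = contr x S * ExteriorAlgebra.ι ℂ a * ExteriorAlgebra.ι ℂ b
        + (x a • (S * ExteriorAlgebra.ι ℂ b) - x b • (S * ExteriorAlgebra.ι ℂ a)) := by
  rw [mul_assoc, contr_even_mul hS, contr_ι_mul, contr_ι, mul_assoc, mul_sub, mul_smul_comm,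
    Algebra.algebraMap_eq_smul_one, mul_smul_comm, mul_smul_comm, mul_one]

/-- The vector part kills `σ` and `τ`, so its contraction only meets `Ψ`; the covector part along
the lines is a combination of `σ` and `τ`, which wedges to zero. -/
theorem cliffordAct_prodSpinor {Ψ : CForm V} (hΨ : Ψ ∈ evenForms (V →L[ℝ] ℂ))
    {σ τ : V × ℂ × ℂ →L[ℝ] ℂ} {u v : (V × ℂ × ℂ) × (V × ℂ × ℂ →L[ℝ] ℝ)}
    (h : cliffordAct (genFst u) (genFst v) Ψ = 0) (hσ : complexEval u.1 v.1 σ = 0)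
    (hτ : complexEval u.1 v.1 τ = 0) {a b : ℂ} (hc : complexCovector u.2 v.2
      = (complexCovector (genFst u).2 (genFst v).2).comp (.fst ℝ V (ℂ × ℂ)) + (a • σ + b • τ)) :
    cliffordAct u v (prodSpinor Ψ σ τ) = 0 := by
  have h1 := congrArg (pullForm (.fst ℝ V (ℂ × ℂ))) h
  rw [cliffordAct_eq, map_add, map_mul, pullForm_oneForm, map_zero] at h1
  have h2 : (genFst u).1 = ContinuousLinearMap.fst ℝ V (ℂ × ℂ) u.1 := rfl
  have h3 : (genFst v).1 = ContinuousLinearMap.fst ℝ V (ℂ × ℂ) v.1 := rfl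
  rw [h2, h3, ← contr_pullForm] at h1
  have he := pullForm_mem_evenForms (.fst ℝ V (ℂ × ℂ)) hΨ
  have e1 : oneForm σ * (pullForm (.fst ℝ V (ℂ × ℂ)) Ψ * oneForm σ * oneForm τ) = 0 := by
    rw [evenForms_comm he, mul_assoc, ← mul_assoc (oneForm σ), show oneForm σ * oneForm σ = 0 from
      ExteriorAlgebra.ι_sq_zero σ, zero_mul]
  have e2 : oneForm τ * (pullForm (.fst ℝ V (ℂ × ℂ)) Ψ * oneForm σ * oneForm τ) = 0 := by
    rw [mul_assoc, ← mul_assoc (oneForm τ), ← evenForms_comm he, mul_assoc,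
      ← mul_assoc (oneForm τ), show oneForm τ * oneForm σ = -(oneForm σ * oneForm τ) from
      ι_mul_ι_comm τ σ, neg_mul, mul_assoc (oneForm σ), show oneForm τ * oneForm τ = 0 from
      ExteriorAlgebra.ι_sq_zero τ, mul_zero, neg_zero, mul_zero]
  rw [cliffordAct_eq, prodSpinor, hc, oneForm_add, oneForm_add, oneForm_smul, oneForm_smul, add_mul,
    add_mul, smul_mul_assoc, smul_mul_assoc, e1, e2, smul_zero, smul_zero, add_zero, add_zero]
  have h4 := contr_even_mul_mul he (complexEval u.1 v.1) σ τ
  rw [hσ, hτ, zero_smul ℂ, zero_smul ℂ, sub_zero, add_zero] at h4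
  change contr (complexEval u.1 v.1) (pullForm _ Ψ * ExteriorAlgebra.ι ℂ σ * ExteriorAlgebra.ι ℂ τ)
    + _ = 0
  rw [h4]
  change _ * oneForm σ * oneForm τ + _ = 0
  rw [← mul_assoc, ← mul_assoc, ← add_mul, ← add_mul, h1, zero_mul, zero_mul]

/-- Contracting with a vector of the first line and then one of the second strips off `σ` and `τ`,
since the pulled-back `Ψ` does not see these directions. -/
theorem prodSpinor_ne_zero {Ψ : CForm V} (hΨ : Ψ ∈ evenForms (V →L[ℝ] ℂ)) (h0 : Ψ ≠ 0)
    {σ τ : ℂ →L[ℝ] ℂ} {z w : ℂ} (hσ : σ z ≠ 0) (hτ : τ w ≠ 0) :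
    prodSpinor Ψ (σ.comp (.comp (.fst ℝ ℂ ℂ) (.snd ℝ V (ℂ × ℂ))))
      (τ.comp (.comp (.snd ℝ ℂ ℂ) (.snd ℝ V (ℂ × ℂ)))) ≠ 0 := by
  intro h
  have he := pullForm_mem_evenForms (.fst ℝ V (ℂ × ℂ)) hΨ
  have hz : ∀ p : ℂ × ℂ, contr (complexEval ((0 : V), p) 0)
      (pullForm (.fst ℝ V (ℂ × ℂ)) Ψ) = 0 := by
    intro p
    rw [contr_pullForm]
    have : complexEval (ContinuousLinearMap.fst ℝ V (ℂ × ℂ) ((0 : V), p))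
        (ContinuousLinearMap.fst ℝ V (ℂ × ℂ) 0) = 0 := by
      ext φ; simp [complexEval]
    rw [this, map_zero, LinearMap.zero_apply, map_zero]
  have hev : ∀ (p : V × ℂ × ℂ) (φ : V × ℂ × ℂ →L[ℝ] ℂ), complexEval p 0 φ = φ p := by
    intro p φ; simp [complexEval]
  have h1 := contr_even_mul_mul he (complexEval ((0 : V), z, (0 : ℂ)) 0)
    (σ.comp (.comp (.fst ℝ ℂ ℂ) (.snd ℝ V (ℂ × ℂ))))
    (τ.comp (.comp (.snd ℝ ℂ ℂ) (.snd ℝ V (ℂ × ℂ))))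
  rw [hz, zero_mul, zero_mul, zero_add, hev, hev, show pullForm (.fst ℝ V (ℂ × ℂ)) Ψ *
    ExteriorAlgebra.ι ℂ (σ.comp (.comp (.fst ℝ ℂ ℂ) (.snd ℝ V (ℂ × ℂ)))) *
    ExteriorAlgebra.ι ℂ (τ.comp (.comp (.snd ℝ ℂ ℂ) (.snd ℝ V (ℂ × ℂ)))) = 0 from h, map_zero] at h1
  simp only [ContinuousLinearMap.comp_apply, ContinuousLinearMap.coe_snd',
    ContinuousLinearMap.coe_fst', map_zero, zero_smul, sub_zero] at h1
  have h2 := ((smul_eq_zero.1 h1.symm).resolve_left hσ)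
  have h3 := contr_even_mul he (complexEval ((0 : V), (0 : ℂ), w) 0)
    (ExteriorAlgebra.ι ℂ (τ.comp (.comp (.snd ℝ ℂ ℂ) (.snd ℝ V (ℂ × ℂ)))))
  rw [h2, hz, map_zero, zero_mul, zero_add, contr_ι, hev, Algebra.algebraMap_eq_smul_one,
    mul_smul_comm, mul_one] at h3
  have h4 := ((smul_eq_zero.1 h3.symm).resolve_left hτ)
  refine h0 (pullForm_injective (A := .fst ℝ V (ℂ × ℂ)) (B := .inl ℝ V (ℂ × ℂ)) ?_ ?_)
  · ext; rfl
  · rw [h4, map_zero]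

/-- Multiplication by a complex number, as a real linear map. -/
def mulC (c : ℂ) : ℂ →L[ℝ] ℂ := ContinuousLinearMap.mul ℝ ℂ c

theorem mulC_apply (c z : ℂ) : mulC c z = c * z := rfl

/-- The real-linear maps `ℂ → ℂ` intertwining `κ` with `i` form a complex line: they are determined
by their value at `1`. The two values of `κ` are the holomorphic and antiholomorphic cases. -/
theorem exists_smul_eq_of_mulC {κ : ℂ} (hκ : κ = Complex.I ∨ κ = -Complex.I) {σ ξ : ℂ →L[ℝ] ℂ}
    (hσ : ∀ z, σ (κ * z) = Complex.I * σ z) (hξ : ∀ z, ξ (κ * z) = Complex.I * ξ z) {z₀ : ℂ}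
    (h0 : σ z₀ ≠ 0) : ∃ c : ℂ, ξ = c • σ := by
  have hκ2 : κ = (-(κ * Complex.I) : ℂ) * Complex.I := by
    rw [neg_mul, mul_assoc, Complex.I_mul_I]; ring
  obtain ⟨ε, hε, hκε⟩ : ∃ ε : ℝ, ε * ε = 1 ∧ κ = ε * Complex.I := by
    rcases hκ with rfl | rfl
    · exact ⟨1, by simp, by simp⟩
    · exact ⟨-1, by simp, by simp⟩
  have hgen : ∀ η : ℂ →L[ℝ] ℂ, (∀ z, η (κ * z) = Complex.I * η z) →
      ∀ z, η z = (z.re + ε * z.im * Complex.I) * η 1 := by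
    intro η hη z
    have h1 : z = z.re • (1 : ℂ) + (ε * z.im) • (κ * 1) := by
      rw [hκε]
      apply Complex.ext <;> simp
      rw [mul_right_comm, hε, one_mul]
    conv_lhs => rw [h1]
    rw [map_add, map_smul, map_smul, hη]
    simp
    ring
  have h1 : σ 1 ≠ 0 := fun h => h0 (by rw [hgen σ hσ, h, mul_zero])
  refine ⟨ξ 1 / σ 1, ?_⟩
  ext z
  rw [hgen ξ hξ]
  change _ = ξ 1 / σ 1 * σ z
  rw [hgen σ hσ z]
  field_simp

/-- Because of the sign in `-A`, the `+i`-eigenspace consists of (0,1)-vectors, which kill a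
(1,0)-covector, together with the (1,0)-covectors. -/
theorem inEigen_genOfComplex {κ : ℂ} {u v : ℂ × (ℂ →L[ℝ] ℝ)}
    (h : InEigen (genOfComplex (mulC κ)) u v) {σ : ℂ →L[ℝ] ℂ}
    (hσ : ∀ z, σ (κ * z) = Complex.I * σ z) : complexEval u.1 v.1 σ = 0 ∧
      ∀ z, complexCovector u.2 v.2 (κ * z) = Complex.I * complexCovector u.2 v.2 z := by
  obtain ⟨h1, h2⟩ := h
  rw [genOfComplex_apply] at h1 h2
  have a1 := congrArg Prod.fst h1
  have a2 := congrArg Prod.snd h1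
  have a3 := congrArg Prod.snd h2
  simp only [Prod.fst_neg, Prod.snd_neg, mulC_apply, neg_inj] at a1 a2 a3
  constructor
  · simp only [complexEval, LinearMap.coe_mk, AddHom.coe_mk, ← a1, hσ]
    rw [← mul_assoc, Complex.I_mul_I]
    ring
  · intro z
    have b1 : u.2 (κ * z) = -v.2 z := congrArg (fun φ : ℂ →L[ℝ] ℝ => φ z) a2
    have b2 : v.2 (κ * z) = u.2 z := congrArg (fun φ : ℂ →L[ℝ] ℝ => φ z) a3
    simp [complexCovector, b1, b2]
    rw [mul_add, ← mul_assoc, Complex.I_mul_I]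
    ring

/-- The endomorphism of `(V × ℂ × ℂ) ⊕ (V × ℂ × ℂ)*` that extends a given one of `V ⊕ V*` by the
complex structures `κ₁` and `κ₂` of the lines. -/
def extendEnd (J : V × (V →L[ℝ] ℝ) →ₗ[ℝ] V × (V →L[ℝ] ℝ)) (κ₁ κ₂ : ℂ) :
    (V × ℂ × ℂ) × (V × ℂ × ℂ →L[ℝ] ℝ) →ₗ[ℝ] (V × ℂ × ℂ) × (V × ℂ × ℂ →L[ℝ] ℝ) :=
  prodEnd J (prodEnd (genOfComplex (mulC κ₁)) (genOfComplex (mulC κ₂)))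

theorem mulC_mulC {κ : ℂ} (hκ : κ = Complex.I ∨ κ = -Complex.I) (z : ℂ) :
    mulC κ (mulC κ z) = -z := by
  rcases hκ with rfl | rfl <;> simp [mulC_apply, ← mul_assoc]

theorem IsLinGenComplex.extendEnd {J : V × (V →L[ℝ] ℝ) →ₗ[ℝ] V × (V →L[ℝ] ℝ)}
    (hJ : IsLinGenComplex J) {κ₁ κ₂ : ℂ} (h₁ : κ₁ = Complex.I ∨ κ₁ = -Complex.I)
    (h₂ : κ₂ = Complex.I ∨ κ₂ = -Complex.I) : IsLinGenComplex (extendEnd J κ₁ κ₂) :=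
  hJ.prodEnd ((isLinGenComplex_genOfComplex (mulC_mulC h₁)).prodEnd
    (isLinGenComplex_genOfComplex (mulC_mulC h₂)))

theorem cliffordAct_extendEnd {J : V × (V →L[ℝ] ℝ) →ₗ[ℝ] V × (V →L[ℝ] ℝ)} {Ψ : CForm V}
    (hΨ : Ψ ∈ evenForms (V →L[ℝ] ℂ)) {κ₁ κ₂ : ℂ} (h₁ : κ₁ = Complex.I ∨ κ₁ = -Complex.I)
    (h₂ : κ₂ = Complex.I ∨ κ₂ = -Complex.I) (hJ : ∀ u v, InEigen J u v → cliffordAct u v Ψ = 0)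
    {σ τ : ℂ →L[ℝ] ℂ} (hσ : ∀ z, σ (κ₁ * z) = Complex.I * σ z)
    (hτ : ∀ z, τ (κ₂ * z) = Complex.I * τ z) {z w : ℂ} (hz : σ z ≠ 0) (hw : τ w ≠ 0)
    (u v : (V × ℂ × ℂ) × (V × ℂ × ℂ →L[ℝ] ℝ)) (huv : InEigen (extendEnd J κ₁ κ₂) u v) :
    cliffordAct u v (prodSpinor Ψ (σ.comp (.comp (.fst ℝ ℂ ℂ) (.snd ℝ V (ℂ × ℂ))))
      (τ.comp (.comp (.snd ℝ ℂ ℂ) (.snd ℝ V (ℂ × ℂ))))) = 0 := by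
  obtain ⟨e1, e2⟩ := inEigen_prodEnd huv
  obtain ⟨e2, e3⟩ := inEigen_prodEnd e2
  obtain ⟨a1, a2⟩ := inEigen_genOfComplex e2 hσ
  obtain ⟨b1, b2⟩ := inEigen_genOfComplex e3 hτ
  obtain ⟨a, ha⟩ := exists_smul_eq_of_mulC h₁ hσ a2 hz
  obtain ⟨b, hb⟩ := exists_smul_eq_of_mulC h₂ hτ b2 hw
  refine cliffordAct_prodSpinor hΨ (hJ _ _ e1) a1 b1 (a := a) (b := b) ?_
  have h3 : a • (σ.comp (.comp (.fst ℝ ℂ ℂ) (.snd ℝ V (ℂ × ℂ))))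
      = (a • σ).comp (.comp (.fst ℝ ℂ ℂ) (.snd ℝ V (ℂ × ℂ))) := rfl
  have h4 : b • (τ.comp (.comp (.snd ℝ ℂ ℂ) (.snd ℝ V (ℂ × ℂ))))
      = (b • τ).comp (.comp (.snd ℝ ℂ ℂ) (.snd ℝ V (ℂ × ℂ))) := rfl
  rw [h3, h4, ← ha, ← hb]
  conv_lhs => rw [← genPair_genFst_genSnd u, ← genPair_genFst_genSnd v,
    ← genPair_genFst_genSnd (genSnd u), ← genPair_genFst_genSnd (genSnd v)]
  ext x <;> simp [complexCovector, genPair_apply]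

end ProdSpinor

/-- The annihilator of the twistor spinor is the `+i`-eigenspace. -/
theorem IsQuaternionHermitian.cliffordAct_prodSpinor_iff {V : Type*} [AddCommGroup V] [Module ℝ V]
    [TopologicalSpace V] [IsTopologicalAddGroup V] [ContinuousSMul ℝ V] [T2Space V]
    [FiniteDimensional ℝ V] {g : V →L[ℝ] V →L[ℝ] ℝ} {I J K : V →L[ℝ] V}
    (h : IsQuaternionHermitian g I J K) {a₀ a₁ g₀ g₁ : ℂ} (ha : a₀ ≠ 0 ∨ a₁ ≠ 0)
    (hg : g₀ ≠ 0 ∨ g₁ ≠ 0) {n : ℕ} (hn : Module.finrank ℝ V = 4 * n) {A B : V →L[ℝ] V}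
    (hA : A = twistorEnd I J K a₀ a₁)
    (hB : B = twistorEnd I J K (starRingEnd ℂ g₁) (starRingEnd ℂ g₀))
    (hAB : IsBiHermitian g A B) {κ₁ κ₂ : ℂ} (h₁ : κ₁ = Complex.I ∨ κ₁ = -Complex.I)
    (h₂ : κ₂ = Complex.I ∨ κ₂ = -Complex.I) {σ τ : ℂ →L[ℝ] ℂ}
    (hσ : ∀ z, σ (κ₁ * z) = Complex.I * σ z) (hτ : ∀ z, τ (κ₂ * z) = Complex.I * τ z) {z w : ℂ}
    (hz : σ z ≠ 0) (hw : τ w ≠ 0) (u v : (V × ℂ × ℂ) × (V × ℂ × ℂ →L[ℝ] ℝ)) :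
    cliffordAct u v (prodSpinor (h.spinor n a₀ a₁ g₀ g₁)
      (σ.comp (.comp (.fst ℝ ℂ ℂ) (.snd ℝ V (ℂ × ℂ))))
      (τ.comp (.comp (.snd ℝ ℂ ℂ) (.snd ℝ V (ℂ × ℂ))))) = 0
        ↔ InEigen (extendEnd (biHermitianJ' g A B) κ₁ κ₂) u v := by
  refine cliffordAct_eq_zero_iff (hAB.isLinGenComplex.extendEnd h₁ h₂) ?_
    (prodSpinor_ne_zero (h.spinor_mem_evenForms _ _ _ _ _) (h.spinor_ne_zero ha hg hn) hz hw)
    (cliffordAct_extendEnd (h.spinor_mem_evenForms _ _ _ _ _) h₁ h₂ (fun u v huv => ?_) hσ hτ hz hw)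
    u v
  · rintro ⟨v, z, w⟩ hφ
    have e1 : v = 0 := by
      by_contra hne
      have := hφ ((g v).comp (.fst ℝ V (ℂ × ℂ)))
      exact (h.pos v hne).ne' this
    have e2 : ∀ ψ : ℂ × ℂ →L[ℝ] ℝ, ψ (z, w) = 0 := fun ψ => hφ (ψ.comp (.snd ℝ V (ℂ × ℂ)))
    have e3 : z = 0 := Complex.ext (e2 (Complex.reCLM.comp (.fst ℝ ℂ ℂ)))
      (e2 (Complex.imCLM.comp (.fst ℝ ℂ ℂ)))
    have e4 : w = 0 := Complex.ext (e2 (Complex.reCLM.comp (.snd ℝ ℂ ℂ)))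
      (e2 (Complex.imCLM.comp (.snd ℝ ℂ ℂ)))
    rw [e1, e3, e4]; rfl
  · obtain ⟨hp, hq⟩ := hAB.inEigen huv
    rw [hB] at hp
    rw [hA] at hq
    exact h.contr_spinor ha hg hn u.1 v.1 _ hp hq

end

noncomputable section

/-! ### The metric of a commuting pair -/

section Signature

/-- A positive definite and a negative definite subspace bound the two indices from below; if their
dimensions exhaust the space, both bounds are attained. -/
theorem sig_eq_of_linearMap {X Y Z : Type*} [AddCommGroup X] [Module ℝ X] [FiniteDimensional ℝ X]
    [AddCommGroup Y] [Module ℝ Y] [FiniteDimensional ℝ Y] [AddCommGroup Z] [Module ℝ Z]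
    [FiniteDimensional ℝ Z] {Q : QuadraticForm ℝ X} (L : Y →ₗ[ℝ] X) (L' : Z →ₗ[ℝ] X)
    (hL : ∀ y, y ≠ 0 → 0 < Q (L y)) (hL' : ∀ z, z ≠ 0 → Q (L' z) < 0)
    (hdim : Module.finrank ℝ Y + Module.finrank ℝ Z = Module.finrank ℝ X) :
    sigPos Q = Module.finrank ℝ Y ∧ sigNeg Q = Module.finrank ℝ Z := by
  have i1 : Function.Injective L := by
    rw [injective_iff_map_eq_zero]
    intro y hy
    by_contra hne
    have := hL y hne
    simp [hy] at this
  have i2 : Function.Injective L' := by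
    rw [injective_iff_map_eq_zero]
    intro y hy
    by_contra hne
    have := hL' y hne
    simp [hy] at this
  have h1 : Module.finrank ℝ Y ≤ sigPos Q := by
    rw [← LinearMap.finrank_range_of_inj i1]
    refine le_sigPos_of_posDef Q ?_
    rintro ⟨_, y, rfl⟩ hy
    exact hL y fun h => hy (by simp [h])
  have h2 : Module.finrank ℝ Z ≤ sigNeg Q := by
    rw [← LinearMap.finrank_range_of_inj i2]
    refine le_sigNeg_of_negDef Q ?_
    rintro ⟨_, y, rfl⟩ hy
    have := hL' y fun h => hy (by simp [h])
    exact neg_pos.2 this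
  have h3 := QuadraticForm.sigPos_add_sigNeg_add_radical (Q := Q)
  omega

variable {V : Type*} [AddCommGroup V] [Module ℝ V] [TopologicalSpace V]
  [IsTopologicalAddGroup V] [ContinuousSMul ℝ V] [T2Space V] [FiniteDimensional ℝ V]

theorem genPairing_symm (u v : V × (V →L[ℝ] ℝ)) : genPairing V u v = genPairing V v u := by
  rw [genPairing_apply, genPairing_apply]
  ring

theorem eq_zero_of_genPairing {w : V × (V →L[ℝ] ℝ)} (hw : ∀ x, genPairing V w x = 0) : w = 0 := by
  have hfin : FiniteDimensional ℝ (Module.Dual ℝ V) := inferInstance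
  ext1
  · refine (Module.forall_dual_apply_eq_zero_iff ℝ w.1).1 fun φ => ?_
    have := hw (0, LinearMap.toContinuousLinearMap φ)
    simpa [genPairing_apply] using this
  · ext x
    have := hw (x, 0)
    simpa [genPairing_apply] using this

/-- The pairing `-⟨J u, J' v⟩`. -/
def linGenMetric (J J' : V × (V →L[ℝ] ℝ) →ₗ[ℝ] V × (V →L[ℝ] ℝ)) :
    LinearMap.BilinForm ℝ (V × (V →L[ℝ] ℝ)) := -(genPairing V).compl₁₂ J J'

theorem linGenMetric_apply (J J' : V × (V →L[ℝ] ℝ) →ₗ[ℝ] V × (V →L[ℝ] ℝ))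
    (u v : V × (V →L[ℝ] ℝ)) : linGenMetric J J' u v = -genPairing V (J u) (J' v) := rfl

theorem linGenMetric_isSymm {J J' : V × (V →L[ℝ] ℝ) →ₗ[ℝ] V × (V →L[ℝ] ℝ)}
    (hJ : IsLinGenComplex J) (hJ' : IsLinGenComplex J') (hc : ∀ u, J (J' u) = J' (J u)) :
    (linGenMetric J J').IsSymm := by
  constructor
  intro u v
  rw [linGenMetric_apply, linGenMetric_apply, hJ.skew, hc,
    genPairing_symm (J v), hJ'.skew]

theorem linGenMetric_nondegenerate {J J' : V × (V →L[ℝ] ℝ) →ₗ[ℝ] V × (V →L[ℝ] ℝ)}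
    (hJ : IsLinGenComplex J) (hJ' : IsLinGenComplex J') :
    (linGenMetric J J').Nondegenerate := by
  constructor
  · intro u hu
    have h1 : J' (J u) = 0 := eq_zero_of_genPairing fun x => by
      rw [hJ'.skew]; exact hu x
    have h2 := hJ'.sq (J u)
    rw [h1, map_zero] at h2
    have h3 := hJ.sq u
    rwa [neg_eq_zero.1 h2.symm, map_zero, eq_comm, neg_eq_zero] at h3
  · intro v hv
    have h1 : J (J' v) = 0 := eq_zero_of_genPairing fun x => by
      rw [genPairing_symm, ← neg_neg (genPairing V x _), ← hJ.skew]; exact hv x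
    have h2 := hJ.sq (J' v)
    rw [h1, map_zero] at h2
    have h3 := hJ'.sq v
    rwa [neg_eq_zero.1 h2.symm, map_zero, eq_comm, neg_eq_zero] at h3

theorem extendEnd_comm {J J' : V × (V →L[ℝ] ℝ) →ₗ[ℝ] V × (V →L[ℝ] ℝ)}
    (hc : ∀ u, J (J' u) = J' (J u)) (κ₁ κ₂ κ₁' κ₂' : ℂ)
    (u : (V × ℂ × ℂ) × (V × ℂ × ℂ →L[ℝ] ℝ)) :
    extendEnd J κ₁ κ₂ (extendEnd J' κ₁' κ₂' u) = extendEnd J' κ₁' κ₂' (extendEnd J κ₁ κ₂ u) := by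
  have h1 : ∀ (κ κ' : ℂ) (u : ℂ × (ℂ →L[ℝ] ℝ)), genOfComplex (mulC κ) (genOfComplex (mulC κ') u)
      = genOfComplex (mulC κ') (genOfComplex (mulC κ) u) := by
    intro κ κ' u
    simp only [genOfComplex_apply]
    refine Prod.ext ?_ ?_
    · simp only [mulC_apply, mul_neg, mul_left_comm]
    · ext z
      simp only [ContinuousLinearMap.comp_apply, mulC_apply]
      rw [mul_left_comm]
  exact prodEnd_comm hc (prodEnd_comm (h1 _ _) (h1 _ _)) u

/-- The quadratic form of the pairing `-⟨J u, J' u⟩` of the two structures of a bi-Hermitian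
structure. -/
theorem linGenMetric_extendEnd {g : V →L[ℝ] V →L[ℝ] ℝ} {A B : V →L[ℝ] V}
    (h : IsBiHermitian g A B) (x y : V) (s t : ℂ × (ℂ →L[ℝ] ℝ)) :
    linGenMetric (extendEnd (biHermitianJ' g A (-B)) Complex.I Complex.I)
      (extendEnd (biHermitianJ' g A B) Complex.I (-Complex.I))
      (genPair ((x, g y), genPair (s, t))) (genPair ((x, g y), genPair (s, t)))
      = (1 / 2) * (g x x + g y y) - s.2 s.1 + t.2 t.1 := by
  rw [linGenMetric_apply, genPairing_eq_add, genPairing_eq_add (V := ℂ)]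
  simp only [extendEnd, genFst_prodEnd, genSnd_prodEnd, genFst_genPair, genSnd_genPair]
  have hI := isLinGenComplex_genOfComplex (mulC_mulC (Or.inl rfl))
  have e1 := h.neg_right.isLinGenComplex.skew (x, g y) (biHermitianJ' g A B (x, g y))
  rw [h.biHermitianJ'_neg_right] at e1
  have e2 := hI.orthogonal s s
  have e3 := hI.orthogonal t t
  have e4 : genOfComplex (mulC (-Complex.I)) t = -genOfComplex (mulC Complex.I) t := by
    rw [← genOfComplex_neg]
    congr 2
    ext
    simp [mulC_apply]
  rw [e1, e2, e4, map_neg, e3]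
  simp only [genPairing_apply]
  ring

theorem signature_extendEnd {g : V →L[ℝ] V →L[ℝ] ℝ} {A B : V →L[ℝ] V}
    (h : IsBiHermitian g A B) {n : ℕ} (hn : Module.finrank ℝ V = 4 * n) :
    sigPos (LinearMap.BilinMap.toQuadraticMap
      (linGenMetric (extendEnd (biHermitianJ' g A (-B)) Complex.I Complex.I)
      (extendEnd (biHermitianJ' g A B) Complex.I (-Complex.I)))) = 8 * n + 4 ∧
    sigNeg (LinearMap.BilinMap.toQuadraticMap
      (linGenMetric (extendEnd (biHermitianJ' g A (-B)) Complex.I Complex.I)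
      (extendEnd (biHermitianJ' g A B) Complex.I (-Complex.I)))) = 4 := by
  -- The graph of `c` times the Euclidean metric on a line, on which `ξ(X) = c |X|²`.
  let D : ℝ → ℂ →ₗ[ℝ] ℂ × (ℂ →L[ℝ] ℝ) := fun c =>
    LinearMap.prod LinearMap.id (c • (Complex.reLm.smulRight Complex.reCLM + Complex.imLm.smulRight Complex.imCLM))
  have hD : ∀ c z, (D c z).2 (D c z).1 = c * ‖z‖ ^ 2 := by
    intro c z
    change c * (z.re * z.re + z.im * z.im) = _
    rw [← Complex.normSq_apply, Complex.normSq_eq_norm_sq]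
  -- `G` is minus the pairing on the first line, where the structures agree, and plus the pairing on
  -- the second, where they are opposite. The positive subspace thus uses the graphs with `c = -1`
  -- and `c = 1`, and the negative one the reverse choice.
  let L : (V × V) × ℂ × ℂ →ₗ[ℝ] (V × ℂ × ℂ) × (V × ℂ × ℂ →L[ℝ] ℝ) :=
    genPair ∘ₗ (LinearMap.prodMap (LinearMap.prodMap LinearMap.id (g : V →ₗ[ℝ] V →L[ℝ] ℝ))
      (genPair ∘ₗ LinearMap.prodMap (D (-1)) (D 1)))
  let L' : ℂ × ℂ →ₗ[ℝ] (V × ℂ × ℂ) × (V × ℂ × ℂ →L[ℝ] ℝ) :=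
    genPair ∘ₗ (LinearMap.prod 0 (genPair ∘ₗ LinearMap.prodMap (D 1) (D (-1))))
  have hL : ∀ x y z w, L ((x, y), z, w) = genPair ((x, g y), genPair (D (-1) z, D 1 w)) :=
    fun _ _ _ _ => rfl
  have hL' : ∀ z w, L' (z, w) = genPair ((0, g 0), genPair (D 1 z, D (-1) w)) := fun _ _ => by
    rw [map_zero]; rfl
  have hfin : FiniteDimensional ℝ (V × ℂ × ℂ →L[ℝ] ℝ) :=
    Module.Finite.equiv (LinearMap.toContinuousLinearMap (𝕜 := ℝ) (E := V × ℂ × ℂ) (F' := ℝ))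
  have hrank : Module.finrank ℝ (V × ℂ × ℂ →L[ℝ] ℝ) = Module.finrank ℝ (V × ℂ × ℂ) := by
    rw [← (LinearMap.toContinuousLinearMap (𝕜 := ℝ) (E := V × ℂ × ℂ) (F' := ℝ)).finrank_eq]
    exact Subspace.dual_finrank_eq (K := ℝ) (V := V × ℂ × ℂ)
  have hg : ∀ v, 0 ≤ g v v := fun v => by
    by_cases hv : v = 0
    · simp [hv]
    · exact (h.pos v hv).le
  have d1 : Module.finrank ℝ ((V × V) × ℂ × ℂ) = 8 * n + 4 := by
    simp [hn]; ring
  have d2 : Module.finrank ℝ (ℂ × ℂ) = 4 := by simp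
  rw [← d1, ← d2]
  refine sig_eq_of_linearMap L L' ?_ ?_ ?_
  · rintro ⟨⟨x, y⟩, z, w⟩ hne
    rw [LinearMap.BilinMap.toQuadraticMap_apply, hL, linGenMetric_extendEnd h, hD, hD]
    have h1 := hg x
    have h2 := hg y
    have h3 := sq_nonneg ‖z‖
    have h4 := sq_nonneg ‖w‖
    by_contra hcon
    have e1 : x = 0 := by_contra fun hx => by linarith [h.pos x hx]
    have e2 : y = 0 := by_contra fun hy => by linarith [h.pos y hy]
    have e3 : z = 0 := by_contra fun hz => by linarith [sq_pos_of_pos (norm_pos_iff.2 hz)]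
    have e4 : w = 0 := by_contra fun hw => by linarith [sq_pos_of_pos (norm_pos_iff.2 hw)]
    exact hne (by rw [e1, e2, e3, e4]; rfl)
  · rintro ⟨z, w⟩ hne
    rw [LinearMap.BilinMap.toQuadraticMap_apply, hL', linGenMetric_extendEnd h, hD, hD]
    have h3 := sq_nonneg ‖z‖
    have h4 := sq_nonneg ‖w‖
    by_contra hcon
    simp only [map_zero] at hcon
    have e3 : z = 0 := by_contra fun hz => by linarith [sq_pos_of_pos (norm_pos_iff.2 hz)]
    have e4 : w = 0 := by_contra fun hw => by linarith [sq_pos_of_pos (norm_pos_iff.2 hw)]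
    exact hne (by rw [e3, e4]; rfl)
  · rw [d1, d2, Module.finrank_prod, hrank]
    simp [hn]
    ring

end Signature
end

noncomputable section

/-! ### Calculus in finite-dimensional complex vector spaces without a norm -/

section Calculus

variable {F : Type*} [NormedAddCommGroup F] [NormedSpace ℝ F]
  {X : Type*} [AddCommGroup X] [Module ℂ X] [FiniteDimensional ℂ X]
  {Y : Type*} [AddCommGroup Y] [Module ℂ Y] [FiniteDimensional ℂ Y]
  {Z : Type*} [AddCommGroup Z] [Module ℂ Z] [FiniteDimensional ℂ Z]

/-- Smoothness near `y` of all components of a map to a complex vector space. -/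
def VSmoothAt (f : F → X) (y : F) : Prop :=
  ∀ l : Module.Dual ℂ X, ContDiffAt ℝ ∞ (fun z => l (f z)) y

/-- The derivative of a map to a finite-dimensional complex vector space. -/
def vderiv (f : F → X) (y v : F) : X :=
  ∑ i, fderiv ℝ (fun z => (Module.finBasis ℂ X).coord i (f z)) y v • Module.finBasis ℂ X i

theorem eq_of_forall_dual {a b : X} (h : ∀ l : Module.Dual ℂ X, l a = l b) : a = b :=
  sub_eq_zero.1 ((Module.forall_dual_apply_eq_zero_iff ℂ (a - b)).1 fun l => by
    rw [map_sub, h, sub_self])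

theorem VSmoothAt.differentiableAt {f : F → X} {y : F} (hf : VSmoothAt f y)
    (l : Module.Dual ℂ X) : DifferentiableAt ℝ (fun z => l (f z)) y :=
  (hf l).differentiableAt (by simp)

/-- Every linear functional commutes with the derivative, so `vderiv` does not depend on the basis
in its definition, and identities between derivatives can be tested on functionals. -/
theorem VSmoothAt.dual_vderiv {f : F → X} {y : F} (hf : VSmoothAt f y) (l : Module.Dual ℂ X)
    (v : F) : l (vderiv f y v) = fderiv ℝ (fun z => l (f z)) y v := by
  have h1 : (fun z => l (f z)) = fun z => ∑ i, (Module.finBasis ℂ X).coord i (f z)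
      * l (Module.finBasis ℂ X i) := by
    funext z
    conv_lhs => rw [← (Module.finBasis ℂ X).sum_repr (f z)]
    simp only [map_sum, map_smul, smul_eq_mul, Module.Basis.coord_apply]
  have h2 : HasFDerivAt (fun z => l (f z))
      (∑ i, l (Module.finBasis ℂ X i) •
        fderiv ℝ (fun z => (Module.finBasis ℂ X).coord i (f z)) y) y := by
    rw [h1]
    exact HasFDerivAt.fun_sum fun i _ => ((hf.differentiableAt _).hasFDerivAt).mul_const _
  rw [h2.fderiv, vderiv, map_sum]
  simp [mul_comm]

theorem vderiv_eq_of_hasFDerivAt {f : F → X} {y : F} (hf : VSmoothAt f y) {v : F} {w : X}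
    (h : ∀ l : Module.Dual ℂ X, ∃ L : F →L[ℝ] ℂ, HasFDerivAt (fun z => l (f z)) L y ∧ L v = l w) :
    vderiv f y v = w := eq_of_forall_dual fun l => by
  obtain ⟨L, h1, h2⟩ := h l
  rw [hf.dual_vderiv, h1.fderiv, h2]

theorem isRealLinear_vderiv (f : F → X) (y : F) : IsRealLinear (vderiv f y) where
  map_add v w := by simp [vderiv, add_smul, Finset.sum_add_distrib]
  map_smul c v := by simp [vderiv, mul_smul, Finset.smul_sum]

theorem VSmoothAt.congr {f g : F → X} {y : F} (hf : VSmoothAt f y) (h : f =ᶠ[𝓝 y] g) :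
    VSmoothAt g y := fun l => (hf l).congr_of_eventuallyEq (h.symm.mono fun _ hz => congrArg l hz)

theorem Filter.EventuallyEq.vderiv_eq {f g : F → X} {y : F} (h : f =ᶠ[𝓝 y] g) (v : F) :
    vderiv f y v = vderiv g y v := by
  refine Finset.sum_congr rfl fun i _ => ?_
  rw [Filter.EventuallyEq.fderiv_eq (h.mono fun z hz => by rw [hz])]

theorem vsmoothAt_const (c : X) (y : F) : VSmoothAt (fun _ => c) y := fun _ => contDiffAt_const

theorem vderiv_const (c : X) (y v : F) : vderiv (fun _ => c) y v = 0 := by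
  simp [vderiv]

theorem VSmoothAt.add {f g : F → X} {y : F} (hf : VSmoothAt f y) (hg : VSmoothAt g y) :
    VSmoothAt (fun z => f z + g z) y := fun l => by
  simpa only [map_add] using (hf l).add (hg l)

theorem VSmoothAt.vderiv_add {f g : F → X} {y : F} (hf : VSmoothAt f y) (hg : VSmoothAt g y)
    (v : F) : vderiv (fun z => f z + g z) y v = vderiv f y v + vderiv g y v := by
  refine vderiv_eq_of_hasFDerivAt (hf.add hg) fun l =>
    ⟨_, ?_, show (fderiv ℝ (fun z => l (f z)) y + fderiv ℝ (fun z => l (g z)) y) v = _ from ?_⟩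
  · simpa only [map_add] using
      (hf.differentiableAt l).hasFDerivAt.fun_add (hg.differentiableAt l).hasFDerivAt
  · rw [map_add, hf.dual_vderiv, hg.dual_vderiv]; rfl

theorem VSmoothAt.linear {f : F → X} {y : F} (hf : VSmoothAt f y) (L : X →ₗ[ℂ] Y) :
    VSmoothAt (fun z => L (f z)) y := fun l => hf (l ∘ₗ L)

theorem VSmoothAt.vderiv_linear {f : F → X} {y : F} (hf : VSmoothAt f y) (L : X →ₗ[ℂ] Y) (v : F) :
    vderiv (fun z => L (f z)) y v = L (vderiv f y v) :=
  eq_of_forall_dual fun l => by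
    rw [(hf.linear L).dual_vderiv]
    exact (hf.dual_vderiv (l ∘ₗ L) v).symm

theorem bilin_eq_sum (B : X →ₗ[ℂ] Y →ₗ[ℂ] Z) (l : Module.Dual ℂ Z) (x : X) (y : Y) :
    l (B x y) = ∑ i, (Module.finBasis ℂ X).coord i x * (l ∘ₗ B (Module.finBasis ℂ X i)) y := by
  conv_lhs => rw [← (Module.finBasis ℂ X).sum_repr x]
  simp only [map_sum, map_smul, smul_eq_mul, Module.Basis.coord_apply, LinearMap.sum_apply,
    LinearMap.smul_apply, LinearMap.comp_apply]

theorem VSmoothAt.bilin {f : F → X} {g : F → Y} {y : F} (hf : VSmoothAt f y) (hg : VSmoothAt g y)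
    (B : X →ₗ[ℂ] Y →ₗ[ℂ] Z) : VSmoothAt (fun z => B (f z) (g z)) y := fun l => by
  simp only [bilin_eq_sum B l]
  exact ContDiffAt.sum fun i _ => (hf _).mul (hg _)

theorem VSmoothAt.vderiv_bilin {f : F → X} {g : F → Y} {y : F} (hf : VSmoothAt f y)
    (hg : VSmoothAt g y) (B : X →ₗ[ℂ] Y →ₗ[ℂ] Z) (v : F) :
    vderiv (fun z => B (f z) (g z)) y v = B (vderiv f y v) (g y) + B (f y) (vderiv g y v) := by
  refine vderiv_eq_of_hasFDerivAt (hf.bilin hg B) fun l =>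
    ⟨∑ i, ((Module.finBasis ℂ X).coord i (f y) •
        fderiv ℝ (fun z => (l ∘ₗ B (Module.finBasis ℂ X i)) (g z)) y
      + (l ∘ₗ B (Module.finBasis ℂ X i)) (g y) •
        fderiv ℝ (fun z => (Module.finBasis ℂ X).coord i (f z)) y), ?_, ?_⟩
  · simp only [bilin_eq_sum B l]
    exact HasFDerivAt.fun_sum fun i _ => (hf.differentiableAt _).hasFDerivAt.mul
      (hg.differentiableAt _).hasFDerivAt
  · rw [map_add, bilin_eq_sum B l, bilin_eq_sum B l, ← Finset.sum_add_distrib]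
    simp only [FunLike.coe_sum, Finset.sum_apply]
    refine Finset.sum_congr rfl fun i _ => ?_
    rw [hf.dual_vderiv, hg.dual_vderiv]
    simp
    ring

theorem VSmoothAt.comp {G : Type*} [NormedAddCommGroup G] [NormedSpace ℝ G] {f : F → X} {p : G → F}
    {y : G} (hf : VSmoothAt f (p y)) (hp : ContDiffAt ℝ ∞ p y) : VSmoothAt (fun z => f (p z)) y :=
  fun l => (hf l).comp y hp

theorem VSmoothAt.vderiv_comp {G : Type*} [NormedAddCommGroup G] [NormedSpace ℝ G] {f : F → X}
    {p : G → F} {y : G} (hf : VSmoothAt f (p y)) (hp : ContDiffAt ℝ ∞ p y) (v : G) :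
    vderiv (fun z => f (p z)) y v = vderiv f (p y) (fderiv ℝ p y v) := by
  refine vderiv_eq_of_hasFDerivAt (hf.comp hp) fun l => ⟨_,
    (hf.differentiableAt l).hasFDerivAt.comp y (hp.differentiableAt (by simp)).hasFDerivAt, ?_⟩
  rw [hf.dual_vderiv]; rfl

theorem vsmoothAt_of_isRealLinear {G : Type*} [NormedAddCommGroup G] [NormedSpace ℝ G]
    [FiniteDimensional ℝ G] {T : G → X} (hT : IsRealLinear T) {u : F → G} {y : F}
    (hu : ContDiffAt ℝ ∞ u y) : VSmoothAt (fun z => T (u z)) y := fun l => by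
  let L : G →ₗ[ℝ] ℂ :=
    { toFun := fun w => l (T w)
      map_add' := fun v w => by rw [hT.map_add, map_add]
      map_smul' := fun c v => by rw [hT.map_smul, map_smul]; rfl }
  exact (LinearMap.toContinuousLinearMap L).contDiff.contDiffAt.comp y hu

theorem vderiv_of_isRealLinear {G : Type*} [NormedAddCommGroup G] [NormedSpace ℝ G]
    [FiniteDimensional ℝ G] {T : G → X} (hT : IsRealLinear T) {u : F → G} {y : F}
    (hu : ContDiffAt ℝ ∞ u y) (v : F) :
    vderiv (fun z => T (u z)) y v = T (fderiv ℝ u y v) := by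
  refine vderiv_eq_of_hasFDerivAt (vsmoothAt_of_isRealLinear hT hu) fun l => ?_
  let L : G →ₗ[ℝ] ℂ :=
    { toFun := fun w => l (T w)
      map_add' := fun v w => by rw [hT.map_add, map_add]
      map_smul' := fun c v => by rw [hT.map_smul, map_smul]; rfl }
  exact ⟨_, (LinearMap.toContinuousLinearMap L).hasFDerivAt.comp y
    (hu.differentiableAt (by simp)).hasFDerivAt, rfl⟩

end Calculus

/-! ### Closed forms in a chart -/

section ClosedForms

variable {F : Type*} [NormedAddCommGroup F] [NormedSpace ℝ F] [FiniteDimensional ℝ F]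

/-- Multiplication of forms. -/
def wedgeMul (F : Type*) [NormedAddCommGroup F] [NormedSpace ℝ F] [FiniteDimensional ℝ F] :
    CForm F →ₗ[ℂ] CForm F →ₗ[ℂ] CForm F := LinearMap.mul ℂ (CForm F)

theorem wedgeMul_apply (Φ Ψ : CForm F) : wedgeMul F Φ Ψ = Φ * Ψ := rfl

theorem VSmoothAt.mul {f g : F → CForm F} {y : F} (hf : VSmoothAt f y) (hg : VSmoothAt g y) :
    VSmoothAt (fun z => f z * g z) y := hf.bilin hg (wedgeMul F)

theorem VSmoothAt.vderiv_mul {f g : F → CForm F} {y : F} (hf : VSmoothAt f y)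
    (hg : VSmoothAt g y) (v : F) :
    vderiv (fun z => f z * g z) y v = vderiv f y v * g y + f y * vderiv g y v :=
  hf.vderiv_bilin hg (wedgeMul F) v

/-- The exterior derivative `∑ᵢ eⁱ ∧ ∂ᵢ f`. -/
def extD (f : F → CForm F) (y : F) : CForm F := wedgeD (vderiv f y)

/-- No sign appears in the Leibniz rule because the value of the first factor is even and commutes
with the dual basis. -/
theorem extD_mul {f g : F → CForm F} {y : F} (hf : VSmoothAt f y) (hg : VSmoothAt g y)
    (hfe : f y ∈ evenForms (F →L[ℝ] ℂ)) :
    extD (fun z => f z * g z) y = extD f y * g y + f y * extD g y := by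
  simp only [extD, wedgeD, hf.vderiv_mul hg, mul_add, Finset.sum_add_distrib, Finset.sum_mul,
    Finset.mul_sum, ← mul_assoc]
  simp only [evenForms_comm hfe (oneForm _)]

theorem extD_add {f g : F → CForm F} {y : F} (hf : VSmoothAt f y) (hg : VSmoothAt g y) :
    extD (fun z => f z + g z) y = extD f y + extD g y := by
  simp only [extD, wedgeD, hf.vderiv_add hg, mul_add, Finset.sum_add_distrib]

/-- An even form whose differential is killed by `θ`. -/
structure IsBasic (θ : CForm F) (f : F → CForm F) (y : F) : Prop where
  smooth : VSmoothAt f y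
  even : f y ∈ evenForms (F →L[ℝ] ℂ)
  extD_mul_eq_zero : extD f y * θ = 0

namespace IsBasic

variable {θ : CForm F} {f g : F → CForm F} {y : F}

theorem add (hf : IsBasic θ f y) (hg : IsBasic θ g y) : IsBasic θ (fun z => f z + g z) y where
  smooth := hf.smooth.add hg.smooth
  even := Subalgebra.add_mem _ hf.even hg.even
  extD_mul_eq_zero := by
    rw [extD_add hf.smooth hg.smooth, add_mul, hf.extD_mul_eq_zero, hg.extD_mul_eq_zero, add_zero]

/-- By the Leibniz rule and commutativity of even forms, basic forms are stable under products. With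
sums and scalar functions this covers every polynomial expression, in particular `polySpinor`. -/
theorem mul (hf : IsBasic θ f y) (hg : IsBasic θ g y) : IsBasic θ (fun z => f z * g z) y where
  smooth := hf.smooth.mul hg.smooth
  even := Subalgebra.mul_mem _ hf.even hg.even
  extD_mul_eq_zero := by
    rw [extD_mul hf.smooth hg.smooth hf.even, add_mul, mul_assoc, evenForms_comm hg.even,
      ← mul_assoc, hf.extD_mul_eq_zero, zero_mul, mul_assoc, hg.extD_mul_eq_zero, mul_zero,
      add_zero]

theorem const {c : CForm F} (hc : c ∈ evenForms (F →L[ℝ] ℂ)) : IsBasic θ (fun _ => c) y where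
  smooth := vsmoothAt_const c y
  even := hc
  extD_mul_eq_zero := by simp [extD, wedgeD, vderiv_const]

theorem pow (hf : IsBasic θ f y) (k : ℕ) : IsBasic θ (fun z => f z ^ k) y := by
  induction k with
  | zero => simpa only [pow_zero] using const (Subalgebra.one_mem _)
  | succ k ih => simpa only [pow_succ] using ih.mul hf

theorem sum {ι : Type*} (s : Finset ι) {f : ι → F → CForm F} (hf : ∀ i ∈ s, IsBasic θ (f i) y) :
    IsBasic θ (fun z => ∑ i ∈ s, f i z) y := by
  classical
  induction s using Finset.induction_on with
  | empty => simpa only [Finset.sum_empty] using const (Subalgebra.zero_mem _)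
  | insert a s ha ih =>
    simp only [Finset.sum_insert ha]
    exact (hf a (Finset.mem_insert_self a s)).add
      (ih fun i hi => hf i (Finset.mem_insert_of_mem hi))

theorem scalar {s : F → ℂ} (hs : ContDiffAt ℝ ∞ s y) (hθ : oneForm (fderiv ℝ s y) * θ = 0) :
    IsBasic θ (fun z => algebraMap ℂ (CForm F) (s z)) y := by
  have h0 : VSmoothAt s y := fun l => by
    have : (fun z => l (s z)) = fun z => s z * l 1 := by
      funext z
      rw [← smul_eq_mul, ← map_smul, smul_eq_mul, mul_one]
    rw [this]
    exact hs.mul contDiffAt_const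
  have h1 : ∀ v, vderiv (fun z => algebraMap ℂ (CForm F) (s z)) y v
      = algebraMap ℂ (CForm F) (fderiv ℝ s y v) := fun v => by
    rw [show (fun z => algebraMap ℂ (CForm F) (s z))
      = fun z => Algebra.linearMap ℂ (CForm F) (s z) from rfl, h0.vderiv_linear]
    exact congrArg _ (h0.dual_vderiv LinearMap.id v)
  refine ⟨h0.linear (Algebra.linearMap ℂ (CForm F)), Subalgebra.algebraMap_mem _ _, ?_⟩
  rw [← hθ]
  congr 1
  conv_rhs => rw [← sum_dualVec_smul (fderiv ℝ s y)]
  simp only [extD, wedgeD, h1]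
  simp only [Algebra.algebraMap_eq_smul_one, mul_smul_comm, mul_one]
  simp only [oneForm, map_sum, map_smul]

theorem smul {s : F → ℂ} (hs : ContDiffAt ℝ ∞ s y) (hθ : oneForm (fderiv ℝ s y) * θ = 0)
    (hf : IsBasic θ f y) : IsBasic θ (fun z => s z • f z) y := by
  have := (scalar hs hθ).mul hf
  simpa only [Algebra.algebraMap_eq_smul_one, smul_mul_assoc, one_mul] using this

end IsBasic

/-- The map `φ ↦ φ` from covectors to one-forms is linear over the reals. -/
theorem isRealLinear_oneForm : IsRealLinear (oneForm : (F →L[ℝ] ℂ) → CForm F) where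
  map_add := oneForm_add
  map_smul c φ := by
    rw [← oneForm_smul]
    rfl

theorem vsmoothAt_oneForm {s : F → ℂ} {y : F} (hs : ContDiffAt ℝ ∞ s y) :
    VSmoothAt (fun z => oneForm (fderiv ℝ s z)) y :=
  vsmoothAt_of_isRealLinear isRealLinear_oneForm (hs.fderiv_right (by simp))

/-- This is `d² = 0` on functions: the second derivative is symmetric. -/
theorem extD_oneForm_fderiv {s : F → ℂ} {y : F} (hs : ContDiffAt ℝ ∞ s y) :
    extD (fun z => oneForm (fderiv ℝ s z)) y = 0 := by
  rw [extD, show vderiv (fun z => oneForm (fderiv ℝ s z)) y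
    = formMap (fderiv ℝ (fderiv ℝ s) y : F →ₗ[ℝ] F →L[ℝ] ℂ) from
    funext fun v => vderiv_of_isRealLinear isRealLinear_oneForm (hs.fderiv_right (by simp)) v]
  exact wedgeD_symm fun v w => (hs.isSymmSndFDerivAt (by
    rw [minSmoothness_of_isRCLikeNormedField]; exact WithTop.coe_le_coe.2 le_top)).eq v w

theorem VSmoothAt.mul_oneForm_mul_oneForm {f : F → CForm F} {y : F} (hf : VSmoothAt f y)
    {s t : F → ℂ} (hs : ContDiffAt ℝ ∞ s y) (ht : ContDiffAt ℝ ∞ t y) :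
    VSmoothAt (fun z => f z * oneForm (fderiv ℝ s z) * oneForm (fderiv ℝ t z)) y :=
  (hf.mul (vsmoothAt_oneForm hs)).mul (vsmoothAt_oneForm ht)

theorem extD_oneForm_mul {f g : F → CForm F} {y : F} (hf : VSmoothAt f y) (hg : VSmoothAt g y)
    {φ : F →L[ℝ] ℂ} (hφ : f y = oneForm φ) :
    extD (fun z => f z * g z) y = extD f y * g y - f y * extD g y := by
  have h1 : ∀ i, oneForm (dualVec F i) * f y = -(f y * oneForm (dualVec F i)) := fun i => by
    rw [hφ]; exact ι_mul_ι_comm _ _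
  simp only [extD, wedgeD, hf.vderiv_mul hg, mul_add, Finset.sum_add_distrib, Finset.sum_mul,
    Finset.mul_sum, ← mul_assoc, h1, neg_mul, Finset.sum_neg_distrib, sub_eq_add_neg]

/-- As `ds` and `dt` are closed, `d(f ∧ ds ∧ dt) = df ∧ ds ∧ dt`, which vanishes by the choice of
`θ`. -/
theorem IsBasic.extD_eq_zero {f : F → CForm F} {y : F} {s t : F → ℂ} (hs : ContDiffAt ℝ ∞ s y)
    (ht : ContDiffAt ℝ ∞ t y)
    (hf : IsBasic (oneForm (fderiv ℝ s y) * oneForm (fderiv ℝ t y)) f y) :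
    extD (fun z => f z * oneForm (fderiv ℝ s z) * oneForm (fderiv ℝ t z)) y = 0 := by
  simp only [mul_assoc]
  rw [extD_mul hf.smooth ((vsmoothAt_oneForm hs).mul (vsmoothAt_oneForm ht)) hf.even,
    hf.extD_mul_eq_zero, extD_oneForm_mul (vsmoothAt_oneForm hs) (vsmoothAt_oneForm ht) rfl,
    extD_oneForm_fderiv hs, extD_oneForm_fderiv ht]
  simp

theorem oneForm_mul_self (φ : F →L[ℝ] ℂ) : oneForm φ * oneForm φ = 0 :=
  ExteriorAlgebra.ι_sq_zero φ

theorem oneForm_mul_left (φ ψ : F →L[ℝ] ℂ) : oneForm φ * (oneForm φ * oneForm ψ) = 0 := by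
  rw [← mul_assoc, oneForm_mul_self, zero_mul]

theorem oneForm_mul_right (φ ψ : F →L[ℝ] ℂ) : oneForm ψ * (oneForm φ * oneForm ψ) = 0 := by
  rw [← mul_assoc, show oneForm ψ * oneForm φ = -(oneForm φ * oneForm ψ) from ι_mul_ι_comm _ _,
    neg_mul, mul_assoc, oneForm_mul_self, mul_zero, neg_zero]

end ClosedForms
end

noncomputable section

/-! ### The Courant bracket in a chart -/

section ChartBracket

variable {F : Type*} [NormedAddCommGroup F] [NormedSpace ℝ F] [FiniteDimensional ℝ F]

variable (F) in
/-- The complexification of `F ⊕ F*`. -/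
abbrev CGen : Type _ := Module.Dual ℂ (F →L[ℝ] ℂ) × (F →L[ℝ] ℂ)

/-- The Clifford action of the complexification of `F ⊕ F*` on forms. -/
def cAct : CGen F →ₗ[ℂ] CForm F →ₗ[ℂ] CForm F :=
  contr.coprod ((LinearMap.mul ℂ (CForm F)).comp (ExteriorAlgebra.ι ℂ))

theorem cAct_apply (a : CGen F) (Φ : CForm F) :
    cAct a Φ = contr a.1 Φ + ExteriorAlgebra.ι ℂ a.2 * Φ := rfl

/-- The pairing `ξ(Y) + η(X)` on the complexification of `F ⊕ F*`. -/
def cPair (a b : CGen F) : ℂ := a.1 b.2 + b.1 a.2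

theorem cAct_cAct (a b : CGen F) (Φ : CForm F) :
    cAct a (cAct b Φ) = cPair a b • Φ - cAct b (cAct a Φ) := by
  rw [cAct_apply, cAct_apply, cAct_apply, cAct_apply, map_add, map_add, mul_add, mul_add,
    contr_ι_mul, contr_ι_mul, contr_comm b.1, ← mul_assoc, ← mul_assoc,
    ι_mul_ι_comm b.2, cPair, neg_mul, add_smul]
  abel

variable (F) in
/-- The `i`-th dual basis vector in the complexification of `F ⊕ F*`. -/
def cDual (i : Fin (Module.finrank ℝ F)) : CGen F := (0, dualVec F i)

theorem cAct_cDual (i : Fin (Module.finrank ℝ F)) (Φ : CForm F) :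
    cAct (cDual F i) Φ = oneForm (dualVec F i) * Φ := by
  rw [cAct_apply, cDual, map_zero, LinearMap.zero_apply, zero_add]
  rfl

/-- The Courant bracket of sections with values `a`, `b` and partial derivatives `a' i`, `b' i`. -/
def cBracket (a b : CGen F) (a' b' : Fin (Module.finrank ℝ F) → CGen F) : CGen F :=
  ∑ i, (cPair a (cDual F i) • b' i - cPair b (cDual F i) • a' i + cPair (a' i) b • cDual F i)

/-- The Courant bracket of two sections that annihilate a closed form annihilates it. -/
theorem cAct_cBracket {a b : CGen F} {a' b' : Fin (Module.finrank ℝ F) → CGen F} {Φ : CForm F}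
    {Φ' : Fin (Module.finrank ℝ F) → CForm F} (hb : cAct b Φ = 0)
    (ha' : ∀ i, cAct (a' i) Φ + cAct a (Φ' i) = 0) (hb' : ∀ i, cAct (b' i) Φ + cAct b (Φ' i) = 0)
    (hΦ : ∑ i, oneForm (dualVec F i) * Φ' i = 0) : cAct (cBracket a b a' b') Φ = 0 := by
  -- The derived bracket formula, one direction at a time: each summand of the bracket acts on `Φ`
  -- as `-b·a·(eⁱ ∧ ∂ᵢΦ)`, and summing over `i` produces `dΦ`.
  have key : ∀ i, cAct (cPair a (cDual F i) • b' i - cPair b (cDual F i) • a' i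
      + cPair (a' i) b • cDual F i) Φ = -cAct b (cAct a (oneForm (dualVec F i) * Φ' i)) := by
    intro i
    rw [map_add, map_sub, LinearMap.add_apply, LinearMap.sub_apply, map_smul, map_smul, map_smul,
      LinearMap.smul_apply, LinearMap.smul_apply, LinearMap.smul_apply,
      eq_neg_of_add_eq_zero_left (ha' i), eq_neg_of_add_eq_zero_left (hb' i)]
    -- From `b·Φ = 0` and the Clifford relation, `⟨a', b⟩ Φ = b·a'·Φ = -b·a·Φ'`, using the
    -- differentiated equation `a'·Φ = -a·Φ'`.
    have h1 : cPair (a' i) b • cAct (cDual F i) Φ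
        = -cAct (cDual F i) (cAct b (cAct a (Φ' i))) := by
      have h2 := cAct_cAct (a' i) b Φ
      rw [hb, map_zero, eq_neg_of_add_eq_zero_left (ha' i), eq_comm, sub_eq_zero, map_neg] at h2
      rw [← map_smul, h2, map_neg]
    have h3 := cAct_cAct a (cDual F i) (Φ' i)
    have h4 := cAct_cAct b (cDual F i) (Φ' i)
    have h5 := cAct_cAct b (cDual F i) (cAct a (Φ' i))
    rw [h1, ← cAct_cDual, h3, map_sub, map_smul, h5]
    module
  rw [cBracket, map_sum, LinearMap.sum_apply, Finset.sum_congr rfl fun i _ => key i,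
    Finset.sum_neg_distrib, ← map_sum, ← map_sum, hΦ, map_zero, map_zero, neg_zero]

/-- The complexification of a real element of `F ⊕ F*`. -/
def cReal (u : F × (F →L[ℝ] ℝ)) : CGen F := (complexEval u.1 0, complexCovector u.2 0)

theorem isRealLinear_cReal : IsRealLinear (cReal : F × (F →L[ℝ] ℝ) → CGen F) where
  map_add u v := by
    refine Prod.ext ?_ ?_
    · ext φ; simp [cReal, complexEval]
    · ext x; simp [cReal, complexCovector]
  map_smul c u := by
    refine Prod.ext ?_ ?_
    · ext φ; simp [cReal, complexEval]
    · ext x; simp [cReal, complexCovector]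

theorem cReal_add_smul (u v : F × (F →L[ℝ] ℝ)) :
    cReal u + Complex.I • cReal v = (complexEval u.1 v.1, complexCovector u.2 v.2) := by
  refine Prod.ext ?_ ?_
  · exact (complexEval_eq _ _).symm
  · exact (complexCovector_eq _ _).symm

theorem cAct_cReal (u v : F × (F →L[ℝ] ℝ)) (Φ : CForm F) :
    cAct (cReal u + Complex.I • cReal v) Φ = cliffordAct u v Φ := by
  rw [cReal_add_smul]; rfl

theorem cPair_cReal (u v : F × (F →L[ℝ] ℝ)) :
    cPair (cReal u) (cReal v) = ((u.2 v.1 + v.2 u.1 : ℝ) : ℂ) := by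
  simp [cPair, cReal, complexEval, complexCovector]
  ring

/-- The Courant bracket of sections with values `u`, `v` and derivatives `u'`, `v'`. -/
def vecBracket (u v : F × (F →L[ℝ] ℝ)) (u' v' : F →L[ℝ] F × (F →L[ℝ] ℝ)) : F × (F →L[ℝ] ℝ) :=
  v' u.1 - u' v.1 + (0, ((ContinuousLinearMap.apply ℝ ℝ v.1).comp
    (.comp (.snd ℝ F (F →L[ℝ] ℝ)) u')) + v.2.comp (.comp (.fst ℝ F (F →L[ℝ] ℝ)) u'))

theorem cReal_vecBracket (u v : F × (F →L[ℝ] ℝ)) (u' v' : F →L[ℝ] F × (F →L[ℝ] ℝ)) :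
    cReal (vecBracket u v u' v') = cBracket (cReal u) (cReal v)
      (fun i => cReal (u' (Module.finBasis ℝ F i))) fun i => cReal (v' (Module.finBasis ℝ F i)) := by
  have hlin : ∀ w : F →L[ℝ] F × (F →L[ℝ] ℝ), IsRealLinear fun x => cReal (w x) := fun w =>
    ⟨fun x y => by rw [map_add, isRealLinear_cReal.map_add],
      fun c x => by rw [map_smul, isRealLinear_cReal.map_smul]⟩
  have hp : ∀ (w : F × (F →L[ℝ] ℝ)) i, cPair (cReal w) (cDual F i) = dualVec F i w.1 := by
    intro w i
    simp [cPair, cReal, cDual, complexEval]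
  have hsub : ∀ x y : F × (F →L[ℝ] ℝ), cReal (x - y) = cReal x - cReal y := by
    intro x y
    rw [sub_eq_add_neg, ← neg_one_smul ℝ y, isRealLinear_cReal.map_add, isRealLinear_cReal.map_smul]
    push_cast
    module
  rw [vecBracket, isRealLinear_cReal.map_add, hsub, cBracket]
  simp only [hp, Finset.sum_add_distrib, Finset.sum_sub_distrib, (hlin _).sum_dualVec]
  congr 1
  simp only [cPair_cReal]
  refine Prod.ext ?_ ?_
  · rw [Prod.fst_sum]
    simp only [cReal, cDual, Prod.smul_fst, smul_zero, Finset.sum_const_zero]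
    ext φ
    simp [complexEval]
  · rw [Prod.snd_sum]
    simp only [cDual, Prod.smul_snd]
    rw [← sum_dualVec_smul (cReal _).2]
    refine Finset.sum_congr rfl fun i _ => ?_
    congr 1
    simp [cReal, complexCovector]

theorem bracket_identity {X : Type*} [AddCommGroup X] [Module ℂ X]
    (p₁ p₂ q₁ q₂ r₁₁ r₂₁ r₁₂ r₂₂ : ℂ) (a₁ a₂ b₁ b₂ e : X) :
    (p₁ + Complex.I * p₂) • (b₁ + Complex.I • b₂) - (q₁ + Complex.I * q₂) • (a₁ + Complex.I • a₂)
        + ((r₁₁ + Complex.I * r₂₁) + Complex.I * (r₁₂ + Complex.I * r₂₂)) • e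
      = ((p₁ • b₁ - q₁ • a₁ + r₁₁ • e) - (p₂ • b₂ - q₂ • a₂ + r₂₂ • e))
        + Complex.I • ((p₁ • b₂ - q₂ • a₁ + r₁₂ • e) + (p₂ • b₁ - q₁ • a₂ + r₂₁ • e)) := by
  have h : Complex.I * Complex.I = -1 := Complex.I_mul_I
  rw [show (r₁₁ + Complex.I * r₂₁) + Complex.I * (r₁₂ + Complex.I * r₂₂)
    = r₁₁ - r₂₂ + Complex.I * (r₁₂ + r₂₁) by linear_combination r₂₂ * h]
  rw [smul_add (p₁ + _), smul_add (q₁ + _), smul_smul, smul_smul,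
    show (p₁ + Complex.I * p₂) * Complex.I = Complex.I * p₁ - p₂ by linear_combination p₂ * h,
    show (q₁ + Complex.I * q₂) * Complex.I = Complex.I * q₁ - q₂ by linear_combination q₂ * h]
  module

theorem bracket_sum_identity {κ X : Type*} [Fintype κ] [AddCommGroup X] [Module ℂ X]
    (p₁ p₂ q₁ q₂ r₁₁ r₂₁ r₁₂ r₂₂ : κ → ℂ) (a₁ a₂ b₁ b₂ e : κ → X) :
    ∑ i, ((p₁ i + Complex.I * p₂ i) • (b₁ i + Complex.I • b₂ i)
        - (q₁ i + Complex.I * q₂ i) • (a₁ i + Complex.I • a₂ i)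
        + ((r₁₁ i + Complex.I * r₂₁ i) + Complex.I * (r₁₂ i + Complex.I * r₂₂ i)) • e i)
      = (∑ i, (p₁ i • b₁ i - q₁ i • a₁ i + r₁₁ i • e i)
          - ∑ i, (p₂ i • b₂ i - q₂ i • a₂ i + r₂₂ i • e i))
        + Complex.I • (∑ i, (p₁ i • b₂ i - q₂ i • a₁ i + r₁₂ i • e i)
          + ∑ i, (p₂ i • b₁ i - q₁ i • a₂ i + r₂₁ i • e i)) := by
  rw [← Finset.sum_sub_distrib, ← Finset.sum_add_distrib, Finset.smul_sum, ← Finset.sum_add_distrib]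
  exact Finset.sum_congr rfl fun i _ => bracket_identity ..

/-- The bracket of complex sections agrees with the complex bilinear extension used to define
involutivity. -/
theorem cBracket_bilin (a₁ a₂ b₁ b₂ : CGen F) (a₁' a₂' b₁' b₂' : Fin (Module.finrank ℝ F) → CGen F) :
    cBracket (a₁ + Complex.I • a₂) (b₁ + Complex.I • b₂) (fun i => a₁' i + Complex.I • a₂' i)
      (fun i => b₁' i + Complex.I • b₂' i)
      = (cBracket a₁ b₁ a₁' b₁' - cBracket a₂ b₂ a₂' b₂')
        + Complex.I • (cBracket a₁ b₂ a₁' b₂' + cBracket a₂ b₁ a₂' b₁') := by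
  have hl : ∀ a a₂ b : CGen F, cPair (a + Complex.I • a₂) b
      = cPair a b + Complex.I * cPair a₂ b := by
    intro a a₂ b; simp [cPair]; ring
  have hlr : ∀ a a₂ b b₂ : CGen F, cPair (a + Complex.I • a₂) (b + Complex.I • b₂)
      = (cPair a b + Complex.I * cPair a₂ b) + Complex.I * (cPair a b₂ + Complex.I * cPair a₂ b₂) := by
    intro a a₂ b b₂; simp [cPair]; ring
  refine (Finset.sum_congr rfl fun i _ => ?_).trans (bracket_sum_identity
    (fun i => cPair a₁ (cDual F i)) (fun i => cPair a₂ (cDual F i)) (fun i => cPair b₁ (cDual F i))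
    (fun i => cPair b₂ (cDual F i)) (fun i => cPair (a₁' i) b₁) (fun i => cPair (a₂' i) b₁)
    (fun i => cPair (a₁' i) b₂) (fun i => cPair (a₂' i) b₂) a₁' a₂' b₁' b₂' (cDual F))
  rw [hl, hl, hlr]

/-- Smooth sections that annihilate a closed form near a point have a Courant bracket that
annihilates it. -/
theorem cliffordAct_vecBracket {Φ : F → CForm F} {y : F} (hΦ : VSmoothAt Φ y)
    (hd : extD Φ y = 0) {a b c d : F → F × (F →L[ℝ] ℝ)} (ha : ContDiffAt ℝ ∞ a y)
    (hb : ContDiffAt ℝ ∞ b y) (hc : ContDiffAt ℝ ∞ c y) (hd' : ContDiffAt ℝ ∞ d y)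
    (hab : ∀ᶠ z in 𝓝 y, cliffordAct (a z) (b z) (Φ z) = 0)
    (hcd : ∀ᶠ z in 𝓝 y, cliffordAct (c z) (d z) (Φ z) = 0) :
    cliffordAct (vecBracket (a y) (c y) (fderiv ℝ a y) (fderiv ℝ c y)
        - vecBracket (b y) (d y) (fderiv ℝ b y) (fderiv ℝ d y))
      (vecBracket (a y) (d y) (fderiv ℝ a y) (fderiv ℝ d y)
        + vecBracket (b y) (c y) (fderiv ℝ b y) (fderiv ℝ c y)) (Φ y) = 0 := by
  have hsub : ∀ x y : F × (F →L[ℝ] ℝ), cReal (x - y) = cReal x - cReal y := by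
    intro x y
    rw [sub_eq_add_neg, ← neg_one_smul ℝ y, isRealLinear_cReal.map_add, isRealLinear_cReal.map_smul]
    push_cast
    module
  -- The annihilation equation holds in a neighbourhood, so it can be differentiated at `y`.
  have hder : ∀ {a b : F → F × (F →L[ℝ] ℝ)}, ContDiffAt ℝ ∞ a y → ContDiffAt ℝ ∞ b y →
      (∀ᶠ z in 𝓝 y, cliffordAct (a z) (b z) (Φ z) = 0) → ∀ v,
      cAct (cReal (fderiv ℝ a y v) + Complex.I • cReal (fderiv ℝ b y v)) (Φ y)
        + cAct (cReal (a y) + Complex.I • cReal (b y)) (vderiv Φ y v) = 0 := by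
    intro a b ha hb hab v
    have sa := vsmoothAt_of_isRealLinear isRealLinear_cReal ha
    have sb := (vsmoothAt_of_isRealLinear isRealLinear_cReal hb).linear
      (Complex.I • (LinearMap.id : CGen F →ₗ[ℂ] CGen F))
    have h1 : (fun z => cAct (cReal (a z)
        + (Complex.I • (LinearMap.id : CGen F →ₗ[ℂ] CGen F)) (cReal (b z))) (Φ z))
        =ᶠ[𝓝 y] fun _ => 0 := hab.mono fun z hz => (cAct_cReal _ _ _).trans hz
    have h2 := h1.vderiv_eq v
    rw [vderiv_const, (sa.add sb).vderiv_bilin hΦ, sa.vderiv_add sb,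
      (vsmoothAt_of_isRealLinear isRealLinear_cReal hb).vderiv_linear,
      vderiv_of_isRealLinear isRealLinear_cReal ha,
      vderiv_of_isRealLinear isRealLinear_cReal hb] at h2
    exact h2
  rw [← cAct_cReal, hsub, isRealLinear_cReal.map_add, cReal_vecBracket, cReal_vecBracket,
    cReal_vecBracket, cReal_vecBracket, ← cBracket_bilin]
  exact cAct_cBracket ((cAct_cReal _ _ _).trans hcd.self_of_nhds) (fun i => hder ha hb hab _)
    (fun i => hder hc hd' hcd _) hd

end ChartBracket
end

noncomputable section

/-! ### Closedness of twistor spinors in a chart -/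

section BasicFunctions

variable {F : Type*} [NormedAddCommGroup F] [NormedSpace ℝ F] [FiniteDimensional ℝ F]

/-- A smooth function whose differential is killed by `θ`. -/
structure IsBasicFun (θ : CForm F) (s : F → ℂ) (y : F) : Prop where
  contDiffAt : ContDiffAt ℝ ∞ s y
  oneForm_mul : oneForm (fderiv ℝ s y) * θ = 0

namespace IsBasicFun

variable {θ : CForm F} {s t : F → ℂ} {y : F}

theorem differentiableAt (hs : IsBasicFun θ s y) : DifferentiableAt ℝ s y :=
  hs.contDiffAt.differentiableAt (by simp)

theorem const (c : ℂ) : IsBasicFun θ (fun _ => c) y :=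
  ⟨contDiffAt_const, by simp [oneForm]⟩

theorem add (hs : IsBasicFun θ s y) (ht : IsBasicFun θ t y) :
    IsBasicFun θ (fun z => s z + t z) y :=
  ⟨hs.contDiffAt.add ht.contDiffAt, by
    rw [fderiv_fun_add hs.differentiableAt ht.differentiableAt, oneForm_add, add_mul,
      hs.oneForm_mul, ht.oneForm_mul, add_zero]⟩

theorem mul (hs : IsBasicFun θ s y) (ht : IsBasicFun θ t y) :
    IsBasicFun θ (fun z => s z * t z) y :=
  ⟨hs.contDiffAt.mul ht.contDiffAt, by
    rw [fderiv_fun_mul hs.differentiableAt ht.differentiableAt, oneForm_add, oneForm_smul,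
      oneForm_smul, add_mul, smul_mul_assoc, smul_mul_assoc, hs.oneForm_mul, ht.oneForm_mul,
      smul_zero, smul_zero, add_zero]⟩

theorem neg (hs : IsBasicFun θ s y) : IsBasicFun θ (fun z => -s z) y := by
  simpa using (const (-1)).mul hs

theorem sub (hs : IsBasicFun θ s y) (ht : IsBasicFun θ t y) :
    IsBasicFun θ (fun z => s z - t z) y := by
  simpa only [sub_eq_add_neg] using hs.add ht.neg

theorem pow (hs : IsBasicFun θ s y) (k : ℕ) : IsBasicFun θ (fun z => s z ^ k) y := by
  induction k with
  | zero => simpa only [pow_zero] using const 1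
  | succ k ih => simpa only [pow_succ] using ih.mul hs

theorem smul {f : F → CForm F} (hs : IsBasicFun θ s y) (hf : IsBasic θ f y) :
    IsBasic θ (fun z => s z • f z) y := hf.smul hs.contDiffAt hs.oneForm_mul

theorem polySpinor {S T : F → CForm F} (n : ℕ) (hs : IsBasicFun θ s y) (ht : IsBasicFun θ t y)
    (hS : IsBasic θ S y) (hT : IsBasic θ T y) :
    IsBasic θ (fun z => polySpinor n (s z) (t z) (S z) (T z)) y := by
  unfold _root_.polySpinor
  exact IsBasic.sum _ fun j _ => IsBasic.sum _ fun k _ =>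
    ((const _).mul ((ht.pow _).mul (hs.pow _))).smul ((hS.pow _).mul (hT.pow _))

end IsBasicFun

end BasicFunctions

/-! ### The exponent two-form and algebra homomorphisms. -/

section SpinForm

variable {N : Type*} [AddCommGroup N] [Module ℂ N]

/-- The two-form in the exponent of the twistor spinor. -/
def spinForm (ωI ωJ ωK : ExteriorAlgebra ℂ N) (a₀ a₁ g₀ g₁ : ℂ) : ExteriorAlgebra ℂ N :=
  (-(a₁ * g₀ - a₀ * g₁)) • ωI + (a₀ * g₀ + a₁ * g₁) • ωJ
    + (Complex.I * (a₀ * g₀ - a₁ * g₁)) • ωK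

theorem map_spinForm {N' : Type*} [AddCommGroup N'] [Module ℂ N']
    (f : ExteriorAlgebra ℂ N →ₐ[ℂ] ExteriorAlgebra ℂ N') (ωI ωJ ωK : ExteriorAlgebra ℂ N)
    (a₀ a₁ g₀ g₁ : ℂ) : f (spinForm ωI ωJ ωK a₀ a₁ g₀ g₁)
      = spinForm (f ωI) (f ωJ) (f ωK) a₀ a₁ g₀ g₁ := by
  simp only [spinForm, map_add, map_smul]

theorem map_expSpinor {N' : Type*} [AddCommGroup N'] [Module ℂ N']
    (f : ExteriorAlgebra ℂ N →ₐ[ℂ] ExteriorAlgebra ℂ N') (n : ℕ) (c : ℂ)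
    (S : ExteriorAlgebra ℂ N) : f (expSpinor n c S) = expSpinor n c (f S) := by
  simp only [expSpinor, map_sum, map_smul, map_pow]

theorem map_polySpinor {N' : Type*} [AddCommGroup N'] [Module ℂ N']
    (f : ExteriorAlgebra ℂ N →ₐ[ℂ] ExteriorAlgebra ℂ N') (n : ℕ) (l δ : ℂ)
    (S T : ExteriorAlgebra ℂ N) : f (polySpinor n l δ S T) = polySpinor n l δ (f S) (f T) := by
  simp only [polySpinor, map_sum, map_smul, map_mul, map_pow]

theorem IsQuaternionHermitian.form_spinQuat {V : Type*} [AddCommGroup V] [Module ℝ V]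
    [TopologicalSpace V] [IsTopologicalAddGroup V] [ContinuousSMul ℝ V] [T2Space V]
    [FiniteDimensional ℝ V] {g : V →L[ℝ] V →L[ℝ] ℝ} {I J K : V →L[ℝ] V}
    (h : IsQuaternionHermitian g I J K) (a₀ a₁ g₀ g₁ : ℂ) :
    h.form (spinQuat a₀ a₁ g₀ g₁) = spinForm (twoForm (fundForm g I)) (twoForm (fundForm g J))
      (twoForm (fundForm g K)) a₀ a₁ g₀ g₁ := by
  have e1 : I = imagEnd I J K 1 0 0 := by simp [imagEnd]
  have e2 : J = imagEnd I J K 0 1 0 := by simp [imagEnd]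
  have e3 : K = imagEnd I J K 0 0 1 := by simp [imagEnd]
  have h1 := h.twoForm_fundForm 1 0 0
  have h2 := h.twoForm_fundForm 0 1 0
  have h3 := h.twoForm_fundForm 0 0 1
  rw [← e1] at h1
  rw [← e2] at h2
  rw [← e3] at h3
  rw [spinForm, h1, h2, h3, ← h.form_smul, ← h.form_smul, ← h.form_smul, ← h.form_add,
    ← h.form_add]
  congr 1
  have hs : ∀ (c : ℂ) (x y z : ℂ), c • imagQuat x y z = imagQuat (c * x) (c * y) (c * z) :=
    fun c x y z => Quaternion.ext_complex (mul_zero c) rfl rfl rfl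
  have ha : ∀ x y z x' y' z' : ℂ, imagQuat x y z + imagQuat x' y' z'
      = imagQuat (x + x') (y + y') (z + z') :=
    fun _ _ _ _ _ _ => Quaternion.ext_complex (add_zero 0) rfl rfl rfl
  rw [hs, hs, hs, ha, ha]
  refine Quaternion.ext_complex ?_ ?_ ?_ ?_ <;> simp [spinQuat, imagQuat]

end SpinForm

/-! ### Smoothness and closedness of local spinors. -/

section ChartSpinor

variable {E : Type*} [NormedAddCommGroup E] [NormedSpace ℝ E] [FiniteDimensional ℝ E]

/-- Pull-back commutes with the exterior derivative, by `sum_oneForm_comp` for the projection, so a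
closed form on `E` stays closed on the product. -/
theorem isBasic_pullForm {θ : CForm (E × ℂ × ℂ)} {f : E → CForm E} {y : E × ℂ × ℂ}
    (hf : VSmoothAt f y.1) (he : f y.1 ∈ evenForms (E →L[ℝ] ℂ)) (hd : extD f y.1 = 0) :
    IsBasic θ (fun z => pullForm (.fst ℝ E (ℂ × ℂ)) (f z.1)) y := by
  have h1 : VSmoothAt (fun z : E × ℂ × ℂ => f z.1) y := hf.comp contDiffAt_fst
  refine ⟨h1.linear (pullForm (.fst ℝ E (ℂ × ℂ))).toLinearMap, pullForm_mem_evenForms _ he, ?_⟩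
  have h2 : vderiv (fun z : E × ℂ × ℂ => pullForm (.fst ℝ E (ℂ × ℂ)) (f z.1)) y
      = fun v => pullForm (.fst ℝ E (ℂ × ℂ)) (vderiv f y.1 (ContinuousLinearMap.fst ℝ E (ℂ × ℂ) v)) := by
    funext v
    have h3 := h1.vderiv_linear (pullForm (.fst ℝ E (ℂ × ℂ))).toLinearMap v
    rw [hf.vderiv_comp contDiffAt_fst, fderiv_fst] at h3
    exact h3
  have hlin : IsRealLinear fun v => pullForm (.fst ℝ E (ℂ × ℂ)) (vderiv f y.1 v) :=
    ⟨fun v w => by rw [(isRealLinear_vderiv f y.1).map_add, map_add],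
      fun c v => by rw [(isRealLinear_vderiv f y.1).map_smul, map_smul]⟩
  rw [extD, h2, ← sum_oneForm_comp (.fst ℝ E (ℂ × ℂ)) hlin]
  have h4 := congrArg (pullForm (.fst ℝ E (ℂ × ℂ))) hd
  simp only [extD, wedgeD, map_sum, map_mul, pullForm_oneForm, map_zero] at h4
  rw [h4, zero_mul]

variable {g : E → E →L[ℝ] E →L[ℝ] ℝ} {I J K : E → E →L[ℝ] E}

/-- The local form of the twistor spinor on `E × ℂ × ℂ`. -/
def chartSpinor (g : E → E →L[ℝ] E →L[ℝ] ℝ) (I J K : E → E →L[ℝ] E) (n : ℕ)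
    (a₀ a₁ g₀ g₁ s t : E × ℂ × ℂ → ℂ) (z : E × ℂ × ℂ) : CForm (E × ℂ × ℂ) :=
  prodSpinor (expSpinor n (Complex.I * (a₁ z * g₀ z + a₀ z * g₁ z))
    (spinForm (twoForm (fundForm (g z.1) (I z.1))) (twoForm (fundForm (g z.1) (J z.1)))
      (twoForm (fundForm (g z.1) (K z.1))) (a₀ z) (a₁ z) (g₀ z) (g₁ z))) (fderiv ℝ s z) (fderiv ℝ t z)

theorem isRealLinear_twoForm :
    IsRealLinear (twoForm : (E →L[ℝ] E →L[ℝ] ℝ) → CForm E) := by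
  have h1 : ∀ φ ψ : E →L[ℝ] ℝ, complexCovector (φ + ψ) 0
      = complexCovector φ 0 + complexCovector ψ 0 := fun φ ψ => by ext; simp [complexCovector]
  have h2 : ∀ (c : ℝ) (φ : E →L[ℝ] ℝ), complexCovector (c • φ) 0
      = (c : ℂ) • complexCovector φ 0 := fun c φ => by ext; simp [complexCovector]
  constructor
  · intro B C
    simp only [twoForm, add_apply, h1, oneForm_add, mul_add, Finset.sum_add_distrib, smul_add]
  · intro c B
    simp only [twoForm, smul_apply, h2, oneForm_smul, mul_smul_comm, ← Finset.smul_sum]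
    exact smul_comm _ _ _

set_option synthInstance.maxHeartbeats 200000 in
theorem vsmoothAt_twoForm {A : E → E →L[ℝ] E} {e : E} (hg : ContDiffAt ℝ ∞ g e)
    (hA : ContDiffAt ℝ ∞ A e) : VSmoothAt (fun z => twoForm (fundForm (g z) (A z))) e :=
  vsmoothAt_of_isRealLinear (G := E →L[ℝ] E →L[ℝ] ℝ) (u := fun z => fundForm (g z) (A z))
    isRealLinear_twoForm (hg.clm_comp hA)

theorem twoForm_mem_evenForms (B : E →L[ℝ] E →L[ℝ] ℝ) : twoForm B ∈ evenForms (E →L[ℝ] ℂ) :=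
  Subalgebra.smul_mem _ (Subalgebra.sum_mem _ fun _ _ => ι_mul_ι_mem_evenForms _ _) _

/-- The data of a hyperkähler structure in a chart near `e`. -/
structure IsChartHyperkahler (g : E → E →L[ℝ] E →L[ℝ] ℝ) (I J K : E → E →L[ℝ] E) (e : E) :
    Prop where
  smooth_g : ContDiffAt ℝ ∞ g e
  smooth_I : ContDiffAt ℝ ∞ I e
  smooth_J : ContDiffAt ℝ ∞ J e
  smooth_K : ContDiffAt ℝ ∞ K e
  hermitian : ∀ᶠ z in 𝓝 e, IsQuaternionHermitian (g z) (I z) (J z) (K z)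
  closed_I : extD (fun z => twoForm (fundForm (g z) (I z))) e = 0
  closed_J : extD (fun z => twoForm (fundForm (g z) (J z))) e = 0
  closed_K : extD (fun z => twoForm (fundForm (g z) (K z))) e = 0

theorem isBasic_spinForm {θ : CForm (E × ℂ × ℂ)} {y : E × ℂ × ℂ}
    (h : IsChartHyperkahler g I J K y.1) {a₀ a₁ g₀ g₁ : E × ℂ × ℂ → ℂ} (ha₀ : IsBasicFun θ a₀ y)
    (ha₁ : IsBasicFun θ a₁ y) (hg₀ : IsBasicFun θ g₀ y) (hg₁ : IsBasicFun θ g₁ y) :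
    IsBasic θ (fun z => pullForm (.fst ℝ E (ℂ × ℂ)) (spinForm (twoForm (fundForm (g z.1) (I z.1)))
      (twoForm (fundForm (g z.1) (J z.1))) (twoForm (fundForm (g z.1) (K z.1)))
      (a₀ z) (a₁ z) (g₀ z) (g₁ z))) y := by
  simp only [map_spinForm]
  have hI := isBasic_pullForm (θ := θ) (vsmoothAt_twoForm h.smooth_g h.smooth_I)
    (twoForm_mem_evenForms _) h.closed_I
  have hJ := isBasic_pullForm (θ := θ) (vsmoothAt_twoForm h.smooth_g h.smooth_J)
    (twoForm_mem_evenForms _) h.closed_J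
  have hK := isBasic_pullForm (θ := θ) (vsmoothAt_twoForm h.smooth_g h.smooth_K)
    (twoForm_mem_evenForms _) h.closed_K
  exact ((((ha₁.mul hg₀).sub (ha₀.mul hg₁)).neg.smul hI).add
    (((ha₀.mul hg₀).add (ha₁.mul hg₁)).smul hJ)).add
    (((IsBasicFun.const _).mul ((ha₀.mul hg₀).sub (ha₁.mul hg₁))).smul hK)

/-- The exponential formula has negative powers of `δ` and is not visibly smooth where `δ = 0`. With
an auxiliary pair `(b₀, b₁)` it equals a polynomial in basic functions and basic forms, for which
smoothness and closedness are clear. -/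
theorem chartSpinor_smooth_closed {n : ℕ} (hn : Module.finrank ℝ E = 4 * n) {y : E × ℂ × ℂ}
    (h : IsChartHyperkahler g I J K y.1) {a₀ a₁ g₀ g₁ b₀ b₁ s t : E × ℂ × ℂ → ℂ}
    (hs : ContDiffAt ℝ ∞ s y) (ht : ContDiffAt ℝ ∞ t y)
    (ha₀ : IsBasicFun (oneForm (fderiv ℝ s y) * oneForm (fderiv ℝ t y)) a₀ y)
    (ha₁ : IsBasicFun (oneForm (fderiv ℝ s y) * oneForm (fderiv ℝ t y)) a₁ y)
    (hg₀ : IsBasicFun (oneForm (fderiv ℝ s y) * oneForm (fderiv ℝ t y)) g₀ y)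
    (hg₁ : IsBasicFun (oneForm (fderiv ℝ s y) * oneForm (fderiv ℝ t y)) g₁ y)
    (hb₀ : IsBasicFun (oneForm (fderiv ℝ s y) * oneForm (fderiv ℝ t y)) b₀ y)
    (hb₁ : IsBasicFun (oneForm (fderiv ℝ s y) * oneForm (fderiv ℝ t y)) b₁ y)
    (hb : ∀ᶠ z in 𝓝 y, a₁ z * b₀ z + a₀ z * b₁ z = 1) :
    VSmoothAt (chartSpinor g I J K n a₀ a₁ g₀ g₁ s t) y ∧
      extD (chartSpinor g I J K n a₀ a₁ g₀ g₁ s t) y = 0 := by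
  let f : E × ℂ × ℂ → CForm (E × ℂ × ℂ) := fun z =>
    polySpinor n (g₀ z * b₁ z - g₁ z * b₀ z) (a₁ z * g₀ z + a₀ z * g₁ z)
      (pullForm (.fst ℝ E (ℂ × ℂ)) (spinForm (twoForm (fundForm (g z.1) (I z.1)))
        (twoForm (fundForm (g z.1) (J z.1))) (twoForm (fundForm (g z.1) (K z.1)))
        (a₀ z) (a₁ z) (a₀ z) (-a₁ z)))
      (pullForm (.fst ℝ E (ℂ × ℂ)) (spinForm (twoForm (fundForm (g z.1) (I z.1)))
        (twoForm (fundForm (g z.1) (J z.1))) (twoForm (fundForm (g z.1) (K z.1)))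
        (a₀ z) (a₁ z) (b₀ z) (b₁ z)))
  have h1 : IsBasic _ f y := IsBasicFun.polySpinor n ((hg₀.mul hb₁).sub (hg₁.mul hb₀))
    ((ha₁.mul hg₀).add (ha₀.mul hg₁)) (isBasic_spinForm h ha₀ ha₁ ha₀ ha₁.neg)
    (isBasic_spinForm h ha₀ ha₁ hb₀ hb₁)
  have hq : ∀ᶠ z : E × ℂ × ℂ in 𝓝 y, IsQuaternionHermitian (g z.1) (I z.1) (J z.1) (K z.1) :=
    continuousAt_fst.eventually h.hermitian
  have h2 : (fun z => f z * oneForm (fderiv ℝ s z) * oneForm (fderiv ℝ t z)) =ᶠ[𝓝 y]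
      chartSpinor g I J K n a₀ a₁ g₀ g₁ s t := by
    filter_upwards [hq, hb] with z hz hbz
    rw [chartSpinor, prodSpinor, ← hz.form_spinQuat]
    rw [show expSpinor n (Complex.I * (a₁ z * g₀ z + a₀ z * g₁ z))
      (hz.form (spinQuat (a₀ z) (a₁ z) (g₀ z) (g₁ z))) = hz.spinor n (a₀ z) (a₁ z) (g₀ z) (g₁ z)
      from rfl, hz.spinor_eq_polySpinor hbz hn, map_polySpinor,
      IsQuaternionHermitian.pureForm, hz.form_spinQuat, hz.form_spinQuat]
  have h3 := h1.smooth.mul_oneForm_mul_oneForm hs ht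
  refine ⟨h3.congr h2, ?_⟩
  have h4 := h1.extD_eq_zero hs ht
  rw [extD] at h4 ⊢
  rw [← h4]
  congr 1
  exact funext fun v => (h2.vderiv_eq v).symm

end ChartSpinor
end

noncomputable section

/-! ### Smoothness of the generalized complex structures in a chart -/

section ChartSmooth

variable {G : Type*} [NormedAddCommGroup G] [NormedSpace ℝ G]
  {E : Type*} [NormedAddCommGroup E] [NormedSpace ℝ E] [FiniteDimensional ℝ E]
  {g : G → E →L[ℝ] E →L[ℝ] ℝ} {y : G}

theorem ContDiffAt.linearMap {E₁ E₂ : Type*} [NormedAddCommGroup E₁] [NormedSpace ℝ E₁]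
    [FiniteDimensional ℝ E₁] [NormedAddCommGroup E₂] [NormedSpace ℝ E₂] {u : G → E₁}
    (hu : ContDiffAt ℝ ∞ u y) (L : E₁ →ₗ[ℝ] E₂) : ContDiffAt ℝ ∞ (fun z => L (u z)) y :=
  (LinearMap.toContinuousLinearMap L).contDiff.contDiffAt.comp y hu

set_option synthInstance.maxHeartbeats 200000 in
theorem contDiffAt_biHermitianJ' {A B : G → E →L[ℝ] E} (hg : ContDiffAt ℝ ∞ g y)
    (hA : ContDiffAt ℝ ∞ A y) (hB : ContDiffAt ℝ ∞ B y) (h : IsBiHermitian (g y) (A y) (B y))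
    {u : G → E × (E →L[ℝ] ℝ)} (hu : ContDiffAt ℝ ∞ u y) :
    ContDiffAt ℝ ∞ (fun z => biHermitianJ' (g z) (A z) (B z) (u z)) y := by
  -- Inversion is smooth at invertible maps, and `ω_A` is invertible at the point in question.
  have hinv : ∀ {A B : G → E →L[ℝ] E}, ContDiffAt ℝ ∞ A y → IsBiHermitian (g y) (A y) (B y) →
      ContDiffAt ℝ ∞ (fun z => (fundForm (g z) (A z)).inverse) y := by
    intro A B hA h
    obtain ⟨e, he⟩ := h.exists_equiv
    have h1 : ContDiffAt ℝ ∞ (ContinuousLinearMap.inverse : (E →L[ℝ] E →L[ℝ] ℝ) → _)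
        (fundForm (g y) (A y)) := he ▸ contDiffAt_map_inverse e
    exact h1.comp y (hg.clm_comp hA)
  have hA' := hinv hA h
  have hB' := hinv hB h.swap
  have h1 : ContDiffAt ℝ ∞ (fun z => (u z).1) y := hu.fst
  have h2 : ContDiffAt ℝ ∞ (fun z => (u z).2) y := hu.snd
  have hAu := hA.clm_apply h1
  have hBu := hB.clm_apply h1
  have h3 : ContDiffAt ℝ ∞ (fun z => (1 / 2 : ℝ) • (-(A z (u z).1 - B z (u z).1)
      + -((fundForm (g z) (A z)).inverse (u z).2 + (fundForm (g z) (B z)).inverse (u z).2))) y :=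
    ContDiffAt.const_smul (1 / 2 : ℝ) ((hAu.sub hBu).neg.add
      ((hA'.clm_apply h2).add (hB'.clm_apply h2)).neg)
  have h4 : ContDiffAt ℝ ∞ (fun z => (1 / 2 : ℝ) • ((g z (A z (u z).1) + g z (B z (u z).1))
      + ((u z).2.comp (A z) - (u z).2.comp (B z)))) y :=
    ContDiffAt.const_smul (1 / 2 : ℝ) (((hg.clm_apply hAu).add (hg.clm_apply hBu)).add
      ((h2.clm_comp hA).sub (h2.clm_comp hB)))
  exact h3.prodMk h4

theorem contDiffAt_extendEnd {A B : G → E →L[ℝ] E} (hg : ContDiffAt ℝ ∞ g y)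
    (hA : ContDiffAt ℝ ∞ A y) (hB : ContDiffAt ℝ ∞ B y) (h : IsBiHermitian (g y) (A y) (B y))
    (κ₁ κ₂ : ℂ) {u : G → (E × ℂ × ℂ) × (E × ℂ × ℂ →L[ℝ] ℝ)} (hu : ContDiffAt ℝ ∞ u y) :
    ContDiffAt ℝ ∞ (fun z => extendEnd (biHermitianJ' (g z) (A z) (B z)) κ₁ κ₂ (u z)) y := by
  have h1 := contDiffAt_biHermitianJ' hg hA hB h (hu.linearMap genFst)
  have h2 := (hu.linearMap genSnd).linearMap
    (prodEnd (genOfComplex (mulC κ₁)) (genOfComplex (mulC κ₂)))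
  exact (h1.prodMk h2).linearMap genPair

theorem contDiffAt_twistorEnd {I J K : G → E →L[ℝ] E} {a₀ a₁ : G → ℂ} (hI : ContDiffAt ℝ ∞ I y)
    (hJ : ContDiffAt ℝ ∞ J y) (hK : ContDiffAt ℝ ∞ K y) (h₀ : ContDiffAt ℝ ∞ a₀ y)
    (h₁ : ContDiffAt ℝ ∞ a₁ y) (ha : a₀ y ≠ 0 ∨ a₁ y ≠ 0) :
    ContDiffAt ℝ ∞ (fun z => twistorEnd (I z) (J z) (K z) (a₀ z) (a₁ z)) y := by
  have n₀ := h₀.norm_sq ℝ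
  have n₁ := h₁.norm_sq ℝ
  have hne := norm_sq_add_ne_zero ha
  have hc : ContDiffAt ℝ ∞ (fun z => a₁ z * starRingEnd ℂ (a₀ z)) y :=
    h₁.mul (Complex.conjCLE.contDiff.contDiffAt.comp y h₀)
  have hre : ContDiffAt ℝ ∞ (fun z => (a₁ z * starRingEnd ℂ (a₀ z)).re) y :=
    Complex.reCLM.contDiff.contDiffAt.comp y hc
  have him : ContDiffAt ℝ ∞ (fun z => (a₁ z * starRingEnd ℂ (a₀ z)).im) y :=
    Complex.imCLM.contDiff.contDiffAt.comp y hc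
  have hX : ContDiffAt ℝ ∞ (fun z => twistorX (a₀ z) (a₁ z)) y :=
    (n₀.sub n₁).div (n₀.add n₁) hne
  have hY : ContDiffAt ℝ ∞ (fun z => twistorY (a₀ z) (a₁ z)) y :=
    (contDiffAt_const.mul hre).div (n₀.add n₁) hne
  have hZ : ContDiffAt ℝ ∞ (fun z => twistorZ (a₀ z) (a₁ z)) y :=
    (contDiffAt_const.mul him).div (n₀.add n₁) hne
  exact ((hX.smul hI).add (hY.smul hJ)).add (hZ.smul hK)

end ChartSmooth

/-- The sum of the squares of the twistor coefficients is one. -/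
theorem twistor_sq_add {a₀ a₁ : ℂ} (ha : a₀ ≠ 0 ∨ a₁ ≠ 0) :
    twistorX a₀ a₁ ^ 2 + twistorY a₀ a₁ ^ 2 + twistorZ a₀ a₁ ^ 2 = 1 := by
  have hne := norm_sq_add_ne_zero ha
  rw [twistorX, twistorY, twistorZ]
  have h1 : (a₁ * starRingEnd ℂ a₀).re ^ 2 + (a₁ * starRingEnd ℂ a₀).im ^ 2
      = ‖a₀‖ ^ 2 * ‖a₁‖ ^ 2 := by
    rw [← Complex.normSq_eq_norm_sq, ← Complex.normSq_eq_norm_sq, Complex.normSq_apply,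
      Complex.normSq_apply]
    simp
    ring
  field_simp
  linear_combination 4 * h1

theorem IsQuaternionHermitian.isBiHermitian_twistorEnd {V : Type*} [AddCommGroup V] [Module ℝ V]
    [TopologicalSpace V] [IsTopologicalAddGroup V] [ContinuousSMul ℝ V] [T2Space V]
    [FiniteDimensional ℝ V] {g : V →L[ℝ] V →L[ℝ] ℝ} {I J K : V →L[ℝ] V}
    (h : IsQuaternionHermitian g I J K) {a₀ a₁ b₀ b₁ : ℂ} (ha : a₀ ≠ 0 ∨ a₁ ≠ 0)
    (hb : b₀ ≠ 0 ∨ b₁ ≠ 0) :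
    IsBiHermitian g (twistorEnd I J K a₀ a₁) (twistorEnd I J K b₀ b₁) :=
  h.isBiHermitian (twistor_sq_add ha) (twistor_sq_add hb)

end

noncomputable section

/-! ### Generalized tangent vectors in a chart -/

section Chart

variable {E : Type*} [NormedAddCommGroup E] [NormedSpace ℝ E] {H : Type*} [TopologicalSpace H]
  (I : ModelWithCorners ℝ E H) {M : Type*} [TopologicalSpace M] [ChartedSpace H M]
  [IsManifold I ∞ M]

instance : IsManifold I 1 M := IsManifold.of_le (n := ∞) (by norm_cast)

/-- Tangent vectors at `x` in the preferred chart at `x₀`. -/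
def chartFwd (x₀ x : M) : TangentSpace I x →L[ℝ] E :=
  (trivializationAt E (TangentSpace I) x₀).continuousLinearMapAt ℝ x

/-- The tangent vector at `x` with given coordinates in the preferred chart at `x₀`. -/
def chartBwd (x₀ x : M) : E →L[ℝ] TangentSpace I x :=
  (trivializationAt E (TangentSpace I) x₀).symmL ℝ x

variable {I}

theorem chartFwd_chartBwd {x₀ x : M} (hx : x ∈ (chartAt H x₀).source) (v : E) :
    chartFwd I x₀ x (chartBwd I x₀ x v) = v :=
  (trivializationAt E (TangentSpace I) x₀).continuousLinearMapAt_symmL (by simpa using hx) v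

theorem chartBwd_chartFwd {x₀ x : M} (hx : x ∈ (chartAt H x₀).source) (v : TangentSpace I x) :
    chartBwd I x₀ x (chartFwd I x₀ x v) = v :=
  (trivializationAt E (TangentSpace I) x₀).symmL_continuousLinearMapAt (by simpa using hx) v

theorem chartFwd_eq {x₀ x : M} (hx : x ∈ (chartAt H x₀).source) :
    chartFwd I x₀ x = mfderiv I 𝓘(ℝ, E) (extChartAt I x₀) x :=
  TangentBundle.continuousLinearMapAt_trivializationAt hx

theorem chartFwd_self (x : M) (v : TangentSpace I x) : chartFwd I x x v = v := by
  rw [chartFwd_eq (mem_chart_source H x), mfderiv_extChartAt_self]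
  rfl

theorem chartBwd_self (x : M) (v : E) : chartBwd I x x v = v := by
  rw [← chartFwd_self (I := I) x (chartBwd I x x v), chartFwd_chartBwd (mem_chart_source H x)]

theorem chart_symm_mem_source {x₀ : M} {y : E} (hy : y ∈ (extChartAt I x₀).target) :
    (extChartAt I x₀).symm y ∈ (chartAt H x₀).source := by
  rw [← extChartAt_source (I := I)]
  exact (extChartAt I x₀).map_target hy

theorem mfderivWithin_symm_eq_chartBwd {x₀ : M} {y : E} (hy : y ∈ (extChartAt I x₀).target) :
    (mfderivWithin 𝓘(ℝ, E) I (extChartAt I x₀).symm (range I) y) =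
      chartBwd I x₀ ((extChartAt I x₀).symm y) := by
  have h := TangentBundle.symmL_trivializationAt (I := I) (𝕜 := ℝ) (chart_symm_mem_source hy)
  have h2 : ∀ z, z = y → (mfderivWithin 𝓘(ℝ, E) I (extChartAt I x₀).symm (range I) z : E →L[ℝ] E)
      = mfderivWithin 𝓘(ℝ, E) I (extChartAt I x₀).symm (range I) y := by
    rintro z rfl
    rfl
  exact (h.trans (h2 _ ((extChartAt I x₀).right_inv hy))).symm

variable (I)

/-- Generalized tangent vectors at `x` in the preferred chart at `x₀`. -/
def genChart (x₀ x : M) : GenTangent I x →ₗ[ℝ] E × (E →L[ℝ] ℝ) where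
  toFun u := (chartFwd I x₀ x u.1, u.2.comp (chartBwd I x₀ x))
  map_add' u v := by simp [ContinuousLinearMap.add_comp]
  map_smul' c u := by simp [ContinuousLinearMap.smul_comp]

variable {I}

theorem genChart_apply (x₀ x : M) (u : GenTangent I x) :
    genChart I x₀ x u = (chartFwd I x₀ x u.1, u.2.comp (chartBwd I x₀ x)) := rfl

theorem genChart_self (x : M) (u : GenTangent I x) : genChart I x x u = u := by
  refine Prod.ext (chartFwd_self x u.1) ?_
  ext v
  exact congrArg u.2 (chartBwd_self x v)

variable (I)

/-- A section of `T ⊕ T*` in the preferred chart at `x₀`. -/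
def genInChart (u : ∀ x : M, GenTangent I x) (x₀ : M) (y : E) : E × (E →L[ℝ] ℝ) :=
  genChart I x₀ ((extChartAt I x₀).symm y) (u ((extChartAt I x₀).symm y))

variable {I}

theorem genInChart_self (u : ∀ x : M, GenTangent I x) (x₀ : M) :
    genInChart I u x₀ (extChartAt I x₀ x₀) = u x₀ := by
  have h : ∀ x, x = x₀ → (genChart I x₀ x (u x) : E × (E →L[ℝ] ℝ)) = u x₀ := by
    rintro x rfl
    exact genChart_self x _
  exact h _ (extChartAt_to_inv x₀)

variable [I.Boundaryless]

theorem eventually_mem_target (x₀ : M) :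
    ∀ᶠ y in 𝓝 (extChartAt I x₀ x₀), y ∈ (extChartAt I x₀).target :=
  extChartAt_target_mem_nhds x₀

theorem contMDiffAt_iff_chart {F : Type*} [NormedAddCommGroup F] [NormedSpace ℝ F] {f : M → F}
    {x₀ : M} : ContMDiffAt I 𝓘(ℝ, F) ∞ f x₀ ↔
      ContDiffAt ℝ ∞ (fun y => f ((extChartAt I x₀).symm y)) (extChartAt I x₀ x₀) := by
  rw [contMDiffAt_iff_source, I.range_eq_univ, contMDiffWithinAt_univ, contMDiffAt_iff_contDiffAt]
  rfl

theorem eventually_mem_source (x₀ : M) : ∀ᶠ x in 𝓝 x₀, x ∈ (chartAt H x₀).source :=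
  (chartAt H x₀).open_source.mem_nhds (mem_chart_source H x₀)

theorem contMDiffAt_vector_iff {X : ∀ x : M, TangentSpace I x} {x₀ : M} :
    ContMDiffAt I I.tangent ∞ (fun x => (⟨x, X x⟩ : TangentBundle I M)) x₀ ↔
      ContDiffAt ℝ ∞ (fun y => chartFwd I x₀ ((extChartAt I x₀).symm y)
        (X ((extChartAt I x₀).symm y))) (extChartAt I x₀ x₀) := by
  rw [← contMDiffAt_iff_chart (I := I) (f := fun x => chartFwd I x₀ x (X x))]
  refine (Bundle.contMDiffAt_section x₀).trans ?_
  refine EventuallyEq.contMDiffAt_iff ?_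
  filter_upwards [eventually_mem_source (H := H) x₀] with x hx
  rw [chartFwd, Trivialization.continuousLinearMapAt_apply,
    Trivialization.linearMapAt_apply, if_pos (by simpa using hx)]

theorem contMDiffAt_covector_iff {ξ : ∀ x : M, TangentSpace I x →L[ℝ] ℝ} {x₀ : M} :
    ContMDiffAt I (I.prod 𝓘(ℝ, E →L[ℝ] ℝ)) ∞
      (fun x => TotalSpace.mk' (E →L[ℝ] ℝ)
        (E := fun x : M => TangentSpace I x →L[ℝ] Bundle.Trivial M ℝ x) x (ξ x)) x₀ ↔
      ContDiffAt ℝ ∞ (fun y => (ξ ((extChartAt I x₀).symm y)).comp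
        (chartBwd I x₀ ((extChartAt I x₀).symm y))) (extChartAt I x₀ x₀) := by
  rw [← contMDiffAt_iff_chart (I := I) (f := fun x => (ξ x).comp (chartBwd I x₀ x))]
  refine (Bundle.contMDiffAt_section x₀).trans ?_
  refine EventuallyEq.contMDiffAt_iff (Eventually.of_forall fun x => ?_)
  ext v
  change (ContinuousLinearMap.inCoordinates E (TangentSpace I) ℝ (Bundle.Trivial M ℝ) x₀ x x₀ x
    (ξ x)) v = _
  simp [ContinuousLinearMap.inCoordinates]
  rfl

theorem smoothSectionOn_iff {u : ∀ x : M, GenTangent I x} {U : Set M} (hU : IsOpen U) :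
    SmoothSectionOn I u U ↔
      ∀ x ∈ U, ContDiffAt ℝ ∞ (genInChart I u x) (extChartAt I x x) := by
  have h : ∀ x, ContDiffAt ℝ ∞ (genInChart I u x) (extChartAt I x x) ↔
      ContMDiffAt I I.tangent ∞ (fun x => (⟨x, (u x).1⟩ : TangentBundle I M)) x ∧
      ContMDiffAt I (I.prod 𝓘(ℝ, E →L[ℝ] ℝ)) ∞ (fun x => TotalSpace.mk' (E →L[ℝ] ℝ)
        (E := fun x : M => TangentSpace I x →L[ℝ] Bundle.Trivial M ℝ x) x (u x).2) x := by
    intro x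
    rw [contMDiffAt_vector_iff, contMDiffAt_covector_iff]
    exact ⟨fun h => ⟨h.fst, h.snd⟩, fun h => h.1.prodMk h.2⟩
  simp only [h]
  constructor
  · intro hu x hx
    exact ⟨(hu.1 x hx).contMDiffAt (hU.mem_nhds hx), (hu.2 x hx).contMDiffAt (hU.mem_nhds hx)⟩
  · intro hu
    exact ⟨fun x hx => (hu x hx).1.contMDiffWithinAt, fun x hx => (hu x hx).2.contMDiffWithinAt⟩

/-- The Courant bracket in a chart. -/
theorem courantBracket_eq_vecBracket {u v : ∀ x : M, GenTangent I x} {x₀ : M}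
    (hu : ContDiffAt ℝ ∞ (genInChart I u x₀) (extChartAt I x₀ x₀))
    (hv : ContDiffAt ℝ ∞ (genInChart I v x₀) (extChartAt I x₀ x₀)) :
    courantBracket I u v x₀ = vecBracket (genInChart I u x₀ (extChartAt I x₀ x₀))
      (genInChart I v x₀ (extChartAt I x₀ x₀))
      (fderiv ℝ (genInChart I u x₀) (extChartAt I x₀ x₀))
      (fderiv ℝ (genInChart I v x₀) (extChartAt I x₀ x₀)) := by
  have hdu := hu.differentiableAt (by simp)
  have hdv := hv.differentiableAt (by simp)
  -- The Lie bracket is defined by pulling the fields back along the inverse chart; these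
  -- pulled-back fields are the vector parts of the coordinate sections.
  have hpull : ∀ w : ∀ x : M, GenTangent I x,
      (VectorField.mpullbackWithin 𝓘(ℝ, E) I (extChartAt I x₀).symm (fun x => (w x).1) (range I))
        =ᶠ[𝓝 (extChartAt I x₀ x₀)] fun y => (genInChart I w x₀ y).1 := by
    intro w
    filter_upwards [eventually_mem_target (I := I) x₀] with y hy
    rw [VectorField.mpullbackWithin_apply, mfderivWithin_symm_eq_chartBwd hy]
    have hs := chart_symm_mem_source hy
    have hinv := ContinuousLinearMap.inverse_eq (f := chartBwd I x₀ ((extChartAt I x₀).symm y))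
      (g := chartFwd I x₀ ((extChartAt I x₀).symm y))
      (ContinuousLinearMap.ext fun v => chartBwd_chartFwd hs v)
      (ContinuousLinearMap.ext fun v => chartFwd_chartBwd hs v)
    exact congrArg (fun f : TangentSpace I ((extChartAt I x₀).symm y) →L[ℝ] E => f (w _).1) hinv
  have hcov : ∀ w : ∀ x : M, GenTangent I x, (covectorInChart I (fun x => (w x).2) x₀)
        =ᶠ[𝓝 (extChartAt I x₀ x₀)] fun y => (genInChart I w x₀ y).2 := by
    intro w
    filter_upwards [eventually_mem_target (I := I) x₀] with y hy
    rw [covectorInChart, mfderivWithin_symm_eq_chartBwd hy]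
    rfl
  have hpair : (fun y => (v ((extChartAt I x₀).symm y)).2 (u ((extChartAt I x₀).symm y)).1)
      =ᶠ[𝓝 (extChartAt I x₀ x₀)] fun y => (genInChart I v x₀ y).2 (genInChart I u x₀ y).1 := by
    filter_upwards [eventually_mem_target (I := I) x₀] with y hy
    exact (congrArg _ (chartBwd_chartFwd (chart_symm_mem_source hy) _)).symm
  have hmd : MDifferentiableAt I 𝓘(ℝ, ℝ) (fun x => (v x).2 (u x).1) x₀ :=
    (contMDiffAt_iff_chart.2 ((hv.snd.clm_apply hu.fst).congr_of_eventuallyEq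
      hpair)).mdifferentiableAt (by simp)
  have hext : ∀ (w : ∀ x : M, GenTangent I x) (Y Z : E),
      DifferentiableAt ℝ (genInChart I w x₀) (extChartAt I x₀ x₀) →
      contractExtDeriv I (fun x => (w x).2) x₀ Y Z =
        (fderiv ℝ (genInChart I w x₀) (extChartAt I x₀ x₀) Y).2 Z -
        (fderiv ℝ (genInChart I w x₀) (extChartAt I x₀ x₀) Z).2 Y := by
    intro w Y Z hw
    have h1 : fderivWithin ℝ (covectorInChart I (fun x => (w x).2) x₀) (range I)
        (extChartAt I x₀ x₀) = (ContinuousLinearMap.snd ℝ E (E →L[ℝ] ℝ)).comp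
          (fderiv ℝ (genInChart I w x₀) (extChartAt I x₀ x₀)) := by
      rw [I.range_eq_univ, fderivWithin_univ, (hcov w).fderiv_eq]
      exact hw.hasFDerivAt.snd.fderiv
    have h2 : mfderiv I 𝓘(ℝ, E) (extChartAt I x₀) x₀ = ContinuousLinearMap.id ℝ _ :=
      mfderiv_extChartAt_self
    have h3 : ∀ (D : E →L[ℝ] E →L[ℝ] ℝ) (A : E →L[ℝ] E), A = .id ℝ E →
        ((D (A Y) - D.flip (A Y)).comp A) Z = D Y Z - D Z Y := by
      rintro D A rfl
      rfl
    exact (h3 _ _ h2).trans (by rw [h1]; rfl)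
  have hval : ∀ w : ∀ x : M, GenTangent I x, genInChart I w x₀ (extChartAt I x₀ x₀) = w x₀ :=
    fun w => genInChart_self w x₀
  have hdw : ∀ {w : ∀ x : M, GenTangent I x},
      DifferentiableAt ℝ (genInChart I w x₀) (extChartAt I x₀ x₀) →
      fderiv ℝ (VectorField.mpullbackWithin 𝓘(ℝ, E) I (extChartAt I x₀).symm (fun x => (w x).1)
        (range I)) (extChartAt I x₀ x₀) = (ContinuousLinearMap.fst ℝ E (E →L[ℝ] ℝ)).comp
          (fderiv ℝ (genInChart I w x₀) (extChartAt I x₀ x₀)) := by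
    intro w hw
    rw [(hpull w).fderiv_eq]
    exact hw.hasFDerivAt.fst.fderiv
  refine Prod.ext ?_ ?_
  · have h1 : (courantBracket I u v x₀).1 = (mfderiv I 𝓘(ℝ, E) (extChartAt I x₀) x₀).inverse
        ((VectorField.lieBracketWithin ℝ
          (VectorField.mpullbackWithin 𝓘(ℝ, E) I (extChartAt I x₀).symm (fun x => (u x).1)
            (range I))
          (VectorField.mpullbackWithin 𝓘(ℝ, E) I (extChartAt I x₀).symm (fun x => (v x).1)
            (range I))
          ((extChartAt I x₀).symm ⁻¹' univ ∩ range I)) (extChartAt I x₀ x₀)) := rfl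
    have h2 : mfderiv I 𝓘(ℝ, E) (extChartAt I x₀) x₀ = ContinuousLinearMap.id ℝ _ :=
      mfderiv_extChartAt_self
    have h3 : ∀ (V W : E → E) (s : Set E) (A : E →L[ℝ] E), s = univ → A = .id ℝ E →
        A.inverse (VectorField.lieBracketWithin ℝ V W s (extChartAt I x₀ x₀))
          = fderiv ℝ W (extChartAt I x₀ x₀) (V (extChartAt I x₀ x₀))
            - fderiv ℝ V (extChartAt I x₀ x₀) (W (extChartAt I x₀ x₀)) := by
      rintro V W s A rfl rfl
      rw [VectorField.lieBracketWithin_univ, ContinuousLinearMap.inverse_id]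
      rfl
    refine (h1.trans (h3 _ _ _ _ (by rw [preimage_univ, univ_inter, I.range_eq_univ]) h2)).trans ?_
    rw [hdw hdu, hdw hdv, (hpull u).self_of_nhds, (hpull v).self_of_nhds]
    change _ = (_ - _) + (0 : E)
    rw [add_zero]
    rfl
  · ext Z
    have h1 : (courantBracket I u v x₀).2 Z = mvfderiv I (fun y => (v y).2 (u y).1) x₀ Z
        + contractExtDeriv I (fun y => (v y).2) x₀ (u x₀).1 Z
        - contractExtDeriv I (fun y => (u y).2) x₀ (v x₀).1 Z := rfl
    have h2 : mvfderiv I (fun y => (v y).2 (u y).1) x₀ Z =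
        (genInChart I v x₀ (extChartAt I x₀ x₀)).2
          (fderiv ℝ (genInChart I u x₀) (extChartAt I x₀ x₀) Z).1
        + (fderiv ℝ (genInChart I v x₀) (extChartAt I x₀ x₀) Z).2
          (genInChart I u x₀ (extChartAt I x₀ x₀)).1 := by
      have h3 : mfderiv I 𝓘(ℝ, ℝ) (fun x => (v x).2 (u x).1) x₀ = fderiv ℝ
          (fun y => (genInChart I v x₀ y).2 (genInChart I u x₀ y).1) (extChartAt I x₀ x₀) := by
        refine Eq.trans (if_pos hmd) ?_
        rw [I.range_eq_univ]
        exact (congrFun fderivWithin_univ _).trans hpair.fderiv_eq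
      have h4 := (hdv.hasFDerivAt.snd.clm_apply hdu.hasFDerivAt.fst).fderiv
      exact (congrArg (fun f : E →L[ℝ] ℝ => f Z) (h3.trans h4)).trans rfl
    have h3 : ∀ {w w' : ∀ x : M, GenTangent I x},
        DifferentiableAt ℝ (genInChart I w x₀) (extChartAt I x₀ x₀) →
        contractExtDeriv I (fun x => (w x).2) x₀ (w' x₀).1 Z =
        (fderiv ℝ (genInChart I w x₀) (extChartAt I x₀ x₀)
          (genInChart I w' x₀ (extChartAt I x₀ x₀)).1).2 Z -
        (fderiv ℝ (genInChart I w x₀) (extChartAt I x₀ x₀) Z).2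
          (genInChart I w' x₀ (extChartAt I x₀ x₀)).1 := fun {w w'} hw =>
      (congrArg (fun Y : E × (E →L[ℝ] ℝ) => contractExtDeriv I (fun x => (w x).2) x₀ Y.1 Z)
        (hval w').symm).trans (hext w _ _ hw)
    refine h1.trans ?_
    rw [h2, h3 hdv, h3 hdu]
    change _ = (fderiv ℝ (genInChart I v x₀) (extChartAt I x₀ x₀)
        (genInChart I u x₀ (extChartAt I x₀ x₀)).1).2 Z
      - (fderiv ℝ (genInChart I u x₀) (extChartAt I x₀ x₀)
        (genInChart I v x₀ (extChartAt I x₀ x₀)).1).2 Z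
      + ((fderiv ℝ (genInChart I u x₀) (extChartAt I x₀ x₀) Z).2
          (genInChart I v x₀ (extChartAt I x₀ x₀)).1
        + (genInChart I v x₀ (extChartAt I x₀ x₀)).2
          (fderiv ℝ (genInChart I u x₀) (extChartAt I x₀ x₀) Z).1)
    -- The term `(D_Z η)(X)` of `d(η(X))` cancels against the one in `ι_X dη`.
    ring

/-- The endomorphism `J` of `T ⊕ T*` is given near `x₀` by the endomorphisms `J'` of the model
space. -/
def HasChartExpr (J : ∀ x : M, GenTangent I x →ₗ[ℝ] GenTangent I x) (x₀ : M)
    (J' : E → E × (E →L[ℝ] ℝ) →ₗ[ℝ] E × (E →L[ℝ] ℝ)) : Prop :=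
  ∀ᶠ y in 𝓝 (extChartAt I x₀ x₀), ∀ u : GenTangent I ((extChartAt I x₀).symm y),
    genChart I x₀ _ (J _ u) = J' y (genChart I x₀ _ u)

theorem HasChartExpr.apply_self {J : ∀ x : M, GenTangent I x →ₗ[ℝ] GenTangent I x} {x₀ : M}
    {J' : E → E × (E →L[ℝ] ℝ) →ₗ[ℝ] E × (E →L[ℝ] ℝ)} (h : HasChartExpr J x₀ J')
    (u : GenTangent I x₀) : J x₀ u = J' (extChartAt I x₀ x₀) u := by
  have h2 : ∀ x, x = x₀ → (∀ u : GenTangent I x, genChart I x₀ x (J x u)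
      = J' (extChartAt I x₀ x₀) (genChart I x₀ x u)) →
      ∀ u : GenTangent I x₀, J x₀ u = J' (extChartAt I x₀ x₀) u := by
    rintro x rfl hx u
    have := hx u
    rwa [genChart_self, genChart_self] at this
  exact h2 _ (extChartAt_to_inv x₀) h.self_of_nhds u

theorem smoothSectionOn_of_hasChartExpr {J : ∀ x : M, GenTangent I x →ₗ[ℝ] GenTangent I x}
    {J' : M → E → E × (E →L[ℝ] ℝ) →ₗ[ℝ] E × (E →L[ℝ] ℝ)} (h : ∀ x, HasChartExpr J x (J' x))
    (hs : ∀ (x : M) (u : E → E × (E →L[ℝ] ℝ)), ContDiffAt ℝ ∞ u (extChartAt I x x) →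
      ContDiffAt ℝ ∞ (fun y => J' x y (u y)) (extChartAt I x x))
    {U : Set M} (hU : IsOpen U) {u : ∀ x : M, GenTangent I x} (hu : SmoothSectionOn I u U) :
    SmoothSectionOn I (fun x => J x (u x)) U := by
  rw [smoothSectionOn_iff hU] at hu ⊢
  intro x hx
  exact (hs x _ (hu x hx)).congr_of_eventuallyEq ((h x).mono fun y hy => hy _)

theorem inEigen_hasChartExpr {V W : Type*} [AddCommGroup V] [AddCommGroup W] {J : V → V}
    {J' : W → W} {φ : V →+ W} (h : ∀ u, φ (J u) = J' (φ u)) {u v : V} (huv : InEigen J u v) :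
    InEigen J' (φ u) (φ v) :=
  ⟨by rw [← h, huv.1, map_neg], by rw [← h, huv.2]⟩

/-- An endomorphism of `T ⊕ T*` whose `+i`-eigenbundle annihilates, near every point, a smooth
form with vanishing exterior derivative, is integrable. -/
theorem courantInvolutive_of_hasChartExpr [FiniteDimensional ℝ E]
    {J : ∀ x : M, GenTangent I x →ₗ[ℝ] GenTangent I x}
    {J' : M → E → E × (E →L[ℝ] ℝ) →ₗ[ℝ] E × (E →L[ℝ] ℝ)} (h : ∀ x, HasChartExpr J x (J' x))
    (hs : ∀ x : M, ∃ Ψ : E → CForm E, VSmoothAt Ψ (extChartAt I x x) ∧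
      extD Ψ (extChartAt I x x) = 0 ∧ ∀ᶠ y in 𝓝 (extChartAt I x x), ∀ u v,
        cliffordAct u v (Ψ y) = 0 ↔ InEigen (J' x y) u v) : CourantInvolutive I J := by
  intro U hU a b c d ha hb hc hd hab hcd x hx
  rw [smoothSectionOn_iff hU] at ha hb hc hd
  obtain ⟨Ψ, hΨ, hdΨ, hker⟩ := hs x
  have hU' : ∀ᶠ y in 𝓝 (extChartAt I x x), (extChartAt I x).symm y ∈ U :=
    (continuousAt_extChartAt_symm x).eventually_mem (by
      rw [extChartAt_to_inv x]
      exact hU.mem_nhds hx)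
  have hev : ∀ {a b : ∀ x : M, GenTangent I x}, (∀ x ∈ U, InEigen (J x) (a x) (b x)) →
      ∀ᶠ y in 𝓝 (extChartAt I x x),
        cliffordAct (genInChart I a x y) (genInChart I b x y) (Ψ y) = 0 := by
    intro a b hab
    filter_upwards [hker, hU', h x] with y h1 h2 h3
    exact (h1 _ _).2 (inEigen_hasChartExpr (φ := (genChart I x _).toAddMonoidHom) h3 (hab _ h2))
  -- The bracket annihilates the closed spinor at the base point. There the annihilator is exactly
  -- the eigenspace, and the chart acts as the identity on generalized tangent vectors.
  have hbr := (hker.self_of_nhds _ _).1 (cliffordAct_vecBracket hΨ hdΨ (ha x hx) (hb x hx)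
    (hc x hx) (hd x hx) (hev hab) (hev hcd))
  rw [← courantBracket_eq_vecBracket (ha x hx) (hc x hx),
    ← courantBracket_eq_vecBracket (hb x hx) (hd x hx),
    ← courantBracket_eq_vecBracket (ha x hx) (hd x hx),
    ← courantBracket_eq_vecBracket (hb x hx) (hc x hx)] at hbr
  exact ⟨((h x).apply_self _).trans hbr.1, ((h x).apply_self _).trans hbr.2⟩

end Chart
end

noncomputable section

/-! ### Forms in a chart -/

section PullTwoForm

variable {V W : Type*} [AddCommGroup V] [Module ℝ V] [TopologicalSpace V]
  [IsTopologicalAddGroup V] [ContinuousSMul ℝ V] [T2Space V] [FiniteDimensional ℝ V]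
  [AddCommGroup W] [Module ℝ W] [TopologicalSpace W]
  [IsTopologicalAddGroup W] [ContinuousSMul ℝ W] [T2Space W] [FiniteDimensional ℝ W]

/-- Pull-back of two-forms. -/
theorem pullForm_twoForm (A : V →L[ℝ] W) {B : W →L[ℝ] W →L[ℝ] ℝ} {C : V →L[ℝ] V →L[ℝ] ℝ}
    (h : ∀ v w, C v w = B (A v) (A w)) : pullForm A (twoForm B) = twoForm C := by
  have hF : IsRealLinear fun w : W => oneForm ((complexCovector (B w) 0).comp A) := by
    constructor
    · intro v w
      rw [← oneForm_add]
      congr 1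
      ext
      simp [complexCovector]
    · intro c v
      rw [← oneForm_smul]
      congr 1
      ext
      simp [complexCovector]
  have h1 := sum_oneForm_comp A hF
  have h2 : ∀ v, (complexCovector (B (A v)) 0).comp A = complexCovector (C v) 0 := by
    intro v
    ext w
    simp [complexCovector, h]
  simp only [h2] at h1
  simp only [twoForm, map_smul, map_sum, map_mul, pullForm_oneForm]
  exact congrArg _ h1

end PullTwoForm

section ChartForms

variable {E : Type*} [NormedAddCommGroup E] [NormedSpace ℝ E] {H : Type*} [TopologicalSpace H]
  {I : ModelWithCorners ℝ E H} {M : Type*} [TopologicalSpace M] [ChartedSpace H M]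
  [IsManifold I ∞ M]

theorem formInChart_eq (Φ : ∀ x : M, CForm (TangentSpace I x)) {x₀ : M} {y : E}
    (hy : y ∈ (extChartAt I x₀).target) :
    formInChart I Φ x₀ y = pullForm (chartBwd I x₀ ((extChartAt I x₀).symm y))
      (Φ ((extChartAt I x₀).symm y)) := by
  have h := mfderivWithin_symm_eq_chartBwd (I := I) hy
  exact congrArg (fun A : E →L[ℝ] TangentSpace I ((extChartAt I x₀).symm y) =>
    pullForm A (Φ ((extChartAt I x₀).symm y))) h

theorem formInChart_self (Φ : ∀ x : M, CForm (TangentSpace I x)) (x₀ : M) :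
    formInChart I Φ x₀ (extChartAt I x₀ x₀) = Φ x₀ := by
  rw [formInChart_eq Φ (mem_extChartAt_target x₀)]
  have h : ∀ x, x = x₀ → (pullForm (chartBwd I x₀ x) (Φ x) : CForm E) = Φ x₀ := by
    rintro x rfl
    have h2 : chartBwd I x x = ContinuousLinearMap.id ℝ E :=
      ContinuousLinearMap.ext (chartBwd_self x)
    exact (congrArg (fun A : E →L[ℝ] E => pullForm A (Φ x : CForm E)) h2).trans (pullForm_id _)
  exact h _ (extChartAt_to_inv x₀)

variable [I.Boundaryless]

theorem smoothFormOn_iff {Φ : ∀ x : M, CForm (TangentSpace I x)} {U : Set M} :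
    SmoothFormOn I Φ U ↔ ∀ x ∈ U, VSmoothAt (formInChart I Φ x) (extChartAt I x x) := by
  simp only [SmoothFormOn, I.range_eq_univ, contDiffWithinAt_univ]
  rfl

theorem closedFormOn_iff [FiniteDimensional ℝ E] {Φ : ∀ x : M, CForm (TangentSpace I x)}
    {U : Set M} (hΦ : ∀ x ∈ U, VSmoothAt (formInChart I Φ x) (extChartAt I x x)) :
    ClosedFormOn I Φ U ↔ ∀ x ∈ U, extD (formInChart I Φ x) (extChartAt I x x) = 0 := by
  have h : ∀ x ∈ U, ∀ l : Module.Dual ℂ (CForm E),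
      ∑ i, fderivWithin ℝ (fun y => l (oneForm (complexCovector
        (LinearMap.toContinuousLinearMap ((Module.finBasis ℝ E).coord i)) 0)
          * formInChart I Φ x y))
      (range I) (extChartAt I x x) (Module.finBasis ℝ E i)
        = l (extD (formInChart I Φ x) (extChartAt I x x)) := by
    intro x hx l
    rw [extD, wedgeD, map_sum]
    refine Finset.sum_congr rfl fun i _ => ?_
    rw [I.range_eq_univ, fderivWithin_univ]
    exact ((hΦ x hx).dual_vderiv (l ∘ₗ LinearMap.mulLeft ℂ (oneForm (dualVec E i))) _).symm
  constructor
  · intro hc x hx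
    exact eq_of_forall_dual fun l => by rw [← h x hx, hc x hx, map_zero]
  · intro hc x hx l
    rw [h x hx, hc x hx, map_zero]

/-- The differential of a function in a chart. -/
theorem mvfderiv_comp_chartBwd {F : Type*} [NormedAddCommGroup F] [NormedSpace ℝ F] {f : M → F}
    {x₀ : M} {y : E} (hy : y ∈ (extChartAt I x₀).target)
    (hf : MDifferentiableAt I 𝓘(ℝ, F) f ((extChartAt I x₀).symm y)) :
    (mvfderiv I f ((extChartAt I x₀).symm y)).comp (chartBwd I x₀ ((extChartAt I x₀).symm y))
      = fderiv ℝ (fun z => f ((extChartAt I x₀).symm z)) y := by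
  have h1 := (mdifferentiableWithinAt_extChartAt_symm hy).hasMFDerivWithinAt
  have h2 := (hf.hasMFDerivAt.comp_hasMFDerivWithinAt y h1).hasFDerivWithinAt
  have h3 : ∀ f' : E →L[ℝ] F, HasFDerivWithinAt (fun z => f ((extChartAt I x₀).symm z)) f'
      (range I) y → f' = fderiv ℝ (fun z => f ((extChartAt I x₀).symm z)) y := by
    intro f' hf'
    rw [I.range_eq_univ, hasFDerivWithinAt_univ] at hf'
    exact hf'.fderiv.symm
  have h := mfderivWithin_symm_eq_chartBwd (I := I) hy
  exact (congrArg (fun A : E →L[ℝ] TangentSpace I ((extChartAt I x₀).symm y) =>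
    (mfderiv I 𝓘(ℝ, F) f ((extChartAt I x₀).symm y)).comp A) h.symm).trans (h3 _ h2)

end ChartForms

/-! ### Product manifolds -/

section Product

variable {E : Type*} [NormedAddCommGroup E] [NormedSpace ℝ E] {H : Type*} [TopologicalSpace H]
  {I : ModelWithCorners ℝ E H} {M : Type*} [TopologicalSpace M] [ChartedSpace H M]
  {E' : Type*} [NormedAddCommGroup E'] [NormedSpace ℝ E'] {H' : Type*} [TopologicalSpace H']
  {I' : ModelWithCorners ℝ E' H'} {N : Type*} [TopologicalSpace N] [ChartedSpace H' N]

theorem genProd_eq_prodEnd {x : M} {y : N} (J₁ : GenTangent I x →ₗ[ℝ] GenTangent I x)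
    (J₂ : GenTangent I' y →ₗ[ℝ] GenTangent I' y) :
    genProd I I' J₁ J₂ = prodEnd (V := TangentSpace I x) (W := TangentSpace I' y) J₁ J₂ := by
  have h : ∀ (p₁ : TangentSpace I x × TangentSpace I' y →L[ℝ] TangentSpace I x)
      (p₂ : TangentSpace I x × TangentSpace I' y →L[ℝ] TangentSpace I' y)
      (i₁ : TangentSpace I x →L[ℝ] TangentSpace I x × TangentSpace I' y)
      (i₂ : TangentSpace I' y →L[ℝ] TangentSpace I x × TangentSpace I' y),
      p₁ = .fst ℝ _ _ → p₂ = .snd ℝ _ _ → i₁ = .inl ℝ _ _ → i₂ = .inr ℝ _ _ →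
      ∀ u : (TangentSpace I x × TangentSpace I' y) × (TangentSpace I x × TangentSpace I' y →L[ℝ] ℝ),
      (i₁ (J₁ (p₁ u.1, u.2.comp i₁)).1 + i₂ (J₂ (p₂ u.1, u.2.comp i₂)).1,
        (J₁ (p₁ u.1, u.2.comp i₁)).2.comp p₁ + (J₂ (p₂ u.1, u.2.comp i₂)).2.comp p₂)
        = prodEnd J₁ J₂ u := by
    rintro p₁ p₂ i₁ i₂ rfl rfl rfl rfl u
    rw [prodEnd_apply, genPair_apply]
    refine Prod.ext (Prod.ext ?_ ?_) rfl
    · exact add_zero _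
    · exact zero_add _
  exact LinearMap.ext fun u => h _ _ _ _ (mfderiv_fst (I := I) (I' := I'))
    (mfderiv_snd (I := I) (I' := I')) (mfderiv_prod_left (I := I) (I' := I'))
    (mfderiv_prod_right (I := I) (I' := I')) u

variable [IsManifold I ∞ M] [IsManifold I' ∞ N]

theorem chartFwd_prod {x₀ x : M} {y₀ y : N} (hx : x ∈ (chartAt H x₀).source)
    (hy : y ∈ (chartAt H' y₀).source) (v : TangentSpace I x × TangentSpace I' y) :
    chartFwd (I.prod I') (x₀, y₀) (x, y) v = (chartFwd I x₀ x v.1, chartFwd I' y₀ y v.2) := by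
  have hs : (x, y) ∈ (chartAt (ModelProd H H') (x₀, y₀)).source := by
    rw [prodChartedSpace_chartAt]
    exact ⟨hx, hy⟩
  rw [chartFwd_eq hs, chartFwd_eq hx, chartFwd_eq hy]
  have h1 : (extChartAt (I.prod I') (x₀, y₀) : M × N → E × E')
      = Prod.map (extChartAt I x₀) (extChartAt I' y₀) := by
    rw [extChartAt_prod]
    rfl
  have h2 : HasMFDerivAt (I.prod I') 𝓘(ℝ, E × E')
      (Prod.map (extChartAt I x₀) (extChartAt I' y₀)) (x, y)
      ((mfderiv I 𝓘(ℝ, E) (extChartAt I x₀) x).prodMap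
        (mfderiv I' 𝓘(ℝ, E') (extChartAt I' y₀) y)) := by
    rw [modelWithCornersSelf_prod, ← chartedSpaceSelf_prod]
    exact HasMFDerivAt.prodMap (p := (x, y))
      (mdifferentiableAt_extChartAt (I := I) hx).hasMFDerivAt
      (mdifferentiableAt_extChartAt (I := I') hy).hasMFDerivAt
  rw [h1]
  exact congrArg (fun A : E × E' →L[ℝ] E × E' => A v) h2.mfderiv

theorem chartBwd_prod {x₀ x : M} {y₀ y : N} (hx : x ∈ (chartAt H x₀).source)
    (hy : y ∈ (chartAt H' y₀).source) (v : E × E') :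
    chartBwd (I.prod I') (x₀, y₀) (x, y) v = (chartBwd I x₀ x v.1, chartBwd I' y₀ y v.2) := by
  have hs : (x, y) ∈ (chartAt (ModelProd H H') (x₀, y₀)).source := by
    rw [prodChartedSpace_chartAt]
    exact ⟨hx, hy⟩
  have h1 := chartFwd_prod (I := I) (I' := I') hx hy (chartBwd I x₀ x v.1, chartBwd I' y₀ y v.2)
  rw [chartFwd_chartBwd hx, chartFwd_chartBwd hy] at h1
  rw [← chartBwd_chartFwd (I := I.prod I') hs
    ((chartBwd I x₀ x v.1, chartBwd I' y₀ y v.2) : TangentSpace I x × TangentSpace I' y)]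
  exact congrArg (chartBwd (I.prod I') (x₀, y₀) (x, y)) h1.symm

theorem genChart_prod {x₀ x : M} {y₀ y : N} (hx : x ∈ (chartAt H x₀).source)
    (hy : y ∈ (chartAt H' y₀).source)
    (u : (TangentSpace I x × TangentSpace I' y) × (TangentSpace I x × TangentSpace I' y →L[ℝ] ℝ)) :
    genChart (I.prod I') (x₀, y₀) (x, y) u
      = genPair (genChart I x₀ x (genFst u), genChart I' y₀ y (genSnd u)) := by
  refine Prod.ext (chartFwd_prod hx hy u.1) ?_
  ext v
  · refine (congrArg u.2 (chartBwd_prod (I := I) (I' := I') hx hy (v, 0))).trans ?_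
    rw [map_zero (chartBwd I' y₀ y)]
    simp [genPair_apply, genChart_apply, genFst_apply]
  · refine (congrArg u.2 (chartBwd_prod (I := I) (I' := I') hx hy (0, v))).trans ?_
    rw [map_zero (chartBwd I x₀ x)]
    simp [genPair_apply, genChart_apply, genSnd_apply]

/-- A product structure in a product chart. -/
theorem genChart_genProd {x₀ x : M} {y₀ y : N} (hx : x ∈ (chartAt H x₀).source)
    (hy : y ∈ (chartAt H' y₀).source) {J₁ : GenTangent I x →ₗ[ℝ] GenTangent I x}
    {J₂ : GenTangent I' y →ₗ[ℝ] GenTangent I' y} {K₁ : E × (E →L[ℝ] ℝ) →ₗ[ℝ] E × (E →L[ℝ] ℝ)}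
    {K₂ : E' × (E' →L[ℝ] ℝ) →ₗ[ℝ] E' × (E' →L[ℝ] ℝ)}
    (h₁ : ∀ u, genChart I x₀ x (J₁ u) = K₁ (genChart I x₀ x u))
    (h₂ : ∀ u, genChart I' y₀ y (J₂ u) = K₂ (genChart I' y₀ y u))
    (u : GenTangent (I.prod I') (x, y)) :
    genChart (I.prod I') (x₀, y₀) (x, y) (genProd I I' J₁ J₂ u)
      = prodEnd K₁ K₂ (genChart (I.prod I') (x₀, y₀) (x, y) u) := by
  rw [genProd_eq_prodEnd]
  have key : ∀ u' : (TangentSpace I x × TangentSpace I' y) ×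
      (TangentSpace I x × TangentSpace I' y →L[ℝ] ℝ),
      (genPair (genChart I x₀ x (genFst (prodEnd J₁ J₂ u')),
        genChart I' y₀ y (genSnd (prodEnd J₁ J₂ u'))) : (E × E') × (E × E' →L[ℝ] ℝ))
        = prodEnd K₁ K₂ (genPair (genChart I x₀ x (genFst u'), genChart I' y₀ y (genSnd u'))) := by
    intro u'
    rw [genFst_prodEnd, genSnd_prodEnd, h₁, h₂, prodEnd_apply, genFst_genPair, genSnd_genPair]
  exact (genChart_prod hx hy _).trans ((key u).trans
    (congrArg (prodEnd K₁ K₂) (genChart_prod hx hy u).symm))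

end Product
end

noncomputable section

/-! ### Metrics and endomorphisms in a chart -/

section ChartTensors

variable {E : Type*} [NormedAddCommGroup E] [NormedSpace ℝ E] [FiniteDimensional ℝ E]
  {H : Type*} [TopologicalSpace H]
  {I : ModelWithCorners ℝ E H} {M : Type*} [TopologicalSpace M] [ChartedSpace H M]
  [IsManifold I ∞ M]

variable (I) in
/-- An endomorphism of the tangent space at `x` in the preferred chart at `x₀`. -/
def chartEnd (x₀ x : M) (A : TangentSpace I x →L[ℝ] TangentSpace I x) : E →L[ℝ] E :=
  (chartFwd I x₀ x).comp (A.comp (chartBwd I x₀ x))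

variable (I) in
/-- A bilinear form on the tangent space at `x` in the preferred chart at `x₀`. -/
def chartMetric (x₀ x : M) (g : TangentSpace I x →L[ℝ] TangentSpace I x →L[ℝ] ℝ) :
    E →L[ℝ] E →L[ℝ] ℝ :=
  LinearMap.toContinuousLinearMap
    { toFun := fun v => (g (chartBwd I x₀ x v)).comp (chartBwd I x₀ x)
      map_add' := fun v w => by simp [ContinuousLinearMap.add_comp]
      map_smul' := fun c v => by simp [ContinuousLinearMap.smul_comp] }

theorem chartEnd_apply (x₀ x : M) (A : TangentSpace I x →L[ℝ] TangentSpace I x) (v : E) :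
    chartEnd I x₀ x A v = chartFwd I x₀ x (A (chartBwd I x₀ x v)) := rfl

theorem chartMetric_apply (x₀ x : M) (g : TangentSpace I x →L[ℝ] TangentSpace I x →L[ℝ] ℝ) (v : E) :
    chartMetric I x₀ x g v = (g (chartBwd I x₀ x v)).comp (chartBwd I x₀ x) := rfl

theorem chartMetric_apply_apply (x₀ x : M)
    (g : TangentSpace I x →L[ℝ] TangentSpace I x →L[ℝ] ℝ) (v w : E) :
    chartMetric I x₀ x g v w = g (chartBwd I x₀ x v) (chartBwd I x₀ x w) := rfl

theorem chartEnd_chartEnd {x₀ x : M} (hx : x ∈ (chartAt H x₀).source)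
    (A B : TangentSpace I x →L[ℝ] TangentSpace I x) (v : E) :
    chartEnd I x₀ x A (chartEnd I x₀ x B v) = chartEnd I x₀ x (A.comp B) v := by
  rw [chartEnd_apply, chartEnd_apply, chartBwd_chartFwd hx]
  rfl

theorem chartMetric_skew {x₀ x : M} (hx : x ∈ (chartAt H x₀).source)
    {g : TangentSpace I x →L[ℝ] TangentSpace I x →L[ℝ] ℝ}
    {A : TangentSpace I x →L[ℝ] TangentSpace I x} (h : ∀ v w, g (A v) w = -g v (A w)) (v w : E) :
    chartMetric I x₀ x g (chartEnd I x₀ x A v) w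
      = -chartMetric I x₀ x g v (chartEnd I x₀ x A w) := by
  rw [chartMetric_apply_apply, chartMetric_apply_apply, chartEnd_apply, chartEnd_apply,
    chartBwd_chartFwd hx, chartBwd_chartFwd hx, h]

theorem chartMetric_pos {x₀ x : M} (hx : x ∈ (chartAt H x₀).source)
    {g : TangentSpace I x →L[ℝ] TangentSpace I x →L[ℝ] ℝ} (h : ∀ v, v ≠ 0 → 0 < g v v) (v : E)
    (hv : v ≠ 0) : 0 < chartMetric I x₀ x g v v := by
  refine h _ fun h0 => hv ?_
  rw [← chartFwd_chartBwd (I := I) hx v, h0, map_zero]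

theorem IsQuaternionHermitian.chart {x₀ x : M} (hx : x ∈ (chartAt H x₀).source)
    {g : TangentSpace I x →L[ℝ] TangentSpace I x →L[ℝ] ℝ}
    {A B C : TangentSpace I x →L[ℝ] TangentSpace I x} (h : IsQuaternionHermitian g A B C) :
    IsQuaternionHermitian (chartMetric I x₀ x g) (chartEnd I x₀ x A) (chartEnd I x₀ x B)
      (chartEnd I x₀ x C) where
  symm v w := h.symm _ _
  pos := chartMetric_pos hx h.pos
  skew_I := chartMetric_skew hx h.skew_I
  skew_J := chartMetric_skew hx h.skew_J
  skew_K := chartMetric_skew hx h.skew_K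
  I_I v := by
    rw [chartEnd_chartEnd hx, chartEnd_apply, ContinuousLinearMap.comp_apply, h.I_I, map_neg,
      chartFwd_chartBwd hx]
  J_J v := by
    rw [chartEnd_chartEnd hx, chartEnd_apply, ContinuousLinearMap.comp_apply, h.J_J, map_neg,
      chartFwd_chartBwd hx]
  I_J v := by
    rw [chartEnd_chartEnd hx, chartEnd_apply, ContinuousLinearMap.comp_apply, h.I_J]
    rfl
  J_I v := by
    rw [chartEnd_chartEnd hx, chartEnd_apply, ContinuousLinearMap.comp_apply, h.J_I, map_neg]
    rfl

theorem IsBiHermitian.chart {x₀ x : M} (hx : x ∈ (chartAt H x₀).source)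
    {g : TangentSpace I x →L[ℝ] TangentSpace I x →L[ℝ] ℝ}
    {A B : TangentSpace I x →L[ℝ] TangentSpace I x} (h : IsBiHermitian g A B) :
    IsBiHermitian (chartMetric I x₀ x g) (chartEnd I x₀ x A) (chartEnd I x₀ x B) where
  symm v w := h.symm _ _
  pos := chartMetric_pos hx h.pos
  skew_left := chartMetric_skew hx h.skew_left
  skew_right := chartMetric_skew hx h.skew_right
  sq_left v := by
    rw [chartEnd_chartEnd hx, chartEnd_apply, ContinuousLinearMap.comp_apply, h.sq_left, map_neg,
      chartFwd_chartBwd hx]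
  sq_right v := by
    rw [chartEnd_chartEnd hx, chartEnd_apply, ContinuousLinearMap.comp_apply, h.sq_right, map_neg,
      chartFwd_chartBwd hx]

theorem chartEnd_apply_chartFwd {x₀ x : M} (hx : x ∈ (chartAt H x₀).source)
    (A : TangentSpace I x →L[ℝ] TangentSpace I x) (v : TangentSpace I x) :
    chartEnd I x₀ x A (chartFwd I x₀ x v) = chartFwd I x₀ x (A v) := by
  rw [chartEnd_apply, chartBwd_chartFwd hx]

theorem chartMetric_chartFwd {x₀ x : M} (hx : x ∈ (chartAt H x₀).source)
    (g : TangentSpace I x →L[ℝ] TangentSpace I x →L[ℝ] ℝ) (v : TangentSpace I x) :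
    chartMetric I x₀ x g (chartFwd I x₀ x v) = (g v).comp (chartBwd I x₀ x) := by
  rw [chartMetric_apply, chartBwd_chartFwd hx]

/-- A bi-Hermitian generalized complex structure in a chart. -/
theorem genChart_biHermitianJ' {x₀ x : M} (hx : x ∈ (chartAt H x₀).source)
    {g : TangentSpace I x →L[ℝ] TangentSpace I x →L[ℝ] ℝ}
    {A B : TangentSpace I x →L[ℝ] TangentSpace I x} (h : IsBiHermitian g A B)
    (u : GenTangent I x) : genChart I x₀ x (biHermitianJ' g A B u)
      = biHermitianJ' (chartMetric I x₀ x g) (chartEnd I x₀ x A) (chartEnd I x₀ x B)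
        (genChart I x₀ x u) := by
  obtain ⟨v, φ⟩ := u
  obtain ⟨w, rfl⟩ := h.surjective φ
  rw [h.biHermitianJ'_apply]
  have h1 : ∀ v w : TangentSpace I x, genChart I x₀ x (v, g w)
      = (chartFwd I x₀ x v, chartMetric I x₀ x g (chartFwd I x₀ x w)) := fun v w => by
    rw [chartMetric_chartFwd hx]
    rfl
  rw [h1, h1, (h.chart hx).biHermitianJ'_apply]
  simp only [chartEnd_apply_chartFwd hx, map_smul, map_add, map_sub, map_neg]

/-- The generalized complex structure of a complex structure in a chart. -/
theorem genChart_genOfComplex {x₀ x : M} (hx : x ∈ (chartAt H x₀).source)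
    {A : TangentSpace I x →L[ℝ] TangentSpace I x} {B : E →L[ℝ] E}
    (h : ∀ v, chartFwd I x₀ x (A v) = B (chartFwd I x₀ x v)) (u : GenTangent I x) :
    genChart I x₀ x (genOfComplex A u) = genOfComplex B (genChart I x₀ x u) := by
  rw [genOfComplex_apply, genOfComplex_apply, genChart_apply, genChart_apply]
  refine Prod.ext ?_ ?_
  · change chartFwd I x₀ x (-A u.1) = -B (chartFwd I x₀ x u.1)
    rw [map_neg, h]
  · ext v
    change u.2 (A (chartBwd I x₀ x v)) = u.2 (chartBwd I x₀ x (B v))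
    have h1 := h (chartBwd I x₀ x v)
    rw [chartFwd_chartBwd hx] at h1
    rw [← h1, chartBwd_chartFwd hx]

theorem twistorEnd_chartEnd (x₀ x : M) (A B C : TangentSpace I x →L[ℝ] TangentSpace I x)
    (a₀ a₁ : ℂ) : twistorEnd (chartEnd I x₀ x A) (chartEnd I x₀ x B) (chartEnd I x₀ x C) a₀ a₁
      = chartEnd I x₀ x (twistorEnd A B C a₀ a₁) := by
  ext v
  simp [twistorEnd, imagEnd, chartEnd_apply]

variable [I.Boundaryless]

theorem contMDiffAt_end_iff {A : ∀ x : M, TangentSpace I x →L[ℝ] TangentSpace I x} {x₀ : M} :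
    ContMDiffAt I (I.prod 𝓘(ℝ, E →L[ℝ] E)) ∞
      (fun x => TotalSpace.mk' (E →L[ℝ] E)
        (E := fun x : M => TangentSpace I x →L[ℝ] TangentSpace I x) x (A x)) x₀ ↔
      ContDiffAt ℝ ∞ (fun y => chartEnd I x₀ ((extChartAt I x₀).symm y)
        (A ((extChartAt I x₀).symm y))) (extChartAt I x₀ x₀) := by
  rw [← contMDiffAt_iff_chart (I := I) (f := fun x => chartEnd I x₀ x (A x))]
  exact Bundle.contMDiffAt_section x₀

theorem contMDiffAt_metric_iff {g : ∀ x : M, TangentSpace I x →L[ℝ] TangentSpace I x →L[ℝ] ℝ}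
    {x₀ : M} :
    ContMDiffAt I (I.prod 𝓘(ℝ, E →L[ℝ] E →L[ℝ] ℝ)) ∞
      (fun x => TotalSpace.mk' (E →L[ℝ] E →L[ℝ] ℝ)
        (E := fun x : M => TangentSpace I x →L[ℝ] TangentSpace I x →L[ℝ] Bundle.Trivial M ℝ x)
        x (g x)) x₀ ↔
      ContDiffAt ℝ ∞ (fun y => chartMetric I x₀ ((extChartAt I x₀).symm y)
        (g ((extChartAt I x₀).symm y))) (extChartAt I x₀ x₀) := by
  rw [← contMDiffAt_iff_chart (I := I) (f := fun x => chartMetric I x₀ x (g x))]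
  refine (Bundle.contMDiffAt_section x₀).trans ?_
  refine EventuallyEq.contMDiffAt_iff ?_
  filter_upwards [eventually_mem_source (H := H) x₀] with x hx
  ext v w
  change (ContinuousLinearMap.inCoordinates E (TangentSpace I) (E →L[ℝ] ℝ)
    (fun x : M => TangentSpace I x →L[ℝ] Bundle.Trivial M ℝ x) x₀ x x₀ x (g x)) v w = _
  rw [ContinuousLinearMap.inCoordinates, ContinuousLinearMap.comp_apply,
    Trivialization.continuousLinearMapAt_apply, Trivialization.linearMapAt_apply, if_pos]
  · change (ContinuousLinearMap.inCoordinates E (TangentSpace I) ℝ (Bundle.Trivial M ℝ) x₀ x x₀ x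
      (g x (chartBwd I x₀ x v))) w = _
    simp [ContinuousLinearMap.inCoordinates]
    rfl
  · simpa using hx

end ChartTensors
end

noncomputable section

/-! ### The projective line in its charts -/

namespace CP1

theorem chartAt_infty : chartAt ℂ (OnePoint.infty : CP1) = chartInv := rfl

theorem chartAt_coe (z : ℂ) : chartAt ℂ (z : CP1) = chart := rfl

/-- Homogeneous coordinates of the point with coordinate `z` in the preferred chart at `p`. -/
def lift (p : CP1) (z : ℂ) : ℂ × ℂ := p.elim (z, 1) fun _ => (1, z)

theorem lift_infty (z : ℂ) : lift OnePoint.infty z = (z, 1) := rfl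

theorem lift_coe (w z : ℂ) : lift (w : CP1) z = (1, z) := rfl

theorem lift_ne_zero (p : CP1) (z : ℂ) : (lift p z).1 ≠ 0 ∨ (lift p z).2 ≠ 0 := by
  induction p using OnePoint.rec with
  | infty => exact Or.inr one_ne_zero
  | coe w => exact Or.inl one_ne_zero

theorem extChartAt_target_eq (p : CP1) : (extChartAt 𝓘(ℝ, ℂ) p).target = univ := by
  induction p using OnePoint.rec with
  | infty => simp [extChartAt, chartAt_infty, chartInv, chart_target]
  | coe w => simp [extChartAt, chartAt_coe, chart_target]

theorem hasMFDerivAt_restrictScalars {f : CP1 → ℂ} {p : CP1} {f' : ℂ →L[ℂ] ℂ}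
    (h : HasMFDerivAt 𝓘(ℂ, ℂ) 𝓘(ℂ, ℂ) f p f') :
    HasMFDerivAt 𝓘(ℝ, ℂ) 𝓘(ℝ, ℂ) f p (f'.restrictScalars ℝ) :=
  ⟨h.1, HasFDerivWithinAt.restrictScalars ℝ h.2⟩

instance : IsManifold 𝓘(ℂ, ℂ) 1 CP1 := IsManifold.of_le (n := ω) le_top

/-- The charts are holomorphic, so their real differentials are restrictions of complex linear maps
and preserve multiplication by `i`. -/
theorem chartFwd_mul {p₀ p : CP1} (hp : p ∈ (chartAt ℂ p₀).source) (c z : ℂ) :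
    chartFwd 𝓘(ℝ, ℂ) p₀ p (c * z : ℂ) = c * chartFwd 𝓘(ℝ, ℂ) p₀ p z := by
  have h1 : MDifferentiableAt 𝓘(ℂ, ℂ) 𝓘(ℂ, ℂ) (extChartAt 𝓘(ℂ, ℂ) p₀) p :=
    mdifferentiableAt_extChartAt hp
  have h2 := hasMFDerivAt_restrictScalars h1.hasMFDerivAt
  have h3 : chartFwd 𝓘(ℝ, ℂ) p₀ p = _ := (chartFwd_eq hp).trans h2.mfderiv
  rw [h3]
  exact map_smul (mfderiv 𝓘(ℂ, ℂ) 𝓘(ℂ, ℂ) (extChartAt 𝓘(ℂ, ℂ) p₀) p : ℂ →L[ℂ] ℂ) c z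

theorem genChart_complexStructure {p₀ p : CP1} (hp : p ∈ (chartAt ℂ p₀).source)
    (u : GenTangent 𝓘(ℝ, ℂ) p) :
    genChart 𝓘(ℝ, ℂ) p₀ p (genOfComplex (complexStructureCP1 p) u)
      = genOfComplex (mulC Complex.I) (genChart 𝓘(ℝ, ℂ) p₀ p u) :=
  genChart_genOfComplex hp (fun v => chartFwd_mul hp Complex.I v) u

theorem genChart_neg_complexStructure {p₀ p : CP1} (hp : p ∈ (chartAt ℂ p₀).source)
    (u : GenTangent 𝓘(ℝ, ℂ) p) :
    genChart 𝓘(ℝ, ℂ) p₀ p (genOfComplex (-complexStructureCP1 p) u)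
      = genOfComplex (mulC (-Complex.I)) (genChart 𝓘(ℝ, ℂ) p₀ p u) := by
  refine genChart_genOfComplex hp (fun v => ?_) u
  rw [_root_.neg_apply, map_neg, mulC_apply, neg_mul]
  exact congrArg _ (chartFwd_mul hp Complex.I v)

end CP1

/-! ### Hyperkähler manifolds in a chart -/

section

variable {E : Type*} [NormedAddCommGroup E] [NormedSpace ℝ E] [FiniteDimensional ℝ E]
  {M : Type*} [TopologicalSpace M] [ChartedSpace E M] [IsManifold 𝓘(ℝ, E) ∞ M]

theorem IsKahlerian.skew {g : ContMDiffRiemannianMetric 𝓘(ℝ, E) ∞ E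
    (fun x : M => TangentSpace 𝓘(ℝ, E) x)}
    {A : ∀ x : M, TangentSpace 𝓘(ℝ, E) x →L[ℝ] TangentSpace 𝓘(ℝ, E) x} (h : IsKahlerian g A)
    (x : M) (v w : TangentSpace 𝓘(ℝ, E) x) : g.inner x (A x v) w = -g.inner x v (A x w) := by
  rw [← h.invariant x (A x v) w, h.sq, map_neg, _root_.neg_apply]

namespace HyperkahlerStructure

variable (h : HyperkahlerStructure E M)

theorem isQuaternionHermitian (x : M) :
    IsQuaternionHermitian (h.g.inner x) (h.I x) (h.J x) (h.K x) where
  symm := h.g.symm x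
  pos := h.g.pos x
  skew_I := h.kahler_I.skew x
  skew_J := h.kahler_J.skew x
  skew_K := h.kahler_K.skew x
  I_I := h.kahler_I.sq x
  J_J := h.kahler_J.sq x
  I_J v := congrArg (fun A : TangentSpace 𝓘(ℝ, E) x →L[ℝ] TangentSpace 𝓘(ℝ, E) x => A v) (h.I_J x)
  J_I v := congrArg (fun A : TangentSpace 𝓘(ℝ, E) x →L[ℝ] TangentSpace 𝓘(ℝ, E) x => A v) (h.J_I x)

/-- The complex structures of the twistor family in homogeneous coordinates. -/
theorem twistorI_chart (p : CP1) (z : ℂ) (x : M) :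
    h.twistorI ((chartAt ℂ p).symm z) x
      = twistorEnd (h.I x) (h.J x) (h.K x) (CP1.lift p z).1 (CP1.lift p z).2 := by
  induction p using OnePoint.rec with
  | infty =>
    rw [CP1.chartAt_infty, CP1.lift_infty]
    by_cases hz : z = 0
    · rw [hz, CP1.chartInv_symm_zero]
      ext v
      simp [twistorI, twistorEnd, imagEnd, twistorX, twistorY, twistorZ]
    · have hz' : ‖z‖ ^ 2 ≠ 0 := by simpa using hz
      have h1 : 1 + (‖z‖ ^ 2)⁻¹ ≠ 0 := by positivity
      have h2 : ‖z‖ ^ 2 + 1 ≠ 0 := by positivity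
      rw [CP1.chartInv_symm z hz]
      -- The coefficients are invariant under rescaling homogeneous coordinates, and `(1, z⁻¹)`
      -- represents the same point as `(z, 1)`.
      have e1 : (1 - ‖z⁻¹‖ ^ 2) / (1 + ‖z⁻¹‖ ^ 2) = twistorX z 1 := by
        rw [norm_inv, inv_pow, twistorX, norm_one]
        field_simp
      have e2 : 2 * (z⁻¹).re / (1 + ‖z⁻¹‖ ^ 2) = twistorY z 1 := by
        rw [norm_inv, inv_pow, twistorY, Complex.inv_re, Complex.normSq_eq_norm_sq, norm_one]
        field_simp
        simp
      have e3 : 2 * (z⁻¹).im / (1 + ‖z⁻¹‖ ^ 2) = twistorZ z 1 := by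
        rw [norm_inv, inv_pow, twistorZ, Complex.inv_im, Complex.normSq_eq_norm_sq, norm_one]
        field_simp
        simp
      rw [twistorEnd, imagEnd, ← e1, ← e2, ← e3]
      rfl
  | coe w =>
    rw [CP1.chartAt_coe, CP1.lift_coe, CP1.chart_symm_apply]
    have e1 : (1 - ‖z‖ ^ 2) / (1 + ‖z‖ ^ 2) = twistorX 1 z := by simp [twistorX]
    have e2 : 2 * z.re / (1 + ‖z‖ ^ 2) = twistorY 1 z := by simp [twistorY]
    have e3 : 2 * z.im / (1 + ‖z‖ ^ 2) = twistorZ 1 z := by simp [twistorZ]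
    rw [twistorEnd, imagEnd, ← e1, ← e2, ← e3]
    rfl

theorem isBiHermitian (α β : CP1) (x : M) :
    IsBiHermitian (h.g.inner x) (h.twistorI α x) (h.twistorI β x) := by
  have key : ∀ p : CP1, h.twistorI p x = twistorEnd (h.I x) (h.J x) (h.K x)
      (CP1.lift p (chartAt ℂ p p)).1 (CP1.lift p (chartAt ℂ p p)).2 := fun p => by
    conv_lhs => rw [← (chartAt ℂ p).left_inv (mem_chart_source ℂ p)]
    exact h.twistorI_chart p _ x
  rw [key α, key β]
  exact (h.isQuaternionHermitian x).isBiHermitian_twistorEnd (CP1.lift_ne_zero _ _)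
    (CP1.lift_ne_zero _ _)

/-- The metric in the preferred chart at `x₀`. -/
def chartG (x₀ : M) (e : E) : E →L[ℝ] E →L[ℝ] ℝ :=
  chartMetric 𝓘(ℝ, E) x₀ _ (h.g.inner ((extChartAt 𝓘(ℝ, E) x₀).symm e))

/-- The complex structure `I` in the preferred chart at `x₀`. -/
def chartI (x₀ : M) (e : E) : E →L[ℝ] E :=
  chartEnd 𝓘(ℝ, E) x₀ _ (h.I ((extChartAt 𝓘(ℝ, E) x₀).symm e))

/-- The complex structure `J` in the preferred chart at `x₀`. -/
def chartJ (x₀ : M) (e : E) : E →L[ℝ] E :=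
  chartEnd 𝓘(ℝ, E) x₀ _ (h.J ((extChartAt 𝓘(ℝ, E) x₀).symm e))

/-- The complex structure `K` in the preferred chart at `x₀`. -/
def chartK (x₀ : M) (e : E) : E →L[ℝ] E :=
  chartEnd 𝓘(ℝ, E) x₀ _ (h.K ((extChartAt 𝓘(ℝ, E) x₀).symm e))

theorem smooth_chartG (x₀ : M) : ContDiffAt ℝ ∞ (h.chartG x₀) (extChartAt 𝓘(ℝ, E) x₀ x₀) :=
  contMDiffAt_metric_iff.1 (h.g.contMDiff x₀)

theorem pullForm_fundForm {x₀ x : M} (hx : x ∈ (chartAt E x₀).source)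
    (A : TangentSpace 𝓘(ℝ, E) x →L[ℝ] TangentSpace 𝓘(ℝ, E) x) :
    pullForm (chartBwd 𝓘(ℝ, E) x₀ x) (twoForm (fundForm (h.g.inner x) A))
      = twoForm (fundForm (chartMetric 𝓘(ℝ, E) x₀ x (h.g.inner x)) (chartEnd 𝓘(ℝ, E) x₀ x A)) := by
  refine pullForm_twoForm _ fun v w => ?_
  change h.g.inner x (chartBwd 𝓘(ℝ, E) x₀ x (chartFwd 𝓘(ℝ, E) x₀ x _)) _ = _
  rw [chartBwd_chartFwd hx]
  rfl

theorem chart_smooth_closed {A : ∀ x : M, TangentSpace 𝓘(ℝ, E) x →L[ℝ] TangentSpace 𝓘(ℝ, E) x}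
    (hA : IsKahlerian h.g A) (x₀ : M) :
    ContDiffAt ℝ ∞ (fun e => chartEnd 𝓘(ℝ, E) x₀ _ (A ((extChartAt 𝓘(ℝ, E) x₀).symm e)))
      (extChartAt 𝓘(ℝ, E) x₀ x₀) ∧
    extD (fun e => twoForm (fundForm (h.chartG x₀ e)
      (chartEnd 𝓘(ℝ, E) x₀ _ (A ((extChartAt 𝓘(ℝ, E) x₀).symm e)))))
      (extChartAt 𝓘(ℝ, E) x₀ x₀) = 0 := by
  have hs : ∀ x₀ : M, ContDiffAt ℝ ∞
      (fun e => chartEnd 𝓘(ℝ, E) x₀ _ (A ((extChartAt 𝓘(ℝ, E) x₀).symm e)))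
      (extChartAt 𝓘(ℝ, E) x₀ x₀) := fun x₀ => contMDiffAt_end_iff.1 (hA.smooth x₀)
  have he : ∀ x₀ : M, (fun e => twoForm (fundForm (h.chartG x₀ e)
      (chartEnd 𝓘(ℝ, E) x₀ _ (A ((extChartAt 𝓘(ℝ, E) x₀).symm e)))))
      =ᶠ[𝓝 (extChartAt 𝓘(ℝ, E) x₀ x₀)] formInChart 𝓘(ℝ, E)
        (fun x : M => twoForm (fundForm (h.g.inner x) (A x))) x₀ := by
    intro x₀
    filter_upwards [eventually_mem_target (I := 𝓘(ℝ, E)) x₀] with e he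
    rw [formInChart_eq _ he, h.pullForm_fundForm (chart_symm_mem_source he)]
    rfl
  have hv : ∀ x₀ : M, VSmoothAt (formInChart 𝓘(ℝ, E)
      (fun x : M => twoForm (fundForm (h.g.inner x) (A x))) x₀) (extChartAt 𝓘(ℝ, E) x₀ x₀) :=
    fun x₀ => (vsmoothAt_twoForm (h.smooth_chartG x₀) (hs x₀)).congr (he x₀)
  refine ⟨hs x₀, ?_⟩
  have h1 := (closedFormOn_iff fun x _ => hv x).1 hA.closed x₀ (mem_univ x₀)
  rw [extD] at h1 ⊢
  rw [← h1]
  congr 1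
  exact funext fun v => (he x₀).vderiv_eq v

theorem isChartHyperkahler (x₀ : M) : IsChartHyperkahler (h.chartG x₀) (h.chartI x₀)
    (h.chartJ x₀) (h.chartK x₀) (extChartAt 𝓘(ℝ, E) x₀ x₀) where
  smooth_g := h.smooth_chartG x₀
  smooth_I := (h.chart_smooth_closed h.kahler_I x₀).1
  smooth_J := (h.chart_smooth_closed h.kahler_J x₀).1
  smooth_K := (h.chart_smooth_closed h.kahler_K x₀).1
  hermitian := by
    filter_upwards [eventually_mem_target (I := 𝓘(ℝ, E)) x₀] with e he
    exact (h.isQuaternionHermitian _).chart (chart_symm_mem_source he)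
  closed_I := (h.chart_smooth_closed h.kahler_I x₀).2
  closed_J := (h.chart_smooth_closed h.kahler_J x₀).2
  closed_K := (h.chart_smooth_closed h.kahler_K x₀).2

end HyperkahlerStructure

end
end

noncomputable section

/-! ### Local spinors for the twistor structures -/

namespace CP1

theorem conj_lift_fst (p : CP1) (z : ℂ) :
    starRingEnd ℂ (lift p z).1 = (lift p (starRingEnd ℂ z)).1 := by
  induction p using OnePoint.rec with
  | infty => rfl
  | coe w => exact map_one _

theorem conj_lift_snd (p : CP1) (z : ℂ) :
    starRingEnd ℂ (lift p z).2 = (lift p (starRingEnd ℂ z)).2 := by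
  induction p using OnePoint.rec with
  | infty => exact map_one _
  | coe w => rfl

/-- In either chart one homogeneous coordinate is constantly `1`, so the complementary pair can be
chosen constant, in particular basic. -/
theorem exists_lift_complement (p : CP1) :
    ∃ b₀ b₁ : ℂ, ∀ z, (lift p z).2 * b₀ + (lift p z).1 * b₁ = 1 := by
  induction p using OnePoint.rec with
  | infty => exact ⟨1, 0, fun z => by simp [lift_infty]⟩
  | coe w => exact ⟨0, 1, fun z => by simp [lift_coe]⟩

theorem contDiffAt_lift {F : Type*} [NormedAddCommGroup F] [NormedSpace ℝ F] {s : F → ℂ} {y : F}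
    (hs : ContDiffAt ℝ ∞ s y) (p : CP1) :
    ContDiffAt ℝ ∞ (fun z => (lift p (s z)).1) y ∧
      ContDiffAt ℝ ∞ (fun z => (lift p (s z)).2) y := by
  induction p using OnePoint.rec with
  | infty => exact ⟨hs, contDiffAt_const⟩
  | coe w => exact ⟨contDiffAt_const, hs⟩

theorem isBasicFun_lift {F : Type*} [NormedAddCommGroup F] [NormedSpace ℝ F]
    [FiniteDimensional ℝ F] {θ : CForm F} {s : F → ℂ} {y : F}
    (hs : IsBasicFun θ s y) (p : CP1) :
    IsBasicFun θ (fun z => (lift p (s z)).1) y ∧ IsBasicFun θ (fun z => (lift p (s z)).2) y := by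
  induction p using OnePoint.rec with
  | infty => exact ⟨hs, IsBasicFun.const _⟩
  | coe w => exact ⟨IsBasicFun.const _, hs⟩

end CP1

/-- The antipodal map of the twistor line. It presents `𝒥` as a structure of the same kind as `𝒥'`,
which provides closed spinors for both. -/
theorem neg_twistorEnd {V : Type*} [AddCommGroup V] [Module ℝ V] [TopologicalSpace V]
    [IsTopologicalAddGroup V] [ContinuousSMul ℝ V] (I J K : V →L[ℝ] V) (b₀ b₁ : ℂ) :
    -twistorEnd I J K b₀ b₁
      = twistorEnd I J K (starRingEnd ℂ (-b₁)) (starRingEnd ℂ b₀) := by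
  have e1 : twistorX (starRingEnd ℂ (-b₁)) (starRingEnd ℂ b₀) = -twistorX b₀ b₁ := by
    simp only [twistorX, RCLike.norm_conj, norm_neg]
    rw [add_comm (‖b₁‖ ^ 2), ← neg_div, neg_sub]
  have e2 : twistorY (starRingEnd ℂ (-b₁)) (starRingEnd ℂ b₀) = -twistorY b₀ b₁ := by
    simp only [twistorY, RCLike.norm_conj, norm_neg, Complex.conj_conj]
    rw [add_comm (‖b₁‖ ^ 2), ← neg_div]
    congr 1
    simp
    ring
  have e3 : twistorZ (starRingEnd ℂ (-b₁)) (starRingEnd ℂ b₀) = -twistorZ b₀ b₁ := by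
    simp only [twistorZ, RCLike.norm_conj, norm_neg, Complex.conj_conj]
    rw [add_comm (‖b₁‖ ^ 2), ← neg_div]
    congr 1
    simp
    ring
  rw [twistorEnd, twistorEnd, e1, e2, e3]
  simp only [imagEnd, neg_smul, neg_add]

/-! ### Annihilators of local spinors. -/

section LocalSpinor

variable {E : Type*} [NormedAddCommGroup E] [NormedSpace ℝ E] [FiniteDimensional ℝ E]
  {g : E → E →L[ℝ] E →L[ℝ] ℝ} {I J K : E → E →L[ℝ] E}

/-- The annihilator of the local spinor. -/
theorem cliffordAct_chartSpinor_iff {n : ℕ} (hn : Module.finrank ℝ E = 4 * n)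
    {a₀ a₁ g₀ g₁ s t : E × ℂ × ℂ → ℂ} {z : E × ℂ × ℂ}
    (hz : IsQuaternionHermitian (g z.1) (I z.1) (J z.1) (K z.1)) (ha : a₀ z ≠ 0 ∨ a₁ z ≠ 0)
    (hg : g₀ z ≠ 0 ∨ g₁ z ≠ 0) {κ₁ κ₂ : ℂ} (h₁ : κ₁ = Complex.I ∨ κ₁ = -Complex.I)
    (h₂ : κ₂ = Complex.I ∨ κ₂ = -Complex.I) {σ τ : ℂ →L[ℝ] ℂ}
    (hs : fderiv ℝ s z = σ.comp (.comp (.fst ℝ ℂ ℂ) (.snd ℝ E (ℂ × ℂ))))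
    (ht : fderiv ℝ t z = τ.comp (.comp (.snd ℝ ℂ ℂ) (.snd ℝ E (ℂ × ℂ))))
    (hσ : ∀ z, σ (κ₁ * z) = Complex.I * σ z) (hτ : ∀ z, τ (κ₂ * z) = Complex.I * τ z)
    (hσ₁ : σ 1 ≠ 0) (hτ₁ : τ 1 ≠ 0) (u v : (E × ℂ × ℂ) × (E × ℂ × ℂ →L[ℝ] ℝ)) :
    cliffordAct u v (chartSpinor g I J K n a₀ a₁ g₀ g₁ s t z) = 0 ↔
      InEigen (extendEnd (biHermitianJ' (g z.1) (twistorEnd (I z.1) (J z.1) (K z.1) (a₀ z) (a₁ z))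
        (twistorEnd (I z.1) (J z.1) (K z.1) (starRingEnd ℂ (g₁ z)) (starRingEnd ℂ (g₀ z)))) κ₁ κ₂)
        u v := by
  have hg' : starRingEnd ℂ (g₁ z) ≠ 0 ∨ starRingEnd ℂ (g₀ z) ≠ 0 := by
    simpa [or_comm] using hg
  have key := hz.cliffordAct_prodSpinor_iff ha hg hn rfl rfl (hz.isBiHermitian_twistorEnd ha hg')
    h₁ h₂ hσ hτ hσ₁ hτ₁ u v
  rw [← hs, ← ht] at key
  rw [chartSpinor, ← hz.form_spinQuat]
  exact key

theorem hasFDerivAt_fst_snd (z : E × ℂ × ℂ) : HasFDerivAt (fun z : E × ℂ × ℂ => z.2.1)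
    ((ContinuousLinearMap.fst ℝ ℂ ℂ).comp (.snd ℝ E (ℂ × ℂ))) z :=
  ((ContinuousLinearMap.fst ℝ ℂ ℂ).comp (.snd ℝ E (ℂ × ℂ))).hasFDerivAt

theorem hasFDerivAt_snd_snd (z : E × ℂ × ℂ) : HasFDerivAt (fun z : E × ℂ × ℂ => z.2.2)
    ((ContinuousLinearMap.snd ℝ ℂ ℂ).comp (.snd ℝ E (ℂ × ℂ))) z :=
  ((ContinuousLinearMap.snd ℝ ℂ ℂ).comp (.snd ℝ E (ℂ × ℂ))).hasFDerivAt

theorem contDiffAt_fst_snd (z : E × ℂ × ℂ) :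
    ContDiffAt ℝ ∞ (fun z : E × ℂ × ℂ => z.2.1) z :=
  ((ContinuousLinearMap.fst ℝ ℂ ℂ).comp (.snd ℝ E (ℂ × ℂ))).contDiff.contDiffAt

theorem contDiffAt_snd_snd (z : E × ℂ × ℂ) :
    ContDiffAt ℝ ∞ (fun z : E × ℂ × ℂ => z.2.2) z :=
  ((ContinuousLinearMap.snd ℝ ℂ ℂ).comp (.snd ℝ E (ℂ × ℂ))).contDiff.contDiffAt

/-- Existence of closed local spinors: the coordinate `t` on the second factor is holomorphic
or antiholomorphic, according to the value of `κ`. -/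
theorem exists_chartSpinor {n : ℕ} (hn : Module.finrank ℝ E = 4 * n) {y : E × ℂ × ℂ}
    (h : IsChartHyperkahler g I J K y.1) (p : CP1) {κ : ℂ}
    (hκ : κ = Complex.I ∨ κ = -Complex.I) {τ : ℂ →L[ℝ] ℂ}
    (hτ : ∀ z, τ (κ * z) = Complex.I * τ z) (hτ₁ : τ 1 ≠ 0) {g₀ g₁ : ℂ → ℂ}
    (hg : ∀ z, g₀ z ≠ 0 ∨ g₁ z ≠ 0)
    (hb : ∀ θ : CForm (E × ℂ × ℂ), IsBasicFun θ (fun z : E × ℂ × ℂ => τ z.2.2) y →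
      IsBasicFun θ (fun z : E × ℂ × ℂ => g₀ z.2.2) y ∧
        IsBasicFun θ (fun z : E × ℂ × ℂ => g₁ z.2.2) y) :
    ∃ Ψ : E × ℂ × ℂ → CForm (E × ℂ × ℂ), VSmoothAt Ψ y ∧ extD Ψ y = 0 ∧
      ∀ᶠ z in 𝓝 y, ∀ u v, cliffordAct u v (Ψ z) = 0 ↔
        InEigen (extendEnd (biHermitianJ' (g z.1)
          (twistorEnd (I z.1) (J z.1) (K z.1) (CP1.lift p z.2.1).1 (CP1.lift p z.2.1).2)
          (twistorEnd (I z.1) (J z.1) (K z.1) (starRingEnd ℂ (g₁ z.2.2))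
            (starRingEnd ℂ (g₀ z.2.2)))) Complex.I κ) u v := by
  let s : E × ℂ × ℂ → ℂ := fun z => z.2.1
  let t : E × ℂ × ℂ → ℂ := fun z => τ z.2.2
  have hs : ContDiffAt ℝ ∞ s y := contDiffAt_fst_snd y
  have ht : ContDiffAt ℝ ∞ t y := τ.contDiff.contDiffAt.comp y (contDiffAt_snd_snd y)
  -- `s` and `t` are basic because `ds` and `dt` already occur in `θ = ds ∧ dt`.
  have bs : IsBasicFun (oneForm (fderiv ℝ s y) * oneForm (fderiv ℝ t y)) s y :=
    ⟨hs, oneForm_mul_left _ _⟩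
  have bt : IsBasicFun (oneForm (fderiv ℝ s y) * oneForm (fderiv ℝ t y)) t y :=
    ⟨ht, oneForm_mul_right _ _⟩
  obtain ⟨b₀, b₁, hb₁⟩ := CP1.exists_lift_complement p
  have ba := CP1.isBasicFun_lift bs p
  have bg := hb _ bt
  have key := chartSpinor_smooth_closed hn h hs ht ba.1 ba.2 bg.1 bg.2 (IsBasicFun.const b₀)
    (IsBasicFun.const b₁) (Eventually.of_forall fun z => hb₁ _)
  refine ⟨_, key.1, key.2, ?_⟩
  have hq : ∀ᶠ z : E × ℂ × ℂ in 𝓝 y, IsQuaternionHermitian (g z.1) (I z.1) (J z.1) (K z.1) :=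
    continuousAt_fst.eventually h.hermitian
  filter_upwards [hq] with z hz u v
  exact cliffordAct_chartSpinor_iff hn hz (CP1.lift_ne_zero p _) (hg _) (Or.inl rfl) hκ
    (σ := .id ℝ ℂ) (hasFDerivAt_fst_snd z).fderiv
    (τ.hasFDerivAt.comp z (hasFDerivAt_snd_snd z)).fderiv (fun _ => rfl) hτ one_ne_zero hτ₁ u v

end LocalSpinor
end

noncomputable section

/-! ### The generalized complex structures of the twistor family -/

theorem pairing_orthogonal {E : Type*} [NormedAddCommGroup E] [NormedSpace ℝ E] {H : Type*}
    [TopologicalSpace H] {I : ModelWithCorners ℝ E H} {M : Type*} [TopologicalSpace M]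
    [ChartedSpace H M] {x : M} {J : GenTangent I x →ₗ[ℝ] GenTangent I x}
    (hJ : ∀ u v, pairing I x (J u) v = -pairing I x u (J v)) (hJ' : ∀ u, J (J u) = -u)
    (u v : GenTangent I x) : pairing I x (J u) (J v) = pairing I x u v := by
  rw [hJ, hJ', map_neg, neg_neg]

section

variable {E : Type*} [NormedAddCommGroup E] [NormedSpace ℝ E] [FiniteDimensional ℝ E]
  {M : Type*} [TopologicalSpace M] [ChartedSpace E M] [IsManifold 𝓘(ℝ, E) ∞ M]

namespace HyperkahlerStructure

variable (h : HyperkahlerStructure E M)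

theorem twistorJ_eq (p : M × CP1 × CP1) : h.twistorJ p = extendEnd (V := TangentSpace 𝓘(ℝ, E) p.1)
    (biHermitianJ' (h.g.inner p.1) (h.twistorI p.2.1 p.1) (-h.twistorI p.2.2 p.1))
    Complex.I Complex.I := by
  rw [← (h.isBiHermitian p.2.1 p.2.2 p.1).biHermitianJ_eq]
  refine (genProd_eq_prodEnd _ _).trans ?_
  exact congrArg (prodEnd (V := TangentSpace 𝓘(ℝ, E) p.1) (W := ℂ × ℂ) (h.familyJ p.2.1 p.2.2 p.1))
    (genProd_eq_prodEnd (I := 𝓘(ℝ, ℂ)) (I' := 𝓘(ℝ, ℂ)) (x := p.2.1) (y := p.2.2) _ _)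

theorem neg_mulC : -mulC Complex.I = mulC (-Complex.I) := by
  refine ContinuousLinearMap.ext fun z => ?_
  rw [_root_.neg_apply, mulC_apply, mulC_apply, neg_mul]

theorem twistorJ'_eq (p : M × CP1 × CP1) :
    h.twistorJ' p = extendEnd (V := TangentSpace 𝓘(ℝ, E) p.1)
    (biHermitianJ' (h.g.inner p.1) (h.twistorI p.2.1 p.1) (h.twistorI p.2.2 p.1))
    Complex.I (-Complex.I) := by
  rw [extendEnd, ← neg_mulC]
  refine (genProd_eq_prodEnd _ _).trans ?_
  exact congrArg (prodEnd (V := TangentSpace 𝓘(ℝ, E) p.1) (W := ℂ × ℂ) (h.familyJ' p.2.1 p.2.2 p.1))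
    (genProd_eq_prodEnd (I := 𝓘(ℝ, ℂ)) (I' := 𝓘(ℝ, ℂ)) (x := p.2.1) (y := p.2.2) _ _)

theorem isLinGenComplex_twistorJ (p : M × CP1 × CP1) :
    IsLinGenComplex (V := TangentSpace 𝓘(ℝ, E) p.1 × ℂ × ℂ) (h.twistorJ p) := by
  rw [h.twistorJ_eq]
  exact (h.isBiHermitian p.2.1 p.2.2 p.1).neg_right.isLinGenComplex.extendEnd (Or.inl rfl)
    (Or.inl rfl)

theorem isLinGenComplex_twistorJ' (p : M × CP1 × CP1) :
    IsLinGenComplex (V := TangentSpace 𝓘(ℝ, E) p.1 × ℂ × ℂ) (h.twistorJ' p) := by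
  rw [h.twistorJ'_eq]
  exact (h.isBiHermitian p.2.1 p.2.2 p.1).isLinGenComplex.extendEnd (Or.inl rfl) (Or.inr rfl)

theorem twistorJ_comm (p : M × CP1 × CP1) (u : GenTangent (twistorModel E) p) :
    h.twistorJ p (h.twistorJ' p u) = h.twistorJ' p (h.twistorJ p u) := by
  rw [h.twistorJ_eq, h.twistorJ'_eq]
  exact extendEnd_comm (h.isBiHermitian p.2.1 p.2.2 p.1).comm _ _ _ _ _

theorem hasSignature {n : ℕ} (hn : Module.finrank ℝ E = 4 * n) :
    HasSignature (twistorModel E) h.twistorJ h.twistorJ' (8 * n + 4) 4 := by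
  intro p
  have key := signature_extendEnd (h.isBiHermitian p.2.1 p.2.2 p.1) (n := n) hn
  rw [← h.twistorJ_eq, ← h.twistorJ'_eq] at key
  exact key

/-- The structure `𝒥'` in the preferred chart at `p`. -/
def chartTwistorJ' (p : M × CP1 × CP1) (y : E × ℂ × ℂ) :
    (E × ℂ × ℂ) × (E × ℂ × ℂ →L[ℝ] ℝ) →ₗ[ℝ] (E × ℂ × ℂ) × (E × ℂ × ℂ →L[ℝ] ℝ) :=
  extendEnd (biHermitianJ' (h.chartG p.1 y.1)
    (twistorEnd (h.chartI p.1 y.1) (h.chartJ p.1 y.1) (h.chartK p.1 y.1)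
      (CP1.lift p.2.1 y.2.1).1 (CP1.lift p.2.1 y.2.1).2)
    (twistorEnd (h.chartI p.1 y.1) (h.chartJ p.1 y.1) (h.chartK p.1 y.1)
      (CP1.lift p.2.2 y.2.2).1 (CP1.lift p.2.2 y.2.2).2)) Complex.I (-Complex.I)

/-- The structure `𝒥` in the preferred chart at `p`. -/
def chartTwistorJ (p : M × CP1 × CP1) (y : E × ℂ × ℂ) :
    (E × ℂ × ℂ) × (E × ℂ × ℂ →L[ℝ] ℝ) →ₗ[ℝ] (E × ℂ × ℂ) × (E × ℂ × ℂ →L[ℝ] ℝ) :=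
  extendEnd (biHermitianJ' (h.chartG p.1 y.1)
    (twistorEnd (h.chartI p.1 y.1) (h.chartJ p.1 y.1) (h.chartK p.1 y.1)
      (CP1.lift p.2.1 y.2.1).1 (CP1.lift p.2.1 y.2.1).2)
    (-twistorEnd (h.chartI p.1 y.1) (h.chartJ p.1 y.1) (h.chartK p.1 y.1)
      (CP1.lift p.2.2 y.2.2).1 (CP1.lift p.2.2 y.2.2).2)) Complex.I Complex.I

theorem mem_target_prod {p : M × CP1 × CP1} {y : E × ℂ × ℂ}
    (hy : y ∈ (extChartAt (twistorModel E) p).target) :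
    y.1 ∈ (extChartAt 𝓘(ℝ, E) p.1).target := by
  rw [extChartAt_prod] at hy
  exact hy.1

theorem chart_symm_mem (p : CP1) (z : ℂ) : (chartAt ℂ p).symm z ∈ (chartAt ℂ p).source := by
  apply (chartAt ℂ p).map_target
  have := CP1.extChartAt_target_eq p
  simp only [extChartAt, mfld_simps] at this
  rw [this]
  trivial

theorem twistorEnd_chart (p : M × CP1 × CP1) (y : E × ℂ × ℂ) (q : CP1) (z : ℂ) :
    twistorEnd (h.chartI p.1 y.1) (h.chartJ p.1 y.1) (h.chartK p.1 y.1)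
      (CP1.lift q z).1 (CP1.lift q z).2 = chartEnd 𝓘(ℝ, E) p.1 _
        (h.twistorI ((chartAt ℂ q).symm z) ((extChartAt 𝓘(ℝ, E) p.1).symm y.1)) := by
  rw [h.twistorI_chart, ← twistorEnd_chartEnd]
  rfl

theorem hasChartExpr_twistorJ' (p : M × CP1 × CP1) :
    HasChartExpr h.twistorJ' p (h.chartTwistorJ' p) := by
  filter_upwards [eventually_mem_target (I := twistorModel E) p] with y hy u
  have hx := chart_symm_mem_source (mem_target_prod hy)
  rw [chartTwistorJ', h.twistorEnd_chart, h.twistorEnd_chart]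
  exact genChart_genProd (I := 𝓘(ℝ, E)) (I' := 𝓘(ℝ, ℂ).prod 𝓘(ℝ, ℂ)) (x₀ := p.1) (y₀ := p.2)
    hx (by
      rw [prodChartedSpace_chartAt]
      exact ⟨chart_symm_mem _ _, chart_symm_mem _ _⟩)
    (genChart_biHermitianJ' hx (h.isBiHermitian _ _ _))
    (genChart_genProd (I := 𝓘(ℝ, ℂ)) (I' := 𝓘(ℝ, ℂ)) (x₀ := p.2.1) (y₀ := p.2.2)
      (chart_symm_mem _ _) (chart_symm_mem _ _)
      (CP1.genChart_complexStructure (chart_symm_mem _ _))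
      (CP1.genChart_neg_complexStructure (chart_symm_mem _ _))) u

theorem chartEnd_neg {x₀ x : M} (A : TangentSpace 𝓘(ℝ, E) x →L[ℝ] TangentSpace 𝓘(ℝ, E) x) :
    chartEnd 𝓘(ℝ, E) x₀ x (-A) = -chartEnd 𝓘(ℝ, E) x₀ x A := by
  ext v
  simp [chartEnd_apply]

theorem hasChartExpr_twistorJ (p : M × CP1 × CP1) :
    HasChartExpr h.twistorJ p (h.chartTwistorJ p) := by
  filter_upwards [eventually_mem_target (I := twistorModel E) p] with y hy u
  have hx := chart_symm_mem_source (mem_target_prod hy)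
  rw [chartTwistorJ, h.twistorEnd_chart, h.twistorEnd_chart, ← chartEnd_neg]
  exact genChart_genProd (I := 𝓘(ℝ, E)) (I' := 𝓘(ℝ, ℂ).prod 𝓘(ℝ, ℂ)) (x₀ := p.1) (y₀ := p.2)
    hx (by
      rw [prodChartedSpace_chartAt]
      exact ⟨chart_symm_mem _ _, chart_symm_mem _ _⟩)
    (fun u => by
      rw [familyJ, (h.isBiHermitian _ _ _).biHermitianJ_eq]
      exact genChart_biHermitianJ' hx (h.isBiHermitian _ _ _).neg_right u)
    (genChart_genProd (I := 𝓘(ℝ, ℂ)) (I' := 𝓘(ℝ, ℂ)) (x₀ := p.2.1) (y₀ := p.2.2)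
      (chart_symm_mem _ _) (chart_symm_mem _ _)
      (CP1.genChart_complexStructure (chart_symm_mem _ _))
      (CP1.genChart_complexStructure (chart_symm_mem _ _))) u

theorem contDiffAt_chartTwistorEnd (p : M × CP1 × CP1) (q : CP1) {s : E × ℂ × ℂ → ℂ}
    (hs : ContDiffAt ℝ ∞ s (extChartAt (twistorModel E) p p)) :
    ContDiffAt ℝ ∞ (fun y : E × ℂ × ℂ => twistorEnd (h.chartI p.1 y.1) (h.chartJ p.1 y.1)
      (h.chartK p.1 y.1) (CP1.lift q (s y)).1 (CP1.lift q (s y)).2)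
      (extChartAt (twistorModel E) p p) := by
  have hc := h.isChartHyperkahler p.1
  exact contDiffAt_twistorEnd
    (ContDiffAt.comp (extChartAt (twistorModel E) p p) hc.smooth_I contDiffAt_fst)
    (ContDiffAt.comp (extChartAt (twistorModel E) p p) hc.smooth_J contDiffAt_fst)
    (ContDiffAt.comp (extChartAt (twistorModel E) p p) hc.smooth_K contDiffAt_fst)
    (CP1.contDiffAt_lift hs q).1 (CP1.contDiffAt_lift hs q).2 (CP1.lift_ne_zero _ _)

set_option synthInstance.maxHeartbeats 200000 in
theorem contDiffAt_chartG (p : M × CP1 × CP1) :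
    ContDiffAt ℝ ∞ (fun y : E × ℂ × ℂ => h.chartG p.1 y.1) (extChartAt (twistorModel E) p p) :=
  ContDiffAt.comp (g := h.chartG p.1) (f := Prod.fst) (extChartAt (twistorModel E) p p)
    (h.smooth_chartG p.1) contDiffAt_fst

theorem isBiHermitian_chart (p : M × CP1 × CP1) (a b : CP1) (z w : ℂ) :
    IsBiHermitian (h.chartG p.1 (extChartAt (twistorModel E) p p).1)
      (twistorEnd (h.chartI p.1 (extChartAt (twistorModel E) p p).1)
        (h.chartJ p.1 (extChartAt (twistorModel E) p p).1)
        (h.chartK p.1 (extChartAt (twistorModel E) p p).1) (CP1.lift a z).1 (CP1.lift a z).2)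
      (twistorEnd (h.chartI p.1 (extChartAt (twistorModel E) p p).1)
        (h.chartJ p.1 (extChartAt (twistorModel E) p p).1)
        (h.chartK p.1 (extChartAt (twistorModel E) p p).1) (CP1.lift b w).1 (CP1.lift b w).2) :=
  (h.isChartHyperkahler p.1).hermitian.self_of_nhds.isBiHermitian_twistorEnd
    (CP1.lift_ne_zero _ _) (CP1.lift_ne_zero _ _)

theorem isGenAlmostComplex_twistorJ' : IsGenAlmostComplex (twistorModel E) h.twistorJ' where
  smooth _ hU _ hu := smoothSectionOn_of_hasChartExpr h.hasChartExpr_twistorJ'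
    (fun p _ hu => contDiffAt_extendEnd (h.contDiffAt_chartG p)
      (h.contDiffAt_chartTwistorEnd p p.2.1 (contDiffAt_fst_snd _))
      (h.contDiffAt_chartTwistorEnd p p.2.2 (contDiffAt_snd_snd _))
      (h.isBiHermitian_chart p _ _ _ _) _ _ hu) hU hu
  orthogonal p :=
    pairing_orthogonal (h.isLinGenComplex_twistorJ' p).skew (h.isLinGenComplex_twistorJ' p).sq
  sq p u := (h.isLinGenComplex_twistorJ' p).sq u

theorem isGenAlmostComplex_twistorJ : IsGenAlmostComplex (twistorModel E) h.twistorJ where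
  smooth _ hU _ hu := smoothSectionOn_of_hasChartExpr h.hasChartExpr_twistorJ
    (fun p _ hu => contDiffAt_extendEnd (h.contDiffAt_chartG p)
      (h.contDiffAt_chartTwistorEnd p p.2.1 (contDiffAt_fst_snd _))
      (h.contDiffAt_chartTwistorEnd p p.2.2 (contDiffAt_snd_snd _)).neg
      (h.isBiHermitian_chart p _ _ _ _).neg_right _ _ hu) hU hu
  orthogonal p :=
    pairing_orthogonal (h.isLinGenComplex_twistorJ p).skew (h.isLinGenComplex_twistorJ p).sq
  sq p u := (h.isLinGenComplex_twistorJ p).sq u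

theorem isGenComplex_twistorJ' {n : ℕ} (hn : Module.finrank ℝ E = 4 * n) :
    IsGenComplex (twistorModel E) h.twistorJ' := by
  refine ⟨h.isGenAlmostComplex_twistorJ',
    courantInvolutive_of_hasChartExpr h.hasChartExpr_twistorJ' fun p => ?_⟩
  -- For `𝒥'` the second line carries `-i`, so the spinor depends on the conjugate coordinate. The
  -- coordinates `(g₀, g₁)` are the conjugated lift in reversed order, and the conjugates `(ḡ₁, ḡ₀)`
  -- give back `β`.
  have key := exists_chartSpinor hn (y := extChartAt (twistorModel E) p p)
    (h.isChartHyperkahler p.1) p.2.1 (κ := -Complex.I) (Or.inr rfl)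
    (τ := (Complex.conjCLE : ℂ →L[ℝ] ℂ)) (fun z => by simp) (by simp)
    (g₀ := fun w => (CP1.lift p.2.2 (starRingEnd ℂ w)).2)
    (g₁ := fun w => (CP1.lift p.2.2 (starRingEnd ℂ w)).1)
    (fun z => (CP1.lift_ne_zero _ _).symm)
    (fun θ hθ => (CP1.isBasicFun_lift hθ p.2.2).symm)
  simp only [CP1.conj_lift_fst, CP1.conj_lift_snd, Complex.conj_conj] at key
  exact key

theorem isGenComplex_twistorJ {n : ℕ} (hn : Module.finrank ℝ E = 4 * n) :
    IsGenComplex (twistorModel E) h.twistorJ := by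
  refine ⟨h.isGenAlmostComplex_twistorJ,
    courantInvolutive_of_hasChartExpr h.hasChartExpr_twistorJ fun p => ?_⟩
  -- For `𝒥` take `(g₀, g₁) = (b₀, -b₁)` with `(b₀, b₁)` the lift of `β`: then `(ḡ₁, ḡ₀)` represents
  -- the antipode of `β`, and the dependence is holomorphic, matching `+i` on the second line.
  have key := exists_chartSpinor hn (y := extChartAt (twistorModel E) p p)
    (h.isChartHyperkahler p.1) p.2.1 (κ := Complex.I) (Or.inl rfl)
    (τ := .id ℝ ℂ) (fun z => rfl) one_ne_zero
    (g₀ := fun w => (CP1.lift p.2.2 w).1)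
    (g₁ := fun w => -(CP1.lift p.2.2 w).2)
    (fun z => by simpa using CP1.lift_ne_zero p.2.2 z)
    (fun θ hθ => ⟨(CP1.isBasicFun_lift hθ p.2.2).1, (CP1.isBasicFun_lift hθ p.2.2).2.neg⟩)
  simp only [← neg_twistorEnd] at key
  exact key

theorem isGenPseudoKahler {n : ℕ} (hn : Module.finrank ℝ E = 4 * n) :
    IsGenPseudoKahler (twistorModel E) h.twistorJ h.twistorJ' where
  left := h.isGenComplex_twistorJ hn
  right := h.isGenComplex_twistorJ' hn
  commute := h.twistorJ_comm
  symm p := linGenMetric_isSymm (h.isLinGenComplex_twistorJ p) (h.isLinGenComplex_twistorJ' p)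
    (h.twistorJ_comm p)
  nondegenerate p := linGenMetric_nondegenerate (h.isLinGenComplex_twistorJ p)
    (h.isLinGenComplex_twistorJ' p)

end HyperkahlerStructure

end
end

noncomputable section

/-! ### The pure spinor -/

namespace CP1

theorem coord_coe (z : ℂ) : coord (z : CP1) = z := rfl

theorem coordInv_coe (z : ℂ) : coordInv (z : CP1) = z⁻¹ := by
  by_cases hz : z = 0
  · simp [coordInv, invFun_coe, hz, coord]
  · simp [coordInv, invFun_coe, hz, coord_coe]

theorem coordInv_infty : coordInv OnePoint.infty = 0 := by
  rw [coordInv, invFun_infty, coord_coe]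

theorem chart_symm_coord {p : CP1} (hp : p ≠ OnePoint.infty) : chart.symm (coord p) = p := by
  induction p using OnePoint.rec with
  | infty => exact absurd rfl hp
  | coe z => rfl

theorem chartInv_symm_coordInv {p : CP1} (hp : p ≠ ((0 : ℂ) : CP1)) :
    chartInv.symm (coordInv p) = p := by
  induction p using OnePoint.rec with
  | infty => rw [coordInv_infty, chartInv_symm_zero]
  | coe z =>
    have hz : z ≠ 0 := fun h => hp (by rw [h])
    rw [coordInv_coe, chartInv_symm _ (inv_ne_zero hz), inv_inv]

theorem coordInv_chartInv_symm (z : ℂ) : coordInv (chartInv.symm z) = z := by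
  by_cases hz : z = 0
  · rw [hz, chartInv_symm_zero, coordInv_infty]
  · rw [chartInv_symm z hz, coordInv_coe, inv_inv]

theorem hasDerivAt_coord {p : CP1} (hp : p ≠ OnePoint.infty) (z : ℂ) :
    ContDiffAt ℝ ∞ (fun w => coord ((chartAt ℂ p).symm w)) z ∧
      HasDerivAt (fun w => coord ((chartAt ℂ p).symm w)) 1 z := by
  induction p using OnePoint.rec with
  | infty => exact absurd rfl hp
  | coe z => exact ⟨contDiffAt_id, hasDerivAt_id _⟩

/-- The preferred chart may be `z` or `z⁻¹`. Only the non-vanishing of the derivative matters, as it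
keeps `dγ` non-zero. -/
theorem exists_hasDerivAt_coordInv {p : CP1} (hp : p ≠ ((0 : ℂ) : CP1)) :
    ∃ c : ℂ, c ≠ 0 ∧
      ContDiffAt ℝ ∞ (fun w => coordInv ((chartAt ℂ p).symm w)) (chartAt ℂ p p) ∧
      HasDerivAt (fun w => coordInv ((chartAt ℂ p).symm w)) c (chartAt ℂ p p) := by
  induction p using OnePoint.rec with
  | infty =>
    rw [chartAt_infty]
    simp only [coordInv_chartInv_symm]
    exact ⟨1, one_ne_zero, contDiffAt_id, hasDerivAt_id _⟩
  | coe z =>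
    have hz : z ≠ 0 := fun h => hp (by rw [h])
    rw [chartAt_coe, chart_coe]
    simp only [chart_symm_apply, coordInv_coe]
    exact ⟨_, neg_ne_zero.2 (inv_ne_zero (pow_ne_zero 2 hz)), contDiffAt_inv ℝ hz, hasDerivAt_inv hz⟩

theorem contMDiffAt_coord {p : CP1} (hp : p ≠ OnePoint.infty) :
    ContMDiffAt 𝓘(ℝ, ℂ) 𝓘(ℝ, ℂ) ∞ coord p :=
  contMDiffAt_iff_chart.2 (hasDerivAt_coord hp _).1

theorem contMDiffAt_coordInv {p : CP1} (hp : p ≠ ((0 : ℂ) : CP1)) :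
    ContMDiffAt 𝓘(ℝ, ℂ) 𝓘(ℝ, ℂ) ∞ coordInv p := by
  obtain ⟨_, _, hc, _⟩ := exists_hasDerivAt_coordInv hp
  exact contMDiffAt_iff_chart.2 hc

end CP1

/-! ### The explicit spinor in the charts of the product manifold. -/

section

variable {E : Type*} [NormedAddCommGroup E] [NormedSpace ℝ E] [FiniteDimensional ℝ E]
  {M : Type*} [TopologicalSpace M] [ChartedSpace E M] [IsManifold 𝓘(ℝ, E) ∞ M]

namespace HyperkahlerStructure

variable (h : HyperkahlerStructure E M)

/-- The domain of the pure spinor. -/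
def spinorDomain (M : Type*) : Set (M × CP1 × CP1) :=
  {p | p.2.1 ≠ OnePoint.infty ∧ p.2.2 ≠ ((0 : ℂ) : CP1)}

theorem isOpen_spinorDomain : IsOpen (spinorDomain M) :=
  (isOpen_ne.preimage (continuous_fst.comp continuous_snd)).inter
    (isOpen_ne.preimage (continuous_snd.comp continuous_snd))

theorem mdifferentiableAt_coord {p : M × CP1 × CP1} (hp : p ∈ spinorDomain M) :
    MDifferentiableAt (twistorModel E) 𝓘(ℝ, ℂ) (fun q : M × CP1 × CP1 => CP1.coord q.2.1) p :=
  ((CP1.contMDiffAt_coord hp.1).comp p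
    (contMDiffAt_fst.comp p contMDiffAt_snd)).mdifferentiableAt (by simp)

theorem mdifferentiableAt_conj_coordInv {p : M × CP1 × CP1} (hp : p ∈ spinorDomain M) :
    MDifferentiableAt (twistorModel E) 𝓘(ℝ, ℂ)
      (fun q : M × CP1 × CP1 => starRingEnd ℂ (CP1.coordInv q.2.2)) p :=
  (Complex.conjCLE.contDiff.contMDiff.contMDiffAt.comp p ((CP1.contMDiffAt_coordInv hp.2).comp p
    (contMDiffAt_snd.comp p contMDiffAt_snd))).mdifferentiableAt (n := ∞) (by simp)

/-- The function `α` in the preferred chart at `p`. -/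
def chartα (p : M × CP1 × CP1) (y : E × ℂ × ℂ) : ℂ :=
  CP1.coord ((chartAt ℂ p.2.1).symm y.2.1)

/-- The function `γ`, the conjugate of `β⁻¹`, in the preferred chart at `p`. -/
def chartγ (p : M × CP1 × CP1) (y : E × ℂ × ℂ) : ℂ :=
  starRingEnd ℂ (CP1.coordInv ((chartAt ℂ p.2.2).symm y.2.2))

theorem pullForm_pulledForm {x₀ : M} {q₀ q : CP1 × CP1} {x : M} (hx : x ∈ (chartAt E x₀).source)
    (hq : q ∈ (chartAt (ModelProd ℂ ℂ) q₀).source)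
    (A : ∀ x : M, TangentSpace 𝓘(ℝ, E) x →L[ℝ] TangentSpace 𝓘(ℝ, E) x) :
    pullForm (chartBwd (twistorModel E) (x₀, q₀) (x, q)) (h.pulledForm A (x, q))
      = pullForm (.fst ℝ E (ℂ × ℂ)) (twoForm (fundForm (chartMetric 𝓘(ℝ, E) x₀ x (h.g.inner x))
        (chartEnd 𝓘(ℝ, E) x₀ x (A x)))) := by
  have h1 : ∀ f : TangentSpace 𝓘(ℝ, E) x × ℂ × ℂ →L[ℝ] TangentSpace 𝓘(ℝ, E) x,
      f = .fst ℝ _ _ → f.comp (chartBwd (twistorModel E) (x₀, q₀) (x, q))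
        = (chartBwd 𝓘(ℝ, E) x₀ x).comp (.fst ℝ E (ℂ × ℂ)) := by
    rintro f rfl
    ext v
    · exact congrArg Prod.fst (chartBwd_prod (I := 𝓘(ℝ, E)) (I' := 𝓘(ℝ, ℂ).prod 𝓘(ℝ, ℂ)) hx hq _)
    · exact congrArg Prod.fst (chartBwd_prod (I := 𝓘(ℝ, E)) (I' := 𝓘(ℝ, ℂ).prod 𝓘(ℝ, ℂ)) hx hq _)
    · exact congrArg Prod.fst (chartBwd_prod (I := 𝓘(ℝ, E)) (I' := 𝓘(ℝ, ℂ).prod 𝓘(ℝ, ℂ)) hx hq _)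
  have h2 := h1 _ (mfderiv_fst (I := 𝓘(ℝ, E)) (I' := 𝓘(ℝ, ℂ).prod 𝓘(ℝ, ℂ)) (x := (x, q)))
  rw [← h.pullForm_fundForm hx, pullForm_pullForm]
  exact (pullForm_pullForm _ _ _).trans (congrArg (fun B : E × ℂ × ℂ →L[ℝ] TangentSpace 𝓘(ℝ, E) x =>
    pullForm B (twoForm (fundForm (h.g.inner x) (A x)))) h2)

/-- The affine formula is the homogeneous one with `(a₀, a₁) = (1, α)` and `(g₀, g₁) = (1, γ)`.
Applied to the pull-back homomorphism, it computes the spinor in a chart. -/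
theorem map_twistorSpinor' {N : Type*} [AddCommGroup N] [Module ℂ N] (n : ℕ) (p : M × CP1 × CP1)
    (f : CForm (TangentSpace (twistorModel E) p) →ₐ[ℂ] ExteriorAlgebra ℂ N) :
    f (h.twistorSpinor' n p) = expSpinor n
        (Complex.I * (CP1.coord p.2.1 + starRingEnd ℂ (CP1.coordInv p.2.2)))
        (spinForm (f (h.pulledForm h.I p)) (f (h.pulledForm h.J p)) (f (h.pulledForm h.K p))
          1 (CP1.coord p.2.1) 1 (starRingEnd ℂ (CP1.coordInv p.2.2)))
      * f (oneForm (mvfderiv (twistorModel E) (fun q : M × CP1 × CP1 => CP1.coord q.2.1) p))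
      * f (oneForm (mvfderiv (twistorModel E)
        (fun q : M × CP1 × CP1 => starRingEnd ℂ (CP1.coordInv q.2.2)) p)) := by
  have h1 : h.spinor' n p = expSpinor n
      (Complex.I * (CP1.coord p.2.1 + starRingEnd ℂ (CP1.coordInv p.2.2))) (h.exponentForm p) := rfl
  have h2 : f (h.exponentForm p) = spinForm (f (h.pulledForm h.I p)) (f (h.pulledForm h.J p))
      (f (h.pulledForm h.K p)) 1 (CP1.coord p.2.1) 1 (starRingEnd ℂ (CP1.coordInv p.2.2)) := by
    simp only [exponentForm, map_add, map_sub, map_smul, spinForm]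
    module
  rw [twistorSpinor', map_mul, map_mul, h1, map_expSpinor, h2]

theorem formInChart_twistorSpinor' {n : ℕ} {p : M × CP1 × CP1} {y : E × ℂ × ℂ}
    (hy : y ∈ (extChartAt (twistorModel E) p).target)
    (hU : (extChartAt (twistorModel E) p).symm y ∈ spinorDomain M) :
    formInChart (twistorModel E) (h.twistorSpinor' n) p y
      = chartSpinor (h.chartG p.1) (h.chartI p.1) (h.chartJ p.1) (h.chartK p.1) n
        (fun _ => 1) (chartα p) (fun _ => 1) (chartγ p) (chartα p) (chartγ p) y := by
  have hx := chart_symm_mem_source (mem_target_prod hy)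
  have hq : ((chartAt ℂ p.2.1).symm y.2.1, (chartAt ℂ p.2.2).symm y.2.2)
      ∈ (chartAt (ModelProd ℂ ℂ) p.2).source := by
    rw [prodChartedSpace_chartAt]
    exact ⟨chart_symm_mem _ _, chart_symm_mem _ _⟩
  have e1 := mvfderiv_comp_chartBwd hy (mdifferentiableAt_coord hU)
  have e2 := mvfderiv_comp_chartBwd hy (mdifferentiableAt_conj_coordInv hU)
  have e3 := h.pullForm_pulledForm hx hq
  refine (formInChart_eq _ hy).trans ((h.map_twistorSpinor' n _ _).trans ?_)
  rw [pullForm_oneForm, pullForm_oneForm, e1, e2, chartSpinor, prodSpinor, map_expSpinor,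
    map_spinForm, mul_one, one_mul]
  have e4 : ∀ {a b c a' b' c' : CForm (E × ℂ × ℂ)}, a = a' → b = b' → c = c' →
      spinForm a b c 1 (chartα p y) 1 (chartγ p y) = spinForm a' b' c' 1 (chartα p y) 1
        (chartγ p y) := by
    rintro a b c _ _ _ rfl rfl rfl
    rfl
  exact congrArg (fun S => expSpinor n (Complex.I * (chartα p y + chartγ p y)) S *
    oneForm (fderiv ℝ (chartα p) y) * oneForm (fderiv ℝ (chartγ p) y))
    (e4 (e3 h.I) (e3 h.J) (e3 h.K))

theorem eventually_mem_spinorDomain {p : M × CP1 × CP1} (hp : p ∈ spinorDomain M) :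
    ∀ᶠ y in 𝓝 (extChartAt (twistorModel E) p p),
      (extChartAt (twistorModel E) p).symm y ∈ spinorDomain M :=
  (continuousAt_extChartAt_symm p).eventually_mem (by
    rw [extChartAt_to_inv p]
    exact isOpen_spinorDomain.mem_nhds hp)

theorem hasFDerivAt_chartα {p : M × CP1 × CP1} (hp : p ∈ spinorDomain M) (y : E × ℂ × ℂ) :
    ContDiffAt ℝ ∞ (chartα (E := E) p) y ∧ HasFDerivAt (chartα p)
      ((ContinuousLinearMap.id ℝ ℂ).comp (.comp (.fst ℝ ℂ ℂ) (.snd ℝ E (ℂ × ℂ)))) y := by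
  obtain ⟨h1, h2⟩ := CP1.hasDerivAt_coord hp.1 y.2.1
  refine ⟨ContDiffAt.comp (g := fun w => CP1.coord ((chartAt ℂ p.2.1).symm w))
    (f := fun z : E × ℂ × ℂ => z.2.1) y h1 (contDiffAt_fst_snd y), ?_⟩
  refine ((h2.hasFDerivAt.restrictScalars ℝ).comp y (hasFDerivAt_fst_snd y)).congr_fderiv ?_
  refine ContinuousLinearMap.ext fun v => ?_
  simp

theorem hasFDerivAt_chartγ {p : M × CP1 × CP1} (hp : p ∈ spinorDomain M) :
    ContDiffAt ℝ ∞ (chartγ (E := E) p) (extChartAt (twistorModel E) p p) ∧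
      ∃ c : ℂ, c ≠ 0 ∧ HasFDerivAt (chartγ p)
        (((Complex.conjCLE : ℂ →L[ℝ] ℂ).comp (mulC c)).comp
          (.comp (.snd ℝ ℂ ℂ) (.snd ℝ E (ℂ × ℂ)))) (extChartAt (twistorModel E) p p) := by
  obtain ⟨c, hc, h1, h2⟩ := CP1.exists_hasDerivAt_coordInv hp.2
  have h3 := h1.comp (extChartAt (twistorModel E) p p) (contDiffAt_snd_snd _)
  refine ⟨Complex.conjCLE.contDiff.contDiffAt.comp _ h3, c, hc, ?_⟩
  have h4 := (h2.hasFDerivAt.restrictScalars ℝ).comp (extChartAt (twistorModel E) p p)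
    (hasFDerivAt_snd_snd _)
  refine (Complex.conjCLE.hasFDerivAt.comp (extChartAt (twistorModel E) p p) h4).congr_fderiv ?_
  refine ContinuousLinearMap.ext fun v => ?_
  simp [mulC_apply, mul_comm]

theorem formInChart_twistorSpinor'_smooth_closed {n : ℕ} (hn : Module.finrank ℝ E = 4 * n)
    {p : M × CP1 × CP1} (hp : p ∈ spinorDomain M) :
    VSmoothAt (formInChart (twistorModel E) (h.twistorSpinor' n) p)
        (extChartAt (twistorModel E) p p) ∧
      extD (formInChart (twistorModel E) (h.twistorSpinor' n) p)
        (extChartAt (twistorModel E) p p) = 0 := by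
  have hα := (hasFDerivAt_chartα hp (extChartAt (twistorModel E) p p)).1
  have hγ := (hasFDerivAt_chartγ (E := E) hp).1
  -- As `a₀ = 1`, the constant pair `(b₀, b₁) = (0, 1)` is complementary.
  have key := chartSpinor_smooth_closed hn (h.isChartHyperkahler p.1)
    (y := extChartAt (twistorModel E) p p) hα hγ (IsBasicFun.const 1)
    ⟨hα, oneForm_mul_left _ _⟩ (IsBasicFun.const 1) ⟨hγ, oneForm_mul_right _ _⟩
    (IsBasicFun.const 0) (IsBasicFun.const 1) (Eventually.of_forall fun z => by ring)
  have he : formInChart (twistorModel E) (h.twistorSpinor' n) p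
      =ᶠ[𝓝 (extChartAt (twistorModel E) p p)] chartSpinor (h.chartG p.1) (h.chartI p.1)
        (h.chartJ p.1) (h.chartK p.1) n (fun _ => 1) (chartα p) (fun _ => 1) (chartγ p)
        (chartα p) (chartγ p) := by
    filter_upwards [eventually_mem_target (I := twistorModel E) p, eventually_mem_spinorDomain hp]
      with y hy hU
    exact h.formInChart_twistorSpinor' hy hU
  refine ⟨key.1.congr he.symm, ?_⟩
  rw [← key.2, extD, extD]
  congr 1
  exact funext fun v => he.vderiv_eq v

/-- Away from `∞`, the pair `(1, α)` and the lift in the preferred chart represent the same point of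
the line. -/
theorem twistorEnd_chartα {p : M × CP1 × CP1} {y : E × ℂ × ℂ}
    (hU : (chartAt ℂ p.2.1).symm y.2.1 ≠ OnePoint.infty) :
    twistorEnd (h.chartI p.1 y.1) (h.chartJ p.1 y.1) (h.chartK p.1 y.1) 1 (chartα p y)
      = twistorEnd (h.chartI p.1 y.1) (h.chartJ p.1 y.1) (h.chartK p.1 y.1)
        (CP1.lift p.2.1 y.2.1).1 (CP1.lift p.2.1 y.2.1).2 := by
  have h1 := h.twistorEnd_chart p y ((0 : ℂ) : CP1) (chartα p y)
  have h2 : (chartAt ℂ ((0 : ℂ) : CP1)).symm (chartα p y) = (chartAt ℂ p.2.1).symm y.2.1 :=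
    CP1.chart_symm_coord hU
  rw [h2] at h1
  exact h1.trans (h.twistorEnd_chart p y p.2.1 y.2.1).symm

/-- Away from `0`, the pair `(γ̄, 1) = (β⁻¹, 1)` represents `β`. -/
theorem twistorEnd_chartγ {p : M × CP1 × CP1} {y : E × ℂ × ℂ}
    (hU : (chartAt ℂ p.2.2).symm y.2.2 ≠ ((0 : ℂ) : CP1)) :
    twistorEnd (h.chartI p.1 y.1) (h.chartJ p.1 y.1) (h.chartK p.1 y.1)
        (starRingEnd ℂ (chartγ p y)) (starRingEnd ℂ 1)
      = twistorEnd (h.chartI p.1 y.1) (h.chartJ p.1 y.1) (h.chartK p.1 y.1)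
        (CP1.lift p.2.2 y.2.2).1 (CP1.lift p.2.2 y.2.2).2 := by
  have h1 := h.twistorEnd_chart p y OnePoint.infty (CP1.coordInv ((chartAt ℂ p.2.2).symm y.2.2))
  have h2 : (chartAt ℂ (OnePoint.infty : CP1)).symm
      (CP1.coordInv ((chartAt ℂ p.2.2).symm y.2.2)) = (chartAt ℂ p.2.2).symm y.2.2 :=
    CP1.chartInv_symm_coordInv hU
  rw [h2] at h1
  rw [chartγ, Complex.conj_conj, map_one]
  exact h1.trans (h.twistorEnd_chart p y p.2.2 y.2.2).symm

theorem cliffordAct_formInChart_twistorSpinor'_iff {n : ℕ} (hn : Module.finrank ℝ E = 4 * n)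
    {p : M × CP1 × CP1} (hp : p ∈ spinorDomain M) {y : E × ℂ × ℂ}
    (hy : y ∈ (extChartAt (twistorModel E) p).target)
    (hU : (extChartAt (twistorModel E) p).symm y ∈ spinorDomain M)
    (hz : IsQuaternionHermitian (h.chartG p.1 y.1) (h.chartI p.1 y.1) (h.chartJ p.1 y.1)
      (h.chartK p.1 y.1))
    {c : ℂ} (hc : c ≠ 0) (hγ : HasFDerivAt (chartγ p)
        (((Complex.conjCLE : ℂ →L[ℝ] ℂ).comp (mulC c)).comp
          (.comp (.snd ℝ ℂ ℂ) (.snd ℝ E (ℂ × ℂ)))) y)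
    (u v : (E × ℂ × ℂ) × (E × ℂ × ℂ →L[ℝ] ℝ)) :
    cliffordAct u v (formInChart (twistorModel E) (h.twistorSpinor' n) p y) = 0 ↔
      InEigen (h.chartTwistorJ' p y) u v := by
  have key := cliffordAct_chartSpinor_iff hn (g := h.chartG p.1) (I := h.chartI p.1)
    (J := h.chartJ p.1) (K := h.chartK p.1) (a₀ := fun _ => 1) (a₁ := chartα p) (g₀ := fun _ => 1)
    (g₁ := chartγ p) hz (Or.inl one_ne_zero)
    (Or.inl one_ne_zero) (κ₁ := Complex.I) (Or.inl rfl) (Or.inr rfl) (κ₂ := -Complex.I)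
    (hasFDerivAt_chartα hp y).2.fderiv hγ.fderiv
    (fun _ => rfl) (fun z => by simp [mulC_apply]; ring) one_ne_zero (by simpa [mulC_apply] using hc)
    u v
  rw [h.twistorEnd_chartα (p := p) (y := y) hU.1,
    h.twistorEnd_chartγ (p := p) (y := y) hU.2] at key
  rw [h.formInChart_twistorSpinor' hy hU]
  exact key

/-- The annihilator of the spinor is the `+i`-eigenbundle of `𝒥'`. -/
theorem cliffordAct_twistorSpinor'_iff {n : ℕ} (hn : Module.finrank ℝ E = 4 * n)
    {p : M × CP1 × CP1} (hp : p ∈ spinorDomain M) (u v : GenTangent (twistorModel E) p) :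
    cliffordAct u v (h.twistorSpinor' n p) = 0 ↔ InEigen (h.twistorJ' p) u v := by
  have hU : (extChartAt (twistorModel E) p).symm (extChartAt (twistorModel E) p p)
      ∈ spinorDomain M := by rwa [extChartAt_to_inv p]
  obtain ⟨_, c, hc, hγ⟩ := hasFDerivAt_chartγ (E := E) hp
  have key := h.cliffordAct_formInChart_twistorSpinor'_iff hn hp (mem_extChartAt_target p) hU
    (h.isChartHyperkahler p.1).hermitian.self_of_nhds hc hγ u v
  have e3 := (h.hasChartExpr_twistorJ' p).apply_self
  have e4 := formInChart_self (I := twistorModel E) (h.twistorSpinor' n) p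
  have e5 : cliffordAct u v (h.twistorSpinor' n p) = 0 ↔
      InEigen (h.chartTwistorJ' p (extChartAt (twistorModel E) p p)) u v :=
    Iff.trans (iff_of_eq (congrArg (fun Φ : CForm (E × ℂ × ℂ) => cliffordAct u v Φ = 0) e4.symm)) key
  refine e5.trans ⟨fun H => ?_, fun H => ?_⟩
  · exact ⟨(e3 u).trans H.1, (e3 v).trans H.2⟩
  · exact ⟨(e3 u).symm.trans H.1, (e3 v).symm.trans H.2⟩

theorem isPureSpinorOn {n : ℕ} (hn : Module.finrank ℝ E = 4 * n) :
    IsPureSpinorOn (twistorModel E) h.twistorJ' (h.twistorSpinor' n) (spinorDomain M) :=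
  ⟨smoothFormOn_iff.2 fun _ hp => (h.formInChart_twistorSpinor'_smooth_closed hn hp).1,
    fun _ hp u v => h.cliffordAct_twistorSpinor'_iff hn hp u v⟩

theorem closedFormOn {n : ℕ} (hn : Module.finrank ℝ E = 4 * n) :
    ClosedFormOn (twistorModel E) (h.twistorSpinor' n) (spinorDomain M) :=
  (closedFormOn_iff fun _ hp => (h.formInChart_twistorSpinor'_smooth_closed hn hp).1).2
    fun _ hp => (h.formInChart_twistorSpinor'_smooth_closed hn hp).2

end HyperkahlerStructure

end
end

theorem mainTheorem2 {E : Type*} [NormedAddCommGroup E] [NormedSpace ℝ E] [FiniteDimensional ℝ E]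
    {M : Type*} [TopologicalSpace M] [ChartedSpace E M] [IsManifold 𝓘(ℝ, E) ∞ M]
    (n : ℕ) (hdim : Module.finrank ℝ E = 4 * n) (h : HyperkahlerStructure E M) :
    IsGenComplex (twistorModel E) h.twistorJ' ∧
    IsPureSpinorOn (twistorModel E) h.twistorJ' (h.twistorSpinor' n)
      {p : M × CP1 × CP1 | p.2.1 ≠ OnePoint.infty ∧ p.2.2 ≠ ((0 : ℂ) : CP1)} ∧
    ClosedFormOn (twistorModel E) (h.twistorSpinor' n)
      {p : M × CP1 × CP1 | p.2.1 ≠ OnePoint.infty ∧ p.2.2 ≠ ((0 : ℂ) : CP1)} ∧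
    IsGenPseudoKahler (twistorModel E) h.twistorJ h.twistorJ' ∧
    HasSignature (twistorModel E) h.twistorJ h.twistorJ' (8 * n + 4) 4 := by
  exact ⟨h.isGenComplex_twistorJ' hdim, h.isPureSpinorOn hdim, h.closedFormOn hdim,
    h.isGenPseudoKahler hdim, h.hasSignature hdim⟩
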